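/- **Setting.** Let $M$ be a complex manifold of dimension $r$ and $0\to\Gamma_f\to\Gamma\to\Gamma_g\to 0$ an extension of local systems of lattices on $M$, with $\Gamma_f$ trivial and $\Gamma_g$ of rank $2r$. Let $\langle-,-\rangle$ be a parallel, skew, integral pairing on $\Gamma$ that vanishes on $\Gamma_f$ and for which $\Gamma_g$ locally has Darboux frames $(\widetilde\gamma_i,\gamma^i)$, $\langle\widetilde\gamma_i,\gamma^j\rangle=\delta_i^j$, the other pairings being $0$. Let $Z$ be a holomorphic section of $\Gamma^*\otimes\mathbb C$ such that $Z_{\gamma}$ is constant for $\gamma\in\Gamma_f$, and let $\Omega:\Gamma\to\mathbb Z$ be a function. The pairing on $\Gamma_g$ induces one on $\Gamma_g^*\otimes\mathbb C$ through $\gamma\mapsto\langle\gamma,-\rangle$. Assume that $(M,\Gamma,Z,\Omega)$ is a *mutually local hyperkähler variation of BPS structures*: * (central charge affine special Kähler geometry) for flat local sections $(\widetilde\gamma_i,\gamma^i)$ of $\Gamma$ projecting to a Darboux frame, $(dZ_{\gamma^i})$ is a local frame of $T^*M$; $\langle dZ\wedge dZ\rangle=0$; and $\omega:=\frac14\langle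 dZ\wedge d\overline Z\rangle$ is non-degenerate. Put $g_{sK}:=\omega(-,J-)$, where $J$ is the complex structure of $M$; * $\Omega(-\gamma)=\Omega(\gamma)$, and $\Omega$ satisfies the Kontsevich–Soibelman wall-crossing formula: for a strictly convex sector whose boundary rays contain no $Z_\gamma(p)$ with $\Omega(\gamma)\ne 0$, the product, ordered by increasing argument of $Z_\gamma$, of the powers $\mathcal K_\gamma^{\Omega(\gamma)}$ of the automorphisms $\mathcal K_\gamma:X_\beta\mapsto X_\beta(1-X_\gamma)^{\langle\beta,\gamma\rangle}$ of the completed twisted torus algebra $X_\beta X_\gamma=(-1)^{\langle\beta,\gamma\rangle}X_{\beta+\gamma}$, taken over all $\gamma$ with $Z_\gamma$ in the sector, is locally constant at $p$ (each matrix coefficient in the basis $(X_\beta)$); * (support property) locally uniformly on $M$, for a parallel norm on $\Gamma\otimes\mathbb R$, there is $C>0$ with $|Z_\gamma|>C|\gamma|$ whenever $\Omega(\gamma)\neq0$; * (strong convergence) for every $R>0$ the series $\sum_\gamma|\Omega(\gamma)|e^{-R|Z_\gamma|}$ converges normally on compact subsets of $M$; * (mutual locality) $\Omega(\gamma)\ne0\ne\Omega(\gamma')$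 implies $\langle\gamma,\gamma'\rangle=0$. Fix a homomorphism $\theta_f:\Gamma_f\to\mathbb R/2\pi\mathbb Z$ and let $\pi:\mathcal N(\theta_f)\to M$ be the torus bundle with fiber $\{\theta\in\mathrm{Hom}(\Gamma_p,\mathbb R/2\pi\mathbb Z) : \theta|_{\Gamma_f}=\theta_f\}$ over $p$; write $\theta_\gamma$ for the evaluation at $\gamma$. With the modified Bessel functions $K_0,K_1$ of the second kind put $$V_\gamma^{\rm inst}=\frac1{2\pi}\sum_{n>0}e^{in\theta_\gamma}K_0(2\pi n|Z_\gamma|),\qquad A_\gamma^{\rm inst}=-\frac1{4\pi}\sum_{n>0}e^{in\theta_\gamma}|Z_\gamma|K_1(2\pi n|Z_\gamma|)\Big(\frac{dZ_\gamma}{Z_\gamma}-\frac{d\overline Z_\gamma}{\overline Z_\gamma}\Big),$$ $$\omega_1+i\omega_2=-\frac1{2\pi}\langle dZ\wedge d\theta\rangle+\sum_\gamma\Big(\Omega(\gamma)\,dZ_\gamma\wedge A_\gamma^{\rm inst}+\frac{i\Omega(\gamma)}{2\pi}V_\gamma^{\rm inst}\,d\theta_\gamma\wedge dZ_\gamma\Big),$$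 $$\omega_3=\frac14\langle dZ\wedge d\overline Z\rangle-\frac1{8\pi^2}\langle d\theta\wedge d\theta\rangle+\sum_\gamma\Big(\frac{i\Omega(\gamma)}2V_\gamma^{\rm inst}\,dZ_\gamma\wedge d\overline Z_\gamma+\frac{\Omega(\gamma)}{2\pi}\,d\theta_\gamma\wedge A_\gamma^{\rm inst}\Big),$$ $$T=\pi^*g_{sK}+\sum_\gamma\Omega(\gamma)V_\gamma^{\rm inst}\,\pi^*|dZ_\gamma|^2,$$ the sums over $\gamma$ being taken over the fiber of $\Gamma$ (only $\gamma$ with $\Omega(\gamma)\ne0$ contribute). Let $N\subset\mathcal N(\theta_f)$ be the set where $T$ is horizontally non-degenerate, that is, non-degenerate on the normal bundle of the fibers of $\pi$. **Theorem.** All these sums converge absolutely at every point, and $\omega_1,\omega_2,\omega_3$ are smooth real $2$-forms on $\mathcal N(\theta_f)$. The set $N$ is open, and $\omega_1,\omega_2,\omega_3$ define a (possibly indefinite) hyperkähler structure on $N$: there are a pseudo-Riemannian metric $g_N$ and integrable almost complex structures $I_1,I_2,I_3$ on $N$ with $I_1I_2=I_3$, $g_N(I_\alpha-,I_\alpha-)=g_N$,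 $\omega_\alpha=g_N(I_\alpha-,-)$ and $d\omega_\alpha=0$. Moreover, every point of $M$ has a neighbourhood $U$ with a flat frame of $\Gamma|_U$ consisting of sections $(\widetilde\gamma_i,\gamma^i)$ that project to a Darboux frame of $\Gamma_g$ and of a basis of $\Gamma_f$, such that the image in $\Gamma_g$ of $\{\gamma:\Omega(\gamma)\ne0\}$ lies in the span of the images of the $\gamma^i$. For every such frame, let $n_i(\gamma)$ be the coefficient of $\gamma^i$ in $\gamma$, define $\tau_{ij}$ by $dZ_{\widetilde\gamma_i}=\tau_{ij}dZ_{\gamma^j}$ (repeated indices are summed), and put $$W_i=d\theta_{\widetilde\gamma_i}-\tau_{ij}d\theta_{\gamma^j},\qquad W_i^{\rm inst}=\sum_\gamma\Omega(\gamma)n_i(\gamma)\big(2\pi A_\gamma^{\rm inst}-iV_\gamma^{\rm inst}d\theta_\gamma\big),$$ $$N_{ij}=\operatorname{Im}\tau_{ij},\qquad N_{ij}^{\rm inst}=\sum_\gamma\Omega(\gamma)V_\gamma^{\rm inst}n_i(\gamma)n_j(\gamma).$$ These sums converge absolutely; over $U$ one has $$\omega_1+i\omega_2=\frac1{2\pi}dZ_{\gamma^i}\wedge(W_i+W_i^{\rm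 inst}),$$ and at the points of $N$ over $U$ the matrix $N+N^{\rm inst}$ is invertible, with inverse written with upper indices, and $$g_N=dZ_{\gamma^i}(N_{ij}+N_{ij}^{\rm inst})d\overline Z_{\gamma^j}+\frac1{4\pi^2}(W_i+W_i^{\rm inst})(N+N^{\rm inst})^{ij}(\overline W_j+\overline W_j^{\rm inst}),$$ $$\omega_3=\frac i2(N_{ij}+N_{ij}^{\rm inst})dZ_{\gamma^i}\wedge d\overline Z_{\gamma^j}+\frac i{8\pi^2}(N+N^{\rm inst})^{ij}(W_i+W_i^{\rm inst})\wedge(\overline W_j+\overline W_j^{\rm inst}),$$ where the products of $1$-forms in $g_N$ are symmetric products $\alpha\beta=\frac12(\alpha\otimes\beta+\beta\otimes\alpha)$, and $|\alpha|^2=\alpha\overline\alpha$. -/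

import Mathlib

open scoped Manifold ContDiff Topology
open Filter

noncomputable section

namespace HKBPS

universe u v w

/-- The modified Bessel function of the second kind `K_ν(x)`, `x > 0`, through
`K_ν(x) = ∫₀^∞ e^{-x cosh t} cosh(ν t) dt`. -/
def besselK (ν x : ℝ) : ℝ :=
  ∫ t in Set.Ioi (0 : ℝ), Real.exp (-x * Real.cosh t) * Real.cosh (ν * t)

/-! ### Charge lattices -/

/-- The model of the charge lattice: a triple `(a, b, f)` stands for
`∑ i, a i • γ̃_i + ∑ i, b i • γ^i + f`. -/
abbrev Model (r : ℕ) (Γf : Type v) : Type v := (Fin r → ℤ) × (Fin r → ℤ) × Γf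

/-- An isomorphism `Model r Γf ≃+ Γ` that is the inclusion on the flavor charges and such that
the images of `γ̃_i`, `γ^i` in `Γ / Γf` are a Darboux basis: `⟨γ̃_i, γ^j⟩ = δ_i^j`,
`⟨γ̃_i, γ̃_j⟩ = 0 = ⟨γ^i, γ^j⟩`.  In particular the pairing is skew, and flavor charges
pair to zero with everything. -/
structure IsAdapted {r : ℕ} {Γf : Type v} [AddCommGroup Γf] {Γ : Type w} [AddCommGroup Γ]
    (pairing : Γ →+ Γ →+ ℤ) (flavor : Γf →+ Γ) (e : Model r Γf ≃+ Γ) : Prop where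
  flavor : ∀ f : Γf, e (0, 0, f) = flavor f
  darboux : ∀ x y : Model r Γf,
    pairing (e x) (e y) = ∑ i, (x.1 i * y.2.1 i - x.2.1 i * y.1 i)

/-- A charge lattice on `M`: a local system `Γ` of lattices that is an extension
`0 → Γf → Γ → Γg → 0` of a local system `Γg` of rank `2 r` by the trivial local system `Γf`,
with a parallel skew integral pairing that vanishes on `Γf` and for which `Γg` locally admits
Darboux frames.  The local system is given by an atlas of local frames: `frame p` is a frame
near `p`, flat on the open neighbourhood `dom p` of `p` (its values outside `dom p` carry no
information), and the change from one frame to another is locally constant. -/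
structure ChargeLattice (M : Type u) [TopologicalSpace M] (r : ℕ)
    (Γf : Type v) [AddCommGroup Γf] where
  fib : M → Type w
  [grp : ∀ p, AddCommGroup (fib p)]
  pairing : ∀ p, fib p →+ fib p →+ ℤ
  flavor : ∀ p, Γf →+ fib p
  frame : M → ∀ q : M, Model r Γf ≃+ fib q
  dom : M → Set M
  isOpen_dom : ∀ p, IsOpen (dom p)
  mem_dom : ∀ p, p ∈ dom p
  adapted : ∀ p q, IsAdapted (pairing q) (flavor q) (frame p q)
  locallyConstant : ∀ p p' q, q ∈ dom p → q ∈ dom p' →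
    ∀ᶠ q' in 𝓝 q, ∀ x, (frame p' q').symm (frame p q' x) = (frame p' q).symm (frame p q x)

attribute [instance] ChargeLattice.grp

section Lattice

variable {M : Type u} [TopologicalSpace M] {r : ℕ} {Γf : Type v} [AddCommGroup Γf]

/-- The flat local section of `Γ` near `p` through `γ ∈ Γ_p` (its germ at `p` is what counts). -/
def ChargeLattice.flatExt (L : ChargeLattice.{u, v, w} M r Γf) (p : M) (γ : L.fib p) (q : M) :
    L.fib q :=
  L.frame p q ((L.frame p p).symm γ)

/-- `e` is a flat frame `(γ̃_i, γ^i, Γf)` of `Γ` over the open set `U` whose projection to `Γg`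
is a Darboux frame. Here `γ̃_i = e (δ_i, 0, 0)` and `γ^i = e (0, δ_i, 0)`. -/
structure ChargeLattice.IsFlatFrame (L : ChargeLattice.{u, v, w} M r Γf) (U : Set M)
    (e : ∀ q : M, Model r Γf ≃+ L.fib q) : Prop where
  isOpen : IsOpen U
  adapted : ∀ q ∈ U, IsAdapted (L.pairing q) (L.flavor q) (e q)
  flat : ∀ q ∈ U, ∀ᶠ q' in 𝓝 q, ∀ x,
    (L.frame q q').symm (e q' x) = (L.frame q q).symm (e q x)

/-- The charge `γ̃_i` of a frame. -/
def gammaTilde {L : ChargeLattice.{u, v, w} M r Γf} (e : ∀ q : M, Model r Γf ≃+ L.fib q)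
    (p : M) (i : Fin r) : L.fib p := e p (Pi.single i 1, 0, 0)

/-- The charge `γ^i` of a frame. -/
def gammaUp {L : ChargeLattice.{u, v, w} M r Γf} (e : ∀ q : M, Model r Γf ≃+ L.fib q)
    (p : M) (i : Fin r) : L.fib p := e p (0, Pi.single i 1, 0)

/-- The coefficient `n_{i,g}(γ)` of `γ^i` in `γ`. -/
def nCoeff {L : ChargeLattice.{u, v, w} M r Γf} (e : ∀ q : M, Model r Γf ≃+ L.fib q)
    (p : M) (γ : L.fib p) (i : Fin r) : ℤ := ((e p).symm γ).2.1 i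

/-- The pairing on `Γg^* ⊗ ℂ` that is induced from the one on `Γg` by `γ ↦ ⟨γ, -⟩` and
extended bilinearly, written in a Darboux basis (it does not depend on the basis). The
arguments are (additive) functions on `Γ_p` that vanish on `Γf`. -/
def ChargeLattice.dualPairing (L : ChargeLattice.{u, v, w} M r Γf) (p : M)
    (a b : L.fib p → ℂ) : ℂ :=
  ∑ i, (a (gammaTilde (L.frame p) p i) * b (gammaUp (L.frame p) p i)
    - a (gammaUp (L.frame p) p i) * b (gammaTilde (L.frame p) p i))

/-- For `1`-forms `A`, `B` with values in `Γg^* ⊗ ℂ`, the `2`-form `⟨A ∧ B⟩`. -/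
def ChargeLattice.pairWedge (L : ChargeLattice.{u, v, w} M r Γf) (p : M) {V : Type*}
    (A B : V → L.fib p → ℂ) (ξ η : V) : ℂ :=
  L.dualPairing p (A ξ) (B η) - L.dualPairing p (A η) (B ξ)

/-- The `ℓ¹` norm on the model lattice, with respect to a basis of `Γf`. -/
def modelNorm [Module.Free ℤ Γf] [Module.Finite ℤ Γf] (x : Model r Γf) : ℝ :=
  ∑ i, |(x.1 i : ℝ)| + ∑ i, |(x.2.1 i : ℝ)|
    + ∑ j, |((Module.Free.chooseBasis ℤ Γf).repr x.2.2 j : ℝ)|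

end Lattice

/-- The wedge product of two scalar `1`-forms. -/
def wedge {V : Type*} (a b : V → ℂ) (ξ η : V) : ℂ := a ξ * b η - a η * b ξ

/-! ### The Kontsevich-Soibelman wall-crossing formula -/

section WallCrossing

variable {Γ : Type w} [AddCommGroup Γ]

/-- The open sector of `ℂ^×` of the arguments in `(φ₁, φ₂)`. -/
def sector (φ₁ φ₂ : ℝ) : Set ℂ :=
  {z | ∃ ρ : ℝ, 0 < ρ ∧ ∃ φ ∈ Set.Ioo φ₁ φ₂, z = ρ * Complex.exp (φ * Complex.I)}

/-- The open ray of `ℂ^×` of argument `φ`. -/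
def ray (φ : ℝ) : Set ℂ := {z | ∃ ρ : ℝ, 0 < ρ ∧ z = ρ * Complex.exp (φ * Complex.I)}

/-- The rational invariants `DT(γ) = ∑_{k ≥ 1, k ∣ γ} Ω(γ / k) / k²`. -/
def DT (Ω : Γ → ℤ) (γ : Γ) : ℚ :=
  ∑ᶠ q : {q : ℕ × Γ // 0 < q.1 ∧ q.1 • q.2 = γ}, (Ω q.1.2 : ℚ) / (q.1.1 : ℚ) ^ 2

open Classical in
/-- The contribution of a list of charges, sorted by the argument of the central charge, to the
product of exponentials, see `ksCoeff`. A group of `k` entries on one ray gets the factor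
`1 / k!`, as the product of the factors `1 / k`, ..., `1 / 2`, `1 / 1`. -/
def ksWeight (pairing : Γ →+ Γ →+ ℤ) (Z : Γ → ℂ) (Ω : Γ → ℤ) (β : Γ) : List Γ → ℚ
  | [] => 1
  | γ :: l =>
    DT Ω γ * (-1 : ℚ) ^ (pairing γ (β + l.sum)) * (pairing γ (β + l.sum) : ℚ)
      / (1 + (l.countP fun γ' => decide (SameRay ℝ (Z γ) (Z γ'))) : ℚ)
      * ksWeight pairing Z Ω β l

/-- Let `𝒦_γ : X_β ↦ X_β (1 - X_γ)^⟨β, γ⟩` be the Kontsevich-Soibelman automorphism of the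
(completed) twisted torus algebra `X_β X_γ = (-1)^⟨β, γ⟩ X_{β + γ}`, whose Poisson bracket is
`{X_γ, X_β} = ⟨γ, β⟩ X_γ X_β`. For a strictly convex sector, the product
`∏ 𝒦_γ^{Ω γ}` over the `γ` with `Z γ` in the sector, from left to right by increasing argument,
is the product over the rays `ℓ` in the sector of `exp {∑_{Z γ ∈ ℓ} DT(γ) X_γ, -}`.
`ksCoeff` is the coefficient of `X_{β + δ}` in the image of `X_β` under this automorphism, that
is, the sum over the sorted lists of charges with sum `δ`. -/
def ksCoeff (pairing : Γ →+ Γ →+ ℤ) (Z : Γ → ℂ) (Ω : Γ → ℤ) (φ₁ φ₂ : ℝ) (β δ : Γ) : ℚ :=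
  ∑ᶠ l : {l : List Γ // (∀ γ ∈ l, Z γ ∈ sector φ₁ φ₂) ∧
      l.Pairwise (fun γ γ' => 0 ≤ ((starRingEnd ℂ) (Z γ) * Z γ').im) ∧ l.sum = δ},
    ksWeight pairing Z Ω β l.1

end WallCrossing

/-! ### Central charges, ASK geometries, variations of BPS structures -/

section Geometry

variable {E : Type*} [NormedAddCommGroup E] [NormedSpace ℂ E]
  {M : Type u} [TopologicalSpace M] [ChartedSpace E M]
  {r : ℕ} {Γf : Type v} [AddCommGroup Γf]

/-- A holomorphic section of `Γ^* ⊗ ℂ` that is constant on flavor charges. -/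
structure CentralCharge (E : Type*) [NormedAddCommGroup E] [NormedSpace ℂ E]
    {M : Type u} [TopologicalSpace M] [ChartedSpace E M]
    {r : ℕ} {Γf : Type v} [AddCommGroup Γf] (L : ChargeLattice.{u, v, w} M r Γf) where
  val : ∀ p, L.fib p →+ ℂ
  holomorphic : ∀ p (γ : L.fib p),
    ContMDiffAt 𝓘(ℂ, E) 𝓘(ℂ, ℂ) ω (fun q => val q (L.flatExt p γ q)) p
  flavor_const : ∀ (f : Γf) (p q : M), val p (L.flavor p f) = val q (L.flavor q f)

variable {L : ChargeLattice.{u, v, w} M r Γf}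

/-- `dZ_γ` at `p`, a complex linear form on `T_p M = E`. -/
def dZ (Z : CentralCharge E L) (p : M) (γ : L.fib p) : E →L[ℂ] ℂ :=
  mfderiv 𝓘(ℂ, E) 𝓘(ℂ, ℂ) (fun q => Z.val q (L.flatExt p γ q)) p

/-- `dZ` at `p` as a `1`-form with values in `Γg^* ⊗ ℂ`. -/
def dZform (Z : CentralCharge E L) (p : M) (a : E) (γ : L.fib p) : ℂ := dZ Z p γ a

/-- The complex conjugate `dZ̄` of `dZ`. -/
def dZbarform (Z : CentralCharge E L) (p : M) (a : E) (γ : L.fib p) : ℂ :=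
  (starRingEnd ℂ) (dZ Z p γ a)

/-- The (real valued) `2`-form `¼ ⟨dZ ∧ dZ̄⟩` on `M`. -/
def omegaSK (Z : CentralCharge E L) (p : M) (a b : E) : ℂ :=
  (1 / 4) * L.pairWedge p (dZform Z p) (dZbarform Z p) a b

/-- The special Kähler metric `ω(-, J -)` on `M`. -/
def gSK (Z : CentralCharge E L) (p : M) (a b : E) : ℂ := omegaSK Z p a (Complex.I • b)

/-- `(M, Γ, Z)` is a central charge affine special Kähler geometry. As `(-γ^i, γ̃_i)` is again a
Darboux frame, the first condition also covers the forms `dZ_{γ̃_i}`. That the independent forms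
`dZ_{γ^i}` are a frame of `T^*M` uses `dim M = r`, which is assumed separately. -/
structure IsCentralChargeASK (Z : CentralCharge E L) : Prop where
  coframe : ∀ (U : Set M) (e : ∀ q : M, Model r Γf ≃+ L.fib q), L.IsFlatFrame U e →
    ∀ p ∈ U, LinearIndependent ℂ (fun i => dZ Z p (gammaUp e p i))
  lagrangian : ∀ p (a b : E), L.pairWedge p (dZform Z p) (dZform Z p) a b = 0
  nondegenerate : ∀ p (a : E), (∀ b, omegaSK Z p a b = 0) → a = 0

/-- `(M, Γ, Z, Ω)` is a variation of BPS structures. The constant in the support property is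
locally uniform; this does not depend on the parallel norm, here an `ℓ¹` norm in a flat frame. -/
structure IsBPSVariation [Module.Free ℤ Γf] [Module.Finite ℤ Γf]
    (Z : CentralCharge E L) (Ω : ∀ p, L.fib p → ℤ) : Prop where
  symm : ∀ p γ, Ω p (-γ) = Ω p γ
  /-- For a strictly convex sector whose boundary rays contain no `Z_γ` with `Ω γ ≠ 0` at `p`,
  the product of Kontsevich-Soibelman automorphisms over the sector is constant near `p`, each
  matrix coefficient being taken for itself. -/
  wallCrossing : ∀ (p : M) (φ₁ φ₂ : ℝ), φ₁ < φ₂ → φ₂ < φ₁ + Real.pi →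
    (∀ γ, Ω p γ ≠ 0 → Z.val p γ ∉ ray φ₁ ∧ Z.val p γ ∉ ray φ₂) →
    ∀ β δ : L.fib p, ∀ᶠ q in 𝓝 p,
      ksCoeff (L.pairing q) (Z.val q) (Ω q) φ₁ φ₂ (L.flatExt p β q) (L.flatExt p δ q)
        = ksCoeff (L.pairing p) (Z.val p) (Ω p) φ₁ φ₂ β δ
  support : ∀ p, ∃ C : ℝ, 0 < C ∧ ∀ᶠ q in 𝓝 p, ∀ γ : L.fib q, Ω q γ ≠ 0 →
    C * modelNorm ((L.frame p q).symm γ) < ‖Z.val q γ‖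
  convergence : ∀ p, ∃ R : ℝ, 0 < R ∧
    Summable fun γ : L.fib p => |(Ω p γ : ℝ)| * Real.exp (-R * ‖Z.val p γ‖)

/-- A hyperkähler variation of BPS structures. The last condition is the normal convergence of
`∑ |Ω(γ)| exp(-R |Z_γ|)`, near every point of `M`. -/
structure IsHKVariation [Module.Free ℤ Γf] [Module.Finite ℤ Γf]
    (Z : CentralCharge E L) (Ω : ∀ p, L.fib p → ℤ) : Prop extends IsBPSVariation Z Ω where
  ask : IsCentralChargeASK Z
  strongConvergence : ∀ R : ℝ, 0 < R → ∀ p, ∃ c : Model r Γf → ℝ, Summable c ∧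
    ∀ᶠ q in 𝓝 p, ∀ x,
      |(Ω q (L.frame p q x) : ℝ)| * Real.exp (-R * ‖Z.val q (L.frame p q x)‖) ≤ c x

/-- Mutual locality: charges with non-zero BPS index pair to zero. -/
def IsMutuallyLocal (L : ChargeLattice.{u, v, w} M r Γf) (Ω : ∀ p, L.fib p → ℤ) : Prop :=
  ∀ p γ γ', Ω p γ ≠ 0 → Ω p γ' ≠ 0 → L.pairing p γ γ' = 0

/-! ### The torus bundle and its smooth structure -/

/-- The torus bundle `𝒩(θ_f)`: its fiber over `p` consists of the homomorphisms
`θ : Γ_p → ℝ / 2πℤ` that restrict to `θ_f` on the flavor charges. -/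
def TorusBundle (L : ChargeLattice.{u, v, w} M r Γf) (θf : Γf →+ Real.Angle) : Type (max u w) :=
  Σ p : M, {θ : L.fib p →+ Real.Angle // ∀ f, θ (L.flavor p f) = θf f}

/-- The vertical tangent space `Hom(Γ_p / Γf, ℝ)`. -/
def vert (L : ChargeLattice.{u, v, w} M r Γf) (p : M) : Submodule ℝ (L.fib p →+ ℝ) where
  carrier := {α | ∀ f, α (L.flavor p f) = 0}
  add_mem' := fun {a b} ha hb f => by
    have h1 := ha f
    have h2 := hb f
    simp [h1, h2]
  zero_mem' := fun _ => rfl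
  smul_mem' := fun c a ha f => by
    have h1 := ha f
    simp [h1]

/-- The tangent space of `𝒩(θ_f)` at a point over `p`. As `Γ` is a local system, `𝒩(θ_f) → M`
has a canonical flat connection (given by `dθ_γ = 0` for flat `γ`), which splits the tangent
space into `T_p M = E` and the vertical part. -/
abbrev Tan (E : Type*) [NormedAddCommGroup E] [NormedSpace ℂ E]
    {M : Type u} [TopologicalSpace M] {r : ℕ} {Γf : Type v} [AddCommGroup Γf]
    {L : ChargeLattice.{u, v, w} M r Γf} {θf : Γf →+ Real.Angle} (x : TorusBundle L θf) :=
  E × vert L x.1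

/-- The space of local coordinates `(z, a, b)` on `𝒩(θ_f)`. -/
abbrev Coord (E : Type*) (r : ℕ) := E × (Fin r → ℝ) × (Fin r → ℝ)

/-- The linear functional with values `a i`, `b i` on `γ̃_i`, `γ^i` and `0` on `Γf`. -/
def coordHom (L : ChargeLattice.{u, v, w} M r Γf) (p q : M) (a b : Fin r → ℝ) :
    L.fib q →+ ℝ :=
  AddMonoidHom.mk' (fun γ => ∑ i, ((((L.frame p q).symm γ).1 i : ℝ) * a i
      + (((L.frame p q).symm γ).2.1 i : ℝ) * b i)) (by
    intro γ γ'
    rw [← Finset.sum_add_distrib]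
    refine Finset.sum_congr rfl fun i _ => ?_
    simp only [map_add, Prod.fst_add, Prod.snd_add, Pi.add_apply, Int.cast_add]
    ring)

theorem frame_symm_flavor (L : ChargeLattice.{u, v, w} M r Γf) (p q : M) (f : Γf) :
    (L.frame p q).symm (L.flavor q f) = (0, 0, f) := by
  rw [AddEquiv.symm_apply_eq, (L.adapted p q).flavor]

theorem coordHom_flavor (L : ChargeLattice.{u, v, w} M r Γf) (p q : M) (a b : Fin r → ℝ)
    (f : Γf) : coordHom L p q a b (L.flavor q f) = 0 := by
  simp [coordHom, frame_symm_flavor]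

/-- The local parametrization `(z, a, b) ↦ θ` of `𝒩(θ_f)`: `z` is the coordinate of the base
point in the preferred chart at `p`, and `θ_{γ̃_i} = a i`, `θ_{γ^i} = b i` modulo `2π` in the
preferred frame at `p`. -/
def param (L : ChargeLattice.{u, v, w} M r Γf) (θf : Γf →+ Real.Angle) (p : M)
    (y : Coord E r) : TorusBundle L θf :=
  ⟨(chartAt E p).symm y.1,
    Real.Angle.coeHom.comp (coordHom L p ((chartAt E p).symm y.1) y.2.1 y.2.2)
      + AddMonoidHom.mk' (fun γ => θf ((L.frame p ((chartAt E p).symm y.1)).symm γ).2.2) (by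
          intro γ γ'
          simp),
    fun f => by simp [coordHom_flavor, frame_symm_flavor]⟩

/-- The open set of coordinates on which `param` is a local diffeomorphism. -/
def paramDomain (E : Type*) [NormedAddCommGroup E] [NormedSpace ℂ E]
    {M : Type u} [TopologicalSpace M] [ChartedSpace E M] {r : ℕ} {Γf : Type v} [AddCommGroup Γf]
    (L : ChargeLattice.{u, v, w} M r Γf) (p : M) : Set (Coord E r) :=
  {y | y.1 ∈ (chartAt E p).target ∧ (chartAt E p).symm y.1 ∈ L.dom p}

/-- The topology of `𝒩(θ_f)`, for which the local parametrizations are open maps. -/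
@[reducible]
def torusTopology (E : Type*) [NormedAddCommGroup E] [NormedSpace ℂ E]
    {M : Type u} [TopologicalSpace M] [ChartedSpace E M] {r : ℕ} {Γf : Type v} [AddCommGroup Γf]
    (L : ChargeLattice.{u, v, w} M r Γf) (θf : Γf →+ Real.Angle) :
    TopologicalSpace (TorusBundle L θf) :=
  ⨆ p : M, TopologicalSpace.coinduced
    (fun y : paramDomain E L p => param L θf p y.1) inferInstance

/-- The differential of the local parametrization. -/
def dParam (L : ChargeLattice.{u, v, w} M r Γf) (θf : Γf →+ Real.Angle) (p : M)
    (y : Coord E r) (k : Coord E r) : Tan E (param L θf p y) :=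
  ((mfderiv 𝓘(ℂ, E) 𝓘(ℂ, E) (chartAt E p).symm y.1 : E →L[ℂ] E) k.1,
    ⟨coordHom L p _ k.2.1 k.2.2, coordHom_flavor L p _ k.2.1 k.2.2⟩)

/-- The inverse of the differential of the local parametrization. -/
def dParamInv (L : ChargeLattice.{u, v, w} M r Γf) (θf : Γf →+ Real.Angle) (p : M)
    (y : Coord E r) (ξ : Tan E (param L θf p y)) : Coord E r :=
  ((mfderiv 𝓘(ℂ, E) 𝓘(ℂ, E) (chartAt E p) (param L θf p y).1 : E →L[ℂ] E) ξ.1,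
    fun i => ξ.2.1 (gammaTilde (L.frame p) _ i),
    fun i => ξ.2.1 (gammaUp (L.frame p) _ i))

/-! ### Tensor fields on the torus bundle -/

section Tensors

variable {θf : Γf →+ Real.Angle}

/-- The coordinate domain of the part of a subset `S` of `𝒩(θ_f)` that lies in the chart `p`. -/
def chartPart (S : Set (TorusBundle L θf)) (p : M) : Set (Coord E r) :=
  {y | y ∈ paramDomain E L p ∧ param L θf p y ∈ S}

/-- A covariant `2`-tensor field in local coordinates. -/
def pull (B : ∀ x : TorusBundle L θf, Tan E x → Tan E x → ℝ) (p : M) (y k l : Coord E r) : ℝ :=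
  B (param L θf p y) (dParam L θf p y k) (dParam L θf p y l)

/-- An endomorphism field in local coordinates. -/
def pullEnd (J : ∀ x : TorusBundle L θf, Tan E x →ₗ[ℝ] Tan E x) (p : M) (y k : Coord E r) :
    Coord E r :=
  dParamInv L θf p y (J (param L θf p y) (dParam L θf p y k))

/-- Bilinearity on each tangent space. -/
def IsBilin {V : Type*} [AddCommGroup V] [Module ℝ V] (B : V → V → ℝ) : Prop :=
  (∀ ξ, IsLinearMap ℝ (fun η => B ξ η)) ∧ ∀ η, IsLinearMap ℝ (fun ξ => B ξ η)

/-- Smoothness of a `2`-tensor field on the open set `S`. -/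
def IsSmoothTensor (S : Set (TorusBundle L θf))
    (B : ∀ x : TorusBundle L θf, Tan E x → Tan E x → ℝ) : Prop :=
  ∀ (p : M) (k l : Coord E r),
    ContDiffOn ℝ ∞ (fun y => pull B p y k l) (chartPart (E := E) S p)

/-- Smoothness of an endomorphism field on the open set `S`. -/
def IsSmoothEnd (S : Set (TorusBundle L θf))
    (J : ∀ x : TorusBundle L θf, Tan E x →ₗ[ℝ] Tan E x) : Prop :=
  ∀ (p : M) (k : Coord E r),
    ContDiffOn ℝ ∞ (fun y => pullEnd J p y k) (chartPart (E := E) S p)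

/-- A smooth real differential `2`-form on the open set `S`. -/
structure IsSmoothTwoForm (S : Set (TorusBundle L θf))
    (B : ∀ x : TorusBundle L θf, Tan E x → Tan E x → ℝ) : Prop where
  bilin : ∀ x ∈ S, IsBilin (B x)
  alt : ∀ x ∈ S, ∀ ξ, B x ξ ξ = 0
  smooth : IsSmoothTensor S B

/-- `dB = 0` on the open set `S`, evaluated on constant coordinate vector fields. -/
def IsClosedForm (S : Set (TorusBundle L θf))
    (B : ∀ x : TorusBundle L θf, Tan E x → Tan E x → ℝ) : Prop :=
  ∀ (p : M), ∀ y ∈ chartPart (E := E) S p, ∀ k₀ k₁ k₂ : Coord E r,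
    fderiv ℝ (fun y => pull B p y k₁ k₂) y k₀ - fderiv ℝ (fun y => pull B p y k₀ k₂) y k₁
      + fderiv ℝ (fun y => pull B p y k₀ k₁) y k₂ = 0

/-- The Nijenhuis tensor `[Jk, Jl] - J[Jk, l] - J[k, Jl] - [k, l]` vanishes on the open set `S`;
here `k`, `l` are constant coordinate vector fields, so that `[k, l] = 0`. -/
def IsIntegrable (S : Set (TorusBundle L θf))
    (J : ∀ x : TorusBundle L θf, Tan E x →ₗ[ℝ] Tan E x) : Prop :=
  ∀ (p : M), ∀ y ∈ chartPart (E := E) S p, ∀ k l : Coord E r,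
    VectorField.lieBracket ℝ (fun y => pullEnd J p y k) (fun y => pullEnd J p y l) y
      - pullEnd J p y (VectorField.lieBracket ℝ (fun y => pullEnd J p y k) (fun _ => l) y)
      - pullEnd J p y (VectorField.lieBracket ℝ (fun _ => k) (fun y => pullEnd J p y l) y) = 0

/-- `(g, I 0, I 1, I 2)` is a (possibly indefinite) hyperkähler structure on the open set `S` with
Kähler forms `Φ α = g(I α -, -)`: `g` is a pseudo-Riemannian metric, the `I α` are integrable
almost complex structures that are isometries of `g` and satisfy the quaternion relations, and
the forms `Φ α` are closed. -/
structure IsPseudoHyperkahler (S : Set (TorusBundle L θf))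
    (g : ∀ x : TorusBundle L θf, Tan E x → Tan E x → ℝ)
    (I : Fin 3 → ∀ x : TorusBundle L θf, Tan E x →ₗ[ℝ] Tan E x)
    (Φ : Fin 3 → ∀ x : TorusBundle L θf, Tan E x → Tan E x → ℝ) : Prop where
  isOpen : IsOpen[torusTopology E L θf] S
  bilin : ∀ x ∈ S, IsBilin (g x)
  symm : ∀ x ∈ S, ∀ ξ η, g x ξ η = g x η ξ
  nondegenerate : ∀ x ∈ S, ∀ ξ, (∀ η, g x ξ η = 0) → ξ = 0
  smooth : IsSmoothTensor S g
  smooth_I : ∀ α, IsSmoothEnd S (I α)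
  sq : ∀ α, ∀ x ∈ S, ∀ ξ, I α x (I α x ξ) = -ξ
  quaternion : ∀ x ∈ S, ∀ ξ, I 0 x (I 1 x ξ) = I 2 x ξ
  isometry : ∀ α, ∀ x ∈ S, ∀ ξ η, g x (I α x ξ) (I α x η) = g x ξ η
  kahlerForm : ∀ α, ∀ x ∈ S, ∀ ξ η, Φ α x ξ η = g x (I α x ξ) η
  integrable : ∀ α, IsIntegrable S (I α)
  closed : ∀ α, IsClosedForm S (Φ α)

end Tensors

/-! ### The instanton corrected forms -/

section Forms

variable {θf : Γf →+ Real.Angle}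

/-- The value `θ_γ` at a point of `𝒩(θ_f)`. -/
def theta (x : TorusBundle L θf) (γ : L.fib x.1) : Real.Angle := x.2.1 γ

/-- The `1`-form `dθ` with values in `Γg^* ⊗ ℝ`, regarded with complex values. -/
def dTheta (x : TorusBundle L θf) (ξ : Tan E x) (γ : L.fib x.1) : ℂ := ((ξ.2.1 γ : ℝ) : ℂ)

/-- The pull-back of `dZ` to `𝒩(θ_f)`. -/
def dZp (Z : CentralCharge E L) (x : TorusBundle L θf) (ξ : Tan E x) (γ : L.fib x.1) : ℂ :=
  dZform Z x.1 ξ.1 γ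

/-- The pull-back of `dZ̄` to `𝒩(θ_f)`. -/
def dZbarp (Z : CentralCharge E L) (x : TorusBundle L θf) (ξ : Tan E x) (γ : L.fib x.1) : ℂ :=
  dZbarform Z x.1 ξ.1 γ

/-- The term `e^{i n θ_γ} K_0(2π n |Z_γ|)` of `V_γ`, with `n = k + 1`. -/
def VTerm (Z : CentralCharge E L) (x : TorusBundle L θf) (γ : L.fib x.1) (k : ℕ) : ℂ :=
  (((k + 1) • theta x γ).toCircle : ℂ)
    * (besselK 0 (2 * Real.pi * (k + 1) * ‖Z.val x.1 γ‖) : ℂ)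

/-- The term `e^{i n θ_γ} |Z_γ| K_1(2π n |Z_γ|)` of `A_γ`, with `n = k + 1`. -/
def ATerm (Z : CentralCharge E L) (x : TorusBundle L θf) (γ : L.fib x.1) (k : ℕ) : ℂ :=
  (((k + 1) • theta x γ).toCircle : ℂ) * (‖Z.val x.1 γ‖ : ℂ)
    * (besselK 1 (2 * Real.pi * (k + 1) * ‖Z.val x.1 γ‖) : ℂ)

/-- The function `V_γ^inst`. -/
def Vinst (Z : CentralCharge E L) (x : TorusBundle L θf) (γ : L.fib x.1) : ℂ :=
  1 / (2 * Real.pi) * ∑' k : ℕ, VTerm Z x γ k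

/-- The `1`-form `A_γ^inst`. -/
def Ainst (Z : CentralCharge E L) (x : TorusBundle L θf) (γ : L.fib x.1) (ξ : Tan E x) : ℂ :=
  -(1 / (4 * Real.pi)) * (∑' k : ℕ, ATerm Z x γ k)
    * (dZp Z x ξ γ / Z.val x.1 γ - dZbarp Z x ξ γ / (starRingEnd ℂ) (Z.val x.1 γ))

/-- The contribution of `γ` to `ω₁ + i ω₂`. -/
def omega12Term (Z : CentralCharge E L) (Ω : ∀ p, L.fib p → ℤ) (x : TorusBundle L θf)
    (ξ η : Tan E x) (γ : L.fib x.1) : ℂ :=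
  (Ω x.1 γ : ℂ) * wedge (fun ζ => dZp Z x ζ γ) (Ainst Z x γ) ξ η
    + Complex.I * (Ω x.1 γ : ℂ) / (2 * Real.pi) * Vinst Z x γ
      * wedge (fun ζ => dTheta x ζ γ) (fun ζ => dZp Z x ζ γ) ξ η

/-- The form `ω₁ + i ω₂`. -/
def omega12 (Z : CentralCharge E L) (Ω : ∀ p, L.fib p → ℤ) (x : TorusBundle L θf)
    (ξ η : Tan E x) : ℂ :=
  -(1 / (2 * Real.pi)) * L.pairWedge x.1 (dZp Z x) (dTheta x) ξ η
    + ∑' γ : L.fib x.1, omega12Term Z Ω x ξ η γ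

/-- The contribution of `γ` to `ω₃`. -/
def omega3Term (Z : CentralCharge E L) (Ω : ∀ p, L.fib p → ℤ) (x : TorusBundle L θf)
    (ξ η : Tan E x) (γ : L.fib x.1) : ℂ :=
  Complex.I * (Ω x.1 γ : ℂ) / 2 * Vinst Z x γ
      * wedge (fun ζ => dZp Z x ζ γ) (fun ζ => dZbarp Z x ζ γ) ξ η
    + (Ω x.1 γ : ℂ) / (2 * Real.pi) * wedge (fun ζ => dTheta x ζ γ) (Ainst Z x γ) ξ η

/-- The form `ω₃`, as a complex expression (its values are real). -/
def omega3 (Z : CentralCharge E L) (Ω : ∀ p, L.fib p → ℤ) (x : TorusBundle L θf)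
    (ξ η : Tan E x) : ℂ :=
  1 / 4 * L.pairWedge x.1 (dZp Z x) (dZbarp Z x) ξ η
    - 1 / (8 * Real.pi ^ 2) * L.pairWedge x.1 (dTheta x) (dTheta x) ξ η
    + ∑' γ : L.fib x.1, omega3Term Z Ω x ξ η γ

/-- The real `2`-forms `ω₁`, `ω₂`, `ω₃` on `𝒩(θ_f)`, numbered from `0`. -/
def kahlerForms (Z : CentralCharge E L) (Ω : ∀ p, L.fib p → ℤ) :
    Fin 3 → ∀ x : TorusBundle L θf, Tan E x → Tan E x → ℝ :=
  ![fun x ξ η => (omega12 Z Ω x ξ η).re, fun x ξ η => (omega12 Z Ω x ξ η).im,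
    fun x ξ η => (omega3 Z Ω x ξ η).re]

/-- The contribution of `γ` to `T`; here `|dZ_γ|²(ξ, η) = Re (dZ_γ(ξ) dZ̄_γ(η))`. -/
def tensorTTerm (Z : CentralCharge E L) (Ω : ∀ p, L.fib p → ℤ) (x : TorusBundle L θf)
    (ξ η : Tan E x) (γ : L.fib x.1) : ℂ :=
  (Ω x.1 γ : ℂ) * Vinst Z x γ * ((dZp Z x ξ γ * dZbarp Z x η γ).re : ℂ)

/-- The tensor field `T = π^* g_sK + ∑_γ Ω(γ) V_γ^inst π^* |dZ_γ|²`. -/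
def tensorT (Z : CentralCharge E L) (Ω : ∀ p, L.fib p → ℤ) (x : TorusBundle L θf)
    (ξ η : Tan E x) : ℂ :=
  gSK Z x.1 ξ.1 η.1 + ∑' γ : L.fib x.1, tensorTTerm Z Ω x ξ η γ

/-- The subset `N` of `𝒩(θ_f)` on which `T` is horizontally non-degenerate: the kernel of `T`
consists of vertical vectors. -/
def regularSet (Z : CentralCharge E L) (Ω : ∀ p, L.fib p → ℤ) (θf : Γf →+ Real.Angle) :
    Set (TorusBundle L θf) :=
  {x | ∀ ξ : Tan E x, (∀ η : Tan E x, tensorT Z Ω x ξ η = 0) → ξ.1 = 0}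

/-! ### Expressions in a local frame -/

/-- The flat frame `e` over `U` has `p(Supp Ω)` contained in the span of the `p(γ^i)`. -/
def IsSupportFrame (Ω : ∀ p, L.fib p → ℤ) (U : Set M)
    (e : ∀ q : M, Model r Γf ≃+ L.fib q) : Prop :=
  L.IsFlatFrame U e ∧ ∀ p ∈ U, ∀ γ, Ω p γ ≠ 0 → ((e p).symm γ).1 = 0

/-- `W_i = dθ_{γ̃_i} - ∑_j τ_ij dθ_{γ^j}`. -/
def Wform (e : ∀ q : M, Model r Γf ≃+ L.fib q) (x : TorusBundle L θf)
    (τ : Matrix (Fin r) (Fin r) ℂ) (i : Fin r) (ξ : Tan E x) : ℂ :=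
  dTheta x ξ (gammaTilde e x.1 i) - ∑ j, τ i j * dTheta x ξ (gammaUp e x.1 j)

/-- The contribution of `γ` to `W_i^inst`. -/
def WinstTerm (Z : CentralCharge E L) (Ω : ∀ p, L.fib p → ℤ)
    (e : ∀ q : M, Model r Γf ≃+ L.fib q) (x : TorusBundle L θf) (i : Fin r) (ξ : Tan E x)
    (γ : L.fib x.1) : ℂ :=
  (Ω x.1 γ : ℂ) * (nCoeff e x.1 γ i : ℂ)
    * (2 * Real.pi * Ainst Z x γ ξ - Complex.I * Vinst Z x γ * dTheta x ξ γ)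

/-- `W_i + W_i^inst`. -/
def Yform (Z : CentralCharge E L) (Ω : ∀ p, L.fib p → ℤ)
    (e : ∀ q : M, Model r Γf ≃+ L.fib q) (x : TorusBundle L θf)
    (τ : Matrix (Fin r) (Fin r) ℂ) (i : Fin r) (ξ : Tan E x) : ℂ :=
  Wform e x τ i ξ + ∑' γ : L.fib x.1, WinstTerm Z Ω e x i ξ γ

/-- The contribution of `γ` to `N_ij^inst`. -/
def NinstTerm (Z : CentralCharge E L) (Ω : ∀ p, L.fib p → ℤ)
    (e : ∀ q : M, Model r Γf ≃+ L.fib q) (x : TorusBundle L θf) (i j : Fin r)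
    (γ : L.fib x.1) : ℂ :=
  (Ω x.1 γ : ℂ) * Vinst Z x γ * (nCoeff e x.1 γ i : ℂ) * (nCoeff e x.1 γ j : ℂ)

/-- The matrix `N + N^inst`, where `N = Im τ`. -/
def Gmatrix (Z : CentralCharge E L) (Ω : ∀ p, L.fib p → ℤ)
    (e : ∀ q : M, Model r Γf ≃+ L.fib q) (x : TorusBundle L θf)
    (τ : Matrix (Fin r) (Fin r) ℂ) : Matrix (Fin r) (Fin r) ℂ :=
  Matrix.of fun i j => ((τ i j).im : ℂ) + ∑' γ : L.fib x.1, NinstTerm Z Ω e x i j γ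

/-- The symmetric product `a b̄ = (a ⊗ b̄ + b̄ ⊗ a) / 2` of two `1`-forms. -/
def symProdBar {V : Type*} (a b : V → ℂ) (ξ η : V) : ℂ :=
  (a ξ * (starRingEnd ℂ) (b η) + a η * (starRingEnd ℂ) (b ξ)) / 2

/-- The wedge product `a ∧ b̄`. -/
def wedgeBar {V : Type*} (a b : V → ℂ) (ξ η : V) : ℂ :=
  wedge a (fun ζ => (starRingEnd ℂ) (b ζ)) ξ η

end Forms

end Geometry

end HKBPS

end

open HKBPS

noncomputable section

namespace HKBPS

universe u v w

/-! ### Bessel functions -/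

section Bessel

open MeasureTheory

/-! Three independent inputs are combined: arithmetic of the BPS indices, analysis of Bessel series,
and linear algebra in each tangent space.

Mutual locality turns wall-crossing into local constancy. All pairings between active charges
vanish, so the matrix coefficient of the Kontsevich-Soibelman product that leads from `X_{2mβ}` to
`X_{2mβ+δ}` is a polynomial in `2m` (the even factor removes the signs) with linear coefficient
`DT(δ)⟨δ, β⟩`. Its values are locally constant, and for a non-flavor `δ` some `β` has `⟨δ, β⟩ ≠ 0`;
hence `DT(δ)` is locally constant, and so is `Ω(δ)` (`IsBPSVariation.eventually_DT_eq`,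
`IsBPSVariation.eventually_eq`). Indices of flavor charges are not controlled in this way, but `dZ`
and `dθ` vanish on such charges, so they do not contribute.

Near a point the forms are therefore series with constant indices. The Bessel functions enter
through `kappa ν`, a function of `|Z|²` with derivative `-kappa (ν + 1)`. Series of such terms with
coefficients of polynomial growth are stable under differentiation, and the support property with
strong convergence supplies summable majorants; this gives smoothness and termwise differentiation
(`SeriesData.Adm.contDiffOn`). Each term is closed by itself: for `ω₁ + iω₂` by the derivative rule
alone, for `ω₃` with the help of `kappa_recurrence`.

Modulo flavor, the active charges span an isotropic sublattice, which lies in one half of a Darboux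
basis (`exists_symplectic_of_isotropic`). In such a frame everything is expressed by `dZ_{γ^i}`,
`Y_i = W_i + W_i^inst` and the real symmetric matrix `G = N + N^inst`, where `Y = R - i G v` with
`R` and `v = (dθ_{γ^i})` real. If `G` is invertible, `(dZ, Y)` identifies the tangent space with
`ℂ^r × ℂ^r` and the three forms with a standard hyperkähler triple (`isHKAlgebra_standard`).
Invertibility of `G` describes the set `N` (`mem_regularSet_iff`); since a singular `G` makes `ω₁`
degenerate, `N` is also the locus where `ω₁` is non-degenerate, which is open.

The triple of forms determines the rest: `I_{α+2}` is the quotient of `ω_α` by `ω_{α+1}`, and `g =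
-ω₃(I₃ -, -)`. Thus `g` and the `I_α` are smooth and do not depend on the frame. Integrability
follows from closedness of two of the forms (`nijenhuis_eq_zero`). -/

/-- The integrand of `kappa`. -/
def kappaFun (ν : ℕ) (w t : ℝ) : ℝ := Real.exp (-Real.exp t - w * Real.exp (-t) - ν * t)

/-- `kappa ν (x² / 4) = 2 (x / 2)^{-ν} K_ν(x)`. -/
def kappa (ν : ℕ) (w : ℝ) : ℝ := ∫ t : ℝ, kappaFun ν w t

theorem exp_neg_le_factorial_div_pow {y : ℝ} (hy : 0 < y) (k : ℕ) :
    Real.exp (-y) ≤ k.factorial / y ^ k := by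
  rw [Real.exp_neg, inv_le_comm₀ (Real.exp_pos _) (by positivity), inv_div]
  exact Real.pow_div_factorial_le_exp y hy.le k

theorem exp_neg_abs_le (t : ℝ) : Real.exp (-|t|) ≤ 2 * (1 + t ^ 2)⁻¹ := by
  have h := Real.quadratic_le_exp_of_nonneg (abs_nonneg t)
  rw [Real.exp_neg, ← div_eq_mul_inv, le_div_iff₀ (by positivity), ← div_eq_inv_mul,
    div_le_iff₀ (Real.exp_pos _)]
  nlinarith [abs_nonneg t, sq_abs t]

/-- Each double exponential beats all simple exponentials at its own end of the line. The majorant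
is integrable and is independent of everything except the constants, so it serves for dominated
convergence. -/
theorem exp_double_exp_le {α β : ℝ} (hα : 0 < α) (hβ : 0 < β) (ν : ℕ) :
    ∃ C : ℝ, 0 < C ∧ ∀ t : ℝ,
      Real.exp (-(α * Real.exp t) - β * Real.exp (-t) - ν * t) ≤ C * (1 + t ^ 2)⁻¹ := by
  -- The power `ν + 1` is one more than is needed to cancel `e^{-νt}`; the surplus `e^t` provides
  -- the decay at `-∞`.
  set A : ℝ := (ν + 1).factorial / β ^ (ν + 1)
  have hA : 0 < A := by positivity
  refine ⟨A * (1 + 2 / α ^ 2) * 2, by positivity, fun t => ?_⟩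
  have h1 : Real.exp (-(β * Real.exp (-t))) ≤ A * Real.exp ((ν + 1) * t) := by
    refine (exp_neg_le_factorial_div_pow (by positivity) (ν + 1)).trans (le_of_eq ?_)
    rw [mul_pow, ← Real.exp_nat_mul, mul_neg, Real.exp_neg]
    push_cast
    field_simp
    simp only [A]
    field_simp
  have h2 : Real.exp (-(α * Real.exp t)) * Real.exp t ≤ (1 + 2 / α ^ 2) * Real.exp (-|t|) := by
    rcases le_total 0 t with ht | ht
    · have h3 := exp_neg_le_factorial_div_pow (y := α * Real.exp t) (by positivity) 2
      have h4 : Real.exp (-(α * Real.exp t)) * Real.exp t ≤ 2 / α ^ 2 * Real.exp (-t) := by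
        calc _ ≤ (2 : ℕ).factorial / (α * Real.exp t) ^ 2 * Real.exp t := by gcongr
          _ = _ := by rw [Real.exp_neg]; simp; field_simp
      rw [abs_of_nonneg ht]
      refine h4.trans ?_
      gcongr
      linarith
    · rw [abs_of_nonpos ht, neg_neg]
      gcongr
      have : Real.exp (-(α * Real.exp t)) ≤ 1 := Real.exp_le_one_iff.2 (by
        have := Real.exp_pos t; nlinarith)
      have h5 : 0 ≤ 2 / α ^ 2 := by positivity
      linarith
  calc Real.exp (-(α * Real.exp t) - β * Real.exp (-t) - ν * t)
      = Real.exp (-(α * Real.exp t)) * Real.exp (-(β * Real.exp (-t))) * Real.exp (-(ν * t)) := by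
        rw [← Real.exp_add, ← Real.exp_add]; ring_nf
    _ ≤ Real.exp (-(α * Real.exp t)) * (A * Real.exp ((ν + 1) * t)) * Real.exp (-(ν * t)) := by
        gcongr
    _ = A * (Real.exp (-(α * Real.exp t)) * Real.exp t) := by
        have : Real.exp ((ν + 1) * t) * Real.exp (-(ν * t)) = Real.exp t := by
          rw [← Real.exp_add]; ring_nf
        rw [← this]; ring
    _ ≤ A * ((1 + 2 / α ^ 2) * (2 * (1 + t ^ 2)⁻¹)) := by
        refine mul_le_mul_of_nonneg_left (h2.trans ?_) hA.le
        exact mul_le_mul_of_nonneg_left (exp_neg_abs_le t) (by positivity)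
    _ = _ := by ring

theorem continuous_kappaFun (ν : ℕ) (w : ℝ) : Continuous (kappaFun ν w) := by
  unfold kappaFun; fun_prop

theorem kappaFun_pos (ν : ℕ) (w t : ℝ) : 0 < kappaFun ν w t := Real.exp_pos _

/-- The exponent is split into halves. By the inequality of arithmetic and geometric means `e^t + w
e^{-t} ≥ 2√w`, so one half yields `e^{-√w}`; the other half, with `w` replaced by `w₀`, yields the
integrable factor. -/
theorem kappaFun_le {w₀ : ℝ} (hw₀ : 0 < w₀) (ν : ℕ) :
    ∃ C : ℝ, 0 < C ∧ ∀ w, w₀ ≤ w → ∀ t,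
      kappaFun ν w t ≤ Real.exp (-Real.sqrt w) * (C * (1 + t ^ 2)⁻¹) := by
  obtain ⟨C, hC, h⟩ := exp_double_exp_le (α := 1 / 2) (β := w₀ / 2) (by norm_num)
    (by positivity) ν
  refine ⟨C, hC, fun w hw t => ?_⟩
  refine le_trans ?_ (mul_le_mul_of_nonneg_left (h t) (Real.exp_pos _).le)
  rw [← Real.exp_add, kappaFun]
  refine Real.exp_le_exp.2 ?_
  have hs := Real.sq_sqrt (hw₀.le.trans hw)
  have e1 : Real.exp t * Real.exp (-t) = 1 := by rw [← Real.exp_add]; simp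
  have p1 := Real.exp_pos t
  have p2 := Real.exp_pos (-t)
  have key : 2 * Real.sqrt w ≤ Real.exp t + w * Real.exp (-t) := by
    have := sq_nonneg (Real.sqrt w * Real.exp (-t) - 1)
    have h3 : Real.exp t * (Real.sqrt w * Real.exp (-t) - 1) ^ 2
        = Real.exp t + w * Real.exp (-t) - 2 * Real.sqrt w := by
      linear_combination (Real.exp t) * Real.exp (-t) ^ 2 * hs
        + (w * Real.exp (-t) - 2 * Real.sqrt w) * e1
    nlinarith
  nlinarith

theorem integrable_kappaFun (ν : ℕ) {w : ℝ} (hw : 0 < w) : Integrable (kappaFun ν w) := by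
  obtain ⟨C, hC, h⟩ := kappaFun_le hw ν
  refine ((integrable_inv_one_add_sq.const_mul C).const_mul (Real.exp (-Real.sqrt w))).mono'
    (continuous_kappaFun ν w).aestronglyMeasurable (ae_of_all _ fun t => ?_)
  rw [Real.norm_of_nonneg (kappaFun_pos _ _ _).le]
  exact h w le_rfl t

theorem kappa_nonneg (ν : ℕ) (w : ℝ) : 0 ≤ kappa ν w :=
  integral_nonneg fun _ => (kappaFun_pos _ _ _).le

theorem kappa_le {w₀ : ℝ} (hw₀ : 0 < w₀) (ν : ℕ) :
    ∃ C : ℝ, 0 < C ∧ ∀ w, w₀ ≤ w → kappa ν w ≤ C * Real.exp (-Real.sqrt w) := by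
  obtain ⟨C, hC, h⟩ := kappaFun_le hw₀ ν
  refine ⟨C * Real.pi, by positivity, fun w hw => ?_⟩
  calc kappa ν w ≤ ∫ t : ℝ, Real.exp (-Real.sqrt w) * (C * (1 + t ^ 2)⁻¹) :=
        integral_mono (integrable_kappaFun ν (hw₀.trans_le hw))
          ((integrable_inv_one_add_sq.const_mul C).const_mul _) (h w hw)
    _ = _ := by
        rw [integral_const_mul, integral_const_mul, integral_univ_inv_one_add_sq]; ring

/-- Differentiation brings down `-e^{-t}`, which raises `ν` by one. This is the reason for working
with `kappa` instead of `besselK`: derivatives stay in the family, and the argument `|Z|²` is smooth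
in the coordinates. -/
theorem hasDerivAt_kappa (ν : ℕ) {w : ℝ} (hw : 0 < w) :
    HasDerivAt (kappa ν) (-kappa (ν + 1) w) w := by
  obtain ⟨C, hC, h⟩ := kappaFun_le (half_pos hw) (ν + 1)
  have := (hasDerivAt_integral_of_dominated_loc_of_deriv_le (μ := volume)
    (F := fun w t => kappaFun ν w t) (F' := fun w t => -kappaFun (ν + 1) w t)
    (x₀ := w) (bound := fun t => C * (1 + t ^ 2)⁻¹) (s := Set.Ioi (w / 2))
    (Ioi_mem_nhds (half_lt_self hw))
    (Eventually.of_forall fun w => (continuous_kappaFun ν w).aestronglyMeasurable)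
    (integrable_kappaFun ν hw)
    (continuous_kappaFun (ν + 1) w).neg.aestronglyMeasurable
    (ae_of_all _ fun t x hx => ?_) (integrable_inv_one_add_sq.const_mul C)
    (ae_of_all _ fun t x hx => ?_)).2
  · rwa [integral_neg] at this
  · rw [norm_neg, Real.norm_of_nonneg (kappaFun_pos _ _ _).le]
    refine (h x (le_of_lt hx) t).trans ?_
    have h1 : Real.exp (-Real.sqrt x) ≤ 1 := Real.exp_le_one_iff.2 (by simp)
    have h2 : 0 ≤ C * (1 + t ^ 2)⁻¹ := by positivity
    nlinarith
  · have h1 : HasDerivAt (fun x : ℝ => -Real.exp t - x * Real.exp (-t) - ν * t)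
        (-Real.exp (-t)) x := by
      simpa using (((hasDerivAt_id x).mul_const (Real.exp (-t))).const_sub
        (-Real.exp t)).sub_const (ν * t)
    refine h1.exp.congr_deriv ?_
    rw [mul_neg, ← Real.exp_add]
    simp only [kappaFun]
    push_cast
    ring_nf

theorem tendsto_kappaFun (ν : ℕ) {w : ℝ} (hw : 0 < w) {l : Filter ℝ}
    (hl : Tendsto (fun t : ℝ => (1 + t ^ 2)⁻¹) l (𝓝 0)) :
    Tendsto (kappaFun ν w) l (𝓝 0) := by
  obtain ⟨C, hC, h⟩ := kappaFun_le hw ν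
  refine squeeze_zero (fun t => (kappaFun_pos _ _ _).le) (fun t => h w le_rfl t) ?_
  simpa using (hl.const_mul C).const_mul (Real.exp (-Real.sqrt w))

/-- The derivative of `kappaFun 1 w` has integral zero over the line. In classical terms this is
`K₂(x) = K₀(x) + (2 / x) K₁(x)`; it is what makes the terms of `ω₃` closed. -/
theorem kappa_recurrence {w : ℝ} (hw : 0 < w) : w * kappa 2 w = kappa 0 w + kappa 1 w := by
  have hd : ∀ t, HasDerivAt (kappaFun 1 w)
      (w * kappaFun 2 w t - kappaFun 0 w t - kappaFun 1 w t) t := by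
    intro t
    have h1 : HasDerivAt (fun t : ℝ => -Real.exp t - w * Real.exp (-t) - (1 : ℕ) * t)
        (-Real.exp t - w * (Real.exp (-t) * (-1)) - (1 : ℕ) * 1) t :=
      ((Real.hasDerivAt_exp t).neg.sub (((hasDerivAt_neg t).exp).const_mul w)).sub
        ((hasDerivAt_id t).const_mul _)
    have h2 := h1.exp
    refine h2.congr_deriv ?_
    have e0 : kappaFun 0 w t = kappaFun 1 w t * Real.exp t := by
      rw [kappaFun, kappaFun, ← Real.exp_add]; push_cast; ring_nf
    have e2 : kappaFun 2 w t = kappaFun 1 w t * Real.exp (-t) := by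
      rw [kappaFun, kappaFun, ← Real.exp_add]; push_cast; ring_nf
    rw [e0, e2]
    simp only [kappaFun]
    push_cast
    ring
  have hlim : Tendsto (fun t : ℝ => (1 + t ^ 2)⁻¹) atTop (𝓝 0) :=
    tendsto_inv_atTop_zero.comp (tendsto_atTop_add_const_left _ _ (tendsto_pow_atTop two_ne_zero))
  have hlim' : Tendsto (fun t : ℝ => (1 + t ^ 2)⁻¹) atBot (𝓝 0) := by
    have := hlim.comp tendsto_neg_atBot_atTop
    simpa [Function.comp_def] using this
  have i0 := integrable_kappaFun 0 hw
  have i1 := integrable_kappaFun 1 hw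
  have i2 := (integrable_kappaFun 2 hw).const_mul w
  have := integral_of_hasDerivAt_of_tendsto hd ((i2.sub i0).sub i1)
    (tendsto_kappaFun 1 hw hlim') (tendsto_kappaFun 1 hw hlim)
  have e : ∫ t, (w * kappaFun 2 w t - kappaFun 0 w t - kappaFun 1 w t)
      = w * kappa 2 w - kappa 0 w - kappa 1 w := by
    have i3 : Integrable (fun t => w * kappaFun 2 w t - kappaFun 0 w t) := i2.sub i0
    rw [integral_sub i3 i1, integral_sub i2 i0, integral_const_mul]
    rfl
  rw [e] at this
  linarith

/-- The shift of `t` by `log (x / 2)` gives `e^t` and `e^{-t}` the same weight `x / 2`, so the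
exponent becomes `-x cosh t - νt`; folding the line at `0` then produces `cosh (νt)`. -/
theorem kappa_eq_besselK (ν : ℕ) {x : ℝ} (hx : 0 < x) :
    kappa ν (x ^ 2 / 4) = (2 / x) ^ ν * (2 * besselK ν x) := by
  set h : ℝ → ℝ := fun t => Real.exp (-x * Real.cosh t) * Real.exp (-(ν * t)) with hh
  have hshift : ∀ t, kappaFun ν (x ^ 2 / 4) (t + Real.log (x / 2)) = (2 / x) ^ ν * h t := by
    intro t
    have e1 : Real.exp (Real.log (x / 2)) = x / 2 := Real.exp_log (by positivity)
    have e2 : (2 / x) ^ ν = Real.exp (-(ν * Real.log (x / 2))) := by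
      rw [Real.exp_neg, Real.exp_nat_mul, e1, ← inv_pow, inv_div]
    rw [e2, hh]
    simp only
    rw [← Real.exp_add, ← Real.exp_add, kappaFun, neg_add, Real.exp_add t, Real.exp_add (-t),
      Real.exp_neg (Real.log (x / 2)), e1, Real.cosh_eq]
    congr 1
    field_simp
    ring
  have hpos : 0 < x ^ 2 / 4 := by positivity
  have hint : Integrable h := by
    have h1 := ((integrable_kappaFun ν hpos).comp_add_right (Real.log (x / 2))).const_mul
      (((2 / x) ^ ν)⁻¹)
    refine h1.congr (ae_of_all _ fun t => ?_)
    simp only [hshift]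
    field_simp
  have e1 : kappa ν (x ^ 2 / 4) = (2 / x) ^ ν * ∫ t, h t := by
    rw [kappa, ← integral_add_right_eq_self _ (Real.log (x / 2)), ← integral_const_mul]
    exact integral_congr_ae (ae_of_all _ hshift)
  rw [e1]
  congr 1
  rw [← intervalIntegral.integral_Iic_add_Ioi (b := 0) hint.integrableOn hint.integrableOn]
  have e2 : ∫ t in Set.Iic (0 : ℝ), h t = ∫ t in Set.Ioi (0 : ℝ), h (-t) := by
    rw [integral_comp_neg_Ioi]; simp
  rw [e2, ← integral_add hint.comp_neg.integrableOn hint.integrableOn, besselK,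
    ← integral_const_mul]
  refine integral_congr_ae (ae_of_all _ fun t => ?_)
  simp only [hh, Real.cosh_neg, Real.cosh_eq (ν * t)]
  ring_nf

theorem besselK_zero_eq {x : ℝ} (hx : 0 < x) : besselK 0 x = kappa 0 (x ^ 2 / 4) / 2 := by
  have := kappa_eq_besselK 0 hx
  simp only [pow_zero, Nat.cast_zero, one_mul] at this
  linarith

theorem besselK_one_eq {x : ℝ} (hx : 0 < x) : besselK 1 x = x / 4 * kappa 1 (x ^ 2 / 4) := by
  have := kappa_eq_besselK 1 hx
  simp only [pow_one, Nat.cast_one] at this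
  rw [this]
  field_simp
  norm_num

end Bessel

/-! ### Series of Bessel functions with linear arguments -/

section Series

/-- Data for the series `∑ m(x, n) χ_x(y)^{n+1} κ_ν(π² (n+1)² |Z_x(y)|²)` over `x : Λ`, `n : ℕ`,
with `Z_x = ∑ c_j(x) ζ_j` and `d χ_x = i χ_x ∑ c_j(x) t_j`. -/
structure SeriesData (X : Type*) [NormedAddCommGroup X] [NormedSpace ℝ X]
    (Λ J : Type*) [Fintype J] where
  B : Set X
  isOpen : IsOpen B
  W : Λ → ℂ
  s : Λ → ℝ
  c : J → Λ → ℂ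
  ζ : J → X → ℂ
  t : J → X →L[ℝ] ℂ
  χ : Λ → X → ℂ
  smooth : ∀ j, ContDiffOn ℝ ∞ (ζ j) B
  summable : ∀ R : ℝ, 0 < R → Summable fun x => ‖W x‖ * Real.exp (-R * s x)
  one_le : ∀ x, W x ≠ 0 → 1 ≤ s x
  lower : ∃ c₀ : ℝ, 0 < c₀ ∧ ∀ x, W x ≠ 0 → ∀ y ∈ B, c₀ * s x ≤ ‖∑ j, c j x * ζ j y‖
  upper : ∃ C : ℝ, ∀ j x, W x ≠ 0 → ‖c j x‖ ≤ C * s x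
  norm_χ : ∀ x, ∀ y ∈ B, ‖χ x y‖ = 1
  deriv_χ : ∀ x, ∀ y ∈ B, HasFDerivAt (χ x) (χ x y • ∑ j, (Complex.I * c j x) • t j) y

namespace SeriesData

variable {X : Type*} [NormedAddCommGroup X] [NormedSpace ℝ X]
  {Λ J : Type*} [Fintype J] (D : SeriesData X Λ J)

/-- The function `Z_x`. -/
def Z (x : Λ) (y : X) : ℂ := ∑ j, D.c j x * D.ζ j y

/-- The function `χ_x^{n+1} κ_ν(π² (n+1)² |Z_x|²)`. -/
def f (ν : ℕ) (a : Λ × ℕ) (y : X) : ℂ :=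
  D.χ a.1 y ^ (a.2 + 1)
    * (kappa ν (Real.pi ^ 2 * ((a.2 : ℝ) + 1) ^ 2 * Complex.normSq (D.Z a.1 y)) : ℂ)

/-- Coefficients of polynomial growth. -/
def Growth (m : Λ × ℕ → ℂ) : Prop :=
  ∃ (C : ℝ) (k : ℕ), ∀ x n, D.W x ≠ 0 → ‖m (x, n)‖ ≤ C * (((n : ℝ) + 1) * D.s x) ^ k

/-- Families of functions generated by the `W(x) m(x, n) f_ν` with `m` of polynomial growth. -/
inductive Adm : (Λ × ℕ → X → ℂ) → Prop
  | base (ν : ℕ) (m : Λ × ℕ → ℂ) (hm : D.Growth m) : Adm fun a y => D.W a.1 * m a * D.f ν a y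
  | add {g g'} (hg : Adm g) (hg' : Adm g') : Adm fun a y => g a y + g' a y
  | smul {g} (h : X → ℂ) (hh : ContDiffOn ℝ ∞ h D.B) (hg : Adm g) : Adm fun a y => h y * g a y
  | congr {g g'} (hg : Adm g) (h : ∀ a, ∀ y ∈ D.B, g a y = g' a y) : Adm g'

variable {D}

theorem one_le_mul {x : Λ} (hx : D.W x ≠ 0) (n : ℕ) : 1 ≤ ((n : ℝ) + 1) * D.s x := by
  have := D.one_le x hx
  have h : (0 : ℝ) ≤ n := n.cast_nonneg
  nlinarith

theorem Growth.mul {m m' : Λ × ℕ → ℂ} (h : D.Growth m) (h' : D.Growth m') :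
    D.Growth fun a => m a * m' a := by
  obtain ⟨C, k, h⟩ := h
  obtain ⟨C', k', h'⟩ := h'
  refine ⟨C * C', k + k', fun x n hx => ?_⟩
  rw [norm_mul, pow_add]
  calc _ ≤ (C * (((n : ℝ) + 1) * D.s x) ^ k) * (C' * (((n : ℝ) + 1) * D.s x) ^ k') :=
        mul_le_mul (h x n hx) (h' x n hx) (norm_nonneg _) ((norm_nonneg _).trans (h x n hx))
    _ = _ := by ring

theorem Growth.const (z : ℂ) : D.Growth fun _ => z := ⟨‖z‖, 0, fun x n _ => by simp⟩

theorem Growth.nat : D.Growth fun a => ((a.2 : ℂ) + 1) := by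
  refine ⟨1, 1, fun x n hx => ?_⟩
  have h1 : ‖((n : ℂ) + 1)‖ = (n : ℝ) + 1 := by
    rw [← Nat.cast_succ, Complex.norm_natCast]; simp
  have := D.one_le x hx
  have h : (0 : ℝ) ≤ n := n.cast_nonneg
  simp only [h1]
  nlinarith

theorem Growth.of_norm_le {u : Λ → ℂ} {C : ℝ} (h : ∀ x, D.W x ≠ 0 → ‖u x‖ ≤ C * D.s x) :
    D.Growth fun a => u a.1 := by
  refine ⟨|C|, 1, fun x n hx => (h x hx).trans ?_⟩
  have h0 : (0 : ℝ) ≤ n := n.cast_nonneg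
  have h1 := D.one_le x hx
  have h2 := le_abs_self C
  have h3 : 0 ≤ |C| := abs_nonneg C
  have : C * D.s x ≤ |C| * D.s x := by gcongr
  have h4 : 0 ≤ |C| * (n * D.s x) := by positivity
  nlinarith

theorem Growth.coef (j : J) : D.Growth fun a => D.c j a.1 := by
  obtain ⟨C, h⟩ := D.upper
  exact Growth.of_norm_le (h j)

theorem Growth.conj {m : Λ × ℕ → ℂ} (h : D.Growth m) :
    D.Growth fun a => (starRingEnd ℂ) (m a) := by
  obtain ⟨C, k, h⟩ := h
  exact ⟨C, k, fun x n hx => by simpa using h x n hx⟩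

theorem Adm.coef {m : Λ × ℕ → ℂ} (hm : D.Growth m) {g : Λ × ℕ → X → ℂ} (hg : D.Adm g) :
    D.Adm fun a y => m a * g a y := by
  induction hg with
  | base ν m' hm' =>
    exact (Adm.base ν _ (hm.mul hm')).congr fun a y _ => by ring
  | add _ _ h h' => exact (h.add h').congr fun a y _ => by ring
  | smul u hu _ h => exact (h.smul u hu).congr fun a y _ => by ring
  | congr _ h ih => exact ih.congr fun a y hy => by rw [h a y hy]

theorem Adm.zero : D.Adm fun _ _ => 0 :=
  (Adm.base 0 (fun _ => 0) (Growth.const 0)).congr fun a y _ => by simp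

theorem Adm.sum {ι : Type*} (S : Finset ι) {g : ι → Λ × ℕ → X → ℂ} (hg : ∀ i ∈ S, D.Adm (g i)) :
    D.Adm fun a y => ∑ i ∈ S, g i a y := by
  classical
  induction S using Finset.induction_on with
  | empty => simpa using Adm.zero
  | insert i S hi ih =>
    refine ((hg i (Finset.mem_insert_self i S)).add
      (ih fun j hj => hg j (Finset.mem_insert_of_mem hj))).congr fun a y _ => ?_
    rw [Finset.sum_insert hi]

theorem Adm.const_mul {g : Λ × ℕ → X → ℂ} (hg : D.Adm g) (z : ℂ) : D.Adm fun a y => z * g a y :=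
  hg.smul (fun _ => z) contDiffOn_const

theorem Adm.sub {g g' : Λ × ℕ → X → ℂ} (hg : D.Adm g) (hg' : D.Adm g') :
    D.Adm fun a y => g a y - g' a y :=
  (hg.add (hg'.const_mul (-1))).congr fun a y _ => by ring

theorem contDiffOn_conj {h : X → ℂ} {S : Set X} (hh : ContDiffOn ℝ ∞ h S) :
    ContDiffOn ℝ ∞ (fun y => (starRingEnd ℂ) (h y)) S :=
  Complex.conjCLE.contDiff.comp_contDiffOn hh

/-- The factor `Z_x` depends on the index and on the point at once. It is a finite sum of products
of a coefficient of polynomial growth and a smooth function without index, so the two kinds of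
multiplication suffice. -/
theorem Adm.Z_mul {g : Λ × ℕ → X → ℂ} (hg : D.Adm g) : D.Adm fun a y => D.Z a.1 y * g a y := by
  refine (Adm.sum Finset.univ fun j _ =>
    (hg.coef (Growth.coef j)).smul (D.ζ j) (D.smooth j)).congr fun a y _ => ?_
  rw [Z, Finset.sum_mul]
  exact Finset.sum_congr rfl fun j _ => by ring

theorem Adm.conjZ_mul {g : Λ × ℕ → X → ℂ} (hg : D.Adm g) :
    D.Adm fun a y => (starRingEnd ℂ) (D.Z a.1 y) * g a y := by
  refine (Adm.sum Finset.univ fun j _ =>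
    (hg.coef (Growth.coef j).conj).smul _ (contDiffOn_conj (D.smooth j))).congr fun a y _ => ?_
  rw [Z, map_sum, Finset.sum_mul]
  exact Finset.sum_congr rfl fun j _ => by rw [map_mul]; ring

theorem exists_lower : ∃ c₀ : ℝ, 0 < c₀ ∧ ∀ x, D.W x ≠ 0 → ∀ y ∈ D.B, c₀ * D.s x ≤ ‖D.Z x y‖ :=
  D.lower

theorem Z_ne_zero {x : Λ} (hx : D.W x ≠ 0) {y : X} (hy : y ∈ D.B) : D.Z x y ≠ 0 := by
  obtain ⟨c₀, h0, h⟩ := D.exists_lower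
  have h1 := h x hx y hy
  have h2 := D.one_le x hx
  rw [← norm_pos_iff]
  nlinarith

/-- Half of the exponent absorbs the power. The other half decouples charges from `n`, because `s ≥
1` gives `(n + 1) s ≥ s + n`, and leaves a product of two convergent series. -/
theorem summable_pow_mul_exp (k : ℕ) {R : ℝ} (hR : 0 < R) :
    Summable fun a : Λ × ℕ =>
      ‖D.W a.1‖ * (((a.2 : ℝ) + 1) * D.s a.1) ^ k * Real.exp (-R * (((a.2 : ℝ) + 1) * D.s a.1)) := by
  have hR2 : 0 < R / 2 := half_pos hR
  have h1 : Summable fun n : ℕ => Real.exp (-(R / 2) * n) := by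
    have : (fun n : ℕ => Real.exp (-(R / 2) * n)) = fun n : ℕ => Real.exp (-(R / 2)) ^ n := by
      funext n; rw [← Real.exp_nat_mul]; ring_nf
    rw [this]
    exact summable_geometric_of_lt_one (Real.exp_pos _).le (by rw [← Real.exp_zero]; exact Real.exp_lt_exp.2 (by linarith))
  have h2 := ((D.summable (R / 2) hR2).mul_of_nonneg h1 (fun x => by positivity)
    (fun n => (Real.exp_pos _).le)).mul_left (k.factorial / (R / 2) ^ k)
  by_cases hW : ∀ x, D.W x = 0
  · simp [hW, summable_zero]
  refine Summable.of_norm_bounded h2 fun a => ?_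
  by_cases ha : D.W a.1 = 0
  · simp [ha]
  have ha1 := D.one_le a.1 ha
  have hpos := D.one_le_mul ha a.2
  set u := ((a.2 : ℝ) + 1) * D.s a.1
  have hu : D.s a.1 + a.2 ≤ u := by
    have : (0 : ℝ) ≤ a.2 := a.2.cast_nonneg
    simp only [u]; nlinarith
  rw [Real.norm_of_nonneg (by positivity)]
  have e1 : u ^ k ≤ k.factorial / (R / 2) ^ k * Real.exp (R / 2 * u) := by
    have := Real.pow_div_factorial_le_exp (R / 2 * u) (by positivity) k
    rw [div_le_iff₀ (by positivity), mul_pow] at this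
    rw [div_mul_eq_mul_div, le_div_iff₀ (by positivity)]
    linarith
  calc ‖D.W a.1‖ * u ^ k * Real.exp (-R * u)
      ≤ ‖D.W a.1‖ * (k.factorial / (R / 2) ^ k * Real.exp (R / 2 * u)) * Real.exp (-R * u) := by
        gcongr
    _ = k.factorial / (R / 2) ^ k * (‖D.W a.1‖ * Real.exp (-(R / 2) * u)) := by
        have : Real.exp (-(R / 2) * u) = Real.exp (R / 2 * u) * Real.exp (-R * u) := by
          rw [← Real.exp_add]; ring_nf
        rw [this]; ring
    _ ≤ k.factorial / (R / 2) ^ k *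
        (‖D.W a.1‖ * (Real.exp (-(R / 2) * D.s a.1) * Real.exp (-(R / 2) * a.2))) := by
        rw [← Real.exp_add]
        gcongr
        nlinarith
    _ = _ := by ring

/-- The square root of the argument of `kappa` is `π (n + 1) |Z| ≥ π c₀ (n + 1) s`, whence the rate
`π c₀`. The lower bound for `|Z|` also keeps the argument away from `0`, where `kappa_le` gives no
control. -/
theorem exists_bound_f (ν : ℕ) : ∃ C R : ℝ, 0 < R ∧ 0 < C ∧ ∀ x n, D.W x ≠ 0 → ∀ y ∈ D.B,
    ‖D.f ν (x, n) y‖ ≤ C * Real.exp (-R * (((n : ℝ) + 1) * D.s x)) := by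
  obtain ⟨c₀, h0, h⟩ := D.exists_lower
  obtain ⟨C, hC, hk⟩ := kappa_le (w₀ := Real.pi ^ 2 * c₀ ^ 2) (by positivity) ν
  refine ⟨C, Real.pi * c₀, by positivity, hC, fun x n hx y hy => ?_⟩
  have h1 := h x hx y hy
  have h2 := D.one_le x hx
  have hn : (0 : ℝ) ≤ n := n.cast_nonneg
  have hw : Real.pi ^ 2 * ((n : ℝ) + 1) ^ 2 * Complex.normSq (D.Z x y)
      = (Real.pi * ((n : ℝ) + 1) * ‖D.Z x y‖) ^ 2 := by
    rw [Complex.normSq_eq_norm_sq]; ring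
  have h3 : c₀ ≤ ((n : ℝ) + 1) * ‖D.Z x y‖ := by
    have h3 : c₀ ≤ ‖D.Z x y‖ := by nlinarith
    nlinarith
  have h4 : Real.pi ^ 2 * c₀ ^ 2 ≤ (Real.pi * ((n : ℝ) + 1) * ‖D.Z x y‖) ^ 2 := by
    rw [← mul_pow, mul_assoc]; gcongr
  rw [f, norm_mul, norm_pow, D.norm_χ x y hy, one_pow, one_mul, Complex.norm_real,
    Real.norm_of_nonneg (kappa_nonneg _ _), hw]
  refine (hk _ h4).trans ?_
  rw [Real.sqrt_sq (by positivity)]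
  gcongr
  have h5 : ((n : ℝ) + 1) * (c₀ * D.s x) ≤ ((n : ℝ) + 1) * ‖D.Z x y‖ := by gcongr
  have := Real.pi_pos
  nlinarith

/-- Only a majorant near each point is available: the smooth factors allowed in `Adm.smul` are
bounded locally but perhaps not on all of `B`. -/
theorem Adm.bound {g : Λ × ℕ → X → ℂ} (hg : D.Adm g) : ∀ y₀ ∈ D.B,
    ∃ b : Λ × ℕ → ℝ, Summable b ∧ ∀ᶠ y in 𝓝 y₀, ∀ a, ‖g a y‖ ≤ b a := by
  induction hg with
  | base ν m hm =>
    intro y₀ hy₀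
    obtain ⟨C, k, hm⟩ := hm
    obtain ⟨C', R, hR, hC', hf⟩ := D.exists_bound_f ν
    refine ⟨_, (D.summable_pow_mul_exp k hR).mul_left (C * C'), ?_⟩
    filter_upwards [D.isOpen.mem_nhds hy₀] with y hy a
    by_cases ha : D.W a.1 = 0
    · simp [ha]
    rw [norm_mul, norm_mul]
    calc _ ≤ ‖D.W a.1‖ * (C * (((a.2 : ℝ) + 1) * D.s a.1) ^ k)
          * (C' * Real.exp (-R * (((a.2 : ℝ) + 1) * D.s a.1))) := by
          have h1 := hm a.1 a.2 ha
          have h2 := hf a.1 a.2 ha y hy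
          have h3 := (norm_nonneg _).trans h1
          gcongr
      _ = _ := by ring
  | add _ _ h h' =>
    intro y₀ hy₀
    obtain ⟨b, hb, h⟩ := h y₀ hy₀
    obtain ⟨b', hb', h'⟩ := h' y₀ hy₀
    refine ⟨_, hb.add hb', ?_⟩
    filter_upwards [h, h'] with y h1 h2 a
    exact (norm_add_le _ _).trans (add_le_add (h1 a) (h2 a))
  | smul u hu _ h =>
    intro y₀ hy₀
    obtain ⟨b, hb, h⟩ := h y₀ hy₀
    refine ⟨_, hb.mul_left (‖u y₀‖ + 1), ?_⟩
    have hc : ∀ᶠ y in 𝓝 y₀, ‖u y‖ < ‖u y₀‖ + 1 :=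
      ((hu.continuousOn.continuousAt (D.isOpen.mem_nhds hy₀)).norm).eventually_lt_const
        (by linarith)
    filter_upwards [h, hc] with y h1 h2 a
    rw [norm_mul]
    gcongr
    exact h1 a
  | congr _ h ih =>
    intro y₀ hy₀
    obtain ⟨b, hb, ih⟩ := ih y₀ hy₀
    refine ⟨b, hb, ?_⟩
    filter_upwards [ih, D.isOpen.mem_nhds hy₀] with y h1 hy a
    rw [← h a y hy]; exact h1 a

theorem Adm.summable {g : Λ × ℕ → X → ℂ} (hg : D.Adm g) {y : X} (hy : y ∈ D.B) :
    Summable fun a => g a y := by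
  obtain ⟨b, hb, h⟩ := hg.bound y hy
  exact Summable.of_norm_bounded hb h.self_of_nhds

/-- The differential of `Z_x`. -/
def dZ (D : SeriesData X Λ J) (x : Λ) (y : X) : X →L[ℝ] ℂ := ∑ j, D.c j x • fderiv ℝ (D.ζ j) y

theorem hasFDerivAt_Z (x : Λ) {y : X} (hy : y ∈ D.B) : HasFDerivAt (D.Z x) (D.dZ x y) y := by
  refine HasFDerivAt.fun_sum fun j _ => HasFDerivAt.const_mul ?_ (D.c j x)
  exact (((D.smooth j).contDiffAt (D.isOpen.mem_nhds hy)).differentiableAt (by simp)).hasFDerivAt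

theorem hasFDerivAt_conj {h : X → ℂ} {h' : X →L[ℝ] ℂ} {y : X} (hh : HasFDerivAt h h' y) :
    HasFDerivAt (fun y => (starRingEnd ℂ) (h y)) ((Complex.conjCLE : ℂ →L[ℝ] ℂ).comp h') y :=
  (Complex.conjCLE : ℂ →L[ℝ] ℂ).hasFDerivAt.comp y hh

/-- The differential of `f_ν`. -/
def df (D : SeriesData X Λ J) (ν : ℕ) (a : Λ × ℕ) (y : X) : X →L[ℝ] ℂ :=
  (Complex.I * ((a.2 : ℂ) + 1) * D.f ν a y) • (∑ j, D.c j a.1 • D.t j)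
    - ((Real.pi : ℂ) ^ 2 * ((a.2 : ℂ) + 1) ^ 2 * D.f (ν + 1) a y) •
      ((starRingEnd ℂ) (D.Z a.1 y) • D.dZ a.1 y
        + D.Z a.1 y • (Complex.conjCLE : ℂ →L[ℝ] ℂ).comp (D.dZ a.1 y))

/-- The weight must be non-zero because only then is `Z_x` known not to vanish, and `kappa` is
differentiated at positive arguments only. -/
theorem hasFDerivAt_f (ν : ℕ) {a : Λ × ℕ} (ha : D.W a.1 ≠ 0) {y : X} (hy : y ∈ D.B) :
    HasFDerivAt (D.f ν a) (D.df ν a y) y := by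
  have hZ := D.hasFDerivAt_Z a.1 hy
  have h1 : HasFDerivAt (fun y => D.χ a.1 y ^ (a.2 + 1))
      ((((a.2 + 1 : ℕ) : ℂ) * D.χ a.1 y ^ a.2) •
        (D.χ a.1 y • ∑ j, (Complex.I * D.c j a.1) • D.t j)) y := by
    simpa using (D.deriv_χ a.1 y hy).pow (a.2 + 1)
  have hN : (fun y => Complex.normSq (D.Z a.1 y))
      = fun y => ((D.Z a.1 y) * (starRingEnd ℂ) (D.Z a.1 y)).re := by
    funext y; rw [Complex.mul_conj, Complex.ofReal_re]
  have h2 : HasFDerivAt (fun y => Complex.normSq (D.Z a.1 y))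
      ((Complex.reCLM).comp (D.Z a.1 y • (Complex.conjCLE : ℂ →L[ℝ] ℂ).comp (D.dZ a.1 y)
        + (starRingEnd ℂ) (D.Z a.1 y) • D.dZ a.1 y)) y := by
    rw [hN]
    exact (Complex.reCLM.hasFDerivAt).comp y (hZ.mul (hasFDerivAt_conj hZ))
  have hpos : 0 < Real.pi ^ 2 * ((a.2 : ℝ) + 1) ^ 2 * Complex.normSq (D.Z a.1 y) := by
    have := Complex.normSq_pos.2 (D.Z_ne_zero ha hy)
    positivity
  have h3 := ((hasDerivAt_kappa ν hpos).comp_hasFDerivAt y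
    (h2.const_mul (Real.pi ^ 2 * ((a.2 : ℝ) + 1) ^ 2)))
  have h4 := (Complex.ofRealCLM.hasFDerivAt).comp y h3
  have h5 := h1.mul h4
  refine h5.congr_fderiv ?_
  ext v
  -- The differential of `|Z|²` is the sum of a number and its conjugate, so the real part can be
  -- dropped and the comparison is an identity of complex polynomials.
  have hre : ((D.Z a.1 y * (starRingEnd ℂ) (D.dZ a.1 y v)
      + (starRingEnd ℂ) (D.Z a.1 y) * D.dZ a.1 y v).re : ℂ)
      = D.Z a.1 y * (starRingEnd ℂ) (D.dZ a.1 y v)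
      + (starRingEnd ℂ) (D.Z a.1 y) * D.dZ a.1 y v := by
    rw [← Complex.conj_eq_iff_re]
    simp only [map_add, map_mul, Complex.conj_conj]
    ring
  have hsum : ∑ j, Complex.I * D.c j a.1 * (D.t j) v = Complex.I * ∑ j, D.c j a.1 * (D.t j) v := by
    rw [Finset.mul_sum]; exact Finset.sum_congr rfl fun j _ => by ring
  simp only [df, f, add_apply, sub_apply,
    smul_apply, ContinuousLinearMap.comp_apply, sum_apply,
    smul_eq_mul, Complex.ofRealCLM_apply, Complex.reCLM_apply, Function.comp_apply,
    Complex.ofReal_mul, Complex.ofReal_neg, hsum]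
  simp only [ContinuousLinearEquiv.coe_coe, Complex.conjCLE_apply]
  rw [hre]
  push_cast
  ring

/-- The derivative of a basic term consists of `f_ν` and `f_{ν+1}`, multiplied by powers of `n + 1`,
coefficients of charges and the functions `ζ_j`, `dζ_j` with their conjugates; all of these are
permitted factors. Hence the class of admissible families is stable, and every argument about first
derivatives can be iterated. -/
theorem Adm.hasFDerivAt_and {g : Λ × ℕ → X → ℂ} (hg : D.Adm g) :
    (∀ a, ∀ y ∈ D.B, DifferentiableAt ℝ (g a) y) ∧
      ∀ v, D.Adm fun a y => fderiv ℝ (g a) y v := by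
  induction hg with
  | base ν m hm =>
    have hd : ∀ a, ∀ y ∈ D.B, HasFDerivAt (fun y => D.W a.1 * m a * D.f ν a y)
        ((D.W a.1 * m a) • D.df ν a y) y := by
      intro a y hy
      -- Without weight the term is identically zero, even where `f` fails to be differentiable.
      by_cases ha : D.W a.1 = 0
      · refine HasFDerivAt.congr_fderiv (f' := 0) ?_ (by ext v; simp [ha])
        simpa [ha] using hasFDerivAt_const (𝕜 := ℝ) (0 : ℂ) y
      · exact (D.hasFDerivAt_f ν ha hy).const_mul _
    refine ⟨fun a y hy => (hd a y hy).differentiableAt, fun v => ?_⟩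
    have hb := Adm.base (D := D) ν m hm
    have hb' := (Adm.base (D := D) (ν + 1) m hm).coef ((Growth.const ((Real.pi : ℂ) ^ 2)).mul
      (Growth.nat.mul Growth.nat))
    have hζ : ∀ j, ContDiffOn ℝ ∞ (fun y => fderiv ℝ (D.ζ j) y v) D.B := fun j =>
      ((D.smooth j).fderiv_of_isOpen D.isOpen (by simp)).clm_apply contDiffOn_const
    have A1 := Adm.sum Finset.univ fun j _ => (hb.coef (((Growth.const Complex.I).mul
      Growth.nat).mul (Growth.coef j))).const_mul (D.t j v)
    have A2 := Adm.sum Finset.univ fun j _ => (hb'.conjZ_mul.coef (Growth.coef j)).smul _ (hζ j)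
    have A3 := Adm.sum Finset.univ fun j _ =>
      (hb'.Z_mul.coef (Growth.coef j).conj).smul _ (contDiffOn_conj (hζ j))
    refine ((A1.sub A2).sub A3).congr fun a y hy => ?_
    rw [(hd a y hy).fderiv]
    simp only [df, dZ, add_apply, sub_apply,
      smul_apply, ContinuousLinearMap.comp_apply,
      sum_apply, smul_eq_mul, ContinuousLinearEquiv.coe_coe,
      Complex.conjCLE_apply, map_sum, map_mul, mul_sub, mul_add, Finset.mul_sum]
    rw [sub_sub]
    congr 1
    · exact Finset.sum_congr rfl fun j _ => by ring
    · congr 1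
      · exact Finset.sum_congr rfl fun j _ => by ring
      · exact Finset.sum_congr rfl fun j _ => by ring
  | add _ _ h h' =>
    refine ⟨fun a y hy => (h.1 a y hy).add (h'.1 a y hy), fun v => ?_⟩
    refine ((h.2 v).add (h'.2 v)).congr fun a y hy => ?_
    rw [fderiv_fun_add (h.1 a y hy) (h'.1 a y hy)]
    rfl
  | @smul g u hu hg h =>
    have hud : ∀ y ∈ D.B, DifferentiableAt ℝ u y := fun y hy =>
      (hu.contDiffAt (D.isOpen.mem_nhds hy)).differentiableAt (by simp)
    refine ⟨fun a y hy => (hud y hy).mul (h.1 a y hy), fun v => ?_⟩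
    have hu' : ContDiffOn ℝ ∞ (fun y => fderiv ℝ u y v) D.B :=
      (hu.fderiv_of_isOpen D.isOpen (by simp)).clm_apply contDiffOn_const
    refine (((h.2 v).smul u hu).add (hg.smul _ hu')).congr fun a y hy => ?_
    rw [fderiv_fun_mul (hud y hy) (h.1 a y hy)]
    simp only [add_apply, smul_apply, smul_eq_mul]
    ring
  | congr _ h ih =>
    have he : ∀ a, ∀ y ∈ D.B, _ =ᶠ[𝓝 y] _ := fun a y hy =>
      Filter.eventuallyEq_of_mem (D.isOpen.mem_nhds hy) (h a)
    refine ⟨fun a y hy => (ih.1 a y hy).congr_of_eventuallyEq (he a y hy).symm, fun v => ?_⟩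
    refine (ih.2 v).congr fun a y hy => ?_
    rw [(he a y hy).fderiv_eq]

variable [FiniteDimensional ℝ X]

theorem Adm.bound_fderiv {g : Λ × ℕ → X → ℂ} (hg : D.Adm g) : ∀ y₀ ∈ D.B,
    ∃ b : Λ × ℕ → ℝ, Summable b ∧ ∀ᶠ y in 𝓝 y₀, ∀ a, ‖fderiv ℝ (g a) y‖ ≤ b a := by
  intro y₀ hy₀
  let v := Module.finBasis ℝ X
  obtain ⟨C, hC, hop⟩ := v.exists_opNorm_le (F := ℂ)
  choose b hb h using fun i => ((hg.hasFDerivAt_and.2 (v i)).bound y₀ hy₀)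
  refine ⟨fun a => C * ∑ i, b i a, (summable_sum fun i _ => hb i).mul_left C, ?_⟩
  filter_upwards [eventually_all.2 h] with y hy a
  have h0 : ∀ i, 0 ≤ b i a := fun i => (norm_nonneg _).trans (hy i a)
  refine hop (Finset.sum_nonneg fun i _ => h0 i) fun i => (hy i a).trans ?_
  exact Finset.single_le_sum (f := fun i => b i a) (fun i _ => h0 i) (Finset.mem_univ i)

theorem Adm.hasFDerivAt_tsum {g : Λ × ℕ → X → ℂ} (hg : D.Adm g) {y : X} (hy : y ∈ D.B) :
    Summable (fun a => fderiv ℝ (g a) y) ∧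
      HasFDerivAt (fun y => ∑' a, g a y) (∑' a, fderiv ℝ (g a) y) y := by
  obtain ⟨b, hb, h⟩ := hg.bound_fderiv y hy
  refine ⟨Summable.of_norm_bounded hb h.self_of_nhds, ?_⟩
  obtain ⟨ε, hε, hball⟩ := Metric.eventually_nhds_iff_ball.1
    (h.and (D.isOpen.mem_nhds hy))
  have hc : IsPreconnected (Metric.ball y ε) := (convex_ball y ε).isPreconnected
  exact hasFDerivAt_tsum_of_isPreconnected hb Metric.isOpen_ball hc
    (fun a z hz => (hg.hasFDerivAt_and.1 a z (hball z hz).2).hasFDerivAt)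
    (fun a z hz => (hball z hz).1 a) (Metric.mem_ball_self hε) (hg.summable hy)
    (Metric.mem_ball_self hε)

theorem Adm.fderiv_tsum {g : Λ × ℕ → X → ℂ} (hg : D.Adm g) {y : X} (hy : y ∈ D.B) (v : X) :
    fderiv ℝ (fun y => ∑' a, g a y) y v = ∑' a, fderiv ℝ (g a) y v := by
  rw [(hg.hasFDerivAt_tsum hy).2.fderiv]
  exact (ContinuousLinearMap.apply ℝ ℂ v).map_tsum (hg.hasFDerivAt_tsum hy).1

/-- Bootstrapping: each directional derivative of the sum is again the sum of an admissible family,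
so one degree of differentiability is gained at a time. -/
theorem Adm.contDiffOn {g : Λ × ℕ → X → ℂ} (hg : D.Adm g) :
    ContDiffOn ℝ ∞ (fun y => ∑' a, g a y) D.B := by
  refine contDiffOn_infty.2 fun n => ?_
  induction n generalizing g with
  | zero =>
    refine contDiffOn_zero.2 fun y hy => ?_
    exact (hg.hasFDerivAt_tsum hy).2.continuousAt.continuousWithinAt
  | succ n ih =>
    push_cast
    refine (contDiffOn_succ_iff_fderiv_of_isOpen D.isOpen).2 ⟨fun y hy =>
      (hg.hasFDerivAt_tsum hy).2.differentiableAt.differentiableWithinAt, by simp, ?_⟩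
    refine contDiffOn_clm_apply.2 fun v => ?_
    exact (ih (hg.hasFDerivAt_and.2 v)).congr fun y hy => hg.fderiv_tsum hy v

end SeriesData

end Series

/-! ### Darboux bases adapted to isotropic subsets -/

section Symplectic

/-- The standard symplectic form. -/
def stdForm (k : ℕ) : ((Fin k → ℤ) × (Fin k → ℤ)) →ₗ[ℤ] ((Fin k → ℤ) × (Fin k → ℤ)) →ₗ[ℤ] ℤ :=
  LinearMap.mk₂ ℤ (fun x y => ∑ i, (x.1 i * y.2 i - x.2 i * y.1 i))
    (fun x x' y => by
      rw [← Finset.sum_add_distrib]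
      exact Finset.sum_congr rfl fun i _ => by simp; ring)
    (fun a x y => by
      rw [smul_eq_mul, Finset.mul_sum]
      exact Finset.sum_congr rfl fun i _ => by simp; ring)
    (fun x y y' => by
      rw [← Finset.sum_add_distrib]
      exact Finset.sum_congr rfl fun i _ => by simp; ring)
    (fun a x y => by
      rw [smul_eq_mul, Finset.mul_sum]
      exact Finset.sum_congr rfl fun i _ => by simp; ring)

theorem stdForm_apply {k : ℕ} (x y : (Fin k → ℤ) × (Fin k → ℤ)) :
    stdForm k x y = ∑ i, (x.1 i * y.2 i - x.2 i * y.1 i) := rfl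

theorem stdForm_self {k : ℕ} (x : (Fin k → ℤ) × (Fin k → ℤ)) : stdForm k x x = 0 := by
  rw [stdForm_apply]
  exact Finset.sum_eq_zero fun i _ => by ring

theorem stdForm_skew {k : ℕ} (x y : (Fin k → ℤ) × (Fin k → ℤ)) :
    stdForm k x y = -stdForm k y x := by
  rw [stdForm_apply, stdForm_apply, ← Finset.sum_neg_distrib]
  exact Finset.sum_congr rfl fun i _ => by ring

/-- Unimodularity of the standard form over `ℤ`. -/
theorem exists_stdForm_eq {k : ℕ} (F : ((Fin k → ℤ) × (Fin k → ℤ)) →ₗ[ℤ] ℤ) :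
    ∃ v, ∀ y, stdForm k v y = F y := by
  refine ⟨(fun i => F (0, Pi.single i 1), fun i => -F (Pi.single i 1, 0)), fun y => ?_⟩
  have h1 : y = ∑ i, (y.1 i • (Pi.single i 1, 0) + y.2 i • (0, Pi.single i 1) :
      (Fin k → ℤ) × (Fin k → ℤ)) := by
    refine Prod.ext ?_ ?_
    · simp only [Prod.fst_sum, Prod.fst_add, Prod.smul_fst, smul_zero, add_zero]
      exact pi_eq_sum_univ' y.1
    · simp only [Prod.snd_sum, Prod.snd_add, Prod.smul_snd, smul_zero, zero_add]
      exact pi_eq_sum_univ' y.2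
  conv_rhs => rw [h1]
  rw [map_sum, stdForm_apply]
  refine Finset.sum_congr rfl fun i _ => ?_
  simp only [map_add, map_smul, smul_eq_mul]
  ring

/-- A maximal isotropic submodule exists by noetherianity. A vector orthogonal to it can be adjoined
without losing isotropy, as the form is alternating, so it is already contained: the submodule
equals its own orthogonal. -/
theorem exists_maximal_isotropic {r : ℕ} (S : Set ((Fin r → ℤ) × (Fin r → ℤ)))
    (hS : ∀ x ∈ S, ∀ y ∈ S, stdForm r x y = 0) :
    ∃ P : Submodule ℤ ((Fin r → ℤ) × (Fin r → ℤ)), S ⊆ P ∧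
      (∀ x ∈ P, ∀ y ∈ P, stdForm r x y = 0) ∧
      ∀ v, (∀ p ∈ P, stdForm r v p = 0) → v ∈ P := by
  let T : Set (Submodule ℤ ((Fin r → ℤ) × (Fin r → ℤ))) :=
    {P | S ⊆ P ∧ ∀ x ∈ P, ∀ y ∈ P, stdForm r x y = 0}
  have hT : T.Nonempty := by
    refine ⟨Submodule.span ℤ S, Submodule.subset_span, fun x hx y hy => ?_⟩
    induction hx, hy using Submodule.span_induction₂ with
    | mem_mem x y hx hy => exact hS x hx y hy
    | zero_left y hy => simp
    | zero_right x hx => simp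
    | add_left x y z _ _ _ h h' => simp [h, h']
    | add_right x y z _ _ _ h h' => simp [h, h']
    | smul_left a x y _ _ h => simp [-zsmul_eq_mul, h]
    | smul_right a x y _ _ h => simp [-zsmul_eq_mul, h]
  obtain ⟨P, hP, hmax⟩ := set_has_maximal_iff_noetherian.2
    (inferInstance : IsNoetherian ℤ ((Fin r → ℤ) × (Fin r → ℤ))) T hT
  refine ⟨P, hP.1, hP.2, fun v hv => ?_⟩
  by_contra hvP
  refine hmax (P ⊔ Submodule.span ℤ {v}) ⟨hP.1.trans (SetLike.coe_subset_coe.2 le_sup_left), ?_⟩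
    (lt_of_le_of_ne le_sup_left fun h => hvP ?_)
  · have hv' : ∀ p ∈ P, stdForm r p v = 0 := fun p hp => by rw [stdForm_skew, hv p hp, neg_zero]
    intro x hx y hy
    obtain ⟨p, hp, _, hq, rfl⟩ := Submodule.mem_sup.1 hx
    obtain ⟨a, rfl⟩ := Submodule.mem_span_singleton.1 hq
    obtain ⟨p', hp', _, hq', rfl⟩ := Submodule.mem_sup.1 hy
    obtain ⟨a', rfl⟩ := Submodule.mem_span_singleton.1 hq'
    simp [-zsmul_eq_mul, hP.2 p hp p' hp', hv p' hp', hv' p hp, stdForm_self]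
  · rw [h]
    exact Submodule.mem_sup_right (Submodule.mem_span_singleton_self v)

/-- A submodule that equals its orthogonal is saturated, so the quotient is torsion free, hence
free, and `P` is a direct summand. A functional on `P` therefore extends to the whole lattice, where
unimodularity represents it by a vector. -/
theorem exists_dual_of_isotropic {r : ℕ} {P : Submodule ℤ ((Fin r → ℤ) × (Fin r → ℤ))}
    (hP : ∀ v, (∀ p ∈ P, stdForm r v p = 0) → v ∈ P)
    (hP' : ∀ x ∈ P, ∀ y ∈ P, stdForm r x y = 0) (φ : P →ₗ[ℤ] ℤ) :
    ∃ v, ∀ p : P, stdForm r v p = φ p := by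
  have hsat : ∀ (a : ℤ) (v : (Fin r → ℤ) × (Fin r → ℤ)), a ≠ 0 → a • v ∈ P → v ∈ P := by
    intro a v ha hav
    refine hP v fun p hp => ?_
    have := hP' _ hav p hp
    simp only [map_smul, LinearMap.smul_apply, smul_eq_mul, mul_eq_zero] at this
    exact this.resolve_left ha
  have htf : Module.IsTorsionFree ℤ (((Fin r → ℤ) × (Fin r → ℤ)) ⧸ P) := by
    refine Module.IsTorsionFree.mk fun a ha => ?_
    have ha0 : a ≠ 0 := ha.ne_zero
    intro x y hxy
    induction x using Submodule.Quotient.induction_on with | _ x =>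
    induction y using Submodule.Quotient.induction_on with | _ y =>
    simp only [← Submodule.Quotient.mk_smul] at hxy
    rw [Submodule.Quotient.eq] at hxy ⊢
    rw [← smul_sub] at hxy
    exact hsat a _ ha0 hxy
  have hfree : Module.Free ℤ (((Fin r → ℤ) × (Fin r → ℤ)) ⧸ P) :=
    Module.free_of_finite_type_torsion_free'
  obtain ⟨s, hs⟩ := Module.projective_lifting_property P.mkQ LinearMap.id P.mkQ_surjective
  have hmem : ∀ v, v - s (P.mkQ v) ∈ P := fun v => by
    refine (Submodule.Quotient.mk_eq_zero P).1 ?_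
    rw [← Submodule.mkQ_apply, map_sub]
    have := LinearMap.congr_fun hs (P.mkQ v)
    simp only [LinearMap.comp_apply, LinearMap.id_apply] at this
    rw [this, sub_self]
  let ρ : ((Fin r → ℤ) × (Fin r → ℤ)) →ₗ[ℤ] P :=
    LinearMap.codRestrict P (LinearMap.id - s.comp P.mkQ) hmem
  obtain ⟨v, hv⟩ := exists_stdForm_eq (φ.comp ρ)
  refine ⟨v, fun p => ?_⟩
  rw [hv, LinearMap.comp_apply]
  congr 1
  ext1
  have : P.mkQ (p : (Fin r → ℤ) × (Fin r → ℤ)) = 0 := by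
    rw [Submodule.mkQ_apply, Submodule.Quotient.mk_eq_zero]; exact p.2
  simp [ρ, LinearMap.codRestrict_apply, this]

theorem exists_symplectic_basis {r k : ℕ} {P : Submodule ℤ ((Fin r → ℤ) × (Fin r → ℤ))}
    (hP : ∀ v, (∀ p ∈ P, stdForm r v p = 0) → v ∈ P)
    (hP' : ∀ x ∈ P, ∀ y ∈ P, stdForm r x y = 0) (b : Module.Basis (Fin k) ℤ P) :
    ∃ ψ : ((Fin k → ℤ) × (Fin k → ℤ)) ≃ₗ[ℤ] ((Fin r → ℤ) × (Fin r → ℤ)),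
      (∀ x y, stdForm r (ψ x) (ψ y) = stdForm k x y) ∧ ∀ p ∈ P, (ψ.symm p).1 = 0 := by
  choose u hu using fun i => exists_dual_of_isotropic hP hP' (b.coord i)
  have hub : ∀ i j, stdForm r (u i) (b j) = if j = i then 1 else 0 := fun i j => by
    rw [hu, b.coord_apply, b.repr_self, Finsupp.single_apply]
  have hbu : ∀ i j, stdForm r (b j) (u i) = -if j = i then 1 else 0 := fun i j => by
    rw [stdForm_skew, hub]
  have hbb : ∀ i j, stdForm r (b i) (b j) = 0 := fun i j => hP' _ (b i).2 _ (b j).2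
  -- The vectors `u i` are dual to the basis of `P` but need not be isotropic among themselves.
  -- Adding multiples of the `b j` with `j < i` preserves duality and cancels each product `⟨u i, u
  -- j⟩` exactly once.
  let u' : Fin k → (Fin r → ℤ) × (Fin r → ℤ) := fun i =>
    u i + ∑ j, (if j < i then stdForm r (u i) (u j) else 0) • (b j : (Fin r → ℤ) × (Fin r → ℤ))
  have hub' : ∀ i j, stdForm r (u' i) (b j) = if j = i then 1 else 0 := fun i j => by
    simp [-zsmul_eq_mul, -ite_smul, u', map_sum, LinearMap.sum_apply, hub, hbb]
  have hbu' : ∀ i j, stdForm r (b j) (u' i) = -if j = i then 1 else 0 := fun i j => by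
    rw [stdForm_skew, hub']
  have huu' : ∀ i l, stdForm r (u' i) (u' l) = 0 := fun i l => by
    have h1 : stdForm r (u' i) (u' l) = stdForm r (u i) (u l)
        + (if i < l then stdForm r (u l) (u i) else 0)
        - (if l < i then stdForm r (u i) (u l) else 0) := by
      simp only [u', map_add, LinearMap.add_apply, map_sum, LinearMap.sum_apply, map_smul,
        LinearMap.smul_apply, hbb, hub, hbu, smul_eq_mul]
      simp [Finset.sum_neg_distrib]
      ring
    rw [h1]
    rcases lt_trichotomy i l with h | h | h
    · rw [if_pos h, if_neg h.asymm, stdForm_skew (u l)]; ring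
    · subst h; simp [stdForm_self]
    · rw [if_neg h.asymm, if_pos h]; ring
  let Ψ : ((Fin k → ℤ) × (Fin k → ℤ)) →ₗ[ℤ] ((Fin r → ℤ) × (Fin r → ℤ)) :=
    (Fintype.linearCombination ℤ u').comp (LinearMap.fst ℤ _ _)
      + (Fintype.linearCombination ℤ fun i => (b i : (Fin r → ℤ) × (Fin r → ℤ))).comp
        (LinearMap.snd ℤ _ _)
  have hΨ : ∀ x, Ψ x = ∑ i, x.1 i • u' i + ∑ i, x.2 i • (b i : (Fin r → ℤ) × (Fin r → ℤ)) :=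
    fun x => rfl
  have hsymp : ∀ x y, stdForm r (Ψ x) (Ψ y) = stdForm k x y := by
    intro x y
    simp only [hΨ, map_add, LinearMap.add_apply, map_sum, LinearMap.sum_apply, map_smul,
      LinearMap.smul_apply, hbb, hub', hbu', huu', smul_eq_mul, stdForm_apply]
    simp [Finset.sum_add_distrib, mul_comm, sub_eq_add_neg]
    ring
  have hinj : Function.Injective Ψ := by
    rw [← LinearMap.ker_eq_bot, LinearMap.ker_eq_bot']
    intro x hx
    have h0 : ∀ y, stdForm k x y = 0 := fun y => by rw [← hsymp, hx]; simp
    refine Prod.ext (funext fun i => ?_) (funext fun i => ?_)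
    · have := h0 (0, Pi.single i 1)
      simpa [stdForm_apply, Pi.single_apply] using this
    · have := h0 (Pi.single i 1, 0)
      simpa [stdForm_apply, Pi.single_apply] using this
  have hP₁ : ∀ p ∈ P, ∃ z : Fin k → ℤ, Ψ (0, z) = p := fun p hp => by
    refine ⟨fun i => b.repr ⟨p, hp⟩ i, ?_⟩
    have := congrArg P.subtype (b.sum_repr ⟨p, hp⟩)
    simp only [hΨ, Pi.zero_apply, zero_smul, Finset.sum_const_zero, zero_add]
    simpa only [map_sum, map_smul, Submodule.subtype_apply] using this
  have hsurj : Function.Surjective Ψ := by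
    intro v
    -- After subtraction of the `u'` components the vector is orthogonal to `P`, and `P` is its own
    -- orthogonal.
    have hvP : v - ∑ i, stdForm r v (b i) • u' i ∈ P := by
      refine hP _ fun p hp => ?_
      obtain ⟨z, rfl⟩ := hP₁ p hp
      simp only [hΨ, Pi.zero_apply, zero_smul, Finset.sum_const_zero, zero_add, map_sum, map_sub,
        LinearMap.sub_apply, LinearMap.sum_apply, map_smul, LinearMap.smul_apply, hub',
        smul_eq_mul]
      refine Finset.sum_eq_zero fun i _ => ?_
      simp
    obtain ⟨z, hz⟩ := hP₁ _ hvP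
    refine ⟨(fun i => stdForm r v (b i), 0) + (0, z), ?_⟩
    rw [map_add, hz, hΨ]
    simp
  let ψ := LinearEquiv.ofBijective Ψ ⟨hinj, hsurj⟩
  refine ⟨ψ, hsymp, fun p hp => ?_⟩
  obtain ⟨z, rfl⟩ := hP₁ p hp
  have : ψ.symm (Ψ (0, z)) = (0, z) := ψ.symm_apply_apply (0, z)
  rw [this]

/-- An isotropic subset of the standard symplectic lattice lies in the span of the second half of
some Darboux basis. -/
theorem exists_symplectic_of_isotropic {r : ℕ} (S : Set ((Fin r → ℤ) × (Fin r → ℤ)))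
    (hS : ∀ x ∈ S, ∀ y ∈ S, stdForm r x y = 0) :
    ∃ ψ : ((Fin r → ℤ) × (Fin r → ℤ)) ≃ₗ[ℤ] ((Fin r → ℤ) × (Fin r → ℤ)),
      (∀ x y, stdForm r (ψ x) (ψ y) = stdForm r x y) ∧ ∀ x ∈ S, (ψ.symm x).1 = 0 := by
  obtain ⟨P, hSP, hP', hP⟩ := exists_maximal_isotropic S hS
  obtain ⟨k, ⟨b⟩⟩ : ∃ k, Nonempty (Module.Basis (Fin k) ℤ P) := ⟨_, ⟨Module.finBasis ℤ P⟩⟩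
  obtain ⟨ψ, h1, h2⟩ := exists_symplectic_basis hP hP' b
  -- The rank of a Lagrangian is forced by comparing ranks along `ψ`.
  have hk : k = r := by
    have := ψ.finrank_eq
    simp only [Module.finrank_prod, Module.finrank_fin_fun] at this
    omega
  subst hk
  exact ⟨ψ, h1, fun x hx => h2 x (hSP hx)⟩

end Symplectic

/-! ### Consequences of the wall-crossing formula -/

section WallCrossingAlgebra

variable {Γ : Type w} [AddCommGroup Γ] {pairing : Γ →+ Γ →+ ℤ} {Z : Γ → ℂ} {Ω : Γ → ℤ}

open Classical in
/-- The weight `ksWeight` without signs and with all pairings between entries of the list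
dropped. -/
def ksBase (pairing : Γ →+ Γ →+ ℤ) (Z : Γ → ℂ) (Ω : Γ → ℤ) (β : Γ) : List Γ → ℚ
  | [] => 1
  | γ :: l =>
    DT Ω γ * (pairing γ β : ℚ)
      / (1 + (l.countP fun γ' => decide (SameRay ℝ (Z γ) (Z γ'))) : ℚ)
      * ksBase pairing Z Ω β l

theorem DT_ne_zero_of_ksBase_ne_zero {β : Γ} {l : List Γ} (h : ksBase pairing Z Ω β l ≠ 0) :
    ∀ γ ∈ l, DT Ω γ ≠ 0 := by
  induction l with
  | nil => simp
  | cons γ l ih =>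
    rw [ksBase] at h
    intro γ' hγ'
    rcases List.mem_cons.1 hγ' with rfl | hγ'
    · intro h0; simp [h0] at h
    · exact ih (right_ne_zero_of_mul h) γ' hγ'

/-- Entries with non-zero invariants pair to zero with one another, so each factor sees only `2mβ`;
it becomes `2m` times its value for `β`, and evenness removes the sign. -/
theorem ksWeight_nsmul (hloc : ∀ γ γ', DT Ω γ ≠ 0 → DT Ω γ' ≠ 0 → pairing γ γ' = 0)
    (β : Γ) (m : ℕ) (l : List Γ) :
    ksWeight pairing Z Ω ((2 * m) • β) l
      = (2 * m : ℚ) ^ l.length * ksBase pairing Z Ω β l := by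
  induction l with
  | nil => simp [ksWeight, ksBase]
  | cons γ l ih =>
    rw [ksWeight, ksBase, ih]
    -- If `ksBase` vanishes, both sides vanish. Otherwise all entries of the tail have non-zero
    -- invariants, which is what locality needs.
    by_cases h0 : ksBase pairing Z Ω β l = 0
    · simp [h0]
    by_cases h1 : DT Ω γ = 0
    · simp [h1]
    have h2 : pairing γ l.sum = 0 := by
      rw [map_list_sum]
      refine List.sum_eq_zero fun a ha => ?_
      obtain ⟨γ', hγ', rfl⟩ := List.mem_map.1 ha
      exact hloc γ γ' h1 (DT_ne_zero_of_ksBase_ne_zero h0 γ' hγ')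
    have h3 : pairing γ ((2 * m) • β + l.sum) = 2 * m * pairing γ β := by
      rw [map_add, h2, map_nsmul]; simp
    have h4 : (-1 : ℚ) ^ (2 * m * pairing γ β : ℤ) = 1 :=
      Even.neg_one_zpow (by rw [mul_assoc]; exact even_two_mul _)
    rw [h3, h4, List.length_cons, pow_succ]
    push_cast
    ring

/-- The lists over which `ksCoeff` sums. -/
abbrev KSList (Z : Γ → ℂ) (φ₁ φ₂ : ℝ) (δ : Γ) : Type w :=
  {l : List Γ // (∀ γ ∈ l, Z γ ∈ sector φ₁ φ₂) ∧
      l.Pairwise (fun γ γ' => 0 ≤ ((starRingEnd ℂ) (Z γ) * Z γ').im) ∧ l.sum = δ}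

open Polynomial in
/-- For mutually local charges, the coefficients of the wall-crossing product depend polynomially
on multiples of `β`. -/
theorem exists_polynomial_ksCoeff
    (hloc : ∀ γ γ', DT Ω γ ≠ 0 → DT Ω γ' ≠ 0 → pairing γ γ' = 0)
    {φ₁ φ₂ : ℝ} {β δ : Γ} {K : ℕ}
    (hfin : Set.Finite {l : KSList Z φ₁ φ₂ δ | ksBase pairing Z Ω β l.1 ≠ 0})
    (hlen : ∀ l : KSList Z φ₁ φ₂ δ, ksBase pairing Z Ω β l.1 ≠ 0 → l.1.length ≤ K)
    (hδ : Z δ ∈ sector φ₁ φ₂) :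
    ∃ P : ℚ[X], P.natDegree ≤ K ∧
      (∀ m : ℕ, ksCoeff pairing Z Ω φ₁ φ₂ ((2 * m) • β) δ = P.eval (2 * m : ℚ)) ∧
      P.coeff 1 = DT Ω δ * (pairing δ β : ℚ) := by
  classical
  refine ⟨∑ l ∈ hfin.toFinset, C (ksBase pairing Z Ω β l.1) * X ^ l.1.length, ?_, fun m => ?_, ?_⟩
  · refine natDegree_sum_le_of_forall_le _ _ fun l hl => ?_
    exact (natDegree_C_mul_X_pow_le _ _).trans (hlen l (by simpa using hl))
  · rw [ksCoeff, finsum_eq_sum_of_support_subset (s := hfin.toFinset)]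
    · rw [eval_finsetSum]
      refine Finset.sum_congr rfl fun l _ => ?_
      rw [ksWeight_nsmul hloc, eval_mul, eval_C, eval_pow, eval_X, mul_comm]
    · intro l hl
      rw [Function.mem_support, ksWeight_nsmul hloc] at hl
      simpa using right_ne_zero_of_mul hl
  · rw [finsetSum_coeff]
    simp only [coeff_C_mul, coeff_X_pow]
    have hb : ksBase pairing Z Ω β [δ] = DT Ω δ * (pairing δ β : ℚ) := by simp [ksBase]
    -- The degree of a monomial is the length of its list, and the only list of length one with sum
    -- `δ` is `[δ]`; it alone contributes to the linear coefficient.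
    let l₀ : KSList Z φ₁ φ₂ δ := ⟨[δ], by simpa using hδ, by simp, by simp⟩
    rw [Finset.sum_eq_single l₀]
    · simp [l₀, hb]
    · intro l _ hne
      have : ¬ 1 = l.1.length := by
        intro h1
        obtain ⟨γ, hγ⟩ := List.length_eq_one_iff.1 h1.symm
        refine hne (Subtype.ext ?_)
        have hs := l.2.2.2
        rw [hγ] at hs ⊢
        simp only [List.sum_cons, List.sum_nil, add_zero] at hs
        rw [hs]
      simp [this]
    · intro h
      have : ksBase pairing Z Ω β l₀.1 = 0 := by simpa using h
      simp [this]

theorem finite_lists {α : Type*} {F : Set α} (hF : F.Finite) (K : ℕ) :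
    Set.Finite {l : List α | l.length ≤ K ∧ ∀ γ ∈ l, γ ∈ F} := by
  have : Finite F := hF
  refine ((List.finite_length_le F K).image (List.map Subtype.val)).subset ?_
  rintro l ⟨h1, h2⟩
  lift l to List F using h2
  exact ⟨l, by simpa using h1, rfl⟩

/-- Finiteness of the lists of a given sum that contribute to the wall-crossing product. -/
theorem finite_ksLists {N : Γ → ℝ} (hN : ∀ R, {γ | N γ ≤ R}.Finite) (hN1 : ∀ γ, γ ≠ 0 → 1 ≤ N γ)
    {C : ℝ} (hC : 0 < C) (hDT : ∀ γ, DT Ω γ ≠ 0 → γ ≠ 0 ∧ C * N γ ≤ ‖Z γ‖)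
    (hZ : ∀ l : List Γ, Z l.sum = (l.map Z).sum)
    {φ₁ φ₂ φ₀ : ℝ} (hsec : ∀ z ∈ sector φ₁ φ₂, ‖z‖ / 2 ≤ (z * Complex.exp (-(φ₀ * Complex.I))).re)
    {β δ : Γ} {K₀ : ℝ} (hK₀ : ‖Z δ‖ ≤ K₀) {K : ℕ} (hK : 2 * K₀ ≤ C * K) :
    Set.Finite {l : KSList Z φ₁ φ₂ δ | ksBase pairing Z Ω β l.1 ≠ 0} ∧
      ∀ l : KSList Z φ₁ φ₂ δ, ksBase pairing Z Ω β l.1 ≠ 0 → l.1.length ≤ K := by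
  have hN0 : ∀ γ, DT Ω γ ≠ 0 → 1 ≤ N γ := fun γ h => hN1 γ (hDT γ h).1
  -- The real part of `Z` in the direction `φ₀` is additive and, on the sector, at least half of
  -- `|Z|`. Hence no cancellation can occur and the sum of the central charges controls the total
  -- size of the list. As each size is at least `1`, the length is controlled too.
  have key : ∀ l : List Γ, (∀ γ ∈ l, Z γ ∈ sector φ₁ φ₂) → (∀ γ ∈ l, DT Ω γ ≠ 0) →
      C * (l.map N).sum ≤ 2 * (((l.map Z).sum) * Complex.exp (-(φ₀ * Complex.I))).re ∧
      (l.length : ℝ) ≤ (l.map N).sum ∧ ∀ γ ∈ l, N γ ≤ (l.map N).sum := by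
    intro l
    induction l with
    | nil => simp
    | cons γ l ih =>
      intro h1 h2
      obtain ⟨a, b, c⟩ := ih (fun γ h => h1 γ (List.mem_cons_of_mem _ h))
        (fun γ h => h2 γ (List.mem_cons_of_mem _ h))
      have d := hsec _ (h1 γ List.mem_cons_self)
      have e := (hDT γ (h2 γ List.mem_cons_self)).2
      have e' := hN0 γ (h2 γ List.mem_cons_self)
      have hl : (0 : ℝ) ≤ l.length := Nat.cast_nonneg _
      simp only [List.map_cons, List.sum_cons, List.length_cons, add_mul, Complex.add_re]
      push_cast
      refine ⟨by linarith, by linarith, fun γ' hγ' => ?_⟩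
      rcases List.mem_cons.1 hγ' with rfl | hγ'
      · linarith
      · linarith [c γ' hγ']
  have bound : ∀ l : KSList Z φ₁ φ₂ δ, ksBase pairing Z Ω β l.1 ≠ 0 →
      (l.1.map N).sum ≤ K ∧ l.1.length ≤ K ∧ ∀ γ ∈ l.1, γ ∈ {γ | N γ ≤ K} := by
    intro l hl
    obtain ⟨a, b, c⟩ := key l.1 l.2.1 (DT_ne_zero_of_ksBase_ne_zero hl)
    rw [← hZ, l.2.2.2] at a
    have h1 : (Z δ * Complex.exp (-(φ₀ * Complex.I))).re ≤ ‖Z δ‖ := by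
      refine (Complex.re_le_norm _).trans (le_of_eq ?_)
      have : ‖Complex.exp (-(φ₀ * Complex.I))‖ = 1 := by
        rw [← neg_mul, ← Complex.ofReal_neg, Complex.norm_exp_ofReal_mul_I]
      rw [norm_mul, this, mul_one]
    have h2 : (l.1.map N).sum ≤ K := le_of_mul_le_mul_left (by linarith) hC
    exact ⟨h2, by exact_mod_cast b.trans h2, fun γ hγ => (c γ hγ).trans h2⟩
  refine ⟨?_, fun l hl => (bound l hl).2.1⟩
  refine Set.Finite.of_finite_image (f := Subtype.val) ((finite_lists (hN K) K).subset ?_)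
    Subtype.val_injective.injOn
  rintro _ ⟨l, hl, rfl⟩
  exact (bound l hl).2

theorem exists_of_DT_ne_zero {γ : Γ} (h : DT Ω γ ≠ 0) :
    ∃ (k : ℕ) (γ' : Γ), 0 < k ∧ k • γ' = γ ∧ Ω γ' ≠ 0 := by
  by_contra! hc
  refine h ?_
  rw [DT]
  refine finsum_eq_zero_of_forall_eq_zero fun q => ?_
  simp [hc q.1.1 q.1.2 q.2.1 q.2.2]

theorem DT_comp_equiv {Γ' : Type*} [AddCommGroup Γ'] (e : Γ' ≃+ Γ) (x : Γ') :
    DT (fun y => Ω (e y)) x = DT Ω (e x) := by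
  rw [DT, DT]
  let E : {q : ℕ × Γ' // 0 < q.1 ∧ q.1 • q.2 = x} ≃ {q : ℕ × Γ // 0 < q.1 ∧ q.1 • q.2 = e x} :=
    Equiv.subtypeEquiv (Equiv.prodCongr (Equiv.refl ℕ) e.toEquiv) (fun q => by
      simp [← map_nsmul])
  exact finsum_comp_equiv E (f := fun q : {q : ℕ × Γ // 0 < q.1 ∧ q.1 • q.2 = e x} =>
    (Ω q.1.2 : ℚ) / (q.1.1 : ℚ) ^ 2)

/-- The invariants `Ω` are determined by the invariants `DT`. -/
theorem eq_of_DT_eq {Ω' : Γ → ℤ} {N : Γ → ℝ} (hN : ∀ R, {γ | N γ ≤ R}.Finite)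
    (hN1 : ∀ γ, γ ≠ 0 → 1 ≤ N γ) (hNk : ∀ (k : ℕ) γ, N (k • γ) = k * N γ)
    {x : Γ} (hx : x ≠ 0)
    (h : ∀ (k : ℕ) y, 0 < k → k • y = x → DT Ω y = DT Ω' y) : Ω x = Ω' x := by
  -- Induction on an integer bound for the size. A proper divisor `y`, with `k • y = x` and `k ≥ 2`,
  -- has at most half the size of `x`, so it falls under a smaller bound.
  obtain ⟨n, hn⟩ := exists_nat_ge (N x)
  induction n generalizing x with
  | zero => have := hN1 x hx; norm_num at hn; linarith
  | succ n ih =>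
    have hy0 : ∀ (k : ℕ) y, k • y = x → y ≠ 0 := by
      rintro k y rfl rfl; simp at hx
    have : Finite {q : ℕ × Γ // 0 < q.1 ∧ q.1 • q.2 = x} := by
      refine Set.Finite.subset ((Set.finite_Iic (n + 1)).prod (hN (n + 1))) ?_
      rintro ⟨k, y⟩ ⟨hk, rfl⟩
      have h1 := hN1 y (hy0 k y rfl)
      simp only at hk hn ⊢
      rw [hNk] at hn
      have hk' : (1 : ℝ) ≤ k := by exact_mod_cast hk
      push_cast at hn
      refine ⟨?_, ?_⟩
      · have : (k : ℝ) ≤ n + 1 := by nlinarith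
        exact_mod_cast this
      · change N y ≤ n + 1; nlinarith
    have := Fintype.ofFinite {q : ℕ × Γ // 0 < q.1 ∧ q.1 • q.2 = x}
    -- In the difference of the two sums for `DT` at `x` all terms with `k ≥ 2` cancel by induction,
    -- and the term `k = 1` is the difference of the indices.
    have hd := h 1 x one_pos (one_smul _ x)
    rw [DT, DT, finsum_eq_sum_of_fintype, finsum_eq_sum_of_fintype, ← sub_eq_zero,
      ← Finset.sum_sub_distrib, Finset.sum_eq_single ⟨(1, x), one_pos, one_smul _ x⟩] at hd
    · simp only [Nat.cast_one, one_pow, div_one, sub_eq_zero] at hd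
      exact_mod_cast hd
    · rintro ⟨⟨k, y⟩, hk, hky⟩ _ hne
      simp only at hk hky ⊢
      have hk2 : 2 ≤ k := by
        rcases Nat.lt_or_ge 1 k with h2 | h2
        · exact h2
        · obtain rfl : k = 1 := by omega
          rw [one_smul] at hky
          exact (hne (Subtype.ext (Prod.ext rfl hky))).elim
      have hy := hy0 k y hky
      have h1 := hN1 y hy
      have hle : N y ≤ n := by
        rw [← hky, hNk] at hn
        have hk' : (2 : ℝ) ≤ k := by exact_mod_cast hk2
        push_cast at hn
        nlinarith
      rw [ih hy (fun k' y' hk' hy' => h (k * k') y' (Nat.mul_pos hk hk')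
        (by rw [mul_smul, hy', hky])) hle, sub_self]
    · simp

end WallCrossingAlgebra

/-! ### Sectors and rays in the plane of central charges. -/

section Sector

theorem mem_sector_of_arg {φ₁ φ₂ φ₀ : ℝ} {z : ℂ} (hz : z ≠ 0)
    (h : φ₀ + (z * Complex.exp (-(φ₀ * Complex.I))).arg ∈ Set.Ioo φ₁ φ₂) : z ∈ sector φ₁ φ₂ := by
  refine ⟨‖z‖, norm_pos_iff.2 hz, _, h, ?_⟩
  have h1 : ‖z * Complex.exp (-(φ₀ * Complex.I))‖ = ‖z‖ := by
    rw [norm_mul, ← neg_mul, ← Complex.ofReal_neg, Complex.norm_exp_ofReal_mul_I, mul_one]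
  have h2 := Complex.norm_mul_exp_arg_mul_I (z * Complex.exp (-(φ₀ * Complex.I)))
  rw [h1] at h2
  push_cast
  rw [add_mul, Complex.exp_add, mul_left_comm, h2, mul_left_comm, ← Complex.exp_add]
  simp

theorem eventually_mem_sector {φ₁ φ₂ : ℝ} {z₀ : ℂ} (hz : z₀ ≠ 0) (h₁ : φ₁ < z₀.arg)
    (h₂ : z₀.arg < φ₂) : ∀ᶠ z in 𝓝 z₀, z ∈ sector φ₁ φ₂ := by
  have h0 : z₀ * Complex.exp (-(z₀.arg * Complex.I)) = ‖z₀‖ := by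
    have h := Complex.norm_mul_exp_arg_mul_I z₀
    calc z₀ * Complex.exp (-(z₀.arg * Complex.I))
        = ‖z₀‖ * Complex.exp (z₀.arg * Complex.I) * Complex.exp (-(z₀.arg * Complex.I)) := by rw [h]
      _ = _ := by rw [mul_assoc, ← Complex.exp_add]; simp
  have hs : z₀ * Complex.exp (-(z₀.arg * Complex.I)) ∈ Complex.slitPlane := by
    rw [h0]; exact Complex.ofReal_mem_slitPlane.2 (norm_pos_iff.2 hz)
  have hc : ContinuousAt
      (fun z : ℂ => z₀.arg + (z * Complex.exp (-(z₀.arg * Complex.I))).arg) z₀ :=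
    continuousAt_const.add (ContinuousAt.comp (f := fun z : ℂ =>
      z * Complex.exp (-(z₀.arg * Complex.I))) (Complex.continuousAt_arg hs) (by fun_prop))
  have hv : z₀.arg + (z₀ * Complex.exp (-(z₀.arg * Complex.I))).arg = z₀.arg := by
    rw [h0, Complex.arg_ofReal_of_nonneg (norm_nonneg _), add_zero]
  filter_upwards [isOpen_ne.mem_nhds hz, hc.eventually (Ioo_mem_nhds (a := φ₁) (b := φ₂)
    (h₁.trans_eq hv.symm) (hv.trans_lt h₂))] with z h1 h2
  exact mem_sector_of_arg h1 h2

/-- The angle to the axis of the sector is less than `π / 4`, which is below `π / 3`, so its cosine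
is at least `1 / 2`. -/
theorem half_norm_le_of_mem_sector {φ₁ φ₂ φ₀ : ℝ} (h₁ : φ₀ - Real.pi / 4 < φ₁)
    (h₂ : φ₂ < φ₀ + Real.pi / 4) {z : ℂ} (hz : z ∈ sector φ₁ φ₂) :
    ‖z‖ / 2 ≤ (z * Complex.exp (-(φ₀ * Complex.I))).re := by
  obtain ⟨ρ, hρ, φ, ⟨ha, hb⟩, rfl⟩ := hz
  have e1 : (ρ : ℂ) * Complex.exp (φ * Complex.I) * Complex.exp (-(φ₀ * Complex.I))
      = ρ * Complex.exp (((φ - φ₀ : ℝ) : ℂ) * Complex.I) := by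
    rw [mul_assoc, ← Complex.exp_add]; push_cast; ring_nf
  rw [e1, Complex.re_ofReal_mul, Complex.exp_ofReal_mul_I_re, norm_mul,
    Complex.norm_exp_ofReal_mul_I, mul_one, Complex.norm_real, Real.norm_of_nonneg hρ.le]
  have hcos : 1 / 2 ≤ Real.cos (φ - φ₀) := by
    rw [← Real.cos_pi_div_three, ← Real.cos_abs (φ - φ₀)]
    have hpi := Real.pi_pos
    refine Real.cos_le_cos_of_nonneg_of_le_pi (abs_nonneg _) (by linarith) ?_
    rw [abs_le]; constructor <;> linarith
  nlinarith

/-- A given number lies on `ray φ` for at most a coset of `2πℤ` of angles. Countably many numbers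
exclude countably many angles, and the remaining angles are dense. -/
theorem exists_ray_avoiding {A : Set ℂ} (hA : A.Countable) {a b : ℝ} (hab : a < b) :
    ∃ φ ∈ Set.Ioo a b, ∀ z ∈ A, z ∉ ray φ := by
  have hray : ∀ z, {φ | z ∈ ray φ}.Countable := by
    intro z
    rcases Set.eq_empty_or_nonempty {φ | z ∈ ray φ} with h | ⟨φ', ρ', hρ', rfl⟩
    · rw [h]; exact Set.countable_empty
    · refine (Set.countable_range fun n : ℤ => φ' + 2 * Real.pi * n).mono ?_
      rintro φ ⟨ρ, hρ, h⟩
      have hn := congrArg norm h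
      simp only [norm_mul, Complex.norm_exp_ofReal_mul_I, mul_one, Complex.norm_real,
        Real.norm_of_nonneg hρ.le, Real.norm_of_nonneg hρ'.le] at hn
      subst hn
      have hρ0 : (ρ' : ℂ) ≠ 0 := by exact_mod_cast hρ'.ne'
      obtain ⟨n, hn⟩ := Complex.exp_eq_exp_iff_exists_int.1 (mul_left_cancel₀ hρ0 h)
      refine ⟨-n, ?_⟩
      have := congrArg Complex.im hn
      simp at this
      push_cast
      linarith
  have hbad : (⋃ z ∈ A, {φ | z ∈ ray φ}).Countable := hA.biUnion fun z _ => hray z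
  obtain ⟨φ, h1, h2⟩ := (hbad.dense_compl ℝ).exists_between hab
  refine ⟨φ, h2, fun z hz h => h1 ?_⟩
  simp only [Set.mem_iUnion]
  exact ⟨z, hz, h⟩

end Sector

/-! ### The norm on the model lattice. -/

section ModelNorm

variable {r : ℕ} {Γf : Type v} [AddCommGroup Γf] [Module.Free ℤ Γf] [Module.Finite ℤ Γf]

theorem modelNorm_nonneg (x : Model r Γf) : 0 ≤ modelNorm x := by
  unfold modelNorm; positivity

theorem abs_fst_le_modelNorm (x : Model r Γf) (i : Fin r) : |(x.1 i : ℝ)| ≤ modelNorm x := by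
  have h := Finset.single_le_sum (f := fun i => |(x.1 i : ℝ)|) (fun i _ => abs_nonneg _)
    (Finset.mem_univ i)
  have h2 : 0 ≤ ∑ i, |(x.2.1 i : ℝ)| := by positivity
  have h3 : 0 ≤ ∑ j, |((Module.Free.chooseBasis ℤ Γf).repr x.2.2 j : ℝ)| := by positivity
  unfold modelNorm
  linarith

theorem abs_snd_le_modelNorm (x : Model r Γf) (i : Fin r) : |(x.2.1 i : ℝ)| ≤ modelNorm x := by
  have h := Finset.single_le_sum (f := fun i => |(x.2.1 i : ℝ)|) (fun i _ => abs_nonneg _)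
    (Finset.mem_univ i)
  have h2 : 0 ≤ ∑ i, |(x.1 i : ℝ)| := by positivity
  have h3 : 0 ≤ ∑ j, |((Module.Free.chooseBasis ℤ Γf).repr x.2.2 j : ℝ)| := by positivity
  unfold modelNorm
  linarith

theorem abs_repr_le_modelNorm (x : Model r Γf) (j) :
    |((Module.Free.chooseBasis ℤ Γf).repr x.2.2 j : ℝ)| ≤ modelNorm x := by
  have h := Finset.single_le_sum
    (f := fun j => |((Module.Free.chooseBasis ℤ Γf).repr x.2.2 j : ℝ)|) (fun i _ => abs_nonneg _)
    (Finset.mem_univ j)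
  have h2 : 0 ≤ ∑ i, |(x.1 i : ℝ)| := by positivity
  have h3 : 0 ≤ ∑ i, |(x.2.1 i : ℝ)| := by positivity
  unfold modelNorm
  linarith

theorem modelNorm_nsmul (k : ℕ) (x : Model r Γf) : modelNorm (k • x) = k * modelNorm x := by
  simp [modelNorm, mul_add, Finset.mul_sum, abs_mul]

theorem one_le_modelNorm {x : Model r Γf} (hx : x ≠ 0) : 1 ≤ modelNorm x := by
  have one_le : ∀ n : ℤ, n ≠ 0 → (1 : ℝ) ≤ |(n : ℝ)| := fun n hn => by
    exact_mod_cast Int.one_le_abs hn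
  by_cases h1 : x.1 = 0
  · by_cases h2 : x.2.1 = 0
    · have h3 : x.2.2 ≠ 0 := fun h3 => hx (Prod.ext h1 (Prod.ext h2 h3))
      have h4 : (Module.Free.chooseBasis ℤ Γf).repr x.2.2 ≠ 0 := by simpa using h3
      obtain ⟨j, hj⟩ := Finsupp.ne_iff.1 h4
      exact (one_le _ hj).trans (abs_repr_le_modelNorm x j)
    · obtain ⟨i, hi⟩ := Function.ne_iff.1 h2
      exact (one_le _ hi).trans (abs_snd_le_modelNorm x i)
  · obtain ⟨i, hi⟩ := Function.ne_iff.1 h1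
    exact (one_le _ hi).trans (abs_fst_le_modelNorm x i)

theorem finite_modelNorm_le (R : ℝ) : {x : Model r Γf | modelNorm x ≤ R}.Finite := by
  classical
  let b := Module.Free.chooseBasis ℤ Γf
  let F : Model r Γf → (Fin r → ℤ) × (Fin r → ℤ) × (Module.Free.ChooseBasisIndex ℤ Γf → ℤ) :=
    fun x => (x.1, x.2.1, fun j => b.repr x.2.2 j)
  have hF : Function.Injective F := by
    intro x y h
    simp only [F, Prod.mk.injEq] at h
    refine Prod.ext h.1 (Prod.ext h.2.1 (b.repr.injective (Finsupp.ext fun j => ?_)))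
    exact congrFun h.2.2 j
  refine ((Set.finite_Icc (α := (Fin r → ℤ) × (Fin r → ℤ) ×
    (Module.Free.ChooseBasisIndex ℤ Γf → ℤ))
    (fun _ => -⌈R⌉, fun _ => -⌈R⌉, fun _ => -⌈R⌉)
    (fun _ => ⌈R⌉, fun _ => ⌈R⌉, fun _ => ⌈R⌉)).preimage hF.injOn).subset fun x hx => ?_
  have key : ∀ n : ℤ, |(n : ℝ)| ≤ modelNorm x → -⌈R⌉ ≤ n ∧ n ≤ ⌈R⌉ := by
    intro n hn
    have := abs_le.1 (hn.trans (le_trans hx (Int.le_ceil R)))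
    exact ⟨by exact_mod_cast this.1, by exact_mod_cast this.2⟩
  exact ⟨⟨fun i => (key _ (abs_fst_le_modelNorm x i)).1, fun i =>
    (key _ (abs_snd_le_modelNorm x i)).1, fun j => (key _ (abs_repr_le_modelNorm x j)).1⟩,
    ⟨fun i => (key _ (abs_fst_le_modelNorm x i)).2, fun i =>
    (key _ (abs_snd_le_modelNorm x i)).2, fun j => (key _ (abs_repr_le_modelNorm x j)).2⟩⟩

variable (r Γf) in
theorem countable_model : Countable (Model r Γf) := by
  have : (Set.univ : Set (Model r Γf)) = ⋃ n : ℕ, {x | modelNorm x ≤ n} := by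
    refine (Set.eq_univ_of_forall fun x => ?_).symm
    obtain ⟨n, hn⟩ := exists_nat_ge (modelNorm x)
    exact Set.mem_iUnion.2 ⟨n, hn⟩
  rw [← Set.countable_univ_iff, this]
  exact Set.countable_iUnion fun n => (finite_modelNorm_le _).countable

/-- Additive functions on the model lattice are bounded by the norm. -/
theorem exists_bound_modelNorm {F : Type*} [NormedAddCommGroup F] (φ : Model r Γf →+ F) :
    ∃ C : ℝ, 0 ≤ C ∧ ∀ x, ‖φ x‖ ≤ C * modelNorm x := by
  let b := Module.Free.chooseBasis ℤ Γf
  refine ⟨∑ i, ‖φ (Pi.single i 1, 0, 0)‖ + ∑ i, ‖φ (0, Pi.single i 1, 0)‖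
    + ∑ j, ‖φ (0, 0, b j)‖, by positivity, fun x => ?_⟩
  have h0 : x = ∑ i, x.1 i • ((Pi.single i 1, 0, 0) : Model r Γf)
      + ∑ i, x.2.1 i • ((0, Pi.single i 1, 0) : Model r Γf)
      + ∑ j, b.repr x.2.2 j • ((0, 0, b j) : Model r Γf) := by
    refine Prod.ext ?_ (Prod.ext ?_ ?_)
    · simp only [Prod.fst_add, Prod.fst_sum, Prod.smul_fst, smul_zero, Finset.sum_const_zero,
        add_zero]
      exact pi_eq_sum_univ' x.1
    · simp only [Prod.snd_add, Prod.snd_sum, Prod.smul_snd, Prod.fst_add, Prod.fst_sum,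
        Prod.smul_fst, smul_zero, Finset.sum_const_zero, add_zero, zero_add]
      exact pi_eq_sum_univ' x.2.1
    · simp only [Prod.snd_add, Prod.snd_sum, Prod.smul_snd, smul_zero, Finset.sum_const_zero,
        zero_add]
      exact (b.sum_repr x.2.2).symm
  have hz : ∀ (n : ℤ) (y : Model r Γf), |(n : ℝ)| ≤ modelNorm x →
      ‖φ (n • y)‖ ≤ ‖φ y‖ * modelNorm x := by
    intro n y hn
    rw [map_zsmul]
    refine (norm_zsmul_le n (φ y)).trans ?_
    rw [mul_comm]
    gcongr
    simpa [Int.norm_eq_abs] using hn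
  conv_lhs => rw [h0]
  rw [map_add, map_add, map_sum, map_sum, map_sum, add_mul, add_mul, Finset.sum_mul,
    Finset.sum_mul, Finset.sum_mul]
  refine (norm_add_le _ _).trans (add_le_add ((norm_add_le _ _).trans (add_le_add ?_ ?_)) ?_)
  · exact (norm_sum_le _ _).trans (Finset.sum_le_sum fun i _ => hz _ _ (abs_fst_le_modelNorm x i))
  · exact (norm_sum_le _ _).trans (Finset.sum_le_sum fun i _ => hz _ _ (abs_snd_le_modelNorm x i))
  · exact (norm_sum_le _ _).trans (Finset.sum_le_sum fun j _ => hz _ _ (abs_repr_le_modelNorm x j))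

end ModelNorm

/-! ### Local constancy of the BPS indices of non-flavor charges. -/

section LocallyConstant

variable {E : Type*} [NormedAddCommGroup E] [NormedSpace ℂ E]
  {M : Type u} [TopologicalSpace M] [ChartedSpace E M]
  {r : ℕ} {Γf : Type v} [AddCommGroup Γf] {L : ChargeLattice.{u, v, w} M r Γf}

theorem flatExt_frame (p q : M) (x : Model r Γf) :
    L.flatExt p (L.frame p p x) q = L.frame p q x := by
  simp [ChargeLattice.flatExt]

theorem pairing_frame (p q : M) (x y : Model r Γf) :
    L.pairing q (L.frame p q x) (L.frame p q y) = ∑ i, (x.1 i * y.2.1 i - x.2.1 i * y.1 i) :=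
  (L.adapted p q).darboux x y

/-- One partner `y` serves for all points and all frames, because the pairing has the same
coordinate expression in every adapted frame. -/
theorem exists_pairing_ne_zero {x : Model r Γf} (hx : x.1 ≠ 0 ∨ x.2.1 ≠ 0) :
    ∃ y : Model r Γf, ∀ p q, L.pairing q (L.frame p q x) (L.frame p q y) ≠ 0 := by
  rcases hx with hx | hx
  · obtain ⟨i, hi⟩ := Function.ne_iff.1 hx
    refine ⟨(0, Pi.single i 1, 0), fun p q => ?_⟩
    rw [pairing_frame]
    simpa [Pi.single_apply] using hi
  · obtain ⟨i, hi⟩ := Function.ne_iff.1 hx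
    refine ⟨(Pi.single i 1, 0, 0), fun p q => ?_⟩
    rw [pairing_frame]
    simpa [Pi.single_apply] using hi

theorem continuousAt_val (Z : CentralCharge E L) (p : M) (x : Model r Γf) :
    ContinuousAt (fun q => Z.val q (L.frame p q x)) p := by
  have := (Z.holomorphic p (L.frame p p x)).continuousAt
  simpa only [flatExt_frame] using this

variable [Module.Free ℤ Γf] [Module.Finite ℤ Γf]

theorem IsBPSVariation.ne_zero {Z : CentralCharge E L} {Ω : ∀ p, L.fib p → ℤ}
    (h : IsBPSVariation Z Ω) {p : M} {γ : L.fib p} (hγ : Ω p γ ≠ 0) : Z.val p γ ≠ 0 := by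
  obtain ⟨C, hC, hs⟩ := h.support p
  have := hs.self_of_nhds γ hγ
  rw [← norm_pos_iff]
  exact (mul_nonneg hC.le (modelNorm_nonneg _)).trans_lt this

/-- The support property passes from `Ω` to `DT`: a charge with `DT ≠ 0` is a multiple of one with
`Ω ≠ 0`, and both sides of the estimate scale by the multiplicity. -/
theorem IsBPSVariation.eventually_DT {Z : CentralCharge E L} {Ω : ∀ p, L.fib p → ℤ}
    (h : IsBPSVariation Z Ω) (p : M) : ∃ C : ℝ, 0 < C ∧ ∀ᶠ q in 𝓝 p, ∀ x : Model r Γf,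
      DT (Ω q) (L.frame p q x) ≠ 0 → x ≠ 0 ∧ C * modelNorm x ≤ ‖Z.val q (L.frame p q x)‖ := by
  obtain ⟨C, hC, hs⟩ := h.support p
  refine ⟨C, hC, ?_⟩
  filter_upwards [hs] with q hq x hx
  obtain ⟨k, γ', hk, hkγ, hΩ⟩ := exists_of_DT_ne_zero hx
  have h1 := hq γ' hΩ
  have h2 := h.ne_zero hΩ
  have hx' : x = k • (L.frame p q).symm γ' := by
    rw [← map_nsmul, hkγ, AddEquiv.symm_apply_apply]
  constructor
  · rintro rfl
    have : Z.val q (k • γ') = 0 := by rw [hkγ]; simp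
    rw [map_nsmul, smul_eq_zero] at this
    exact this.elim hk.ne' h2
  · rw [← hkγ, hx', modelNorm_nsmul, map_nsmul, nsmul_eq_mul, norm_mul, Complex.norm_natCast]
    have : (0 : ℝ) ≤ k := k.cast_nonneg
    nlinarith

/-- The wall-crossing formula in a sector around `Z_x` makes the polynomials of
`exists_polynomial_ksCoeff` agree at enough points. Their linear coefficients are `DT` times a
non-zero pairing, which does not depend on the point. -/
theorem IsBPSVariation.eventually_DT_eq {Z : CentralCharge E L} {Ω : ∀ p, L.fib p → ℤ}
    (h : IsBPSVariation Z Ω) (hloc : IsMutuallyLocal L Ω) (p : M) {x : Model r Γf}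
    (hx : x.1 ≠ 0 ∨ x.2.1 ≠ 0) :
    ∀ᶠ q in 𝓝 p, DT (Ω q) (L.frame p q x) = DT (Ω p) (L.frame p p x) := by
  have hx0 : x ≠ 0 := by rintro rfl; simp at hx
  obtain ⟨C, hC, hD⟩ := h.eventually_DT p
  have hcont := continuousAt_val Z p x
  have h1x := one_le_modelNorm hx0
  -- A vanishing central charge has no argument and hence no sector. But then `|Z|` stays below the
  -- support constant near `p`, and since the norm of `x` is at least `1`, the invariant is zero at
  -- all these points.
  by_cases hz : Z.val p (L.frame p p x) = 0
  · have hsmall : ∀ᶠ q in 𝓝 p, ‖Z.val q (L.frame p q x)‖ < C :=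
      hcont.norm.eventually_lt_const (by simpa [hz] using hC)
    have hzero : ∀ᶠ q in 𝓝 p, DT (Ω q) (L.frame p q x) = 0 := by
      filter_upwards [hD, hsmall] with q h1 h2
      by_contra h3
      have := (h1 x h3).2
      nlinarith
    filter_upwards [hzero] with q hq
    rw [hq, hzero.self_of_nhds]
  set z₀ := Z.val p (L.frame p p x)
  have hpi := Real.pi_pos
  have := countable_model r Γf
  have hA : (Set.range fun y => Z.val p (L.frame p p y)).Countable := Set.countable_range _
  -- Only countably many central charges occur at `p`, so both boundary rays can avoid them. The
  -- distance `π / 4` from the argument of `z₀` keeps the sector strictly convex and permits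
  -- `half_norm_le_of_mem_sector`.
  obtain ⟨φ₁, h₁, hA₁⟩ := exists_ray_avoiding hA (a := z₀.arg - Real.pi / 4) (b := z₀.arg)
    (by linarith)
  obtain ⟨φ₂, h₂, hA₂⟩ := exists_ray_avoiding hA (a := z₀.arg) (b := z₀.arg + Real.pi / 4)
    (by linarith)
  have hray : ∀ γ, Ω p γ ≠ 0 → Z.val p γ ∉ ray φ₁ ∧ Z.val p γ ∉ ray φ₂ := fun γ _ => by
    have : Z.val p γ ∈ Set.range fun y => Z.val p (L.frame p p y) :=
      ⟨(L.frame p p).symm γ, by simp⟩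
    exact ⟨hA₁ _ this, hA₂ _ this⟩
  have hwc := h.wallCrossing p φ₁ φ₂ (by linarith [h₁.2, h₂.1]) (by linarith [h₁.1, h₂.2]) hray
  obtain ⟨y, hy⟩ := exists_pairing_ne_zero (L := L) hx
  -- A contributing list has length at most `2 |Z_x| / C`, and `|Z_x| ≤ |z₀| + 1` near `p`; so `K`
  -- bounds the degrees of all polynomials near `p` at once.
  obtain ⟨K, hK⟩ := exists_nat_ge (2 * (‖z₀‖ + 1) / C)
  have hK' : 2 * (‖z₀‖ + 1) ≤ C * K := by
    rw [div_le_iff₀ hC] at hK; linarith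
  have hbd : ∀ᶠ q in 𝓝 p, ‖Z.val q (L.frame p q x)‖ ≤ ‖z₀‖ + 1 := by
    filter_upwards [hcont.norm.eventually_lt_const (lt_add_one ‖z₀‖)] with q hq using hq.le
  have hsec : ∀ᶠ q in 𝓝 p, Z.val q (L.frame p q x) ∈ sector φ₁ φ₂ :=
    hcont.eventually (eventually_mem_sector hz h₁.2 h₂.1)
  have hpoly : ∀ᶠ q in 𝓝 p, ∃ P : Polynomial ℚ, P.natDegree ≤ K ∧
      (∀ m : ℕ, ksCoeff (L.pairing q) (Z.val q) (Ω q) φ₁ φ₂ ((2 * m) • L.frame p q y)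
        (L.frame p q x) = P.eval (2 * m : ℚ)) ∧
      P.coeff 1 = DT (Ω q) (L.frame p q x)
        * (L.pairing q (L.frame p q x) (L.frame p q y) : ℚ) := by
    filter_upwards [hD, hbd, hsec] with q hq hb hs
    have hfl := finite_ksLists (pairing := L.pairing q) (Z := Z.val q) (Ω := Ω q)
      (N := fun γ => modelNorm ((L.frame p q).symm γ))
      (fun R => (finite_modelNorm_le R).preimage (L.frame p q).symm.injective.injOn)
      (fun γ hγ => one_le_modelNorm (by simpa using hγ)) hC
      (fun γ hγ => by simpa using hq ((L.frame p q).symm γ) (by simpa using hγ))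
      (fun l => map_list_sum _ _) (fun z hz => half_norm_le_of_mem_sector h₁.1 h₂.2 hz)
      (β := L.frame p q y) hb hK'
    refine exists_polynomial_ksCoeff (fun γ γ' hγ hγ' => ?_) hfl.1 hfl.2 hs
    obtain ⟨k, δ, _, rfl, hδ⟩ := exists_of_DT_ne_zero hγ
    obtain ⟨k', δ', _, rfl, hδ'⟩ := exists_of_DT_ne_zero hγ'
    simp [hloc q δ δ' hδ hδ']
  -- Each matrix coefficient is constant on a neighbourhood of its own, so only finitely many values
  -- of `m` can be used. The `K + 2` nodes are more than a polynomial of degree at most `K`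
  -- requires.
  have hev : ∀ᶠ q in 𝓝 p, ∀ m : Fin (K + 2),
      ksCoeff (L.pairing q) (Z.val q) (Ω q) φ₁ φ₂ ((2 * (m : ℕ)) • L.frame p q y) (L.frame p q x)
      = ksCoeff (L.pairing p) (Z.val p) (Ω p) φ₁ φ₂ ((2 * (m : ℕ)) • L.frame p p y)
        (L.frame p p x) := by
    refine eventually_all.2 fun m => ?_
    have := hwc (L.frame p p ((2 * (m : ℕ)) • y)) (L.frame p p x)
    simp only [flatExt_frame] at this
    simpa only [map_nsmul] using this
  obtain ⟨P, hP1, hP2, hP3⟩ := hpoly.self_of_nhds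
  filter_upwards [hpoly, hev] with q ⟨Q, hQ1, hQ2, hQ3⟩ hq
  have hPQ : Q = P := by
    refine Polynomial.eq_of_natDegree_lt_card_of_eval_eq Q P (ι := Fin (K + 2))
      (f := fun m => (2 * (m : ℕ) : ℚ)) (fun m m' hm => ?_) (fun m => ?_) ?_
    · simp only at hm
      exact Fin.ext (by exact_mod_cast (mul_left_cancel₀ two_ne_zero hm))
    · rw [← hQ2, ← hP2, hq m]
    · rw [Fintype.card_fin]; omega
  rw [hPQ, hP3, (pairing_frame p q x y).trans (pairing_frame p p x y).symm] at hQ3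
  have hne : (L.pairing p (L.frame p p x) (L.frame p p y) : ℚ) ≠ 0 := by exact_mod_cast hy p p
  exact (mul_right_cancel₀ hne hQ3).symm

/-- Under mutual locality, the BPS indices of non-flavor charges are locally constant. -/
theorem IsBPSVariation.eventually_eq {Z : CentralCharge E L} {Ω : ∀ p, L.fib p → ℤ}
    (h : IsBPSVariation Z Ω) (hloc : IsMutuallyLocal L Ω) (p : M) {x : Model r Γf}
    (hx : x.1 ≠ 0 ∨ x.2.1 ≠ 0) :
    ∀ᶠ q in 𝓝 p, Ω q (L.frame p q x) = Ω p (L.frame p p x) := by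
  have hx0 : x ≠ 0 := by rintro rfl; simp at hx
  -- To recover the index of `x`, the invariants of all divisors of `x` are needed. They are
  -- finitely many, so their neighbourhoods can be intersected, and none of them is a flavor charge.
  have hfin : {y : Model r Γf | ∃ k : ℕ, 0 < k ∧ k • y = x}.Finite := by
    refine (finite_modelNorm_le (modelNorm x)).subset ?_
    rintro y ⟨k, hk, rfl⟩
    change modelNorm y ≤ _
    rw [modelNorm_nsmul]
    have : (1 : ℝ) ≤ k := by exact_mod_cast hk
    nlinarith [modelNorm_nonneg y]
  have hev : ∀ᶠ q in 𝓝 p, ∀ y ∈ {y : Model r Γf | ∃ k : ℕ, 0 < k ∧ k • y = x},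
      DT (Ω q) (L.frame p q y) = DT (Ω p) (L.frame p p y) := by
    refine (eventually_all_finite hfin).2 ?_
    rintro y ⟨k, hk, rfl⟩
    refine h.eventually_DT_eq hloc p ?_
    by_contra! hc
    simp [hc.1, hc.2] at hx
  filter_upwards [hev] with q hq
  refine eq_of_DT_eq (Ω := fun y => Ω q (L.frame p q y)) (Ω' := fun y => Ω p (L.frame p p y))
    finite_modelNorm_le (fun _ => one_le_modelNorm) modelNorm_nsmul hx0 fun k y hk hy => ?_
  rw [DT_comp_equiv, DT_comp_equiv, hq y ⟨k, hk, hy⟩]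

end LocallyConstant

/-! ### Local coordinates -/

section Coordinates

variable {E : Type*} [NormedAddCommGroup E] [NormedSpace ℂ E]
  {M : Type u} [TopologicalSpace M] [ChartedSpace E M]
  {r : ℕ} {Γf : Type v} [AddCommGroup Γf] {L : ChargeLattice.{u, v, w} M r Γf}

/-- The function `Z_γ` for the flat section `γ` with coordinates `x` in the preferred frame at
`p`, in the preferred chart at `p`. -/
def Zc (Z : CentralCharge E L) (p : M) (x : Model r Γf) (z : E) : ℂ :=
  Z.val ((chartAt E p).symm z) (L.frame p ((chartAt E p).symm z) x)

/-- The value of the central charge on flavor charges. -/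
def Zflavor (Z : CentralCharge E L) (p : M) : Γf →+ ℂ := (Z.val p).comp (L.flavor p)

theorem val_flavor (Z : CentralCharge E L) (p q : M) (f : Γf) :
    Z.val q (L.frame p q (0, 0, f)) = Zflavor Z p f := by
  rw [(L.adapted p q).flavor]
  exact Z.flavor_const f q p

theorem model_eq_sum (x : Model r Γf) : x = ∑ i, x.1 i • ((Pi.single i 1, 0, 0) : Model r Γf)
    + ∑ i, x.2.1 i • ((0, Pi.single i 1, 0) : Model r Γf) + (0, 0, x.2.2) := by
  refine Prod.ext ?_ (Prod.ext ?_ ?_)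
  · simp only [Prod.fst_add, Prod.fst_sum, Prod.smul_fst, smul_zero, Finset.sum_const_zero,
      add_zero]
    exact pi_eq_sum_univ' x.1
  · simp only [Prod.snd_add, Prod.snd_sum, Prod.smul_snd, Prod.fst_add, Prod.fst_sum,
      Prod.smul_fst, smul_zero, Finset.sum_const_zero, add_zero, zero_add]
    exact pi_eq_sum_univ' x.2.1
  · simp only [Prod.snd_add, Prod.snd_sum, Prod.smul_snd, smul_zero, Finset.sum_const_zero,
      zero_add]

/-- An additive function in terms of its values on a frame. -/
theorem hom_frame_eq {G : Type*} [AddCommGroup G] {Γ : Type w} [AddCommGroup Γ]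
    (e : Model r Γf ≃+ Γ) (φ : Γ →+ G) (x : Model r Γf) :
    φ (e x) = ∑ i, x.1 i • φ (e (Pi.single i 1, 0, 0)) + ∑ i, x.2.1 i • φ (e (0, Pi.single i 1, 0))
      + φ (e (0, 0, x.2.2)) := by
  conv_lhs => rw [model_eq_sum x]
  simp only [map_add, map_sum, map_zsmul]

theorem eventually_frame_eq (p q : M) (hq : q ∈ L.dom p) :
    ∀ᶠ q' in 𝓝 q, ∀ x, L.frame p q' x = L.flatExt q (L.frame p q x) q' := by
  filter_upwards [L.locallyConstant p q q hq (L.mem_dom q)] with q' h x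
  rw [ChargeLattice.flatExt, ← h x, AddEquiv.apply_symm_apply]

theorem isOpen_paramDomain_base (p : M) :
    IsOpen {z : E | z ∈ (chartAt E p).target ∧ (chartAt E p).symm z ∈ L.dom p} :=
  (chartAt E p).continuousOn_symm.isOpen_inter_preimage (chartAt E p).open_target
    (L.isOpen_dom p)

theorem mem_nhds_paramDomain {p : M} {y : Coord E r} (hy : y ∈ paramDomain E L p) :
    paramDomain E L p ∈ 𝓝 y :=
  ((isOpen_paramDomain_base p).preimage continuous_fst).mem_nhds hy

theorem continuousAt_symm {p : M} {z : E} (hz : z ∈ (chartAt E p).target) :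
    ContinuousAt (chartAt E p).symm z :=
  (chartAt E p).continuousAt_symm hz

/-- Transfer of germs from the base to coordinates. -/
theorem eventually_param {p : M} {y : Coord E r} (hy : y ∈ paramDomain E L p) {P : M → Prop}
    (h : ∀ᶠ q in 𝓝 ((chartAt E p).symm y.1), P q) :
    ∀ᶠ y' : Coord E r in 𝓝 y, P ((chartAt E p).symm y'.1) :=
  ((continuousAt_symm hy.1).comp' continuousAt_fst).eventually h

theorem dZ_add (Z : CentralCharge E L) (p : M) (γ γ' : L.fib p) :
    dZ Z p (γ + γ') = dZ Z p γ + dZ Z p γ' := by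
  have h : (fun q => Z.val q (L.flatExt p (γ + γ') q))
      = (fun q => Z.val q (L.flatExt p γ q)) + fun q => Z.val q (L.flatExt p γ' q) := by
    funext q
    simp [ChargeLattice.flatExt]
  rw [dZ, h]
  exact mfderiv_add ((Z.holomorphic p γ).mdifferentiableAt (by simp))
    ((Z.holomorphic p γ').mdifferentiableAt (by simp))

/-- `dZ` evaluated on a tangent vector, as an additive function of the charge. -/
def dZhom (Z : CentralCharge E L) (p : M) (a : E) : L.fib p →+ ℂ :=
  AddMonoidHom.mk' (fun γ => dZ Z p γ a) fun γ γ' => by rw [dZ_add]; rfl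

theorem dZhom_apply (Z : CentralCharge E L) (p : M) (a : E) (γ : L.fib p) :
    dZhom Z p a γ = dZ Z p γ a := rfl

theorem dZ_flavor (Z : CentralCharge E L) (p : M) (f : Γf) : dZ Z p (L.flavor p f) = 0 := by
  have h : (fun q => Z.val q (L.flatExt p (L.flavor p f) q)) = fun _ => Z.val p (L.flavor p f) := by
    funext q
    rw [ChargeLattice.flatExt, frame_symm_flavor, (L.adapted p q).flavor]
    exact Z.flavor_const f q p
  rw [dZ, h]
  exact mfderiv_const

variable {θf : Γf →+ Real.Angle}

theorem coordHom_apply (p q : M) (a b : Fin r → ℝ) (γ : L.fib q) :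
    coordHom L p q a b γ = ∑ i, ((((L.frame p q).symm γ).1 i : ℝ) * a i
      + (((L.frame p q).symm γ).2.1 i : ℝ) * b i) := rfl

theorem coordHom_frame (p q : M) (a b : Fin r → ℝ) (x : Model r Γf) :
    coordHom L p q a b (L.frame p q x) = ∑ i, ((x.1 i : ℝ) * a i + (x.2.1 i : ℝ) * b i) := by
  simp [coordHom]

theorem theta_param (p : M) (y : Coord E r) (x : Model r Γf) :
    theta (param L θf p y) (L.frame p _ x)
      = ((∑ i, ((x.1 i : ℝ) * y.2.1 i + (x.2.1 i : ℝ) * y.2.2 i) : ℝ) : Real.Angle)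
        + θf x.2.2 := by
  change ((coordHom L p _ y.2.1 y.2.2 (L.frame p _ x) : ℝ) : Real.Angle)
    + θf ((L.frame p _).symm (L.frame p _ x)).2.2 = _
  rw [coordHom_frame, AddEquiv.symm_apply_apply]

theorem dTheta_dParam (p : M) (y k : Coord E r) (x : Model r Γf) :
    dTheta (param L θf p y) (dParam L θf p y k) (L.frame p _ x)
      = ((∑ i, ((x.1 i : ℝ) * k.2.1 i + (x.2.1 i : ℝ) * k.2.2 i) : ℝ) : ℂ) := by
  change ((coordHom L p _ k.2.1 k.2.2 (L.frame p _ x) : ℝ) : ℂ) = _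
  rw [coordHom_frame]

variable [IsManifold 𝓘(ℂ, E) ω M]

theorem mdifferentiable_chart' (p : M) :
    (chartAt E p).MDifferentiable 𝓘(ℂ, E) 𝓘(ℂ, E) := by
  have : IsManifold 𝓘(ℂ, E) 1 M := IsManifold.of_le (n := ω) le_top
  exact mdifferentiable_chart p

theorem contDiffAt_Zc (Z : CentralCharge E L) (p : M) (x : Model r Γf) {z : E}
    (hz : z ∈ (chartAt E p).target) (hz' : (chartAt E p).symm z ∈ L.dom p) :
    ContDiffAt ℂ ω (Zc Z p x) z := by
  set q := (chartAt E p).symm z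
  have h1 : ContMDiffAt 𝓘(ℂ, E) 𝓘(ℂ, ℂ) ω (fun q' => Z.val q' (L.frame p q' x)) q := by
    refine (Z.holomorphic q (L.frame p q x)).congr_of_eventuallyEq ?_
    filter_upwards [eventually_frame_eq p q hz'] with q' h
    rw [h x]
  have h2 : ContMDiffAt 𝓘(ℂ, E) 𝓘(ℂ, E) ω (chartAt E p).symm z :=
    contMDiffOn_chart_symm.contMDiffAt ((chartAt E p).open_target.mem_nhds hz)
  exact contMDiffAt_iff_contDiffAt.1 (h1.comp z h2)

/-- This is the chain rule together with a change of frame: `dZ` at `q` is defined by the preferred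
frame at `q`, whereas `Zc` uses the one at `p`, and the two differ near `q` by a constant. -/
theorem fderiv_Zc (Z : CentralCharge E L) (p : M) (x : Model r Γf) {z : E}
    (hz : z ∈ (chartAt E p).target) (hz' : (chartAt E p).symm z ∈ L.dom p) (k : E) :
    fderiv ℂ (Zc Z p x) z k = dZ Z ((chartAt E p).symm z) (L.frame p _ x)
      ((mfderiv 𝓘(ℂ, E) 𝓘(ℂ, E) (chartAt E p).symm z : E →L[ℂ] E) k) := by
  set q := (chartAt E p).symm z with hq
  have h0 : (fun q' => Z.val q' (L.frame p q' x)) =ᶠ[𝓝 q]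
      fun q' => Z.val q' (L.flatExt q (L.frame p q x) q') := by
    filter_upwards [eventually_frame_eq p q hz'] with q' h
    rw [h x]
  have h1 : MDifferentiableAt 𝓘(ℂ, E) 𝓘(ℂ, ℂ) (fun q' => Z.val q' (L.frame p q' x)) q :=
    ((Z.holomorphic q (L.frame p q x)).mdifferentiableAt (by simp)).congr_of_eventuallyEq h0
  have h2 : MDifferentiableAt 𝓘(ℂ, E) 𝓘(ℂ, E) (chartAt E p).symm z :=
    (mdifferentiable_chart' p).mdifferentiableAt_symm hz
  have h3 : mfderiv 𝓘(ℂ, E) 𝓘(ℂ, ℂ) ((fun q' => Z.val q' (L.frame p q' x)) ∘ (chartAt E p).symm) z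
      = (mfderiv 𝓘(ℂ, E) 𝓘(ℂ, ℂ) (fun q' => Z.val q' (L.frame p q' x)) q).comp
        (mfderiv 𝓘(ℂ, E) 𝓘(ℂ, E) (chartAt E p).symm z) := mfderiv_comp z h1 h2
  rw [h0.mfderiv_eq, mfderiv_eq_fderiv] at h3
  have := congrArg (fun F : E →L[ℂ] ℂ => F k) h3
  exact this

theorem dZp_dParam (Z : CentralCharge E L) {p : M} {y : Coord E r} (hy : y ∈ paramDomain E L p)
    (k : Coord E r) (x : Model r Γf) :
    dZp Z (param L θf p y) (dParam L θf p y k) (L.frame p _ x) = fderiv ℂ (Zc Z p x) y.1 k.1 :=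
  (fderiv_Zc Z p x hy.1 hy.2 k.1).symm

/-- `dParam` as a linear map. -/
def dParamLin (L : ChargeLattice.{u, v, w} M r Γf) (θf : Γf →+ Real.Angle) (p : M)
    (y : Coord E r) : Coord E r →ₗ[ℝ] Tan E (param L θf p y) where
  toFun := dParam L θf p y
  map_add' k l := by
    refine Prod.ext (map_add _ _ _) (Subtype.ext (AddMonoidHom.ext fun γ => ?_))
    change coordHom L p _ (k + l).2.1 (k + l).2.2 γ
      = coordHom L p _ k.2.1 k.2.2 γ + coordHom L p _ l.2.1 l.2.2 γ
    simp only [coordHom_apply]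
    rw [← Finset.sum_add_distrib]
    refine Finset.sum_congr rfl fun i _ => ?_
    simp only [Prod.fst_add, Prod.snd_add, Pi.add_apply]
    ring
  map_smul' c k := by
    refine Prod.ext ?_ (Subtype.ext (AddMonoidHom.ext fun γ => ?_))
    · change (mfderiv 𝓘(ℂ, E) 𝓘(ℂ, E) (chartAt E p).symm y.1 : E →L[ℂ] E) (c • k.1) = c • _
      exact ((mfderiv 𝓘(ℂ, E) 𝓘(ℂ, E) (chartAt E p).symm y.1 : E →L[ℂ] E).restrictScalars ℝ).map_smul
        c k.1
    · change coordHom L p _ (c • k).2.1 (c • k).2.2 γ = c * coordHom L p _ k.2.1 k.2.2 γ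
      simp only [coordHom_apply]
      rw [Finset.mul_sum]
      refine Finset.sum_congr rfl fun i _ => ?_
      simp only [Prod.smul_fst, Prod.smul_snd, Pi.smul_apply, smul_eq_mul]
      ring

theorem dParamInv_dParam {p : M} {y : Coord E r} (hy : y ∈ paramDomain E L p) (k : Coord E r) :
    dParamInv L θf p y (dParam L θf p y k) = k := by
  refine Prod.ext ?_ (Prod.ext (funext fun i => ?_) (funext fun i => ?_))
  · exact congrArg (fun F : E →L[ℂ] E => F k.1) ((mdifferentiable_chart' p).comp_symm_deriv hy.1)
  · change coordHom L p _ k.2.1 k.2.2 (L.frame p _ (Pi.single i 1, 0, 0)) = _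
    rw [coordHom_frame]
    simp [Pi.single_apply]
  · change coordHom L p _ k.2.1 k.2.2 (L.frame p _ (0, Pi.single i 1, 0)) = _
    rw [coordHom_frame]
    simp [Pi.single_apply]

theorem dParam_dParamInv {p : M} {y : Coord E r} (hy : y ∈ paramDomain E L p)
    (ξ : Tan E (param L θf p y)) :
    dParam L θf p y (dParamInv L θf p y ξ) = ξ := by
  refine Prod.ext ?_ (Subtype.ext (AddMonoidHom.ext fun γ => ?_))
  · have hq : (chartAt E p).symm y.1 ∈ (chartAt E p).source := (chartAt E p).map_target hy.1
    have h1 := congrArg (fun F : E →L[ℂ] E => F ξ.1) ((mdifferentiable_chart' p).symm_comp_deriv hq)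
    have h2 : (chartAt E p) ((chartAt E p).symm y.1) = y.1 := (chartAt E p).right_inv hy.1
    rw [h2] at h1
    exact h1
  · obtain ⟨x, rfl⟩ := (L.frame p _).surjective γ
    change coordHom L p _ _ _ (L.frame p _ x) = ξ.2.1 (L.frame p _ x)
    rw [coordHom_frame, hom_frame_eq (L.frame p _) ξ.2.1 x, (L.adapted p _).flavor, ξ.2.2,
      add_zero, ← Finset.sum_add_distrib]
    refine Finset.sum_congr rfl fun i _ => ?_
    rw [zsmul_eq_mul, zsmul_eq_mul]
    rfl

/-- The differential of the local parametrization as an isomorphism. -/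
def dParamEquiv {p : M} {y : Coord E r} (hy : y ∈ paramDomain E L p) :
    Coord E r ≃ₗ[ℝ] Tan E (param L θf p y) :=
  LinearEquiv.ofBijective (dParamLin L θf p y)
    ⟨Function.LeftInverse.injective (dParamInv_dParam hy),
      Function.RightInverse.surjective (dParam_dParamInv hy)⟩

theorem dParamEquiv_apply {p : M} {y : Coord E r} (hy : y ∈ paramDomain E L p) (k : Coord E r) :
    dParamEquiv (θf := θf) hy k = dParam L θf p y k := rfl

theorem dParamEquiv_symm_apply {p : M} {y : Coord E r} (hy : y ∈ paramDomain E L p)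
    (ξ : Tan E (param L θf p y)) : (dParamEquiv hy).symm ξ = dParamInv L θf p y ξ := by
  rw [LinearEquiv.symm_apply_eq, dParamEquiv_apply, dParam_dParamInv hy]

theorem exists_param_eq (x : TorusBundle L θf) :
    ∃ (p : M) (y : Coord E r), y ∈ paramDomain E L p ∧ param L θf p y = x := by
  obtain ⟨p, θ, hθ⟩ := x
  have hsurj : ∀ t : Real.Angle, ∃ s : ℝ, (s : Real.Angle) = t := fun t =>
    ⟨t.toReal, t.coe_toReal⟩
  choose a ha using fun i => hsurj (θ (L.frame p p (Pi.single i 1, 0, 0)))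
  choose b hb using fun i => hsurj (θ (L.frame p p (0, Pi.single i 1, 0)))
  have hp : (chartAt E p).symm (chartAt E p p) = p :=
    (chartAt E p).left_inv (mem_chart_source E p)
  refine ⟨p, (chartAt E p p, a, b), ⟨(chartAt E p).map_source (mem_chart_source E p), ?_⟩, ?_⟩
  · change (chartAt E p).symm (chartAt E p p) ∈ L.dom p
    rw [hp]; exact L.mem_dom p
  -- The base point of `param` equals `p` only propositionally, and the fibre depends on it; the
  -- identity is therefore proved for a variable `q` and specialized by substitution.
  · have key : ∀ q (_ : q = p) (h : ∀ f, (Real.Angle.coeHom.comp (coordHom L p q a b)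
        + AddMonoidHom.mk' (fun γ => θf ((L.frame p q).symm γ).2.2)
          (by intro γ γ'; simp)) (L.flavor q f) = θf f),
        (⟨q, _, h⟩ : TorusBundle L θf) = ⟨p, θ, hθ⟩ := by
      intro q hq h
      subst hq
      refine Sigma.ext rfl (heq_of_eq (Subtype.ext (AddMonoidHom.ext fun γ => ?_)))
      obtain ⟨x, rfl⟩ := (L.frame q q).surjective γ
      change ((coordHom L q q a b (L.frame q q x) : ℝ) : Real.Angle)
        + θf ((L.frame q q).symm (L.frame q q x)).2.2 = _
      rw [coordHom_frame, AddEquiv.symm_apply_apply, hom_frame_eq (L.frame q q) θ x,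
        (L.adapted _ _).flavor, hθ]
      congr 1
      rw [Finset.sum_add_distrib, Real.Angle.coe_add]
      have hsum : ∀ f : Fin r → ℝ, ((∑ i, f i : ℝ) : Real.Angle) = ∑ i, (f i : Real.Angle) :=
        fun f => map_sum Real.Angle.coeHom f _
      rw [hsum, hsum]
      congr 1
      · exact Finset.sum_congr rfl fun i _ => by rw [← ha, ← Real.Angle.coe_zsmul, zsmul_eq_mul]
      · exact Finset.sum_congr rfl fun i _ => by rw [← hb, ← Real.Angle.coe_zsmul, zsmul_eq_mul]
    exact key _ hp _

end Coordinates

/-! ### The instanton series in local coordinates -/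

section ClosedForms

variable {X : Type*} [NormedAddCommGroup X] [NormedSpace ℝ X]

/-- The complex valued `2`-form `c` is differentiable and closed at `y`. -/
def IsClosedAt (c : X → X → X → ℂ) (y : X) : Prop :=
  (∀ k l, DifferentiableAt ℝ (fun y => c y k l) y) ∧ ∀ k₀ k₁ k₂,
    fderiv ℝ (fun y => c y k₁ k₂) y k₀ - fderiv ℝ (fun y => c y k₀ k₂) y k₁
      + fderiv ℝ (fun y => c y k₀ k₁) y k₂ = 0

theorem IsClosedAt.of_hasFDerivAt {c : X → X → X → ℂ} {y : X} (c' : X → X → X →L[ℝ] ℂ)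
    (h : ∀ k l, HasFDerivAt (fun y => c y k l) (c' k l) y)
    (h' : ∀ k₀ k₁ k₂, c' k₁ k₂ k₀ - c' k₀ k₂ k₁ + c' k₀ k₁ k₂ = 0) : IsClosedAt c y :=
  ⟨fun k l => (h k l).differentiableAt, fun k₀ k₁ k₂ => by
    rw [(h _ _).fderiv, (h _ _).fderiv, (h _ _).fderiv]; exact h' _ _ _⟩

theorem IsClosedAt.add {c c' : X → X → X → ℂ} {y : X} (h : IsClosedAt c y)
    (h' : IsClosedAt c' y) : IsClosedAt (fun y k l => c y k l + c' y k l) y := by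
  refine .of_hasFDerivAt _ (fun k l => (h.1 k l).hasFDerivAt.add (h'.1 k l).hasFDerivAt)
    fun k₀ k₁ k₂ => ?_
  have e := h.2 k₀ k₁ k₂
  have e' := h'.2 k₀ k₁ k₂
  simp only [add_apply]
  linear_combination e + e'

theorem IsClosedAt.const_mul {c : X → X → X → ℂ} {y : X} (h : IsClosedAt c y) (z : ℂ) :
    IsClosedAt (fun y k l => z * c y k l) y := by
  refine .of_hasFDerivAt _ (fun k l => (h.1 k l).hasFDerivAt.const_mul z) fun k₀ k₁ k₂ => ?_
  have e := h.2 k₀ k₁ k₂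
  simp only [smul_apply, smul_eq_mul]
  linear_combination z * e

theorem IsClosedAt.sum {ι : Type*} [Fintype ι] {c : ι → X → X → X → ℂ} {y : X}
    (h : ∀ i, IsClosedAt (c i) y) : IsClosedAt (fun y k l => ∑ i, c i y k l) y := by
  refine .of_hasFDerivAt _ (fun k l => HasFDerivAt.fun_sum fun i _ => ((h i).1 k l).hasFDerivAt)
    fun k₀ k₁ k₂ => ?_
  simp only [sum_apply]
  rw [← Finset.sum_sub_distrib, ← Finset.sum_add_distrib]
  exact Finset.sum_eq_zero fun i _ => (h i).2 k₀ k₁ k₂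

theorem IsClosedAt.const (b : X → X → ℂ) (y : X) : IsClosedAt (fun _ k l => b k l) y :=
  .of_hasFDerivAt (fun _ _ => 0) (fun _ _ => hasFDerivAt_const _ _) fun _ _ _ => by simp

theorem IsClosedAt.congr {c c' : X → X → X → ℂ} {y : X} (h : IsClosedAt c y)
    (h' : ∀ᶠ y' in 𝓝 y, ∀ k l, c' y' k l = c y' k l) : IsClosedAt c' y := by
  refine .of_hasFDerivAt _ (fun k l => (h.1 k l).hasFDerivAt.congr_of_eventuallyEq ?_) h.2
  filter_upwards [h'] with y' hy'
  exact hy' k l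

theorem two_le_infty : (2 : WithTop ℕ∞) ≤ ∞ := WithTop.coe_le_coe.2 (le_top : (2 : ℕ∞) ≤ ⊤)

theorem hasFDerivAt_fderiv_apply {F : X → ℂ} {y : X} (hF : ContDiffAt ℝ ∞ F y) (k : X) :
    HasFDerivAt (fun y => fderiv ℝ F y k) ((fderiv ℝ (fderiv ℝ F) y).flip k) y := by
  have h : DifferentiableAt ℝ (fderiv ℝ F) y :=
    (hF.fderiv_right (m := 1) two_le_infty).differentiableAt (by simp)
  exact ((ContinuousLinearMap.apply ℝ ℂ k).hasFDerivAt.comp y h.hasFDerivAt)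

theorem fderiv_fderiv_symm {F : X → ℂ} {y : X} (hF : ContDiffAt ℝ ∞ F y) (k l : X) :
    fderiv ℝ (fderiv ℝ F) y k l = fderiv ℝ (fderiv ℝ F) y l k :=
  ((hF.of_le (n := ∞) (m := 2) two_le_infty).isSymmSndFDerivAt (by simp)) k l

/-- `dF ∧ T` is closed for a constant form `T`. -/
theorem isClosedAt_fderiv_wedge_const {F : X → ℂ} {y : X} (hF : ContDiffAt ℝ ∞ F y)
    (T : X → ℂ) :
    IsClosedAt (fun y k l => fderiv ℝ F y k * T l - fderiv ℝ F y l * T k) y := by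
  refine .of_hasFDerivAt _ (fun k l => ((hasFDerivAt_fderiv_apply hF k).mul_const (T l)).sub
    ((hasFDerivAt_fderiv_apply hF l).mul_const (T k))) fun k₀ k₁ k₂ => ?_
  simp only [sub_apply, smul_apply, smul_eq_mul, ContinuousLinearMap.flip_apply]
  rw [fderiv_fderiv_symm hF k₁ k₀, fderiv_fderiv_symm hF k₂ k₀, fderiv_fderiv_symm hF k₂ k₁]
  ring

/-- `dF ∧ dF̄'` is closed. -/
theorem isClosedAt_fderiv_wedge_conj {F F' : X → ℂ} {y : X} (hF : ContDiffAt ℝ ∞ F y)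
    (hF' : ContDiffAt ℝ ∞ F' y) :
    IsClosedAt (fun y k l => fderiv ℝ F y k * (starRingEnd ℂ) (fderiv ℝ F' y l)
      - fderiv ℝ F y l * (starRingEnd ℂ) (fderiv ℝ F' y k)) y := by
  have hc := fun k => SeriesData.hasFDerivAt_conj (hasFDerivAt_fderiv_apply hF' k)
  refine .of_hasFDerivAt _ (fun k l => ((hasFDerivAt_fderiv_apply hF k).mul (hc l)).sub
    ((hasFDerivAt_fderiv_apply hF l).mul (hc k))) fun k₀ k₁ k₂ => ?_
  simp only [sub_apply, add_apply, smul_apply, smul_eq_mul, Pi.sub_apply, Pi.mul_apply,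
    ContinuousLinearMap.flip_apply,
    ContinuousLinearMap.comp_apply, ContinuousLinearEquiv.coe_coe, Complex.conjCLE_apply]
  rw [fderiv_fderiv_symm hF k₁ k₀, fderiv_fderiv_symm hF k₂ k₀, fderiv_fderiv_symm hF k₂ k₁,
    fderiv_fderiv_symm hF' k₁ k₀, fderiv_fderiv_symm hF' k₂ k₀, fderiv_fderiv_symm hF' k₂ k₁]
  ring

end ClosedForms

/-! ### Closedness of the single instanton terms. -/

namespace SeriesData

variable {X : Type*} [NormedAddCommGroup X] [NormedSpace ℝ X]
  {Λ J : Type*} [Fintype J] (D : SeriesData X Λ J)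

/-- The constant form `-i d log χ_x`. -/
def T (x : Λ) : X →L[ℝ] ℂ := ∑ j, D.c j x • D.t j

/-- The terms of the series for `ω₁ + i ω₂`. -/
def term12 (a : Λ × ℕ) (y k l : X) : ℂ :=
  D.W a.1 * (1 / 8 * ((a.2 : ℂ) + 1) * D.f 1 a y * D.Z a.1 y
      * (D.dZ a.1 y k * (starRingEnd ℂ) (D.dZ a.1 y l)
        - D.dZ a.1 y l * (starRingEnd ℂ) (D.dZ a.1 y k))
    + Complex.I / (8 * Real.pi ^ 2) * D.f 0 a y
      * (D.T a.1 k * D.dZ a.1 y l - D.T a.1 l * D.dZ a.1 y k))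

/-- The terms of the series for `ω₃`. -/
def term3 (a : Λ × ℕ) (y k l : X) : ℂ :=
  D.W a.1 * (Complex.I / (8 * Real.pi) * D.f 0 a y
      * (D.dZ a.1 y k * (starRingEnd ℂ) (D.dZ a.1 y l)
        - D.dZ a.1 y l * (starRingEnd ℂ) (D.dZ a.1 y k))
    - 1 / (16 * Real.pi) * ((a.2 : ℂ) + 1) * D.f 1 a y
      * (D.T a.1 k * ((starRingEnd ℂ) (D.Z a.1 y) * D.dZ a.1 y l
          - D.Z a.1 y * (starRingEnd ℂ) (D.dZ a.1 y l))
        - D.T a.1 l * ((starRingEnd ℂ) (D.Z a.1 y) * D.dZ a.1 y k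
          - D.Z a.1 y * (starRingEnd ℂ) (D.dZ a.1 y k))))

variable {D}

theorem dZ_apply (x : Λ) (y k : X) : D.dZ x y k = ∑ j, D.c j x * fderiv ℝ (D.ζ j) y k := by
  simp [dZ, sum_apply]

theorem T_apply (x : Λ) (k : X) : D.T x k = ∑ j, D.c j x * D.t j k := by
  simp [T, sum_apply]

theorem contDiffOn_fderiv_apply (j : J) (k : X) :
    ContDiffOn ℝ ∞ (fun y => fderiv ℝ (D.ζ j) y k) D.B :=
  ((D.smooth j).fderiv_of_isOpen D.isOpen (by simp)).clm_apply contDiffOn_const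

theorem Adm.dZ_mul {g : Λ × ℕ → X → ℂ} (hg : D.Adm g) (k : X) :
    D.Adm fun a y => D.dZ a.1 y k * g a y := by
  refine (Adm.sum Finset.univ fun j _ =>
    (hg.coef (Growth.coef j)).smul _ (contDiffOn_fderiv_apply j k)).congr fun a y _ => ?_
  rw [dZ_apply, Finset.sum_mul]
  exact Finset.sum_congr rfl fun j _ => by ring

theorem Adm.conjdZ_mul {g : Λ × ℕ → X → ℂ} (hg : D.Adm g) (k : X) :
    D.Adm fun a y => (starRingEnd ℂ) (D.dZ a.1 y k) * g a y := by
  refine (Adm.sum Finset.univ fun j _ => (hg.coef (Growth.coef j).conj).smul _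
    (contDiffOn_conj (contDiffOn_fderiv_apply j k))).congr fun a y _ => ?_
  rw [dZ_apply, map_sum, Finset.sum_mul]
  exact Finset.sum_congr rfl fun j _ => by rw [map_mul]; ring

theorem Adm.T_mul {g : Λ × ℕ → X → ℂ} (hg : D.Adm g) (k : X) :
    D.Adm fun a y => D.T a.1 k * g a y := by
  refine (Adm.sum Finset.univ fun j _ =>
    (hg.coef (Growth.coef j)).const_mul (D.t j k)).congr fun a y _ => ?_
  rw [T_apply, Finset.sum_mul]
  exact Finset.sum_congr rfl fun j _ => by ring

variable (D) in
theorem adm_zero : D.Adm fun a y => D.W a.1 * D.f 0 a y :=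
  (Adm.base 0 _ (Growth.const 1)).congr fun a y _ => by ring

variable (D) in
theorem adm_one : D.Adm fun a y => D.W a.1 * (((a.2 : ℂ) + 1) * D.f 1 a y) :=
  (Adm.base 1 _ Growth.nat).congr fun a y _ => by ring

theorem adm_term12 (k l : X) : D.Adm fun a y => D.term12 a y k l := by
  have h0 := D.adm_zero
  have h1 := D.adm_one.Z_mul
  refine ((((h1.dZ_mul k).conjdZ_mul l).sub ((h1.dZ_mul l).conjdZ_mul k)).const_mul (1 / 8)).add
    ((((h0.T_mul k).dZ_mul l).sub ((h0.T_mul l).dZ_mul k)).const_mul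
      (Complex.I / (8 * Real.pi ^ 2))) |>.congr fun a y _ => ?_
  rw [term12]
  ring

theorem adm_term3 (k l : X) : D.Adm fun a y => D.term3 a y k l := by
  have h0 := D.adm_zero
  have h1 := D.adm_one
  refine ((((h0.dZ_mul k).conjdZ_mul l).sub ((h0.dZ_mul l).conjdZ_mul k)).const_mul
    (Complex.I / (8 * Real.pi))).sub
    (((((h1.T_mul k).conjZ_mul.dZ_mul l).sub ((h1.T_mul k).Z_mul.conjdZ_mul l)).sub
      (((h1.T_mul l).conjZ_mul.dZ_mul k).sub ((h1.T_mul l).Z_mul.conjdZ_mul k))).const_mul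
      (1 / (16 * Real.pi))) |>.congr fun a y _ => ?_
  rw [term3]
  ring

theorem fderiv_Z_eq (x : Λ) {y : X} (hy : y ∈ D.B) : fderiv ℝ (D.Z x) y = D.dZ x y :=
  (D.hasFDerivAt_Z x hy).fderiv

theorem contDiffAt_Z (x : Λ) {y : X} (hy : y ∈ D.B) : ContDiffAt ℝ ∞ (D.Z x) y :=
  ContDiffAt.sum fun j _ => contDiffAt_const.mul ((D.smooth j).contDiffAt (D.isOpen.mem_nhds hy))

theorem hasFDerivAt_dZ_apply (x : Λ) {y : X} (hy : y ∈ D.B) (k : X) :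
    HasFDerivAt (fun y => D.dZ x y k) ((fderiv ℝ (fderiv ℝ (D.Z x)) y).flip k) y := by
  refine (hasFDerivAt_fderiv_apply (contDiffAt_Z x hy) k).congr_of_eventuallyEq ?_
  filter_upwards [D.isOpen.mem_nhds hy] with y' hy'
  rw [fderiv_Z_eq x hy']

theorem df_apply (ν : ℕ) (a : Λ × ℕ) (y m : X) : D.df ν a y m
    = Complex.I * ((a.2 : ℂ) + 1) * D.f ν a y * D.T a.1 m
      - (Real.pi : ℂ) ^ 2 * ((a.2 : ℂ) + 1) ^ 2 * D.f (ν + 1) a y *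
      ((starRingEnd ℂ) (D.Z a.1 y) * D.dZ a.1 y m
        + D.Z a.1 y * (starRingEnd ℂ) (D.dZ a.1 y m)) := by
  simp only [df, T, sub_apply, smul_apply, add_apply, smul_eq_mul,
    ContinuousLinearMap.comp_apply, ContinuousLinearEquiv.coe_coe, Complex.conjCLE_apply]

theorem f_recurrence {a : Λ × ℕ} (ha : D.W a.1 ≠ 0) {y : X} (hy : y ∈ D.B) :
    (Real.pi : ℂ) ^ 2 * ((a.2 : ℂ) + 1) ^ 2 * (D.Z a.1 y * (starRingEnd ℂ) (D.Z a.1 y))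
      * D.f 2 a y = D.f 0 a y + D.f 1 a y := by
  have hpos : 0 < Real.pi ^ 2 * ((a.2 : ℝ) + 1) ^ 2 * Complex.normSq (D.Z a.1 y) := by
    have := Complex.normSq_pos.2 (D.Z_ne_zero ha hy)
    positivity
  have := congrArg (fun t : ℝ => (t : ℂ)) (kappa_recurrence hpos)
  push_cast at this
  rw [Complex.mul_conj]
  simp only [f]
  linear_combination D.χ a.1 y ^ (a.2 + 1) * this

/-- Put `n = a.2 + 1` and `T = -i d log χ`. The `T` part of `df₁` contributes `(i n² / 8) f₁ Z T ∧
dZ ∧ dZ̄`, while its `f₂` part is proportional to `d|Z|²` and dies against `dZ ∧ dZ̄`. The `f₁` part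
of `df₀` in the second summand contributes the same three-form with opposite sign. -/
theorem isClosedAt_term12 (a : Λ × ℕ) {y : X} (hy : y ∈ D.B) :
    IsClosedAt (fun y k l => D.term12 a y k l) y := by
  by_cases ha : D.W a.1 = 0
  · exact (IsClosedAt.const (fun _ _ => 0) y).congr (by simp [term12, ha])
  have hf := fun ν => D.hasFDerivAt_f ν ha hy
  have hZ := D.hasFDerivAt_Z a.1 hy
  have hd := fun k => D.hasFDerivAt_dZ_apply a.1 hy k
  have hc := fun k => hasFDerivAt_conj (hd k)
  refine IsClosedAt.const_mul (.of_hasFDerivAt _ (fun k l =>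
    ((((hf 1).const_mul (1 / 8 * ((a.2 : ℂ) + 1))).mul hZ).mul
      (((hd k).mul (hc l)).sub ((hd l).mul (hc k)))).add
    (((hf 0).const_mul (Complex.I / (8 * Real.pi ^ 2))).mul
      (((hd l).const_mul (D.T a.1 k)).sub ((hd k).const_mul (D.T a.1 l)))))
    fun k₀ k₁ k₂ => ?_) _
  have hs := fderiv_fderiv_symm (contDiffAt_Z a.1 hy)
  simp only [sub_apply, add_apply, smul_apply, smul_eq_mul, Pi.sub_apply, Pi.mul_apply,
    ContinuousLinearMap.flip_apply,
    ContinuousLinearMap.comp_apply, ContinuousLinearEquiv.coe_coe, Complex.conjCLE_apply,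
    df_apply]
  rw [hs k₁ k₀, hs k₂ k₀, hs k₂ k₁]
  have hpi : (Real.pi : ℂ) ≠ 0 := by exact_mod_cast Real.pi_ne_zero
  field_simp
  ring

/-- All contributions are multiples of `T ∧ dZ ∧ dZ̄`: the first summand gives `-n f₀ / (8π)` and
the second gives `n (π² n² |Z|² f₂ - f₁) / (8π)`, with `n = a.2 + 1`. They cancel by the Bessel
recurrence. -/
theorem isClosedAt_term3 (a : Λ × ℕ) {y : X} (hy : y ∈ D.B) :
    IsClosedAt (fun y k l => D.term3 a y k l) y := by
  by_cases ha : D.W a.1 = 0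
  · exact (IsClosedAt.const (fun _ _ => 0) y).congr (by simp [term3, ha])
  have hf := fun ν => D.hasFDerivAt_f ν ha hy
  have hZ := D.hasFDerivAt_Z a.1 hy
  have hZc := hasFDerivAt_conj hZ
  have hd := fun k => D.hasFDerivAt_dZ_apply a.1 hy k
  have hc := fun k => hasFDerivAt_conj (hd k)
  refine IsClosedAt.const_mul (.of_hasFDerivAt _ (fun k l =>
    (((hf 0).const_mul (Complex.I / (8 * Real.pi))).mul
      (((hd k).mul (hc l)).sub ((hd l).mul (hc k)))).sub
    (((hf 1).const_mul (1 / (16 * Real.pi) * ((a.2 : ℂ) + 1))).mul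
      ((((hZc.mul (hd l)).sub (hZ.mul (hc l))).const_mul (D.T a.1 k)).sub
        (((hZc.mul (hd k)).sub (hZ.mul (hc k))).const_mul (D.T a.1 l)))))
    fun k₀ k₁ k₂ => ?_) _
  have hs := fderiv_fderiv_symm (contDiffAt_Z a.1 hy)
  have hrec := f_recurrence ha hy
  simp only [sub_apply, add_apply, smul_apply, smul_eq_mul, Pi.sub_apply, Pi.mul_apply,
    ContinuousLinearMap.flip_apply,
    ContinuousLinearMap.comp_apply, ContinuousLinearEquiv.coe_coe, Complex.conjCLE_apply,
    df_apply]
  rw [hs k₁ k₀, hs k₂ k₀, hs k₂ k₁]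
  have hpi : (Real.pi : ℂ) ≠ 0 := by exact_mod_cast Real.pi_ne_zero
  generalize (starRingEnd ℂ) (D.dZ a.1 y k₀) = b₀
  generalize (starRingEnd ℂ) (D.dZ a.1 y k₁) = b₁
  generalize (starRingEnd ℂ) (D.dZ a.1 y k₂) = b₂
  generalize D.dZ a.1 y k₀ = a₀
  generalize D.dZ a.1 y k₁ = a₁
  generalize D.dZ a.1 y k₂ = a₂
  generalize D.T a.1 k₀ = t₀
  generalize D.T a.1 k₁ = t₁
  generalize D.T a.1 k₂ = t₂
  generalize (starRingEnd ℂ) (D.Z a.1 y) = zc at *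
  have e2 : D.f (1 + 1) a y = D.f 2 a y := rfl
  rw [e2]
  linear_combination (((a.2 : ℂ) + 1) / (8 * Real.pi) * (t₀ * (a₁ * b₂ - a₂ * b₁)
    - t₁ * (a₀ * b₂ - a₂ * b₀) + t₂ * (a₀ * b₁ - a₁ * b₀))) * (hrec + D.f 0 a y * Complex.I_sq)

theorem Adm.tsum_prod {g : Λ × ℕ → X → ℂ} (hg : D.Adm g) {y : X} (hy : y ∈ D.B) :
    Summable (fun x => ∑' n, g (x, n) y) ∧ ∑' x, ∑' n, g (x, n) y = ∑' a, g a y :=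
  ⟨(hg.summable hy).prod, ((hg.summable hy).tsum_prod).symm⟩

theorem isClosedAt_tsum [FiniteDimensional ℝ X] {g : Λ × ℕ → X → X → X → ℂ}
    (hg : ∀ k l, D.Adm fun a y => g a y k l) {y : X} (hy : y ∈ D.B)
    (hc : ∀ a, IsClosedAt (g a) y) : IsClosedAt (fun y k l => ∑' a, g a y k l) y := by
  refine ⟨fun k l => ((hg k l).hasFDerivAt_tsum hy).2.differentiableAt, fun k₀ k₁ k₂ => ?_⟩
  have hs : ∀ k l m, Summable fun a => fderiv ℝ (fun y => g a y k l) y m := fun k l m =>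
    (ContinuousLinearMap.apply ℝ ℂ m).summable ((hg k l).hasFDerivAt_tsum hy).1
  rw [(hg _ _).fderiv_tsum hy, (hg _ _).fderiv_tsum hy, (hg _ _).fderiv_tsum hy,
    ← (hs _ _ _).tsum_sub (hs _ _ _), ← ((hs _ _ _).sub (hs _ _ _)).tsum_add (hs _ _ _)]
  simp only [(hc _).2, tsum_zero]

end SeriesData

/-! ### Local series data with constant indices. -/

section LocalData

variable {E : Type*} [NormedAddCommGroup E] [NormedSpace ℂ E]
  {M : Type u} [TopologicalSpace M] [ChartedSpace E M]
  {r : ℕ} {Γf : Type v} [AddCommGroup Γf] {L : ChargeLattice.{u, v, w} M r Γf}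

/-- All adapted frames agree on flavor charges, so being a flavor charge does not depend on the
frame. -/
theorem frame_symm_eq_flavor {p p' q : M} {x : Model r Γf}
    (h : ((L.frame p' q).symm (L.frame p q x)).1 = 0)
    (h' : ((L.frame p' q).symm (L.frame p q x)).2.1 = 0) : x.1 = 0 ∧ x.2.1 = 0 := by
  set x' := (L.frame p' q).symm (L.frame p q x) with hx'
  have h1 : L.frame p' q x' = L.frame p q x := by rw [hx', AddEquiv.apply_symm_apply]
  have h2 : x' = (0, 0, x'.2.2) := Prod.ext h (Prod.ext h' rfl)
  rw [h2, (L.adapted p' q).flavor, ← (L.adapted p q).flavor] at h1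
  rw [← (L.frame p q).injective h1]
  exact ⟨rfl, rfl⟩

variable [Module.Free ℤ Γf] [Module.Finite ℤ Γf]

theorem IsBPSVariation.eventually_eq_of_mem_dom {Z : CentralCharge E L} {Ω : ∀ p, L.fib p → ℤ}
    (h : IsBPSVariation Z Ω) (hloc : IsMutuallyLocal L Ω) {p q : M} (hq : q ∈ L.dom p)
    {x : Model r Γf} (hx : x.1 ≠ 0 ∨ x.2.1 ≠ 0) :
    ∀ᶠ q' in 𝓝 q, Ω q' (L.frame p q' x) = Ω q (L.frame p q x) := by
  have hx' : ((L.frame q q).symm (L.frame p q x)).1 ≠ 0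
      ∨ ((L.frame q q).symm (L.frame p q x)).2.1 ≠ 0 := by
    by_contra! hc
    obtain ⟨h1, h2⟩ := frame_symm_eq_flavor hc.1 hc.2
    simp [h1, h2] at hx
  filter_upwards [h.eventually_eq hloc q hx', eventually_frame_eq p q hq] with q' h1 h2
  rw [AddEquiv.apply_symm_apply] at h1
  rw [h2 x, ← h1]
  rfl

/-- The data `D` describe the instanton series near a point of the chart `p`. -/
structure IsLocalData (Z : CentralCharge E L) (Ω : ∀ p, L.fib p → ℤ) (θf : Γf →+ Real.Angle)
    (p : M) (D : SeriesData (Coord E r) (Model r Γf) (Fin r ⊕ Fin r ⊕ Unit)) : Prop where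
  sub : D.B ⊆ paramDomain E L p
  W_eq : ∀ y ∈ D.B, ∀ x, (x.1 ≠ 0 ∨ x.2.1 ≠ 0) →
    D.W x = (Ω ((chartAt E p).symm y.1) (L.frame p _ x) : ℂ)
  W_flavor : ∀ x, x.1 = 0 → x.2.1 = 0 → D.W x = 0
  Z_eq : ∀ y ∈ D.B, ∀ x, D.Z x y = Zc Z p x y.1
  T_eq : ∀ x k, D.T x k
    = ((∑ i, ((x.1 i : ℝ) * k.2.1 i + (x.2.1 i : ℝ) * k.2.2 i) : ℝ) : ℂ)
  χ_eq : ∀ x y, D.χ x y = ((theta (param L θf p y) (L.frame p _ x)).toCircle : ℂ)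
  growth : ∀ φ : Model r Γf →+ ℂ, ∃ C : ℝ, ∀ x, ‖φ x‖ ≤ C * D.s x

/-- The coordinates of a charge: the coefficients of `γ̃_i` and `γ^i`, and the central charge of
the flavor part. -/
def coefHom (Z : CentralCharge E L) (p : M) : Fin r ⊕ Fin r ⊕ Unit → Model r Γf →+ ℂ
  | .inl i => AddMonoidHom.mk' (fun x => (x.1 i : ℂ)) fun x x' => by simp
  | .inr (.inl i) => AddMonoidHom.mk' (fun x => (x.2.1 i : ℂ)) fun x x' => by simp
  | .inr (.inr _) => AddMonoidHom.mk' (fun x => Zflavor Z p x.2.2) fun x x' => by simp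

/-- The functions `Z_{γ̃_i}`, `Z_{γ^i}` and `1`. -/
def zetaFun (Z : CentralCharge E L) (p : M) : Fin r ⊕ Fin r ⊕ Unit → Coord E r → ℂ
  | .inl i => fun y => Zc Z p (Pi.single i 1, 0, 0) y.1
  | .inr (.inl i) => fun y => Zc Z p (0, Pi.single i 1, 0) y.1
  | .inr (.inr _) => fun _ => 1

variable (E r) in
/-- The forms `dθ_{γ̃_i}`, `dθ_{γ^i}` and `0`. -/
def thetaForm : Fin r ⊕ Fin r ⊕ Unit → Coord E r →L[ℝ] ℂ
  | .inl i => Complex.ofRealCLM.comp ((ContinuousLinearMap.proj i).comp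
      ((ContinuousLinearMap.fst ℝ _ _).comp (ContinuousLinearMap.snd ℝ E _)))
  | .inr (.inl i) => Complex.ofRealCLM.comp ((ContinuousLinearMap.proj i).comp
      ((ContinuousLinearMap.snd ℝ _ _).comp (ContinuousLinearMap.snd ℝ E _)))
  | .inr (.inr _) => 0

theorem sum_coefHom_zetaFun (Z : CentralCharge E L) (p : M) (x : Model r Γf) (y : Coord E r) :
    ∑ j, coefHom Z p j x * zetaFun Z p j y = Zc Z p x y.1 := by
  rw [Fintype.sum_sum_type, Fintype.sum_sum_type, Zc, hom_frame_eq (L.frame p _) (Z.val _) x,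
    val_flavor]
  simp [coefHom, zetaFun, Zc, add_assoc]

theorem sum_coefHom_thetaForm (Z : CentralCharge E L) (p : M) (x : Model r Γf) (k : Coord E r) :
    ∑ j, coefHom Z p j x * thetaForm E r j k
      = ((∑ i, ((x.1 i : ℝ) * k.2.1 i + (x.2.1 i : ℝ) * k.2.2 i) : ℝ) : ℂ) := by
  rw [Fintype.sum_sum_type, Fintype.sum_sum_type]
  simp [coefHom, thetaForm, Finset.sum_add_distrib]

variable [IsManifold 𝓘(ℂ, E) ω M]

theorem contDiffAt_Zc_fst (Z : CentralCharge E L) {p : M} {y : Coord E r}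
    (hy : y ∈ paramDomain E L p) (x : Model r Γf) :
    ContDiffAt ℝ ∞ (fun y : Coord E r => Zc Z p x y.1) y := by
  have h := ((contDiffAt_Zc Z p x hy.1 hy.2).restrict_scalars ℝ).of_le (m := ∞) le_top
  exact h.comp y contDiffAt_fst

theorem exists_localData {Z : CentralCharge E L} {Ω : ∀ p, L.fib p → ℤ}
    (hHK : IsHKVariation Z Ω) (hloc : IsMutuallyLocal L Ω) (θf : Γf →+ Real.Angle) {p : M}
    {y₀ : Coord E r} (hy₀ : y₀ ∈ paramDomain E L p) :
    ∃ D : SeriesData (Coord E r) (Model r Γf) (Fin r ⊕ Fin r ⊕ Unit),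
      y₀ ∈ D.B ∧ IsLocalData Z Ω θf p D := by
  classical
  set q₀ := (chartAt E p).symm y₀.1 with hq₀
  let T : Model r Γf ≃+ Model r Γf := (L.frame p q₀).trans (L.frame q₀ q₀).symm
  obtain ⟨C, hC, hsup⟩ := hHK.support q₀
  have hT : ∀ᶠ q in 𝓝 q₀, ∀ x, (L.frame q₀ q).symm (L.frame p q x) = T x :=
    L.locallyConstant p q₀ q₀ hy₀.2 (L.mem_dom q₀)
  obtain ⟨ε, hε, hB⟩ := Metric.eventually_nhds_iff_ball.1
    (((eventually_param hy₀ hsup).and (eventually_param hy₀ hT)).and (mem_nhds_paramDomain hy₀))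
  -- The neighbourhood on which an index is constant depends on the charge and could shrink along
  -- the infinitely many charges. On a connected ball, however, each locally constant index is
  -- constant, which gives one neighbourhood for all charges.
  have hconst : ∀ x : Model r Γf, (x.1 ≠ 0 ∨ x.2.1 ≠ 0) → ∀ y ∈ Metric.ball y₀ ε,
      Ω ((chartAt E p).symm y.1) (L.frame p _ x) = Ω q₀ (L.frame p q₀ x) := by
    intro x hx y hy
    refine (convex_ball y₀ ε).isPreconnected.constant
      (f := fun y : Coord E r => Ω ((chartAt E p).symm y.1) (L.frame p _ x)) (fun y hy => ?_) hy
      (Metric.mem_ball_self hε)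
    have hyp := (hB y hy).2
    refine ContinuousAt.continuousWithinAt (Tendsto.congr' ?_ tendsto_const_nhds)
    filter_upwards [eventually_param hyp (hHK.eventually_eq_of_mem_dom hloc hyp.2 hx)] with y' h
    exact h.symm
  have hWne : ∀ x : Model r Γf, (if x.1 ≠ 0 ∨ x.2.1 ≠ 0 then (Ω q₀ (L.frame p q₀ x) : ℂ) else 0) ≠ 0 →
      (x.1 ≠ 0 ∨ x.2.1 ≠ 0) ∧ Ω q₀ (L.frame p q₀ x) ≠ 0 := by
    intro x hx
    split_ifs at hx with h
    · exact ⟨h, by exact_mod_cast hx⟩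
    · exact absurd rfl hx
  let D : SeriesData (Coord E r) (Model r Γf) (Fin r ⊕ Fin r ⊕ Unit) :=
    { B := Metric.ball y₀ ε
      isOpen := Metric.isOpen_ball
      -- Indices of flavor charges are discarded: nothing makes them constant, and they do not enter
      -- the forms.
      W := fun x => if x.1 ≠ 0 ∨ x.2.1 ≠ 0 then (Ω q₀ (L.frame p q₀ x) : ℂ) else 0
      -- The support property at `q₀` is expressed in the preferred frame at `q₀`, so the size is
      -- measured after the change of frame `T`.
      s := fun x => modelNorm (T x)
      c := fun j x => coefHom Z p j x
      ζ := zetaFun Z p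
      t := thetaForm E r
      χ := fun x y => Complex.exp (((∑ i, ((x.1 i : ℝ) * y.2.1 i + (x.2.1 i : ℝ) * y.2.2 i) : ℝ) : ℂ)
        * Complex.I) * ((θf x.2.2).toCircle : ℂ)
      smooth := by
        intro j y hy
        have hyp := (hB y hy).2
        refine ContDiffAt.contDiffWithinAt ?_
        match j with
        | .inl i => exact contDiffAt_Zc_fst Z hyp _
        | .inr (.inl i) => exact contDiffAt_Zc_fst Z hyp _
        | .inr (.inr _) => exact contDiffAt_const
      summable := by
        intro R hR
        obtain ⟨C', hC', hb⟩ := exists_bound_modelNorm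
          (Γf := Γf) ((Z.val q₀).comp (L.frame q₀ q₀).toAddMonoidHom)
        -- Since `|Z| ≤ C' s`, decay in `|Z|` at the rate `R / (C' + 1)` dominates decay in `s` at
        -- the rate `R`. The summand `1` avoids a division by zero.
        obtain ⟨c, hc, hcs⟩ := hHK.strongConvergence (R / (C' + 1)) (by positivity) q₀
        refine Summable.of_nonneg_of_le (fun x => by positivity) (fun x => ?_)
          (T.toEquiv.summable_iff.2 hc)
        refine le_trans ?_ (hcs.self_of_nhds (T x))
        have hTx : L.frame q₀ q₀ (T x) = L.frame p q₀ x := by simp [T]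
        rw [hTx]
        have h1 : ‖Z.val q₀ (L.frame p q₀ x)‖ ≤ C' * modelNorm (T x) := by
          have := hb (T x)
          simpa [hTx] using this
        have h2 := modelNorm_nonneg (T x)
        refine mul_le_mul ?_ (Real.exp_le_exp.2 ?_) (Real.exp_pos _).le (abs_nonneg _)
        · split_ifs
          · rw [Complex.norm_intCast]
          · simp
        · have h3 : ‖Z.val q₀ (L.frame p q₀ x)‖ ≤ (C' + 1) * modelNorm (T x) := by linarith
          have h4 : R / (C' + 1) * ‖Z.val q₀ (L.frame p q₀ x)‖ ≤ R * modelNorm (T x) := by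
            rw [div_mul_eq_mul_div, div_le_iff₀ (by positivity)]
            nlinarith
          linarith
      one_le := by
        intro x hx
        refine one_le_modelNorm fun h => ?_
        have h1 : x = 0 := (map_eq_zero_iff T T.injective).1 h
        have := (hWne x hx).1
        simp [h1] at this
      lower := by
        refine ⟨C, hC, fun x hx y hy => ?_⟩
        obtain ⟨h1, h2⟩ := hWne x hx
        have h3 := (hB y hy).1.1 (L.frame p _ x) (by rw [hconst x h1 y hy]; exact h2)
        rw [(hB y hy).1.2 x] at h3
        rw [sum_coefHom_zetaFun]
        exact h3.le
      upper := by
        choose K hK hb using fun j => exists_bound_modelNorm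
          ((coefHom Z p j).comp T.symm.toAddMonoidHom)
        refine ⟨∑ j, K j, fun j x _ => ?_⟩
        have h1 := hb j (T x)
        simp only [AddMonoidHom.comp_apply, AddEquiv.coe_toAddMonoidHom,
          AddEquiv.symm_apply_apply] at h1
        refine h1.trans ?_
        have := modelNorm_nonneg (T x)
        gcongr
        exact Finset.single_le_sum (fun j _ => hK j) (Finset.mem_univ j)
      norm_χ := by
        intro x y _
        rw [norm_mul, Complex.norm_exp_ofReal_mul_I, Circle.norm_coe, mul_one]
      deriv_χ := by
        intro x y _
        have h1 : HasFDerivAt (fun y : Coord E r =>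
            ((∑ i, ((x.1 i : ℝ) * y.2.1 i + (x.2.1 i : ℝ) * y.2.2 i) : ℝ) : ℂ))
            (∑ j, coefHom Z p j x • thetaForm E r j) y := by
          have := (∑ j, coefHom Z p j x • thetaForm E r j).hasFDerivAt (x := y)
          refine this.congr_of_eventuallyEq (Eventually.of_forall fun y' => ?_)
          have h2 := (sum_coefHom_thetaForm Z p x y').symm
          simpa only [sum_apply, smul_apply, smul_eq_mul] using h2
        refine ((h1.mul_const Complex.I).cexp.mul_const _).congr_fderiv ?_
        refine ContinuousLinearMap.ext fun k => ?_
        simp only [smul_apply, sum_apply, smul_eq_mul, Finset.mul_sum]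
        refine Finset.sum_congr rfl fun j _ => ?_
        ring }
  refine ⟨D, Metric.mem_ball_self hε, ⟨fun y hy => (hB y hy).2, fun y hy x hx => ?_,
    fun x h1 h2 => ?_, fun y _ x => sum_coefHom_zetaFun Z p x y, fun x k => ?_, fun x y => ?_,
    fun φ => ?_⟩⟩
  · rw [hconst x hx y hy]
    exact if_pos hx
  · exact if_neg (by simp [h1, h2])
  · rw [SeriesData.T_apply]
    exact sum_coefHom_thetaForm Z p x k
  · rw [theta_param, Real.Angle.toCircle_add, Real.Angle.toCircle_coe, Circle.coe_mul,
      Circle.coe_exp]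
  · obtain ⟨K, hK, hb⟩ := exists_bound_modelNorm (φ.comp T.symm.toAddMonoidHom)
    refine ⟨K, fun x => ?_⟩
    simpa using hb (T x)

namespace IsLocalData

variable {Z : CentralCharge E L} {Ω : ∀ p, L.fib p → ℤ} {θf : Γf →+ Real.Angle} {p : M}
  {D : SeriesData (Coord E r) (Model r Γf) (Fin r ⊕ Fin r ⊕ Unit)}

theorem dZ_eq (h : IsLocalData Z Ω θf p D) {y : Coord E r} (hy : y ∈ D.B) (x : Model r Γf)
    (k : Coord E r) : D.dZ x y k = fderiv ℂ (Zc Z p x) y.1 k.1 := by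
  have hyp := h.sub hy
  have h1 := (contDiffAt_Zc Z p x hyp.1 hyp.2).differentiableAt (by simp)
  have h2 : HasFDerivAt (fun y : Coord E r => Zc Z p x y.1)
      (((fderiv ℂ (Zc Z p x) y.1).restrictScalars ℝ).comp (ContinuousLinearMap.fst ℝ E _)) y :=
    (h1.hasFDerivAt.restrictScalars ℝ).comp y hasFDerivAt_fst
  have h3 : D.Z x =ᶠ[𝓝 y] fun y : Coord E r => Zc Z p x y.1 := by
    filter_upwards [D.isOpen.mem_nhds hy] with y' hy'
    exact h.Z_eq y' hy' x
  rw [← D.fderiv_Z_eq x hy, h3.fderiv_eq, h2.fderiv]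
  rfl

theorem dZp_eq (h : IsLocalData Z Ω θf p D) {y : Coord E r} (hy : y ∈ D.B) (x : Model r Γf)
    (k : Coord E r) :
    dZp Z (param L θf p y) (dParam L θf p y k) (L.frame p _ x) = D.dZ x y k := by
  rw [dZp_dParam Z (h.sub hy), h.dZ_eq hy]

theorem dTheta_eq (h : IsLocalData Z Ω θf p D) (y : Coord E r) (x : Model r Γf)
    (k : Coord E r) :
    dTheta (param L θf p y) (dParam L θf p y k) (L.frame p _ x) = D.T x k := by
  rw [dTheta_dParam, h.T_eq]

end IsLocalData

end LocalData

/-! ### The instanton series at a point -/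

section Pointwise

variable {E : Type*} [NormedAddCommGroup E] [NormedSpace ℂ E]
  {M : Type u} [TopologicalSpace M] [ChartedSpace E M]
  {r : ℕ} {Γf : Type v} [AddCommGroup Γf] {L : ChargeLattice.{u, v, w} M r Γf}
  {θf : Γf →+ Real.Angle}

/-- The term `n^ν e^{i n θ_γ} κ_ν(π² n² |Z_γ|²)`, with `n = k + 1`. -/
def besselTerm (Z : CentralCharge E L) (ν : ℕ) (x : TorusBundle L θf) (γ : L.fib x.1) (k : ℕ) : ℂ :=
  ((k : ℂ) + 1) ^ ν * (((theta x γ).toCircle : ℂ) ^ (k + 1)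
    * (kappa ν (Real.pi ^ 2 * ((k : ℝ) + 1) ^ 2 * Complex.normSq (Z.val x.1 γ)) : ℂ))

/-- The sum of the `besselTerm`s. -/
def besselSum (Z : CentralCharge E L) (ν : ℕ) (x : TorusBundle L θf) (γ : L.fib x.1) : ℂ :=
  ∑' k, besselTerm Z ν x γ k

theorem summable_besselTerm (Z : CentralCharge E L) (ν : ℕ) {x : TorusBundle L θf}
    {γ : L.fib x.1} (hZ : Z.val x.1 γ ≠ 0) : Summable (besselTerm Z ν x γ) := by
  have hpos : 0 < ‖Z.val x.1 γ‖ := norm_pos_iff.2 hZ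
  have hpi := Real.pi_pos
  obtain ⟨C, hC, hk⟩ := kappa_le (w₀ := (Real.pi * ‖Z.val x.1 γ‖) ^ 2) (by positivity) ν
  have h1 := ((summable_nat_add_iff 1).2 (Real.summable_pow_mul_exp_neg_nat_mul ν
    (r := Real.pi * ‖Z.val x.1 γ‖) (by positivity))).mul_left C
  refine Summable.of_norm_bounded h1 fun n => ?_
  have hn : (0 : ℝ) ≤ n := n.cast_nonneg
  have hw : Real.pi ^ 2 * ((n : ℝ) + 1) ^ 2 * Complex.normSq (Z.val x.1 γ)
      = (Real.pi * ((n : ℝ) + 1) * ‖Z.val x.1 γ‖) ^ 2 := by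
    rw [Complex.normSq_eq_norm_sq]; ring
  have h3 : (Real.pi * ‖Z.val x.1 γ‖) ^ 2 ≤ (Real.pi * ((n : ℝ) + 1) * ‖Z.val x.1 γ‖) ^ 2 := by
    gcongr
    nlinarith
  have h4 : ‖(n : ℂ) + 1‖ = (n : ℝ) + 1 := by
    rw [← Nat.cast_succ, Complex.norm_natCast]; simp
  rw [besselTerm, norm_mul, norm_mul, norm_pow, norm_pow, Circle.norm_coe, one_pow, one_mul,
    Complex.norm_real, Real.norm_of_nonneg (kappa_nonneg _ _), hw, h4]
  have h5 := hk _ h3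
  rw [Real.sqrt_sq (by positivity)] at h5
  calc ((n : ℝ) + 1) ^ ν * kappa ν ((Real.pi * ((n : ℝ) + 1) * ‖Z.val x.1 γ‖) ^ 2)
      ≤ ((n : ℝ) + 1) ^ ν * (C * Real.exp (-(Real.pi * ((n : ℝ) + 1) * ‖Z.val x.1 γ‖))) := by
        gcongr
    _ = C * (((n + 1 : ℕ) : ℝ) ^ ν * Real.exp (-(Real.pi * ‖Z.val x.1 γ‖) * ((n + 1 : ℕ) : ℝ))) := by
        push_cast
        ring_nf

theorem coe_toCircle_nsmul (t : Real.Angle) (n : ℕ) :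
    ((n • t).toCircle : ℂ) = (t.toCircle : ℂ) ^ n := by
  induction n with
  | zero => simp
  | succ n ih => rw [succ_nsmul, Real.Angle.toCircle_add, Circle.coe_mul, ih, pow_succ]

theorem VTerm_eq (Z : CentralCharge E L) {x : TorusBundle L θf}
    {γ : L.fib x.1} (hZ : Z.val x.1 γ ≠ 0) (k : ℕ) :
    VTerm Z x γ k = 1 / 2 * besselTerm Z 0 x γ k := by
  have hpos : 0 < ‖Z.val x.1 γ‖ := norm_pos_iff.2 hZ
  have hpi := Real.pi_pos
  rw [VTerm, besselTerm, coe_toCircle_nsmul, besselK_zero_eq (by positivity),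
    Complex.normSq_eq_norm_sq]
  rw [show (2 * Real.pi * ((k : ℝ) + 1) * ‖Z.val x.1 γ‖) ^ 2 / 4
    = Real.pi ^ 2 * ((k : ℝ) + 1) ^ 2 * ‖Z.val x.1 γ‖ ^ 2 by ring]
  push_cast
  ring

theorem ATerm_eq (Z : CentralCharge E L) {x : TorusBundle L θf}
    {γ : L.fib x.1} (hZ : Z.val x.1 γ ≠ 0) (k : ℕ) :
    ATerm Z x γ k = Real.pi / 2 * (Z.val x.1 γ * (starRingEnd ℂ) (Z.val x.1 γ))
      * besselTerm Z 1 x γ k := by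
  have hpos : 0 < ‖Z.val x.1 γ‖ := norm_pos_iff.2 hZ
  have hpi := Real.pi_pos
  rw [ATerm, besselTerm, coe_toCircle_nsmul, besselK_one_eq (by positivity), Complex.mul_conj,
    Complex.normSq_eq_norm_sq]
  rw [show (2 * Real.pi * ((k : ℝ) + 1) * ‖Z.val x.1 γ‖) ^ 2 / 4
    = Real.pi ^ 2 * ((k : ℝ) + 1) ^ 2 * ‖Z.val x.1 γ‖ ^ 2 by ring]
  push_cast
  ring

theorem summable_VTerm (Z : CentralCharge E L) {x : TorusBundle L θf}
    {γ : L.fib x.1} (hZ : Z.val x.1 γ ≠ 0) : Summable (VTerm Z x γ) := by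
  rw [funext (VTerm_eq Z hZ)]
  exact (summable_besselTerm Z 0 hZ).mul_left _

theorem summable_ATerm (Z : CentralCharge E L) {x : TorusBundle L θf}
    {γ : L.fib x.1} (hZ : Z.val x.1 γ ≠ 0) : Summable (ATerm Z x γ) := by
  rw [funext (ATerm_eq Z hZ)]
  exact (summable_besselTerm Z 1 hZ).mul_left _

theorem Vinst_eq (Z : CentralCharge E L) {x : TorusBundle L θf}
    {γ : L.fib x.1} (hZ : Z.val x.1 γ ≠ 0) :
    Vinst Z x γ = 1 / (4 * Real.pi) * besselSum Z 0 x γ := by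
  rw [Vinst, funext (VTerm_eq Z hZ), tsum_mul_left, besselSum]
  ring

/-- The factor `K₁(2πn|Z|) = (π n |Z| / 2) κ₁` supplies a second `|Z|`, so that `|Z|² (dZ / Z - dZ̄
/ Z̄) = Z̄ dZ - Z dZ̄` and no denominators remain. The constant is `-(1 / 4π) (π / 2)`. -/
theorem Ainst_eq (Z : CentralCharge E L) {x : TorusBundle L θf}
    {γ : L.fib x.1} (hZ : Z.val x.1 γ ≠ 0) (ξ : Tan E x) :
    Ainst Z x γ ξ = -(1 / 8) * besselSum Z 1 x γ *
      ((starRingEnd ℂ) (Z.val x.1 γ) * dZp Z x ξ γ - Z.val x.1 γ * dZbarp Z x ξ γ) := by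
  have hZ' : (starRingEnd ℂ) (Z.val x.1 γ) ≠ 0 := by simpa using hZ
  have hpi : (Real.pi : ℂ) ≠ 0 := by exact_mod_cast Real.pi_ne_zero
  rw [Ainst, funext (ATerm_eq Z hZ), tsum_mul_left, besselSum]
  field_simp
  ring

theorem dZp_flavor (Z : CentralCharge E L) (x : TorusBundle L θf) (ξ : Tan E x) (f : Γf) :
    dZp Z x ξ (L.flavor x.1 f) = 0 := by
  rw [dZp, dZform, dZ_flavor]
  rfl

theorem dTheta_flavor (x : TorusBundle L θf) (ξ : Tan E x) (f : Γf) :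
    dTheta x ξ (L.flavor x.1 f) = 0 := by
  rw [dTheta, ξ.2.2]
  simp

theorem dZbarp_eq (Z : CentralCharge E L) (x : TorusBundle L θf) (ξ : Tan E x) (γ : L.fib x.1) :
    dZbarp Z x ξ γ = (starRingEnd ℂ) (dZp Z x ξ γ) := rfl

variable [Module.Free ℤ Γf] [Module.Finite ℤ Γf] {Z : CentralCharge E L}
  {Ω : ∀ p, L.fib p → ℤ}

theorem omega12Term_eq (hΩ : IsBPSVariation Z Ω) (x : TorusBundle L θf) (ξ η : Tan E x)
    (γ : L.fib x.1) :
    omega12Term Z Ω x ξ η γ = (Ω x.1 γ : ℂ) * (1 / 8 * besselSum Z 1 x γ * Z.val x.1 γ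
        * (dZp Z x ξ γ * (starRingEnd ℂ) (dZp Z x η γ)
          - dZp Z x η γ * (starRingEnd ℂ) (dZp Z x ξ γ))
      + Complex.I / (8 * Real.pi ^ 2) * besselSum Z 0 x γ
        * (dTheta x ξ γ * dZp Z x η γ - dTheta x η γ * dZp Z x ξ γ)) := by
  by_cases h0 : Ω x.1 γ = 0
  · simp [omega12Term, h0]
  have hZ := hΩ.ne_zero h0
  have hpi : (Real.pi : ℂ) ≠ 0 := by exact_mod_cast Real.pi_ne_zero
  simp only [omega12Term, wedge, Ainst_eq Z hZ, Vinst_eq Z hZ, dZbarp_eq]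
  field_simp
  ring

theorem omega3Term_eq (hΩ : IsBPSVariation Z Ω) (x : TorusBundle L θf) (ξ η : Tan E x)
    (γ : L.fib x.1) :
    omega3Term Z Ω x ξ η γ = (Ω x.1 γ : ℂ) * (Complex.I / (8 * Real.pi) * besselSum Z 0 x γ
        * (dZp Z x ξ γ * (starRingEnd ℂ) (dZp Z x η γ)
          - dZp Z x η γ * (starRingEnd ℂ) (dZp Z x ξ γ))
      - 1 / (16 * Real.pi) * besselSum Z 1 x γ
        * (dTheta x ξ γ * ((starRingEnd ℂ) (Z.val x.1 γ) * dZp Z x η γ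
            - Z.val x.1 γ * (starRingEnd ℂ) (dZp Z x η γ))
          - dTheta x η γ * ((starRingEnd ℂ) (Z.val x.1 γ) * dZp Z x ξ γ
            - Z.val x.1 γ * (starRingEnd ℂ) (dZp Z x ξ γ)))) := by
  by_cases h0 : Ω x.1 γ = 0
  · simp [omega3Term, h0]
  have hZ := hΩ.ne_zero h0
  have hpi : (Real.pi : ℂ) ≠ 0 := by exact_mod_cast Real.pi_ne_zero
  simp only [omega3Term, wedge, Ainst_eq Z hZ, Vinst_eq Z hZ, dZbarp_eq]
  field_simp
  ring

theorem tensorTTerm_eq (hΩ : IsBPSVariation Z Ω) (x : TorusBundle L θf) (ξ η : Tan E x)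
    (γ : L.fib x.1) :
    tensorTTerm Z Ω x ξ η γ = (Ω x.1 γ : ℂ) * (1 / (8 * Real.pi) * besselSum Z 0 x γ
        * (dZp Z x ξ γ * (starRingEnd ℂ) (dZp Z x η γ)
          + dZp Z x η γ * (starRingEnd ℂ) (dZp Z x ξ γ))) := by
  by_cases h0 : Ω x.1 γ = 0
  · simp [tensorTTerm, h0]
  have hZ := hΩ.ne_zero h0
  have hpi : (Real.pi : ℂ) ≠ 0 := by exact_mod_cast Real.pi_ne_zero
  have h1 := Complex.add_conj (dZp Z x ξ γ * dZbarp Z x η γ)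
  simp only [dZbarp_eq, map_mul, Complex.conj_conj] at h1
  rw [tensorTTerm, Vinst_eq Z hZ]
  simp only [dZbarp_eq]
  push_cast at h1
  field_simp
  linear_combination (-4 * besselSum Z 0 x γ) * h1

theorem NinstTerm_eq (hΩ : IsBPSVariation Z Ω) (e : ∀ q : M, Model r Γf ≃+ L.fib q)
    (x : TorusBundle L θf) (i j : Fin r) (γ : L.fib x.1) :
    NinstTerm Z Ω e x i j γ = (Ω x.1 γ : ℂ) * (1 / (4 * Real.pi) * besselSum Z 0 x γ
        * ((nCoeff e x.1 γ i : ℂ) * (nCoeff e x.1 γ j : ℂ))) := by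
  by_cases h0 : Ω x.1 γ = 0
  · simp [NinstTerm, h0]
  rw [NinstTerm, Vinst_eq Z (hΩ.ne_zero h0)]
  ring

theorem WinstTerm_eq (hΩ : IsBPSVariation Z Ω) (e : ∀ q : M, Model r Γf ≃+ L.fib q)
    (x : TorusBundle L θf) (i : Fin r) (ξ : Tan E x) (γ : L.fib x.1) :
    WinstTerm Z Ω e x i ξ γ = (Ω x.1 γ : ℂ) * (-(Real.pi / 4) * besselSum Z 1 x γ
        * ((nCoeff e x.1 γ i : ℂ) * ((starRingEnd ℂ) (Z.val x.1 γ) * dZp Z x ξ γ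
          - Z.val x.1 γ * (starRingEnd ℂ) (dZp Z x ξ γ)))
      - Complex.I / (4 * Real.pi) * besselSum Z 0 x γ
        * ((nCoeff e x.1 γ i : ℂ) * dTheta x ξ γ)) := by
  by_cases h0 : Ω x.1 γ = 0
  · simp [WinstTerm, h0]
  have hZ := hΩ.ne_zero h0
  rw [WinstTerm, Vinst_eq Z hZ, Ainst_eq Z hZ]
  simp only [dZbarp_eq]
  ring

theorem IsLocalData.besselTerm_eq [IsManifold 𝓘(ℂ, E) ω M] {p : M}
    {D : SeriesData (Coord E r) (Model r Γf) (Fin r ⊕ Fin r ⊕ Unit)}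
    (hD : IsLocalData Z Ω θf p D) {y : Coord E r} (hy : y ∈ D.B) (ν : ℕ) (z : Model r Γf)
    (k : ℕ) : ((k : ℂ) + 1) ^ ν * D.f ν (z, k) y
      = besselTerm Z ν (param L θf p y) (L.frame p _ z) k := by
  rw [SeriesData.f, hD.χ_eq, hD.Z_eq y hy]
  rfl

/-- One factor that vanishes on flavor charges removes those charges, for which the local data carry
no weight. The other additive factors only contribute polynomial growth. -/
theorem summable_besselSum [FiniteDimensional ℂ E] [IsManifold 𝓘(ℂ, E) ω M]
    (hHK : IsHKVariation Z Ω) (hloc : IsMutuallyLocal L Ω)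
    (x : TorusBundle L θf) {ν : ℕ} (hν : ν ≤ 1) {n : ℕ} (φ : Fin (n + 1) → L.fib x.1 →+ ℂ)
    (hφ : ∀ f, φ 0 (L.flavor x.1 f) = 0) :
    Summable fun γ => (Ω x.1 γ : ℂ) * (besselSum Z ν x γ * ∏ i, φ i γ) := by
  obtain ⟨p, y, hy, rfl⟩ := exists_param_eq (E := E) x
  obtain ⟨D, hyD, hD⟩ := exists_localData hHK hloc θf hy
  set e := L.frame p ((chartAt E p).symm y.1) with he
  have hg : D.Growth fun a => ∏ i, φ i (e a.1) := by
    have : ∀ S : Finset (Fin (n + 1)), D.Growth fun a => ∏ i ∈ S, φ i (e a.1) := by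
      intro S
      induction S using Finset.induction_on with
      | empty => exact SeriesData.Growth.const 1
      | insert i S hi ih =>
        obtain ⟨C, hC⟩ := hD.growth ((φ i).comp e.toAddMonoidHom)
        have h1 : D.Growth fun a => φ i (e a.1) :=
          SeriesData.Growth.of_norm_le (u := fun z => φ i (e z)) fun z _ => hC z
        simpa only [Finset.prod_insert hi] using h1.mul ih
    exact this _
  have hA : D.Adm fun a y => D.W a.1 * (((a.2 : ℂ) + 1) ^ ν * D.f ν a y) := by
    interval_cases ν
    · simpa using D.adm_zero
    · simpa using D.adm_one
  have hs := ((hA.coef hg).tsum_prod hyD).1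
  dsimp only at hs
  refine (e.toEquiv.summable_iff).1 (hs.congr fun z => ?_)
  change _ = (Ω ((chartAt E p).symm y.1) (e z) : ℂ)
    * (besselSum Z ν (param L θf p y) (e z) * ∏ i, φ i (e z))
  by_cases hz : z.1 = 0 ∧ z.2.1 = 0
  · rw [hD.W_flavor z hz.1 hz.2]
    have h0 : φ 0 (e z) = 0 := by
      have : z = (0, 0, z.2.2) := Prod.ext hz.1 (Prod.ext hz.2 rfl)
      rw [this, (L.adapted p _).flavor]
      exact hφ _
    simp [Fin.prod_univ_succ, h0]
  · have hW := hD.W_eq y hyD z (by tauto)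
    have hb : besselSum Z ν (param L θf p y) (e z)
        = ∑' k, besselTerm Z ν (param L θf p y) (e z) k := rfl
    rw [hW, tsum_mul_left, tsum_mul_left, hb]
    rw [tsum_congr fun k => hD.besselTerm_eq hyD ν z k]
    exact (mul_left_comm _ _ _).trans (congrArg _ (mul_comm _ _))

end Pointwise

section Pointwise

variable {E : Type*} [NormedAddCommGroup E] [NormedSpace ℂ E]
  {M : Type u} [TopologicalSpace M] [ChartedSpace E M]
  {r : ℕ} {Γf : Type v} [AddCommGroup Γf] {L : ChargeLattice.{u, v, w} M r Γf}
  {θf : Γf →+ Real.Angle}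

/-! #### Reality -/

/-- The phase `e^{iθ}` is conjugated under `γ ↦ -γ`, while `|Z_γ|` is unchanged. -/
theorem besselSum_neg (Z : CentralCharge E L) (ν : ℕ) (x : TorusBundle L θf) (γ : L.fib x.1) :
    besselSum Z ν x (-γ) = (starRingEnd ℂ) (besselSum Z ν x γ) := by
  have h : theta x (-γ) = -theta x γ := map_neg x.2.1 γ
  rw [besselSum, besselSum, Complex.conj_tsum]
  refine tsum_congr fun k => ?_
  simp only [besselTerm, h, Real.Angle.toCircle_neg, map_neg, Complex.normSq_neg, map_mul,
    map_pow, Complex.conj_ofReal, map_add, map_natCast, map_one, Circle.coe_inv_eq_conj]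

/-- The series equals its own conjugate after reindexing by `γ ↦ -γ`. No convergence is needed. -/
theorem tsum_im_eq_zero {Γ : Type*} [AddCommGroup Γ] {t : Γ → ℂ}
    (h : ∀ γ, t (-γ) = (starRingEnd ℂ) (t γ)) : (∑' γ, t γ).im = 0 := by
  rw [← Complex.conj_eq_iff_im, Complex.conj_tsum, ← (Equiv.neg Γ).tsum_eq t]
  exact tsum_congr fun γ => (h γ).symm

theorem dZp_neg (Z : CentralCharge E L) (x : TorusBundle L θf) (ξ : Tan E x) (γ : L.fib x.1) :
    dZp Z x ξ (-γ) = -dZp Z x ξ γ := map_neg (dZhom Z x.1 ξ.1) γ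

theorem dTheta_neg (x : TorusBundle L θf) (ξ : Tan E x) (γ : L.fib x.1) :
    dTheta x ξ (-γ) = -dTheta x ξ γ := by
  rw [dTheta, dTheta, map_neg]
  simp

theorem conj_dTheta (x : TorusBundle L θf) (ξ : Tan E x) (γ : L.fib x.1) :
    (starRingEnd ℂ) (dTheta x ξ γ) = dTheta x ξ γ := Complex.conj_ofReal _

theorem nCoeff_neg
    (e : ∀ q : M, Model r Γf ≃+ L.fib q) (p : M) (γ : L.fib p) (i : Fin r) :
    nCoeff e p (-γ) i = -nCoeff e p γ i := by
  simp [nCoeff]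

variable [Module.Free ℤ Γf] [Module.Finite ℤ Γf] {Z : CentralCharge E L}
  {Ω : ∀ p, L.fib p → ℤ}

theorem omega3Term_neg (hΩ : IsBPSVariation Z Ω) (x : TorusBundle L θf) (ξ η : Tan E x)
    (γ : L.fib x.1) :
    omega3Term Z Ω x ξ η (-γ) = (starRingEnd ℂ) (omega3Term Z Ω x ξ η γ) := by
  simp only [omega3Term_eq hΩ, besselSum_neg, hΩ.symm, dZp_neg, dTheta_neg, map_neg, map_mul,
    map_sub, map_div₀, conj_dTheta, Complex.conj_conj, Complex.conj_ofReal, Complex.conj_I,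
    map_one, map_intCast, map_ofNat]
  ring

theorem NinstTerm_neg (hΩ : IsBPSVariation Z Ω) (e : ∀ q : M, Model r Γf ≃+ L.fib q)
    (x : TorusBundle L θf) (i j : Fin r) (γ : L.fib x.1) :
    NinstTerm Z Ω e x i j (-γ) = (starRingEnd ℂ) (NinstTerm Z Ω e x i j γ) := by
  simp only [NinstTerm_eq hΩ, besselSum_neg, hΩ.symm, nCoeff_neg, map_neg, map_mul,
    map_sub, map_div₀, Complex.conj_ofReal, map_one, map_intCast, map_ofNat, Int.cast_neg]
  ring

/-- The part of `W_i^inst` that comes from the forms `A_γ^inst`. -/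
def AinstTerm (Z : CentralCharge E L) (Ω : ∀ p, L.fib p → ℤ)
    (e : ∀ q : M, Model r Γf ≃+ L.fib q) (x : TorusBundle L θf) (i : Fin r) (ξ : Tan E x)
    (γ : L.fib x.1) : ℂ :=
  (Ω x.1 γ : ℂ) * (nCoeff e x.1 γ i : ℂ) * (2 * Real.pi * Ainst Z x γ ξ)

theorem AinstTerm_eq (hΩ : IsBPSVariation Z Ω) (e : ∀ q : M, Model r Γf ≃+ L.fib q)
    (x : TorusBundle L θf) (i : Fin r) (ξ : Tan E x) (γ : L.fib x.1) :
    AinstTerm Z Ω e x i ξ γ = (Ω x.1 γ : ℂ) * (-(Real.pi / 4) * besselSum Z 1 x γ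
        * ((nCoeff e x.1 γ i : ℂ) * ((starRingEnd ℂ) (Z.val x.1 γ) * dZp Z x ξ γ
          - Z.val x.1 γ * (starRingEnd ℂ) (dZp Z x ξ γ)))) := by
  by_cases h0 : Ω x.1 γ = 0
  · simp [AinstTerm, h0]
  rw [AinstTerm, Ainst_eq Z (hΩ.ne_zero h0)]
  simp only [dZbarp_eq]
  ring

theorem AinstTerm_neg (hΩ : IsBPSVariation Z Ω) (e : ∀ q : M, Model r Γf ≃+ L.fib q)
    (x : TorusBundle L θf) (i : Fin r) (ξ : Tan E x) (γ : L.fib x.1) :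
    AinstTerm Z Ω e x i ξ (-γ) = (starRingEnd ℂ) (AinstTerm Z Ω e x i ξ γ) := by
  simp only [AinstTerm_eq hΩ, besselSum_neg, hΩ.symm, nCoeff_neg, dZp_neg, map_neg, map_mul,
    map_sub, map_div₀, Complex.conj_conj, Complex.conj_ofReal, map_one, map_intCast, map_ofNat,
    Int.cast_neg]
  ring

/-! #### Convergence -/

variable [FiniteDimensional ℂ E] [IsManifold 𝓘(ℂ, E) ω M]

theorem summable_besselSum_two (hHK : IsHKVariation Z Ω) (hloc : IsMutuallyLocal L Ω)
    (x : TorusBundle L θf) {ν : ℕ} (hν : ν ≤ 1) (φ ψ : L.fib x.1 →+ ℂ)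
    (hφ : ∀ f, φ (L.flavor x.1 f) = 0) :
    Summable fun γ => (Ω x.1 γ : ℂ) * (besselSum Z ν x γ * (φ γ * ψ γ)) := by
  simpa [Fin.prod_univ_two] using summable_besselSum hHK hloc x hν ![φ, ψ] hφ

theorem summable_besselSum_three (hHK : IsHKVariation Z Ω) (hloc : IsMutuallyLocal L Ω)
    (x : TorusBundle L θf) {ν : ℕ} (hν : ν ≤ 1) (φ ψ χ : L.fib x.1 →+ ℂ)
    (hφ : ∀ f, φ (L.flavor x.1 f) = 0) :
    Summable fun γ => (Ω x.1 γ : ℂ) * (besselSum Z ν x γ * (φ γ * ψ γ * χ γ)) := by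
  simpa [Fin.prod_univ_three] using summable_besselSum hHK hloc x hν ![φ, ψ, χ] hφ

/-- The conjugate of an additive function. -/
def conjHom {Γ : Type*} [AddCommGroup Γ] (φ : Γ →+ ℂ) : Γ →+ ℂ :=
  (starRingEnd ℂ).toAddMonoidHom.comp φ

/-- `dθ` evaluated on a tangent vector. -/
def dThetaHom (x : TorusBundle L θf) (ξ : Tan E x) : L.fib x.1 →+ ℂ :=
  Complex.ofRealHom.toAddMonoidHom.comp ξ.2.1

/-- The coefficient of `γ^i` as an additive function. -/
def nHom {Γ : Type*} [AddCommGroup Γ] (e : Model r Γf ≃+ Γ) (i : Fin r) : Γ →+ ℂ :=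
  AddMonoidHom.mk' (fun γ => ((e.symm γ).2.1 i : ℂ)) fun γ γ' => by simp

theorem summable_omega12Term (hHK : IsHKVariation Z Ω) (hloc : IsMutuallyLocal L Ω)
    (x : TorusBundle L θf) (ξ η : Tan E x) : Summable (omega12Term Z Ω x ξ η) := by
  have h1 := fun ξ η : Tan E x => summable_besselSum_three hHK hloc x le_rfl
    (dZhom Z x.1 ξ.1) (conjHom (dZhom Z x.1 η.1)) (Z.val x.1) (dZp_flavor Z x ξ)
  have h0 := fun ξ η : Tan E x => summable_besselSum_two hHK hloc x zero_le_one
    (dZhom Z x.1 η.1) (dThetaHom x ξ) (dZp_flavor Z x η)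
  refine ((((h1 ξ η).sub (h1 η ξ)).mul_left (1 / 8)).add
    (((h0 ξ η).sub (h0 η ξ)).mul_left (Complex.I / (8 * Real.pi ^ 2)))).congr fun γ => ?_
  rw [omega12Term_eq hHK.toIsBPSVariation]
  simp only [dZp, dZform, dTheta, dZhom_apply, conjHom, dThetaHom, AddMonoidHom.comp_apply,
    RingHom.toAddMonoidHom_eq_coe, AddMonoidHom.coe_coe, Complex.ofRealHom_eq_coe]
  ring

theorem summable_omega3Term (hHK : IsHKVariation Z Ω) (hloc : IsMutuallyLocal L Ω)
    (x : TorusBundle L θf) (ξ η : Tan E x) : Summable (omega3Term Z Ω x ξ η) := by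
  have h0 := fun ξ η : Tan E x => summable_besselSum_two hHK hloc x zero_le_one
    (dZhom Z x.1 ξ.1) (conjHom (dZhom Z x.1 η.1)) (dZp_flavor Z x ξ)
  have h1 := fun ξ η : Tan E x => summable_besselSum_three hHK hloc x le_rfl
    (dZhom Z x.1 η.1) (dThetaHom x ξ) (conjHom (Z.val x.1)) (dZp_flavor Z x η)
  have h2 := fun ξ η : Tan E x => summable_besselSum_three hHK hloc x le_rfl
    (dThetaHom x ξ) (conjHom (dZhom Z x.1 η.1)) (Z.val x.1) (dTheta_flavor x ξ)
  refine ((((h0 ξ η).sub (h0 η ξ)).mul_left (Complex.I / (8 * Real.pi))).sub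
    ((((h1 ξ η).sub (h2 ξ η)).sub ((h1 η ξ).sub (h2 η ξ))).mul_left
      (1 / (16 * Real.pi) : ℂ))).congr fun γ => ?_
  rw [omega3Term_eq hHK.toIsBPSVariation]
  simp only [dZp, dZform, dTheta, dZhom_apply, conjHom, dThetaHom, AddMonoidHom.comp_apply,
    RingHom.toAddMonoidHom_eq_coe, AddMonoidHom.coe_coe, Complex.ofRealHom_eq_coe]
  ring

theorem summable_tensorTTerm (hHK : IsHKVariation Z Ω) (hloc : IsMutuallyLocal L Ω)
    (x : TorusBundle L θf) (ξ η : Tan E x) : Summable (tensorTTerm Z Ω x ξ η) := by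
  have h0 := fun ξ η : Tan E x => summable_besselSum_two hHK hloc x zero_le_one
    (dZhom Z x.1 ξ.1) (conjHom (dZhom Z x.1 η.1)) (dZp_flavor Z x ξ)
  refine (((h0 ξ η).add (h0 η ξ)).mul_left (1 / (8 * Real.pi) : ℂ)).congr fun γ => ?_
  rw [tensorTTerm_eq hHK.toIsBPSVariation]
  simp only [dZp, dZform, dZhom_apply, conjHom, AddMonoidHom.comp_apply,
    RingHom.toAddMonoidHom_eq_coe, AddMonoidHom.coe_coe]
  ring

theorem nHom_flavor {U : Set M} {e : ∀ q : M, Model r Γf ≃+ L.fib q} (he : L.IsFlatFrame U e)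
    {p : M} (hp : p ∈ U) (i : Fin r) (f : Γf) : nHom (e p) i (L.flavor p f) = 0 := by
  rw [← (he.adapted p hp).flavor]
  simp [nHom]

theorem summable_NinstTerm (hHK : IsHKVariation Z Ω) (hloc : IsMutuallyLocal L Ω)
    {U : Set M} {e : ∀ q : M, Model r Γf ≃+ L.fib q} (he : L.IsFlatFrame U e)
    {x : TorusBundle L θf} (hx : x.1 ∈ U) (i j : Fin r) : Summable (NinstTerm Z Ω e x i j) := by
  refine ((summable_besselSum_two hHK hloc x zero_le_one (nHom (e x.1) i) (nHom (e x.1) j)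
    (nHom_flavor he hx i)).mul_left (1 / (4 * Real.pi) : ℂ)).congr fun γ => ?_
  rw [NinstTerm_eq hHK.toIsBPSVariation]
  simp only [nHom, nCoeff, AddMonoidHom.mk'_apply]
  ring

theorem summable_AinstTerm (hHK : IsHKVariation Z Ω) (hloc : IsMutuallyLocal L Ω)
    {U : Set M} {e : ∀ q : M, Model r Γf ≃+ L.fib q} (he : L.IsFlatFrame U e)
    {x : TorusBundle L θf} (hx : x.1 ∈ U) (i : Fin r) (ξ : Tan E x) :
    Summable (AinstTerm Z Ω e x i ξ) := by
  have h1 := summable_besselSum_three hHK hloc x le_rfl (nHom (e x.1) i) (dZhom Z x.1 ξ.1)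
    (conjHom (Z.val x.1)) (nHom_flavor he hx i)
  have h2 := summable_besselSum_three hHK hloc x le_rfl (nHom (e x.1) i)
    (conjHom (dZhom Z x.1 ξ.1)) (Z.val x.1) (nHom_flavor he hx i)
  refine ((h1.sub h2).mul_left (-(Real.pi / 4) : ℂ)).congr fun γ => ?_
  rw [AinstTerm_eq hHK.toIsBPSVariation]
  simp only [dZp, dZform, dZhom_apply, conjHom, AddMonoidHom.comp_apply, nHom, nCoeff,
    RingHom.toAddMonoidHom_eq_coe, AddMonoidHom.coe_coe, AddMonoidHom.mk'_apply]
  ring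

theorem summable_WinstTerm (hHK : IsHKVariation Z Ω) (hloc : IsMutuallyLocal L Ω)
    {U : Set M} {e : ∀ q : M, Model r Γf ≃+ L.fib q} (he : L.IsFlatFrame U e)
    {x : TorusBundle L θf} (hx : x.1 ∈ U) (i : Fin r) (ξ : Tan E x) :
    Summable (WinstTerm Z Ω e x i ξ) := by
  have h0 := summable_besselSum_two hHK hloc x zero_le_one (nHom (e x.1) i) (dThetaHom x ξ)
    (nHom_flavor he hx i)
  refine ((summable_AinstTerm hHK hloc he hx i ξ).sub
    (h0.mul_left (Complex.I / (4 * Real.pi)))).congr fun γ => ?_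
  rw [AinstTerm_eq hHK.toIsBPSVariation, WinstTerm_eq hHK.toIsBPSVariation]
  simp only [dTheta, dThetaHom, AddMonoidHom.comp_apply, nHom, nCoeff,
    RingHom.toAddMonoidHom_eq_coe, AddMonoidHom.coe_coe, AddMonoidHom.mk'_apply,
    Complex.ofRealHom_eq_coe]
  ring

end Pointwise

/-! ### Independence of the dual pairing from the Darboux frame. -/

section DualPairing

variable {r : ℕ} {Γf : Type v} [AddCommGroup Γf] {Γ : Type w} [AddCommGroup Γ]
  {pairing : Γ →+ Γ →+ ℤ} {flavor : Γf →+ Γ} {e : Model r Γf ≃+ Γ}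

/-- The coefficients of `γ` in a Darboux frame are its pairings with the frame. -/
theorem IsAdapted.hom_eq (he : IsAdapted pairing flavor e) {φ : Γ →+ ℂ}
    (hφ : ∀ f, φ (flavor f) = 0) (γ : Γ) :
    φ γ = ∑ i, ((pairing γ (e (0, Pi.single i 1, 0)) : ℂ) * φ (e (Pi.single i 1, 0, 0))
      - (pairing γ (e (Pi.single i 1, 0, 0)) : ℂ) * φ (e (0, Pi.single i 1, 0))) := by
  obtain ⟨x, rfl⟩ := e.surjective γ
  rw [hom_frame_eq e φ x, he.flavor, hφ, add_zero, ← Finset.sum_add_distrib]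
  refine Finset.sum_congr rfl fun i _ => ?_
  simp [he.darboux, Pi.single_apply]

theorem IsAdapted.skew (he : IsAdapted pairing flavor e) (γ γ' : Γ) :
    pairing γ γ' = -pairing γ' γ := by
  obtain ⟨x, rfl⟩ := e.surjective γ
  obtain ⟨x', rfl⟩ := e.surjective γ'
  rw [he.darboux, he.darboux, ← Finset.sum_neg_distrib]
  exact Finset.sum_congr rfl fun i _ => by ring

/-- Expanding `φ` on the first frame by the second, and `ψ` on the second by the first, gives the
same double sum on both sides up to skewness of the pairing. -/
theorem IsAdapted.sum_eq {e' : Model r Γf ≃+ Γ} (he : IsAdapted pairing flavor e)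
    (he' : IsAdapted pairing flavor e') {φ ψ : Γ →+ ℂ}
    (hφ : ∀ f, φ (flavor f) = 0) (hψ : ∀ f, ψ (flavor f) = 0) :
    ∑ i, (φ (e (Pi.single i 1, 0, 0)) * ψ (e (0, Pi.single i 1, 0))
      - φ (e (0, Pi.single i 1, 0)) * ψ (e (Pi.single i 1, 0, 0)))
    = ∑ i, (φ (e' (Pi.single i 1, 0, 0)) * ψ (e' (0, Pi.single i 1, 0))
      - φ (e' (0, Pi.single i 1, 0)) * ψ (e' (Pi.single i 1, 0, 0))) := by
  have h1 := he'.hom_eq hφ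
  have h2 := he.hom_eq hψ
  have hs := fun γ γ' => congrArg (fun n : ℤ => (n : ℂ)) (he.skew γ γ')
  push_cast at hs
  simp only [h1 (e _), h2 (e' _), Finset.sum_mul, Finset.mul_sum, ← Finset.sum_sub_distrib]
  rw [Finset.sum_comm]
  refine Finset.sum_congr rfl fun i _ => Finset.sum_congr rfl fun j _ => ?_
  rw [hs (e' (Pi.single i 1, 0, 0)) (e (Pi.single j 1, 0, 0)),
    hs (e' (Pi.single i 1, 0, 0)) (e (0, Pi.single j 1, 0)),
    hs (e' (0, Pi.single i 1, 0)) (e (Pi.single j 1, 0, 0)),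
    hs (e' (0, Pi.single i 1, 0)) (e (0, Pi.single j 1, 0))]
  ring

end DualPairing

/-! ### The two-forms `⟨- ∧ -⟩` in an arbitrary Darboux frame. -/

section Smooth

variable {E : Type*} [NormedAddCommGroup E] [NormedSpace ℂ E]
  {M : Type u} [TopologicalSpace M] [ChartedSpace E M]
  {r : ℕ} {Γf : Type v} [AddCommGroup Γf] {L : ChargeLattice.{u, v, w} M r Γf}
  {θf : Γf →+ Real.Angle}

theorem dualPairing_eq {p : M} {e : Model r Γf ≃+ L.fib p}
    (he : IsAdapted (L.pairing p) (L.flavor p) e) {φ ψ : L.fib p →+ ℂ}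
    (hφ : ∀ f, φ (L.flavor p f) = 0) (hψ : ∀ f, ψ (L.flavor p f) = 0) :
    L.dualPairing p φ ψ
      = ∑ i, (φ (e (Pi.single i 1, 0, 0)) * ψ (e (0, Pi.single i 1, 0))
        - φ (e (0, Pi.single i 1, 0)) * ψ (e (Pi.single i 1, 0, 0))) :=
  (L.adapted p p).sum_eq he hφ hψ

variable (Z : CentralCharge E L)

theorem conj_dZhom_flavor (p : M) (a : E) (f : Γf) :
    conjHom (dZhom Z p a) (L.flavor p f) = 0 := by
  change (starRingEnd ℂ) (dZ Z p (L.flavor p f) a) = 0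
  rw [dZ_flavor]
  simp

variable {x : TorusBundle L θf} {e : Model r Γf ≃+ L.fib x.1}
  (ξ η : Tan E x)

theorem pairWedge_dZp_dTheta (he : IsAdapted (L.pairing x.1) (L.flavor x.1) e) :
    L.pairWedge x.1 (dZp Z x) (dTheta x) ξ η
    = ∑ i, (wedge (fun ζ => dZp Z x ζ (e (Pi.single i 1, 0, 0)))
        (fun ζ => dTheta x ζ (e (0, Pi.single i 1, 0))) ξ η
      - wedge (fun ζ => dZp Z x ζ (e (0, Pi.single i 1, 0)))
        (fun ζ => dTheta x ζ (e (Pi.single i 1, 0, 0))) ξ η) := by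
  have h := fun ξ η : Tan E x => dualPairing_eq he (φ := dZhom Z x.1 ξ.1) (ψ := dThetaHom x η)
    (dZp_flavor Z x ξ) (dTheta_flavor x η)
  refine (congrArg₂ (· - ·) (h ξ η) (h η ξ)).trans ?_
  rw [← Finset.sum_sub_distrib]
  refine Finset.sum_congr rfl fun i _ => ?_
  change dZp Z x ξ _ * dTheta x η _ - dZp Z x ξ _ * dTheta x η _
    - (dZp Z x η _ * dTheta x ξ _ - dZp Z x η _ * dTheta x ξ _) = _
  simp only [wedge]
  ring

theorem pairWedge_dTheta_dTheta (he : IsAdapted (L.pairing x.1) (L.flavor x.1) e) :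
    L.pairWedge x.1 (dTheta x) (dTheta x) ξ η
    = ∑ i, 2 * wedge (fun ζ => dTheta x ζ (e (Pi.single i 1, 0, 0)))
        (fun ζ => dTheta x ζ (e (0, Pi.single i 1, 0))) ξ η := by
  have h := fun ξ η : Tan E x => dualPairing_eq he (φ := dThetaHom x ξ) (ψ := dThetaHom x η)
    (dTheta_flavor x ξ) (dTheta_flavor x η)
  refine (congrArg₂ (· - ·) (h ξ η) (h η ξ)).trans ?_
  rw [← Finset.sum_sub_distrib]
  refine Finset.sum_congr rfl fun i _ => ?_
  change dTheta x ξ _ * dTheta x η _ - dTheta x ξ _ * dTheta x η _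
    - (dTheta x η _ * dTheta x ξ _ - dTheta x η _ * dTheta x ξ _) = _
  simp only [wedge]
  ring

theorem pairWedge_dZp_dZbarp (he : IsAdapted (L.pairing x.1) (L.flavor x.1) e) :
    L.pairWedge x.1 (dZp Z x) (dZbarp Z x) ξ η
    = ∑ i, (wedgeBar (fun ζ => dZp Z x ζ (e (Pi.single i 1, 0, 0)))
        (fun ζ => dZp Z x ζ (e (0, Pi.single i 1, 0))) ξ η
      - wedgeBar (fun ζ => dZp Z x ζ (e (0, Pi.single i 1, 0)))
        (fun ζ => dZp Z x ζ (e (Pi.single i 1, 0, 0))) ξ η) := by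
  have h := fun ξ η : Tan E x => dualPairing_eq he (φ := dZhom Z x.1 ξ.1)
    (ψ := conjHom (dZhom Z x.1 η.1)) (dZp_flavor Z x ξ) (conj_dZhom_flavor Z x.1 η.1)
  refine (congrArg₂ (· - ·) (h ξ η) (h η ξ)).trans ?_
  rw [← Finset.sum_sub_distrib]
  refine Finset.sum_congr rfl fun i _ => ?_
  change dZp Z x ξ _ * (starRingEnd ℂ) (dZp Z x η _) - dZp Z x ξ _ * (starRingEnd ℂ) (dZp Z x η _)
    - (dZp Z x η _ * (starRingEnd ℂ) (dZp Z x ξ _) - dZp Z x η _ * (starRingEnd ℂ) (dZp Z x ξ _)) = _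
  simp only [wedge, wedgeBar]
  ring

end Smooth

/-! #### The forms in local coordinates -/

namespace SeriesData

variable {X : Type*} [NormedAddCommGroup X] [NormedSpace ℝ X] {r : ℕ} {Γf : Type v}
  [AddCommGroup Γf] {J : Type*} [Fintype J] (D : SeriesData X (Model r Γf) J)

/-- The form `ω₁ + i ω₂` in local coordinates. -/
def form12 (y k l : X) : ℂ :=
  -(1 / (2 * Real.pi)) * ∑ i,
    ((D.dZ (Pi.single i 1, 0, 0) y k * D.T (0, Pi.single i 1, 0) l
        - D.dZ (Pi.single i 1, 0, 0) y l * D.T (0, Pi.single i 1, 0) k)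
      + (-1) * (D.dZ (0, Pi.single i 1, 0) y k * D.T (Pi.single i 1, 0, 0) l
        - D.dZ (0, Pi.single i 1, 0) y l * D.T (Pi.single i 1, 0, 0) k))
  + ∑' a, D.term12 a y k l

/-- The form `ω₃` in local coordinates. -/
def form3 (y k l : X) : ℂ :=
  (1 / 4) * ∑ i,
    ((D.dZ (Pi.single i 1, 0, 0) y k * (starRingEnd ℂ) (D.dZ (0, Pi.single i 1, 0) y l)
        - D.dZ (Pi.single i 1, 0, 0) y l * (starRingEnd ℂ) (D.dZ (0, Pi.single i 1, 0) y k))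
      + (-1) * (D.dZ (0, Pi.single i 1, 0) y k * (starRingEnd ℂ) (D.dZ (Pi.single i 1, 0, 0) y l)
        - D.dZ (0, Pi.single i 1, 0) y l * (starRingEnd ℂ) (D.dZ (Pi.single i 1, 0, 0) y k)))
  + -(1 / (8 * Real.pi ^ 2)) * (∑ i, 2 * (D.T (Pi.single i 1, 0, 0) k * D.T (0, Pi.single i 1, 0) l
      - D.T (Pi.single i 1, 0, 0) l * D.T (0, Pi.single i 1, 0) k))
  + ∑' a, D.term3 a y k l

variable {D}

theorem contDiffOn_dZ_apply (x : Model r Γf) (k : X) :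
    ContDiffOn ℝ ∞ (fun y => D.dZ x y k) D.B := by
  simp only [dZ_apply]
  exact ContDiffOn.sum fun j _ => contDiffOn_const.mul (contDiffOn_fderiv_apply j k)

variable [FiniteDimensional ℝ X]

theorem contDiffOn_form12 (k l : X) : ContDiffOn ℝ ∞ (fun y => D.form12 y k l) D.B := by
  have h := fun x k => contDiffOn_dZ_apply (D := D) x k
  refine (contDiffOn_const.mul (ContDiffOn.sum fun i _ => ?_)).add (adm_term12 k l).contDiffOn
  exact (((h _ k).mul contDiffOn_const).sub ((h _ l).mul contDiffOn_const)).add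
    (contDiffOn_const.mul (((h _ k).mul contDiffOn_const).sub ((h _ l).mul contDiffOn_const)))

theorem contDiffOn_form3 (k l : X) : ContDiffOn ℝ ∞ (fun y => D.form3 y k l) D.B := by
  have h := fun x k => contDiffOn_dZ_apply (D := D) x k
  have h' := fun x k => contDiffOn_conj (h x k)
  refine ((contDiffOn_const.mul (ContDiffOn.sum fun i _ => ?_)).add contDiffOn_const).add
    (adm_term3 k l).contDiffOn
  exact (((h _ k).mul (h' _ l)).sub ((h _ l).mul (h' _ k))).add
    (contDiffOn_const.mul (((h _ k).mul (h' _ l)).sub ((h _ l).mul (h' _ k))))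

theorem isClosedAt_form12 {y : X} (hy : y ∈ D.B) : IsClosedAt (fun y k l => D.form12 y k l) y := by
  refine (IsClosedAt.const_mul (IsClosedAt.sum fun i => ?_) _).add
    (isClosedAt_tsum adm_term12 hy fun a => isClosedAt_term12 a hy)
  have h := fun x (T : X → ℂ) => (isClosedAt_fderiv_wedge_const (contDiffAt_Z x hy) T).congr
    (c' := fun y k l => D.dZ x y k * T l - D.dZ x y l * T k)
    (by filter_upwards [D.isOpen.mem_nhds hy] with y' hy' k l; rw [fderiv_Z_eq x hy'])
  exact (h _ _).add ((h _ _).const_mul _)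

theorem isClosedAt_form3 {y : X} (hy : y ∈ D.B) : IsClosedAt (fun y k l => D.form3 y k l) y := by
  refine ((IsClosedAt.const_mul (IsClosedAt.sum fun i => ?_) _).add
    (IsClosedAt.const _ y)).add (isClosedAt_tsum adm_term3 hy fun a => isClosedAt_term3 a hy)
  have h := fun x x' => (isClosedAt_fderiv_wedge_conj (contDiffAt_Z x hy)
    (contDiffAt_Z x' hy)).congr
    (c' := fun y k l => D.dZ x y k * (starRingEnd ℂ) (D.dZ x' y l)
      - D.dZ x y l * (starRingEnd ℂ) (D.dZ x' y k))
    (by filter_upwards [D.isOpen.mem_nhds hy] with y' hy' k l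
        rw [fderiv_Z_eq x hy', fderiv_Z_eq x' hy'])
  exact (h _ _).add ((h _ _).const_mul _)

end SeriesData

section Smooth

variable {E : Type*} [NormedAddCommGroup E] [NormedSpace ℂ E]
  {M : Type u} [TopologicalSpace M] [ChartedSpace E M]
  {r : ℕ} {Γf : Type v} [AddCommGroup Γf] {L : ChargeLattice.{u, v, w} M r Γf}
  {θf : Γf →+ Real.Angle} {Z : CentralCharge E L} {Ω : ∀ p, L.fib p → ℤ}

/-! #### Bilinearity -/

/-- Real bilinearity and antisymmetry of a complex valued form. -/
structure IsAltForm {V : Type*} [AddCommGroup V] [Module ℝ V] (B : V → V → ℂ) : Prop where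
  add : ∀ ξ ξ' η, B (ξ + ξ') η = B ξ η + B ξ' η
  smul : ∀ (c : ℝ) ξ η, B (c • ξ) η = c * B ξ η
  neg : ∀ ξ η, B ξ η = -B η ξ

theorem IsAltForm.sum_add {V ι : Type*} [AddCommGroup V] [Module ℝ V] {B : ι → V → V → ℂ}
    (h : ∀ i, IsAltForm (B i)) (hs : ∀ ξ η, Summable fun i => B i ξ η) :
    IsAltForm fun ξ η => ∑' i, B i ξ η where
  add ξ ξ' η := by
    rw [← (hs ξ η).tsum_add (hs ξ' η)]
    exact tsum_congr fun i => (h i).add ξ ξ' η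
  smul c ξ η := by
    rw [← tsum_mul_left]
    exact tsum_congr fun i => (h i).smul c ξ η
  neg ξ η := by
    rw [← tsum_neg]
    exact tsum_congr fun i => (h i).neg ξ η

theorem IsAltForm.add_form {V : Type*} [AddCommGroup V] [Module ℝ V] {B B' : V → V → ℂ}
    (h : IsAltForm B) (h' : IsAltForm B') : IsAltForm fun ξ η => B ξ η + B' ξ η where
  add ξ ξ' η := by rw [h.add, h'.add]; ring
  smul c ξ η := by rw [h.smul, h'.smul]; ring
  neg ξ η := by rw [h.neg, h'.neg]; ring

theorem IsAltForm.const_mul {V : Type*} [AddCommGroup V] [Module ℝ V] {B : V → V → ℂ}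
    (h : IsAltForm B) (z : ℂ) : IsAltForm fun ξ η => z * B ξ η where
  add ξ ξ' η := by rw [h.add]; ring
  smul c ξ η := by rw [h.smul]; ring
  neg ξ η := by rw [h.neg]; ring

theorem IsAltForm.congr {V : Type*} [AddCommGroup V] [Module ℝ V] {B B' : V → V → ℂ}
    (h : IsAltForm B) (h' : ∀ ξ η, B' ξ η = B ξ η) : IsAltForm B' := by
  rw [show B' = B from funext fun ξ => funext (h' ξ)]
  exact h

/-- Real linearity of a complex valued form. -/
structure IsRealForm {V : Type*} [AddCommGroup V] [Module ℝ V] (a : V → ℂ) : Prop where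
  add : ∀ ξ ξ', a (ξ + ξ') = a ξ + a ξ'
  smul : ∀ (c : ℝ) ξ, a (c • ξ) = c * a ξ

theorem IsRealForm.conj {V : Type*} [AddCommGroup V] [Module ℝ V] {a : V → ℂ}
    (h : IsRealForm a) : IsRealForm fun ξ => (starRingEnd ℂ) (a ξ) where
  add ξ ξ' := by rw [h.add, map_add]
  smul c ξ := by rw [h.smul, map_mul, Complex.conj_ofReal]

theorem IsRealForm.wedge {V : Type*} [AddCommGroup V] [Module ℝ V] {a b : V → ℂ}
    (ha : IsRealForm a) (hb : IsRealForm b) : IsAltForm (wedge a b) where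
  add ξ ξ' η := by simp only [HKBPS.wedge, ha.add, hb.add]; ring
  smul c ξ η := by simp only [HKBPS.wedge, ha.smul, hb.smul]; ring
  neg ξ η := by simp only [HKBPS.wedge]; ring

theorem isRealForm_dZp (Z : CentralCharge E L) (x : TorusBundle L θf) (γ : L.fib x.1) :
    IsRealForm fun ξ : Tan E x => dZp Z x ξ γ where
  add ξ ξ' := (dZ Z x.1 γ).map_add ξ.1 ξ'.1
  smul c ξ := ((dZ Z x.1 γ).restrictScalars ℝ).map_smul c ξ.1

theorem isRealForm_dTheta (x : TorusBundle L θf) (γ : L.fib x.1) :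
    IsRealForm fun ξ : Tan E x => dTheta x ξ γ where
  add _ _ := Complex.ofReal_add _ _
  smul _ _ := Complex.ofReal_mul _ _

theorem isRealForm_Ainst (Z : CentralCharge E L) (x : TorusBundle L θf) (γ : L.fib x.1) :
    IsRealForm fun ξ : Tan E x => Ainst Z x γ ξ where
  add ξ ξ' := by
    simp only [Ainst, dZbarp_eq, (isRealForm_dZp Z x γ).add, map_add]
    ring
  smul c ξ := by
    simp only [Ainst, dZbarp_eq, (isRealForm_dZp Z x γ).smul, map_mul, Complex.conj_ofReal]
    ring

theorem isAltForm_omega12Term (x : TorusBundle L θf) (γ : L.fib x.1) :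
    IsAltForm fun ξ η : Tan E x => omega12Term Z Ω x ξ η γ :=
  (((isRealForm_dZp Z x γ).wedge (isRealForm_Ainst Z x γ)).const_mul _).add_form
    (((isRealForm_dTheta x γ).wedge (isRealForm_dZp Z x γ)).const_mul _)

theorem isAltForm_omega3Term (x : TorusBundle L θf) (γ : L.fib x.1) :
    IsAltForm fun ξ η : Tan E x => omega3Term Z Ω x ξ η γ :=
  (((isRealForm_dZp Z x γ).wedge (isRealForm_dZp Z x γ).conj).const_mul _).add_form
    (((isRealForm_dTheta x γ).wedge (isRealForm_Ainst Z x γ)).const_mul _)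

theorem isAltForm_pairWedge (p : M) {V : Type*} [AddCommGroup V] [Module ℝ V]
    {A B : V → L.fib p → ℂ} (hA : ∀ γ, IsRealForm fun ξ => A ξ γ)
    (hB : ∀ γ, IsRealForm fun ξ => B ξ γ) : IsAltForm (L.pairWedge p A B) where
  add ξ ξ' η := by
    simp only [ChargeLattice.pairWedge, ChargeLattice.dualPairing, (hA _).add, (hB _).add,
      ← Finset.sum_add_distrib, ← Finset.sum_sub_distrib]
    exact Finset.sum_congr rfl fun i _ => by ring
  smul c ξ η := by
    simp only [ChargeLattice.pairWedge, ChargeLattice.dualPairing, (hA _).smul, (hB _).smul,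
      ← Finset.sum_sub_distrib, Finset.mul_sum]
    exact Finset.sum_congr rfl fun i _ => by ring
  neg ξ η := by
    simp only [ChargeLattice.pairWedge]
    ring

variable [Module.Free ℤ Γf] [Module.Finite ℤ Γf] [FiniteDimensional ℂ E]
  [IsManifold 𝓘(ℂ, E) ω M]

theorem isAltForm_omega12 (hHK : IsHKVariation Z Ω) (hloc : IsMutuallyLocal L Ω)
    (x : TorusBundle L θf) : IsAltForm (omega12 Z Ω x : Tan E x → Tan E x → ℂ) :=
  ((isAltForm_pairWedge x.1 (isRealForm_dZp Z x) (isRealForm_dTheta x)).const_mul _).add_form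
    (IsAltForm.sum_add (isAltForm_omega12Term x) (summable_omega12Term hHK hloc x))

theorem isAltForm_omega3 (hHK : IsHKVariation Z Ω) (hloc : IsMutuallyLocal L Ω)
    (x : TorusBundle L θf) : IsAltForm (omega3 Z Ω x : Tan E x → Tan E x → ℂ) := by
  refine ((((isAltForm_pairWedge x.1 (isRealForm_dZp Z x)
    (fun γ => (isRealForm_dZp Z x γ).conj)).const_mul (1 / 4)).add_form
    ((isAltForm_pairWedge x.1 (isRealForm_dTheta (E := E) x)
      (isRealForm_dTheta x)).const_mul (-(1 / (8 * Real.pi ^ 2))))).add_form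
    (IsAltForm.sum_add (isAltForm_omega3Term x) (summable_omega3Term hHK hloc x))).congr
    fun ξ η => ?_
  rw [omega3, sub_eq_add_neg, neg_mul_eq_neg_mul]
  rfl

/-! #### Smoothness and closedness -/

variable {p : M} {D : SeriesData (Coord E r) (Model r Γf) (Fin r ⊕ Fin r ⊕ Unit)}

/-- This passes from the iterated sum over charges and then over `n`, as in the definition of the
forms, to a single sum over pairs, to which termwise differentiation applies. Flavor charges have
weight zero on one side and vanishing `F` on the other. -/
theorem IsLocalData.tsum_eq (hHK : IsHKVariation Z Ω)
    (hD : IsLocalData Z Ω θf p D) {y : Coord E r} (hy : y ∈ D.B)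
    {F : L.fib (param L θf p y).1 → ℂ} {g : Model r Γf × ℕ → Coord E r → ℂ} (hg : D.Adm g)
    (c₀ c₁ : Model r Γf → ℂ) (hF : ∀ f, F (L.flavor (param L θf p y).1 f) = 0)
    (hF' : ∀ z, F (L.frame p (param L θf p y).1 z)
      = (Ω (param L θf p y).1 (L.frame p (param L θf p y).1 z) : ℂ)
      * (c₁ z * besselSum Z 1 (param L θf p y) (L.frame p (param L θf p y).1 z)
        + c₀ z * besselSum Z 0 (param L θf p y) (L.frame p (param L θf p y).1 z)))
    (hg' : ∀ (z : Model r Γf) (n : ℕ), g (z, n) y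
      = D.W z * (c₁ z * (((n : ℂ) + 1) * D.f 1 (z, n) y) + c₀ z * D.f 0 (z, n) y)) :
    ∑' γ, F γ = ∑' a, g a y := by
  rw [← (hg.tsum_prod hy).2, ← (L.frame p (param L θf p y).1).toEquiv.tsum_eq]
  refine tsum_congr fun z => ?_
  simp only [hg']
  change F (L.frame p (param L θf p y).1 z) = _
  by_cases hz : z.1 = 0 ∧ z.2.1 = 0
  · have : z = (0, 0, z.2.2) := Prod.ext hz.1 (Prod.ext hz.2 rfl)
    simp only [hD.W_flavor z hz.1 hz.2, zero_mul, tsum_zero]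
    rw [this, (L.adapted p _).flavor, hF]
  have hW : D.W z = (Ω (param L θf p y).1 (L.frame p (param L θf p y).1 z) : ℂ) :=
    hD.W_eq y hy z (by tauto)
  rw [hW, hF']
  -- For inactive charges `Z` may vanish, and then the Bessel series need not converge; the index
  -- zero makes this harmless.
  by_cases h0 : Ω (param L θf p y).1 (L.frame p (param L θf p y).1 z) = 0
  · simp [h0]
  have hZ := hHK.ne_zero h0
  have h : ∀ ν, HasSum (fun n : ℕ => ((n : ℂ) + 1) ^ ν * D.f ν (z, n) y)
      (besselSum Z ν (param L θf p y) (L.frame p (param L θf p y).1 z)) := fun ν => by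
    rw [funext fun n => hD.besselTerm_eq hy ν z n]
    exact (summable_besselTerm Z ν hZ).hasSum
  have h1 := h 1
  have h2 := h 0
  simp only [pow_one, pow_zero, one_mul] at h1 h2
  exact (((h1.mul_left (c₁ z)).add (h2.mul_left (c₀ z))).mul_left _).tsum_eq.symm

theorem IsLocalData.omega12_eq (hHK : IsHKVariation Z Ω)
    (hD : IsLocalData Z Ω θf p D) {y : Coord E r} (hy : y ∈ D.B) (k l : Coord E r) :
    omega12 Z Ω (param L θf p y) (dParam L θf p y k) (dParam L θf p y l) = D.form12 y k l := by
  rw [omega12, SeriesData.form12, pairWedge_dZp_dTheta Z _ _ (L.adapted p _)]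
  congr 1
  · simp only [wedge, hD.dZp_eq hy, hD.dTheta_eq, sub_eq_add_neg (_ - _), neg_one_mul]
  · refine hD.tsum_eq hHK hy (SeriesData.adm_term12 k l)
      (fun z => Complex.I / (8 * Real.pi ^ 2)
        * (D.T z k * D.dZ z y l - D.T z l * D.dZ z y k))
      (fun z => 1 / 8 * D.Z z y * (D.dZ z y k * (starRingEnd ℂ) (D.dZ z y l)
        - D.dZ z y l * (starRingEnd ℂ) (D.dZ z y k))) (fun f => ?_) (fun z => ?_) fun z n => ?_
    · rw [omega12Term_eq hHK.toIsBPSVariation]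
      simp only [dZp_flavor, dTheta_flavor]
      ring
    · rw [omega12Term_eq hHK.toIsBPSVariation, hD.dZp_eq hy, hD.dZp_eq hy, hD.dTheta_eq,
        hD.dTheta_eq, hD.Z_eq y hy]
      change _ * (1 / 8 * _ * Zc Z p z y.1 * _ + _) = _
      ring
    · rw [SeriesData.term12]
      ring

theorem IsLocalData.omega3_eq (hHK : IsHKVariation Z Ω)
    (hD : IsLocalData Z Ω θf p D) {y : Coord E r} (hy : y ∈ D.B) (k l : Coord E r) :
    omega3 Z Ω (param L θf p y) (dParam L θf p y k) (dParam L θf p y l) = D.form3 y k l := by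
  rw [omega3, SeriesData.form3, pairWedge_dZp_dZbarp Z _ _ (L.adapted p _),
    pairWedge_dTheta_dTheta _ _ (L.adapted p _), sub_eq_add_neg, neg_mul_eq_neg_mul]
  congr 1
  · simp only [wedge, wedgeBar, hD.dZp_eq hy, hD.dTheta_eq, sub_eq_add_neg (_ - _), neg_one_mul]
  · refine hD.tsum_eq hHK hy (SeriesData.adm_term3 k l)
      (fun z => Complex.I / (8 * Real.pi) * (D.dZ z y k * (starRingEnd ℂ) (D.dZ z y l)
        - D.dZ z y l * (starRingEnd ℂ) (D.dZ z y k)))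
      (fun z => -(1 / (16 * Real.pi))
        * (D.T z k * ((starRingEnd ℂ) (D.Z z y) * D.dZ z y l
          - D.Z z y * (starRingEnd ℂ) (D.dZ z y l))
        - D.T z l * ((starRingEnd ℂ) (D.Z z y) * D.dZ z y k
          - D.Z z y * (starRingEnd ℂ) (D.dZ z y k)))) (fun f => ?_) (fun z => ?_) fun z n => ?_
    · rw [omega3Term_eq hHK.toIsBPSVariation]
      simp only [dZp_flavor, dTheta_flavor]
      ring
    · rw [omega3Term_eq hHK.toIsBPSVariation, hD.dZp_eq hy, hD.dZp_eq hy, hD.dTheta_eq,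
        hD.dTheta_eq, hD.Z_eq y hy]
      change _ * (_ - 1 / (16 * (Real.pi : ℂ)) * _ * (_ * ((starRingEnd ℂ) (Zc Z p z y.1) * _
        - Zc Z p z y.1 * _) - _ * ((starRingEnd ℂ) (Zc Z p z y.1) * _
        - Zc Z p z y.1 * _))) = _
      ring
    · rw [SeriesData.term3]
      ring

/-- The instanton part is real by the symmetry `γ ↦ -γ`. In `⟨dZ ∧ dZ̄⟩` conjugation exchanges the
two halves of the Darboux sum. -/
theorem omega3_im (hΩ : IsBPSVariation Z Ω) (x : TorusBundle L θf) (ξ η : Tan E x) :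
    (omega3 Z Ω x ξ η).im = 0 := by
  have h1 : (∑' γ, omega3Term Z Ω x ξ η γ).im = 0 := tsum_im_eq_zero (omega3Term_neg hΩ x ξ η)
  rw [← Complex.conj_eq_iff_im] at h1 ⊢
  rw [omega3, pairWedge_dZp_dZbarp Z _ _ (L.adapted x.1 x.1),
    pairWedge_dTheta_dTheta _ _ (L.adapted x.1 x.1)]
  simp only [map_add, map_sub, h1, map_mul, map_sum, wedge, wedgeBar, Complex.conj_conj,
    conj_dTheta, map_div₀, map_one, map_ofNat, map_pow, Complex.conj_ofReal]
  congr 3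
  exact Finset.sum_congr rfl fun i _ => by ring

theorem exists_complex_form (hHK : IsHKVariation Z Ω) (hloc : IsMutuallyLocal L Ω)
    {y₀ : Coord E r} (hy₀ : y₀ ∈ paramDomain E L p) :
    ∃ (B : Set (Coord E r)) (c c' : Coord E r → Coord E r → Coord E r → ℂ), IsOpen B ∧ y₀ ∈ B ∧
      (∀ y ∈ B, ∀ k l, omega12 Z Ω (param L θf p y) (dParam L θf p y k) (dParam L θf p y l) = c y k l)
      ∧ (∀ y ∈ B, ∀ k l,
        omega3 Z Ω (param L θf p y) (dParam L θf p y k) (dParam L θf p y l) = c' y k l)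
      ∧ (∀ k l, ContDiffAt ℝ ∞ (fun y => c y k l) y₀)
      ∧ (∀ k l, ContDiffAt ℝ ∞ (fun y => c' y k l) y₀)
      ∧ IsClosedAt c y₀ ∧ IsClosedAt c' y₀ := by
  obtain ⟨D, hyD, hD⟩ := exists_localData hHK hloc θf hy₀
  have : FiniteDimensional ℝ E := FiniteDimensional.complexToReal E
  refine ⟨D.B, D.form12, D.form3, D.isOpen, hyD, fun y hy => hD.omega12_eq hHK hy,
    fun y hy => hD.omega3_eq hHK hy,
    fun k l => (SeriesData.contDiffOn_form12 k l).contDiffAt (D.isOpen.mem_nhds hyD),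
    fun k l => (SeriesData.contDiffOn_form3 k l).contDiffAt (D.isOpen.mem_nhds hyD),
    SeriesData.isClosedAt_form12 hyD, SeriesData.isClosedAt_form3 hyD⟩

end Smooth

/-! ### Passage from the complex forms to the real ones. -/

section Kahler

variable {E : Type*} [NormedAddCommGroup E] [NormedSpace ℂ E]
  {M : Type u} [TopologicalSpace M] [ChartedSpace E M]
  {r : ℕ} {Γf : Type v} [AddCommGroup Γf] {L : ChargeLattice.{u, v, w} M r Γf}
  {θf : Γf →+ Real.Angle} {Z : CentralCharge E L} {Ω : ∀ p, L.fib p → ℤ}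
  [Module.Free ℤ Γf] [Module.Finite ℤ Γf] [FiniteDimensional ℂ E]
  [IsManifold 𝓘(ℂ, E) ω M]

theorem IsAltForm.re {V : Type*} [AddCommGroup V] [Module ℝ V] {B : V → V → ℂ}
    (h : IsAltForm B) (ℓ : ℂ →ₗ[ℝ] ℝ) :
    IsBilin (fun ξ η => ℓ (B ξ η)) ∧ ∀ ξ, ℓ (B ξ ξ) = 0 := by
  have h1 : ∀ c ξ η, B (c • ξ) η = c • B ξ η := fun c ξ η => by rw [h.smul, Complex.real_smul]
  refine ⟨⟨fun ξ => ⟨fun η η' => ?_, fun c η => ?_⟩, fun η => ⟨fun ξ ξ' => ?_, fun c ξ => ?_⟩⟩,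
    fun ξ => ?_⟩
  · beta_reduce
    rw [h.neg, h.add, neg_add, ← h.neg, ← h.neg, map_add]
  · beta_reduce
    rw [h.neg, h1, ← smul_neg, ← h.neg, map_smul]
  · beta_reduce
    rw [h.add, map_add]
  · beta_reduce
    rw [h1, map_smul]
  · have := h.neg ξ ξ
    rw [self_eq_neg.1 this, map_zero]

theorem IsClosedAt.re {X : Type*} [NormedAddCommGroup X] [NormedSpace ℝ X] {c : X → X → X → ℂ}
    {y : X} (h : IsClosedAt c y) (ℓ : ℂ →L[ℝ] ℝ) (k₀ k₁ k₂ : X) :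
    fderiv ℝ (fun y => ℓ (c y k₁ k₂)) y k₀ - fderiv ℝ (fun y => ℓ (c y k₀ k₂)) y k₁
      + fderiv ℝ (fun y => ℓ (c y k₀ k₁)) y k₂ = 0 := by
  have h1 : ∀ k l, fderiv ℝ (fun y => ℓ (c y k l)) y = ℓ.comp (fderiv ℝ (fun y => c y k l) y) :=
    fun k l => (ℓ.hasFDerivAt.comp y (h.1 k l).hasFDerivAt).fderiv
  rw [h1, h1, h1]
  simp only [ContinuousLinearMap.comp_apply]
  rw [← map_sub, ← map_add, h.2, map_zero]

/-- All three real forms are treated at once as a real linear functional applied to a complex form.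
-/
theorem kahlerForms_eq (Z : CentralCharge E L) (Ω : ∀ p, L.fib p → ℤ) (α : Fin 3) :
    ∃ ℓ : ℂ →L[ℝ] ℝ, (∀ (x : TorusBundle L θf) (ξ η : Tan E x),
        kahlerForms Z Ω α x ξ η = ℓ (omega12 Z Ω x ξ η))
      ∨ (∀ (x : TorusBundle L θf) (ξ η : Tan E x),
        kahlerForms Z Ω α x ξ η = ℓ (omega3 Z Ω x ξ η)) := by
  fin_cases α
  · exact ⟨Complex.reCLM, .inl fun _ _ _ => rfl⟩
  · exact ⟨Complex.imCLM, .inl fun _ _ _ => rfl⟩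
  · exact ⟨Complex.reCLM, .inr fun _ _ _ => rfl⟩

theorem isBilin_kahlerForms (hHK : IsHKVariation Z Ω) (hloc : IsMutuallyLocal L Ω) (α : Fin 3)
    (x : TorusBundle L θf) :
    IsBilin (kahlerForms Z Ω α x) ∧ ∀ ξ, kahlerForms Z Ω α x ξ ξ = 0 := by
  obtain ⟨ℓ, h | h⟩ := kahlerForms_eq (θf := θf) Z Ω α
  · rw [show kahlerForms Z Ω α x = fun ξ η => ℓ (omega12 Z Ω x ξ η) from
      funext fun ξ => funext fun η => h x ξ η]
    exact (isAltForm_omega12 hHK hloc x).re ℓ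
  · rw [show kahlerForms Z Ω α x = fun ξ η => ℓ (omega3 Z Ω x ξ η) from
      funext fun ξ => funext fun η => h x ξ η]
    exact (isAltForm_omega3 hHK hloc x).re ℓ

/-- In local coordinates, the Kähler forms are smooth and closed. -/
theorem kahlerForms_smooth_closed (hHK : IsHKVariation Z Ω) (hloc : IsMutuallyLocal L Ω)
    (θf : Γf →+ Real.Angle) (α : Fin 3) {p : M} {y₀ : Coord E r} (hy₀ : y₀ ∈ paramDomain E L p) :
    (∀ k l, ContDiffAt ℝ ∞ (fun y => pull (θf := θf) (kahlerForms Z Ω α) p y k l) y₀)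
    ∧ ∀ k₀ k₁ k₂ : Coord E r,
      fderiv ℝ (fun y => pull (θf := θf) (kahlerForms Z Ω α) p y k₁ k₂) y₀ k₀
      - fderiv ℝ (fun y => pull (θf := θf) (kahlerForms Z Ω α) p y k₀ k₂) y₀ k₁
      + fderiv ℝ (fun y => pull (θf := θf) (kahlerForms Z Ω α) p y k₀ k₁) y₀ k₂ = 0 := by
  obtain ⟨B, c, c', hB, hy, h1, h2, h3, h4, h5, h6⟩ := exists_complex_form (θf := θf) hHK hloc hy₀
  have key : ∀ (ℓ : ℂ →L[ℝ] ℝ) (c : Coord E r → Coord E r → Coord E r → ℂ),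
      (∀ y ∈ B, ∀ k l, pull (θf := θf) (kahlerForms Z Ω α) p y k l = ℓ (c y k l)) →
      (∀ k l, ContDiffAt ℝ ∞ (fun y => c y k l) y₀) → IsClosedAt c y₀ →
      (∀ k l, ContDiffAt ℝ ∞ (fun y => pull (θf := θf) (kahlerForms Z Ω α) p y k l) y₀)
      ∧ ∀ k₀ k₁ k₂ : Coord E r,
        fderiv ℝ (fun y => pull (θf := θf) (kahlerForms Z Ω α) p y k₁ k₂) y₀ k₀
        - fderiv ℝ (fun y => pull (θf := θf) (kahlerForms Z Ω α) p y k₀ k₂) y₀ k₁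
        + fderiv ℝ (fun y => pull (θf := θf) (kahlerForms Z Ω α) p y k₀ k₁) y₀ k₂ = 0 := by
    intro ℓ c hc hs hcl
    have he : ∀ k l, (fun y => pull (θf := θf) (kahlerForms Z Ω α) p y k l)
        =ᶠ[𝓝 y₀] fun y => ℓ (c y k l) := fun k l => by
      filter_upwards [hB.mem_nhds hy] with y hy
      exact hc y hy k l
    refine ⟨fun k l => (ℓ.contDiff.contDiffAt.comp y₀ (hs k l)).congr_of_eventuallyEq (he k l),
      fun k₀ k₁ k₂ => ?_⟩
    rw [(he _ _).fderiv_eq, (he _ _).fderiv_eq, (he _ _).fderiv_eq]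
    exact hcl.re ℓ k₀ k₁ k₂
  obtain ⟨ℓ, h | h⟩ := kahlerForms_eq (θf := θf) Z Ω α
  · exact key ℓ c (fun y hy k l => by rw [pull, h, h1 y hy]) h3 h5
  · exact key ℓ c' (fun y hy k l => by rw [pull, h, h2 y hy]) h4 h6

theorem isSmoothTwoForm_kahlerForms (hHK : IsHKVariation Z Ω) (hloc : IsMutuallyLocal L Ω)
    (α : Fin 3) : IsSmoothTwoForm (Set.univ : Set (TorusBundle L θf)) (kahlerForms Z Ω α) where
  bilin x _ := (isBilin_kahlerForms hHK hloc α x).1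
  alt x _ := (isBilin_kahlerForms hHK hloc α x).2
  smooth _ k l _ hy :=
    ((kahlerForms_smooth_closed hHK hloc θf α hy.1).1 k l).contDiffWithinAt

theorem isClosedForm_kahlerForms (hHK : IsHKVariation Z Ω) (hloc : IsMutuallyLocal L Ω)
    (S : Set (TorusBundle L θf)) (α : Fin 3) : IsClosedForm S (kahlerForms Z Ω α) :=
  fun _ _ hy => (kahlerForms_smooth_closed hHK hloc θf α hy.1).2

end Kahler

/-! ### Support frames -/

section SupportFrame

variable {E : Type*} [NormedAddCommGroup E] [NormedSpace ℂ E]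
  {M : Type u} [TopologicalSpace M] [ChartedSpace E M]
  {r : ℕ} {Γf : Type v} [AddCommGroup Γf] {L : ChargeLattice.{u, v, w} M r Γf}
  [Module.Free ℤ Γf] [Module.Finite ℤ Γf] {Z : CentralCharge E L} {Ω : ∀ p, L.fib p → ℤ}

/-- A symplectic change of basis of the model that is the identity on flavor charges. -/
def modelEquiv {r : ℕ} {Γf : Type v} [AddCommGroup Γf]
    (ψ : ((Fin r → ℤ) × (Fin r → ℤ)) ≃ₗ[ℤ] ((Fin r → ℤ) × (Fin r → ℤ))) :
    Model r Γf ≃+ Model r Γf :=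
  AddEquiv.prodAssoc.symm.trans
    ((ψ.toAddEquiv.prodCongr (AddEquiv.refl Γf)).trans AddEquiv.prodAssoc)

theorem exists_isOpen_constant (h : IsBPSVariation Z Ω) (hloc : IsMutuallyLocal L Ω) (p : M) :
    ∃ U : Set M, IsOpen U ∧ p ∈ U ∧ U ⊆ L.dom p ∧ ∀ q ∈ U, ∀ x : Model r Γf,
      (x.1 ≠ 0 ∨ x.2.1 ≠ 0) → Ω q (L.frame p q x) = Ω p (L.frame p p x) := by
  have hp : (chartAt E p).symm (chartAt E p p) = p :=
    (chartAt E p).left_inv (mem_chart_source E p)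
  obtain ⟨ε, hε, hB⟩ := Metric.isOpen_iff.1 (isOpen_paramDomain_base (E := E) (L := L) p)
    (chartAt E p p)
    ⟨(chartAt E p).map_source (mem_chart_source E p), by rw [hp]; exact L.mem_dom p⟩
  refine ⟨_, (chartAt E p).isOpen_inter_preimage Metric.isOpen_ball,
    ⟨mem_chart_source E p, Metric.mem_ball_self hε⟩, fun q hq => ?_, fun q hq x hx => ?_⟩
  · have := (hB hq.2).2
    rwa [(chartAt E p).left_inv hq.1] at this
  · have := (convex_ball (chartAt E p p) ε).isPreconnected.constant
      (f := fun z : E => Ω ((chartAt E p).symm z) (L.frame p _ x)) (fun z hz => by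
        refine ContinuousAt.continuousWithinAt (Tendsto.congr' ?_ tendsto_const_nhds)
        filter_upwards [(continuousAt_symm (hB hz).1).eventually
          (h.eventually_eq_of_mem_dom hloc (hB hz).2 hx)] with z' h
        exact h.symm) hq.2 (Metric.mem_ball_self hε)
    beta_reduce at this
    rwa [(chartAt E p).left_inv hq.1, hp] at this

theorem exists_supportFrame (h : IsBPSVariation Z Ω) (hloc : IsMutuallyLocal L Ω) (p : M) :
    ∃ (U : Set M) (e : ∀ q : M, Model r Γf ≃+ L.fib q), p ∈ U ∧ IsSupportFrame Ω U e := by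
  obtain ⟨U, hU, hpU, hUd, hconst⟩ := exists_isOpen_constant h hloc p
  -- Mutual locality says that the active charges at `p`, taken modulo flavor, form an isotropic
  -- set. By constancy of the indices on `U`, the frame found at `p` serves on all of `U`.
  obtain ⟨ψ, hψ, hS⟩ := exists_symplectic_of_isotropic
    {a : (Fin r → ℤ) × (Fin r → ℤ) | ∃ f : Γf, Ω p (L.frame p p (a.1, a.2, f)) ≠ 0} (by
      rintro a ⟨f, hf⟩ a' ⟨f', hf'⟩
      have := hloc p _ _ hf hf'
      rw [(L.adapted p p).darboux] at this
      exact this)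
  refine ⟨U, fun q => (modelEquiv ψ).trans (L.frame p q), hpU, ⟨hU, fun q _ => ⟨fun f => ?_,
    fun x y => ?_⟩, fun q hq => ?_⟩, fun q hq γ hγ => ?_⟩
  · rw [← (L.adapted p q).flavor]
    change L.frame p q (((ψ 0).1, (ψ 0).2, f) : Model r Γf) = _
    rw [map_zero]
    rfl
  · change L.pairing q (L.frame p q _) (L.frame p q _) = _
    rw [(L.adapted p q).darboux]
    exact hψ (x.1, x.2.1) (y.1, y.2.1)
  · filter_upwards [L.locallyConstant p q q (hUd hq) (L.mem_dom q)] with q' h x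
    exact h _
  · obtain ⟨x, rfl⟩ := (L.frame p q).surjective γ
    change ((modelEquiv ψ).symm ((L.frame p q).symm (L.frame p q x))).1 = 0
    rw [AddEquiv.symm_apply_apply]
    change (ψ.symm (x.1, x.2.1)).1 = 0
    -- An active flavor charge is not covered by constancy of the indices, but its image in `Γg` is
    -- zero.
    by_cases hx : x.1 ≠ 0 ∨ x.2.1 ≠ 0
    · refine hS _ ⟨x.2.2, ?_⟩
      rw [hconst q hq x hx] at hγ
      exact hγ
    · push Not at hx
      have : ((x.1, x.2.1) : (Fin r → ℤ) × (Fin r → ℤ)) = 0 := Prod.ext hx.1 hx.2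
      rw [this, map_zero]
      rfl

end SupportFrame

/-! ### Linear algebra of hyperkähler triples -/

section HyperkahlerAlgebra

open Matrix

/-- A (possibly indefinite) hyperkähler structure on a vector space, with Kähler forms `Φ`. -/
structure IsHKAlgebra {V : Type*} [AddCommGroup V] [Module ℝ V] (g : V → V → ℝ)
    (I : Fin 3 → V →ₗ[ℝ] V) (Φ : Fin 3 → V → V → ℝ) : Prop where
  bilin : IsBilin g
  symm : ∀ ξ η, g ξ η = g η ξ
  nondegenerate : ∀ ξ, (∀ η, g ξ η = 0) → ξ = 0
  sq : ∀ α ξ, I α (I α ξ) = -ξ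
  quaternion : ∀ ξ, I 0 (I 1 ξ) = I 2 ξ
  kahler : ∀ α ξ η, Φ α ξ η = g (I α ξ) η

namespace IsHKAlgebra

variable {V : Type*} [AddCommGroup V] [Module ℝ V] {g : V → V → ℝ}
  {I : Fin 3 → V →ₗ[ℝ] V} {Φ : Fin 3 → V → V → ℝ}

theorem form_nondegenerate (h : IsHKAlgebra g I Φ) (α : Fin 3) {ξ : V}
    (hξ : ∀ η, Φ α ξ η = 0) : ξ = 0 := by
  have h1 := h.nondegenerate (I α ξ) fun η => by rw [← h.kahler, hξ]
  have h2 := h.sq α ξ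
  rw [h1, map_zero] at h2
  exact neg_eq_zero.1 h2.symm

theorem mul_one_two (h : IsHKAlgebra g I Φ) (ξ : V) : I 1 (I 2 ξ) = I 0 ξ := by
  have h1 := h.sq 2 ξ
  rw [← h.quaternion (I 2 ξ)] at h1
  have h2 := congrArg (I 0) h1
  rw [h.sq, map_neg] at h2
  exact neg_injective h2

theorem mul_two_zero (h : IsHKAlgebra g I Φ) (ξ : V) : I 2 (I 0 ξ) = I 1 ξ := by
  rw [← h.quaternion, ← h.mul_one_two ξ, h.sq, map_neg, ← h.mul_one_two, h.sq, map_neg, neg_neg]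

/-- The complex structures are quotients of the Kähler forms. -/
theorem form_apply (h : IsHKAlgebra g I Φ) (α : Fin 3) (ξ η : V) :
    Φ (α + 1) (I (α + 2) ξ) η = Φ α ξ η := by
  rw [h.kahler, h.kahler]
  congr 1
  fin_cases α
  · exact h.mul_one_two ξ
  · exact h.mul_two_zero ξ
  · exact h.quaternion ξ

theorem metric_eq (h : IsHKAlgebra g I Φ) (ξ η : V) : g ξ η = -Φ 2 (I 2 ξ) η := by
  rw [h.kahler, h.sq]
  have := (h.bilin.2 η).map_neg ξ
  rw [this, neg_neg]

/-- With `I α` of square `-1`, skewness of the form `g(I α -, -)` is the same as invariance of `g`;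
this is why `IsHKAlgebra` has no field for isometries. -/
theorem isometry (h : IsHKAlgebra g I Φ) {α : Fin 3} (hΦ : ∀ ξ η, Φ α ξ η = -Φ α η ξ) (ξ η : V) :
    g (I α ξ) (I α η) = g ξ η := by
  rw [← h.kahler, hΦ, h.kahler, h.sq, (h.bilin.2 ξ).map_neg, neg_neg, h.symm]

theorem sub_left (h : IsHKAlgebra g I Φ) (α : Fin 3) (ξ ξ' η : V) :
    Φ α (ξ - ξ') η = Φ α ξ η - Φ α ξ' η := by
  simp only [h.kahler, map_sub]
  exact (h.bilin.2 η).map_sub _ _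

/-- The forms determine `I 2` as a quotient of two of them, and `I 2` together with the last form
determines the metric. This makes the local formula for the metric valid in every support frame. -/
theorem unique (h : IsHKAlgebra g I Φ) {g' : V → V → ℝ} {I' : Fin 3 → V →ₗ[ℝ] V}
    (h' : IsHKAlgebra g' I' Φ) (ξ η : V) : g ξ η = g' ξ η := by
  have : I 2 ξ = I' 2 ξ := by
    refine sub_eq_zero.1 (h.form_nondegenerate 1 fun η => ?_)
    rw [h.sub_left, sub_eq_zero]
    exact (h.form_apply 0 ξ η).trans (h'.form_apply 0 ξ η).symm
  rw [h.metric_eq, h'.metric_eq, this]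

end IsHKAlgebra

/-! #### The standard triple -/

variable {r : ℕ}

/-- A real matrix regarded as a complex matrix. -/
abbrev toC (G : Matrix (Fin r) (Fin r) ℝ) : Matrix (Fin r) (Fin r) ℂ :=
  G.map Complex.ofReal

theorem star_toC_mulVec (G : Matrix (Fin r) (Fin r) ℝ) (a : Fin r → ℂ) :
    star (toC G *ᵥ a) = toC G *ᵥ star a := by
  ext i
  simp [Matrix.mulVec, dotProduct]

theorem toC_mul (A B : Matrix (Fin r) (Fin r) ℝ) : toC (A * B) = toC A * toC B :=
  Matrix.map_mul (f := Complex.ofRealHom)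

theorem toC_one : toC (1 : Matrix (Fin r) (Fin r) ℝ) = 1 :=
  Matrix.map_one _ Complex.ofReal_zero Complex.ofReal_one

theorem toC_mul_inv {G : Matrix (Fin r) (Fin r) ℝ} (hG : IsUnit G.det) (a : Fin r → ℂ) :
    toC G *ᵥ (toC G⁻¹ *ᵥ a) = a := by
  rw [Matrix.mulVec_mulVec, ← toC_mul, Matrix.mul_nonsing_inv _ hG, toC_one, Matrix.one_mulVec]

theorem toC_inv_mul {G : Matrix (Fin r) (Fin r) ℝ} (hG : IsUnit G.det) (a : Fin r → ℂ) :
    toC G⁻¹ *ᵥ (toC G *ᵥ a) = a := by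
  rw [Matrix.mulVec_mulVec, ← toC_mul, Matrix.nonsing_inv_mul _ hG, toC_one, Matrix.one_mulVec]

theorem toC_inv {G : Matrix (Fin r) (Fin r) ℝ} (hG : IsUnit G.det) :
    (toC G)⁻¹ = toC G⁻¹ := by
  refine Matrix.inv_eq_right_inv ?_
  rw [← toC_mul, Matrix.mul_nonsing_inv _ hG, toC_one]

theorem isSymm_inv {G : Matrix (Fin r) (Fin r) ℝ} (hG : G.IsSymm) : G⁻¹.IsSymm := by
  rw [Matrix.IsSymm, Matrix.transpose_nonsing_inv, hG]

theorem dotProduct_toC_comm {G : Matrix (Fin r) (Fin r) ℝ} (hG : G.IsSymm) (a b : Fin r → ℂ) :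
    a ⬝ᵥ toC G *ᵥ b = b ⬝ᵥ toC G *ᵥ a := by
  have h : (toC G)ᵀ = toC G := by rw [← Matrix.transpose_map, hG]
  rw [Matrix.dotProduct_mulVec, ← h, Matrix.vecMul_transpose, h, dotProduct_comm]

theorem dotProduct_toC_mul_inv {G : Matrix (Fin r) (Fin r) ℝ} (hG : G.IsSymm)
    (hdet : IsUnit G.det) (a b : Fin r → ℂ) :
    (toC G⁻¹ *ᵥ a) ⬝ᵥ toC G *ᵥ b = a ⬝ᵥ b := by
  rw [dotProduct_toC_comm hG, toC_mul_inv hdet, dotProduct_comm]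

theorem dotProduct_toC_inv_mul {G : Matrix (Fin r) (Fin r) ℝ} (hG : G.IsSymm)
    (hdet : IsUnit G.det) (a b : Fin r → ℂ) :
    (toC G *ᵥ a) ⬝ᵥ toC G⁻¹ *ᵥ b = a ⬝ᵥ b := by
  rw [dotProduct_toC_comm (isSymm_inv hG), toC_inv_mul hdet, dotProduct_comm]

/-- The hermitian form of the standard triple. -/
def hkHermitian (G : Matrix (Fin r) (Fin r) ℝ) (p q : (Fin r → ℂ) × (Fin r → ℂ)) : ℂ :=
  p.1 ⬝ᵥ toC G *ᵥ star q.1 + 1 / (4 * Real.pi ^ 2) * (p.2 ⬝ᵥ toC G⁻¹ *ᵥ star q.2)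

/-- The complex symplectic form of the standard triple. -/
def hkSymplectic (p q : (Fin r → ℂ) × (Fin r → ℂ)) : ℂ :=
  1 / (2 * Real.pi) * (p.1 ⬝ᵥ q.2 - q.1 ⬝ᵥ p.2)

/-- The antilinear complex structures of the standard triple, for `z = 1, i`. -/
def hkJ (G : Matrix (Fin r) (Fin r) ℝ) (z : ℂ) :
    ((Fin r → ℂ) × (Fin r → ℂ)) →ₗ[ℝ] ((Fin r → ℂ) × (Fin r → ℂ)) where
  toFun p := (-(z / (2 * Real.pi)) • (toC G⁻¹ *ᵥ star p.2), (2 * Real.pi * z) • (toC G *ᵥ star p.1))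
  map_add' p q := by
    simp only [Prod.fst_add, Prod.snd_add, star_add, Matrix.mulVec_add, smul_add, Prod.mk_add_mk]
  map_smul' c p := by
    simp only [Prod.smul_fst, Prod.smul_snd, star_smul, star_trivial, Matrix.mulVec_smul,
      RingHom.id_apply, Prod.smul_mk, smul_comm c]

/-- The standard triple of complex structures. -/
def hkI (G : Matrix (Fin r) (Fin r) ℝ) :
    Fin 3 → ((Fin r → ℂ) × (Fin r → ℂ)) →ₗ[ℝ] ((Fin r → ℂ) × (Fin r → ℂ)) :=
  ![hkJ G 1, hkJ G Complex.I, (Complex.I • LinearMap.id :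
    ((Fin r → ℂ) × (Fin r → ℂ)) →ₗ[ℂ] ((Fin r → ℂ) × (Fin r → ℂ))).restrictScalars ℝ]

/-- The standard triple of forms. -/
def hkForm (G : Matrix (Fin r) (Fin r) ℝ) :
    Fin 3 → ((Fin r → ℂ) × (Fin r → ℂ)) → ((Fin r → ℂ) × (Fin r → ℂ)) → ℝ :=
  ![fun p q => (hkSymplectic p q).re, fun p q => (hkSymplectic p q).im,
    fun p q => (Complex.I * hkHermitian G p q).re]

theorem star_dotProduct_toC (G : Matrix (Fin r) (Fin r) ℝ) (a b : Fin r → ℂ) :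
    star (a ⬝ᵥ toC G *ᵥ star b) = star a ⬝ᵥ toC G *ᵥ b := by
  have h : ∀ v : Fin r → ℂ, star (a ⬝ᵥ v) = star a ⬝ᵥ star v := fun v => by simp [dotProduct]
  rw [h, star_toC_mulVec, star_star]

theorem hkHermitian_conj {G : Matrix (Fin r) (Fin r) ℝ} (hG : G.IsSymm)
    (p q : (Fin r → ℂ) × (Fin r → ℂ)) :
    (starRingEnd ℂ) (hkHermitian G p q) = hkHermitian G q p := by
  have h := fun (G : Matrix (Fin r) (Fin r) ℝ) (hG : G.IsSymm) (a b : Fin r → ℂ) =>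
    (star_dotProduct_toC G a b).trans (dotProduct_toC_comm hG (star a) b)
  simp only [hkHermitian, map_add, map_mul, map_div₀, map_one, map_pow, Complex.conj_ofReal,
    map_ofNat]
  simp only [starRingEnd_apply, h G hG, h G⁻¹ (isSymm_inv hG)]

theorem hkHermitian_I_smul (G : Matrix (Fin r) (Fin r) ℝ) (z : ℂ)
    (p q : (Fin r → ℂ) × (Fin r → ℂ)) :
    hkHermitian G (z • p) q = z * hkHermitian G p q := by
  simp only [hkHermitian, Prod.smul_fst, Prod.smul_snd, smul_dotProduct, smul_eq_mul]
  ring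

/-- Both antilinear structures are tested by one formula: for `z = 1` the real part is the real part
of the symplectic form, for `z = i` it is the imaginary part. -/
theorem hkHermitian_hkJ {G : Matrix (Fin r) (Fin r) ℝ} (hG : G.IsSymm) (hdet : IsUnit G.det)
    (z : ℂ) (p q : (Fin r → ℂ) × (Fin r → ℂ)) :
    hkHermitian G (hkJ G z p) q = z * (starRingEnd ℂ) (hkSymplectic p q) := by
  have hpi : (Real.pi : ℂ) ≠ 0 := by exact_mod_cast Real.pi_ne_zero
  have h1 : (starRingEnd ℂ) (p.1 ⬝ᵥ q.2) = star p.1 ⬝ᵥ star q.2 := by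
    rw [starRingEnd_apply, Matrix.star_dotProduct_star, dotProduct_comm]
  have h2 : (starRingEnd ℂ) (q.1 ⬝ᵥ p.2) = star p.2 ⬝ᵥ star q.1 := by
    rw [starRingEnd_apply, Matrix.star_dotProduct_star]
  simp only [hkHermitian, hkJ, LinearMap.coe_mk, AddHom.coe_mk, smul_dotProduct, smul_eq_mul,
    dotProduct_toC_mul_inv hG hdet, dotProduct_toC_inv_mul hG hdet, hkSymplectic, map_mul, map_sub,
    map_div₀, map_one, map_ofNat, Complex.conj_ofReal, h1, h2]
  field_simp
  ring

theorem isBilin_re_hkHermitian (G : Matrix (Fin r) (Fin r) ℝ) :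
    IsBilin fun p q : (Fin r → ℂ) × (Fin r → ℂ) => (hkHermitian G p q).re := by
  refine ⟨fun p => ⟨fun q q' => ?_, fun c q => ?_⟩, fun q => ⟨fun p p' => ?_, fun c p => ?_⟩⟩
  · beta_reduce
    rw [← Complex.add_re]
    congr 1
    simp only [hkHermitian, Prod.fst_add, Prod.snd_add, star_add, Matrix.mulVec_add, dotProduct_add]
    ring
  · beta_reduce
    rw [smul_eq_mul, ← Complex.re_ofReal_mul]
    congr 1
    simp only [hkHermitian, Prod.smul_fst, Prod.smul_snd, star_smul, star_trivial,
      Matrix.mulVec_smul, dotProduct_smul, Complex.real_smul]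
    ring
  · beta_reduce
    rw [← Complex.add_re]
    congr 1
    simp only [hkHermitian, Prod.fst_add, Prod.snd_add, add_dotProduct]
    ring
  · beta_reduce
    rw [smul_eq_mul, ← Complex.re_ofReal_mul]
    congr 1
    simp only [hkHermitian, Prod.smul_fst, Prod.smul_snd, smul_dotProduct, Complex.real_smul]
    ring

theorem eq_zero_of_dotProduct_star_re {a : Fin r → ℂ} (h : (a ⬝ᵥ star a).re = 0) : a = 0 := by
  have h1 : (a ⬝ᵥ star a).re = ∑ i, Complex.normSq (a i) := by
    simp only [dotProduct, Pi.star_apply, Complex.star_def, Complex.mul_conj, Complex.re_sum,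
      Complex.ofReal_re]
  rw [h1, Finset.sum_eq_zero_iff_of_nonneg fun i _ => Complex.normSq_nonneg _] at h
  exact funext fun i => Complex.normSq_eq_zero.1 (h i (Finset.mem_univ i))

theorem isHKAlgebra_standard {G : Matrix (Fin r) (Fin r) ℝ} (hG : G.IsSymm)
    (hdet : IsUnit G.det) :
    IsHKAlgebra (fun p q => (hkHermitian G p q).re) (hkI G) (hkForm G) where
  bilin := isBilin_re_hkHermitian G
  symm p q := by rw [← hkHermitian_conj hG, Complex.conj_re]
  nondegenerate p hp := by
    refine Prod.ext (eq_zero_of_dotProduct_star_re ?_) (eq_zero_of_dotProduct_star_re ?_)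
    -- The metric may be indefinite, so `p` cannot be tested against itself. The inverse matrix in
    -- the test vector turns the pairing into the standard positive one.
    · have := hp (toC G⁻¹ *ᵥ p.1, 0)
      simpa [hkHermitian, star_toC_mulVec, toC_mul_inv hdet] using this
    · have h1 := hp (0, toC G *ᵥ p.2)
      have h2 : hkHermitian G p (0, toC G *ᵥ p.2)
          = ((1 / (4 * Real.pi ^ 2) : ℝ) : ℂ) * (p.2 ⬝ᵥ star p.2) := by
        simp [hkHermitian, star_toC_mulVec, toC_inv_mul hdet]
      rw [h2, Complex.re_ofReal_mul] at h1
      have hpi := Real.pi_pos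
      exact (mul_eq_zero.1 h1).resolve_left (by positivity)
  sq α p := by
    have hpi : (Real.pi : ℂ) ≠ 0 := by exact_mod_cast Real.pi_ne_zero
    -- Applying the antilinear `hkJ G z` twice conjugates one of the two factors `z` and cancels `G`
    -- against its inverse, which leaves `-|z|²`.
    have hJ : ∀ z : ℂ, z * star z = 1 → hkJ G z (hkJ G z p) = -p := by
      intro z hz
      refine Prod.ext ?_ ?_
      · simp only [hkJ, LinearMap.coe_mk, AddHom.coe_mk, star_smul, star_toC_mulVec, star_star,
          Matrix.mulVec_smul, toC_inv_mul hdet, smul_smul, Prod.fst_neg]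
        rw [← neg_one_smul ℂ p.1]
        congr 1
        simp only [star_mul', Complex.star_def, Complex.conj_ofReal, map_ofNat] at hz ⊢
        field_simp
        linear_combination -hz
      · simp only [hkJ, LinearMap.coe_mk, AddHom.coe_mk, star_smul, star_toC_mulVec, star_star,
          Matrix.mulVec_smul, toC_mul_inv hdet, smul_smul, Prod.snd_neg]
        rw [← neg_one_smul ℂ p.2]
        congr 1
        simp only [star_neg, star_mul', star_div₀, Complex.star_def, Complex.conj_ofReal,
          map_ofNat] at hz ⊢
        field_simp
        linear_combination -hz
    fin_cases α
    · exact hJ 1 (by simp)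
    · exact hJ Complex.I (by simp)
    · change Complex.I • Complex.I • p = -p
      rw [smul_smul, Complex.I_mul_I, neg_one_smul]
  quaternion p := by
    have hpi : (Real.pi : ℂ) ≠ 0 := by exact_mod_cast Real.pi_ne_zero
    change hkJ G 1 (hkJ G Complex.I p) = Complex.I • p
    refine Prod.ext ?_ ?_
    · simp only [hkJ, LinearMap.coe_mk, AddHom.coe_mk, star_smul, star_toC_mulVec, star_star,
          Matrix.mulVec_smul, toC_inv_mul hdet, smul_smul, Prod.smul_fst]
      congr 1
      simp only [star_mul', Complex.star_def, Complex.conj_ofReal, map_ofNat, Complex.conj_I]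
      field_simp
    · simp only [hkJ, LinearMap.coe_mk, AddHom.coe_mk, star_smul, star_toC_mulVec, star_star,
          Matrix.mulVec_smul, toC_mul_inv hdet, smul_smul, Prod.smul_snd]
      congr 1
      simp only [star_neg, star_mul', star_div₀, Complex.star_def, Complex.conj_ofReal,
          map_ofNat, Complex.conj_I]
      field_simp
  kahler α p q := by
    fin_cases α
    · change (hkSymplectic p q).re = (hkHermitian G (hkJ G 1 p) q).re
      rw [hkHermitian_hkJ hG hdet, one_mul, Complex.conj_re]
    · change (hkSymplectic p q).im = (hkHermitian G (hkJ G Complex.I p) q).re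
      rw [hkHermitian_hkJ hG hdet, Complex.I_mul_re, Complex.conj_im, neg_neg]
    · change (Complex.I * hkHermitian G p q).re = (hkHermitian G (Complex.I • p) q).re
      rw [hkHermitian_I_smul]

theorem IsHKAlgebra.comap {V K : Type*} [AddCommGroup V] [Module ℝ V] [AddCommGroup K]
    [Module ℝ K] {g : K → K → ℝ} {I : Fin 3 → K →ₗ[ℝ] K} {Φ : Fin 3 → K → K → ℝ}
    (h : IsHKAlgebra g I Φ) (T : V ≃ₗ[ℝ] K) :
    IsHKAlgebra (fun ξ η => g (T ξ) (T η))
      (fun α => T.symm.toLinearMap ∘ₗ I α ∘ₗ T.toLinearMap) (fun α ξ η => Φ α (T ξ) (T η)) where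
  bilin := ⟨fun ξ => ⟨fun η η' => by beta_reduce; rw [map_add, (h.bilin.1 _).map_add],
      fun c η => by beta_reduce; rw [map_smul, (h.bilin.1 _).map_smul]⟩,
    fun η => ⟨fun ξ ξ' => by beta_reduce; rw [map_add, (h.bilin.2 _).map_add],
      fun c ξ => by beta_reduce; rw [map_smul, (h.bilin.2 _).map_smul]⟩⟩
  symm ξ η := h.symm _ _
  nondegenerate ξ hξ := by
    rw [← T.map_eq_zero_iff]
    refine h.nondegenerate _ fun q => ?_
    simpa using hξ (T.symm q)
  sq α ξ := by simp [h.sq]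
  quaternion ξ := by simp [h.quaternion]
  kahler α ξ η := by simp [h.kahler]

end HyperkahlerAlgebra

/-! ### The forms in a support frame -/

section SupportFrameForms

variable {E : Type*} [NormedAddCommGroup E] [NormedSpace ℂ E]
  {M : Type u} [TopologicalSpace M] [ChartedSpace E M]
  {r : ℕ} {Γf : Type v} [AddCommGroup Γf] {L : ChargeLattice.{u, v, w} M r Γf}
  {θf : Γf →+ Real.Angle} {Z : CentralCharge E L} {Ω : ∀ p, L.fib p → ℤ}
  {U : Set M} {e : ∀ q : M, Model r Γf ≃+ L.fib q}

/-- The `r` independent covectors `dZ_{γ^i}` span the dual space, as its dimension is `r`. -/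
theorem exists_tau [FiniteDimensional ℂ E] (hr : Module.finrank ℂ E = r)
    (hZ : IsCentralChargeASK Z) (he : L.IsFlatFrame U e) {p : M} (hp : p ∈ U) :
    ∃ τ : Matrix (Fin r) (Fin r) ℂ,
      ∀ i, dZ Z p (gammaTilde e p i) = ∑ j, τ i j • dZ Z p (gammaUp e p j) := by
  have h1 := hZ.coframe U e he p hp
  have h2 : Module.finrank ℂ (E →L[ℂ] ℂ) = r := by
    rw [← LinearMap.toContinuousLinearMap.finrank_eq, Module.finrank_linearMap_self, hr]
  have h3 := h1.span_eq_top_of_card_eq_finrank' (by rw [h2, Fintype.card_fin])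
  have h4 : ∀ i, ∃ c : Fin r → ℂ, ∑ j, c j • dZ Z p (gammaUp e p j) = dZ Z p (gammaTilde e p i) :=
    fun i => (Submodule.mem_span_range_iff_exists_fun ℂ).1 (by rw [h3]; trivial)
  choose τ hτ using h4
  exact ⟨Matrix.of τ, fun i => (hτ i).symm⟩

theorem eq_zero_of_dZ_gammaUp [FiniteDimensional ℂ E] (hr : Module.finrank ℂ E = r)
    (hZ : IsCentralChargeASK Z) (he : L.IsFlatFrame U e) {p : M} (hp : p ∈ U) {a : E}
    (ha : ∀ i, dZ Z p (gammaUp e p i) a = 0) : a = 0 := by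
  have h1 := hZ.coframe U e he p hp
  have h2 : Module.finrank ℂ (E →L[ℂ] ℂ) = r := by
    rw [← LinearMap.toContinuousLinearMap.finrank_eq, Module.finrank_linearMap_self, hr]
  have h3 := h1.span_eq_top_of_card_eq_finrank' (by rw [h2, Fintype.card_fin])
  refine (Module.forall_dual_apply_eq_zero_iff ℂ a).1 fun φ => ?_
  obtain ⟨c, hc⟩ := (Submodule.mem_span_range_iff_exists_fun ℂ (v := fun i => dZ Z p (gammaUp e p i))
    (x := LinearMap.toContinuousLinearMap φ)).1 (by rw [h3]; trivial)
  have := congrArg (fun F : E →L[ℂ] ℂ => F a) hc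
  simp only [sum_apply, smul_apply, ha, smul_zero, Finset.sum_const_zero] at this
  exact this.symm

theorem exists_dZ_gammaUp_eq [FiniteDimensional ℂ E] (hr : Module.finrank ℂ E = r)
    (hZ : IsCentralChargeASK Z) (he : L.IsFlatFrame U e) {p : M} (hp : p ∈ U) (c : Fin r → ℂ) :
    ∃ a : E, ∀ i, dZ Z p (gammaUp e p i) a = c i := by
  let A : E →ₗ[ℂ] (Fin r → ℂ) := LinearMap.pi fun i => (dZ Z p (gammaUp e p i)).toLinearMap
  have hA : Function.Injective A := by
    rw [← LinearMap.ker_eq_bot, LinearMap.ker_eq_bot']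
    exact fun a ha => eq_zero_of_dZ_gammaUp hr hZ he hp fun i => congrFun ha i
  obtain ⟨a, ha⟩ := (LinearMap.injective_iff_surjective_of_finrank_eq_finrank
    (by rw [hr, Module.finrank_fin_fun])).1 hA c
  exact ⟨a, fun i => congrFun ha i⟩

/-- Symmetry is the condition `⟨dZ ∧ dZ⟩ = 0`, evaluated on two vectors of the basis dual to the
`dZ_{γ^i}`. -/
theorem isSymm_tau [FiniteDimensional ℂ E] (hr : Module.finrank ℂ E = r)
    (hZ : IsCentralChargeASK Z) (he : L.IsFlatFrame U e) {p : M} (hp : p ∈ U)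
    {τ : Matrix (Fin r) (Fin r) ℂ}
    (hτ : ∀ i, dZ Z p (gammaTilde e p i) = ∑ j, τ i j • dZ Z p (gammaUp e p j)) (i j : Fin r) :
    τ i j = τ j i := by
  obtain ⟨a, ha⟩ := exists_dZ_gammaUp_eq hr hZ he hp (Pi.single j 1)
  obtain ⟨b, hb⟩ := exists_dZ_gammaUp_eq hr hZ he hp (Pi.single i 1)
  have h1 := fun a b => dualPairing_eq (he.adapted p hp) (φ := dZhom Z p a) (ψ := dZhom Z p b)
    (fun f => by rw [dZhom_apply, dZ_flavor]; rfl) (fun f => by rw [dZhom_apply, dZ_flavor]; rfl)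
  have h2 : L.dualPairing p (dZhom Z p a) (dZhom Z p b)
    - L.dualPairing p (dZhom Z p b) (dZhom Z p a) = 0 := hZ.lagrangian p a b
  have ht : ∀ i a, dZ Z p (e p (Pi.single i 1, 0, 0)) a
      = ∑ j, τ i j * dZ Z p (e p (0, Pi.single j 1, 0)) a := fun i a => by
    have := congrArg (fun F : E →L[ℂ] ℂ => F a) (hτ i)
    simp only [sum_apply, smul_apply, smul_eq_mul] at this
    exact this
  have ha' : ∀ i, dZ Z p (e p (0, Pi.single i 1, 0)) a = _ := ha
  have hb' : ∀ i, dZ Z p (e p (0, Pi.single i 1, 0)) b = _ := hb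
  rw [h1, h1] at h2
  simp only [dZhom_apply, ht, ha', hb', Pi.single_apply, mul_ite, mul_one, mul_zero, ite_mul,
    one_mul, zero_mul, Finset.sum_ite_eq', Finset.mem_univ, if_true, Finset.sum_sub_distrib] at h2
  linear_combination h2 / 2

/-- In a support frame an active charge has no `γ̃_i` component, and its flavor component is killed
by `φ`. The formulas for the individual instanton terms all rest on this expansion. -/
theorem IsSupportFrame.hom_eq (he : IsSupportFrame Ω U e) {p : M} (hp : p ∈ U) {γ : L.fib p}
    (hγ : Ω p γ ≠ 0) (φ : L.fib p →+ ℂ) (hφ : ∀ f, φ (L.flavor p f) = 0) :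
    φ γ = ∑ i, (nCoeff e p γ i : ℂ) * φ (gammaUp e p i) := by
  have h1 := hom_frame_eq (e p) φ ((e p).symm γ)
  rw [AddEquiv.apply_symm_apply, (he.1.adapted p hp).flavor, hφ, he.2 p hp γ hγ] at h1
  simpa [nCoeff, gammaUp] using h1

variable {x : TorusBundle L θf}

theorem IsSupportFrame.dZp_eq (he : IsSupportFrame Ω U e) (hx : x.1 ∈ U) {γ : L.fib x.1}
    (hγ : Ω x.1 γ ≠ 0) (ξ : Tan E x) :
    dZp Z x ξ γ = ∑ i, (nCoeff e x.1 γ i : ℂ) * dZp Z x ξ (gammaUp e x.1 i) :=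
  he.hom_eq hx hγ (dZhom Z x.1 ξ.1) (dZp_flavor Z x ξ)

theorem IsSupportFrame.dTheta_eq (he : IsSupportFrame Ω U e) (hx : x.1 ∈ U) {γ : L.fib x.1}
    (hγ : Ω x.1 γ ≠ 0) (ξ : Tan E x) :
    dTheta x ξ γ = ∑ i, (nCoeff e x.1 γ i : ℂ) * dTheta x ξ (gammaUp e x.1 i) :=
  he.hom_eq hx hγ (dThetaHom x ξ) (dTheta_flavor x ξ)

theorem IsSupportFrame.WinstTerm_eq (he : IsSupportFrame Ω U e) (hx : x.1 ∈ U) (i : Fin r)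
    (ξ : Tan E x) (γ : L.fib x.1) :
    WinstTerm Z Ω e x i ξ γ = AinstTerm Z Ω e x i ξ γ
      - Complex.I * ∑ j, NinstTerm Z Ω e x i j γ * dTheta x ξ (gammaUp e x.1 j) := by
  by_cases h0 : Ω x.1 γ = 0
  · simp [WinstTerm, AinstTerm, NinstTerm, h0]
  simp only [WinstTerm, AinstTerm, NinstTerm, mul_assoc]
  rw [he.dTheta_eq hx h0 ξ]
  simp only [← Finset.mul_sum]
  ring

theorem IsSupportFrame.omega12Term_eq (he : IsSupportFrame Ω U e) (hx : x.1 ∈ U)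
    (ξ η : Tan E x) (γ : L.fib x.1) :
    omega12Term Z Ω x ξ η γ = 1 / (2 * Real.pi) * ∑ i,
      wedge (fun ζ => dZp Z x ζ (gammaUp e x.1 i)) (fun ζ => WinstTerm Z Ω e x i ζ γ) ξ η := by
  by_cases h0 : Ω x.1 γ = 0
  · simp [WinstTerm, omega12Term, wedge, h0]
  have hpi : (Real.pi : ℂ) ≠ 0 := by exact_mod_cast Real.pi_ne_zero
  have h1 : ∑ i, wedge (fun ζ => dZp Z x ζ (gammaUp e x.1 i))
      (fun ζ => WinstTerm Z Ω e x i ζ γ) ξ η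
      = (Ω x.1 γ : ℂ) * (dZp Z x ξ γ * (2 * Real.pi * Ainst Z x γ η
          - Complex.I * Vinst Z x γ * dTheta x η γ)
        - dZp Z x η γ * (2 * Real.pi * Ainst Z x γ ξ
          - Complex.I * Vinst Z x γ * dTheta x ξ γ)) := by
    rw [he.dZp_eq hx h0 ξ, he.dZp_eq hx h0 η, Finset.sum_mul, Finset.sum_mul,
      ← Finset.sum_sub_distrib, Finset.mul_sum]
    refine Finset.sum_congr rfl fun i _ => ?_
    simp only [wedge, WinstTerm]
    ring
  rw [h1]
  simp only [omega12Term, wedge]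
  field_simp
  ring

theorem IsSupportFrame.omega3Term_eq (he : IsSupportFrame Ω U e) (hx : x.1 ∈ U)
    (ξ η : Tan E x) (γ : L.fib x.1) :
    omega3Term Z Ω x ξ η γ = Complex.I / 2 * ∑ i, ∑ j, NinstTerm Z Ω e x i j γ
        * wedgeBar (fun ζ => dZp Z x ζ (gammaUp e x.1 i))
          (fun ζ => dZp Z x ζ (gammaUp e x.1 j)) ξ η
      + 1 / (4 * Real.pi ^ 2) * ∑ i, wedge (fun ζ => dTheta x ζ (gammaUp e x.1 i))
          (fun ζ => AinstTerm Z Ω e x i ζ γ) ξ η := by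
  by_cases h0 : Ω x.1 γ = 0
  · simp [AinstTerm, NinstTerm, omega3Term, wedge, h0]
  have hpi : (Real.pi : ℂ) ≠ 0 := by exact_mod_cast Real.pi_ne_zero
  have h1 : ∑ i, ∑ j, NinstTerm Z Ω e x i j γ
        * wedgeBar (fun ζ => dZp Z x ζ (gammaUp e x.1 i))
          (fun ζ => dZp Z x ζ (gammaUp e x.1 j)) ξ η
      = (Ω x.1 γ : ℂ) * Vinst Z x γ * (dZp Z x ξ γ * (starRingEnd ℂ) (dZp Z x η γ)
        - dZp Z x η γ * (starRingEnd ℂ) (dZp Z x ξ γ)) := by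
    rw [he.dZp_eq hx h0 ξ, he.dZp_eq hx h0 η]
    simp only [map_sum, map_mul, map_intCast, Finset.sum_mul_sum]
    simp only [← Finset.sum_sub_distrib, Finset.mul_sum]
    refine Finset.sum_congr rfl fun i _ => Finset.sum_congr rfl fun j _ => ?_
    simp only [wedgeBar, wedge, NinstTerm]
    ring
  have h2 : ∑ i, wedge (fun ζ => dTheta x ζ (gammaUp e x.1 i))
          (fun ζ => AinstTerm Z Ω e x i ζ γ) ξ η
      = (Ω x.1 γ : ℂ) * (2 * Real.pi) * (dTheta x ξ γ * Ainst Z x γ η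
        - dTheta x η γ * Ainst Z x γ ξ) := by
    rw [he.dTheta_eq hx h0 ξ, he.dTheta_eq hx h0 η, Finset.sum_mul, Finset.sum_mul,
      ← Finset.sum_sub_distrib, Finset.mul_sum]
    refine Finset.sum_congr rfl fun i _ => ?_
    simp only [wedge, AinstTerm]
    ring
  rw [h1, h2]
  simp only [omega3Term, wedge, dZbarp_eq]
  field_simp
  ring

theorem IsSupportFrame.tensorTTerm_eq (he : IsSupportFrame Ω U e) (hx : x.1 ∈ U)
    (ξ η : Tan E x) (γ : L.fib x.1) :
    tensorTTerm Z Ω x ξ η γ = ∑ i, ∑ j, NinstTerm Z Ω e x i j γ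
        * symProdBar (fun ζ => dZp Z x ζ (gammaUp e x.1 i))
          (fun ζ => dZp Z x ζ (gammaUp e x.1 j)) ξ η := by
  by_cases h0 : Ω x.1 γ = 0
  · simp [NinstTerm, tensorTTerm, h0]
  have h1 := Complex.add_conj (dZp Z x ξ γ * dZbarp Z x η γ)
  rw [tensorTTerm]
  simp only [dZbarp_eq, map_mul, Complex.conj_conj] at h1 ⊢
  push_cast at h1
  rw [he.dZp_eq hx h0 ξ, he.dZp_eq hx h0 η] at h1 ⊢
  have h2 : ∑ i, ∑ j, NinstTerm Z Ω e x i j γ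
        * symProdBar (fun ζ => dZp Z x ζ (gammaUp e x.1 i))
          (fun ζ => dZp Z x ζ (gammaUp e x.1 j)) ξ η
      = (Ω x.1 γ : ℂ) * Vinst Z x γ / 2
        * ((∑ i, (nCoeff e x.1 γ i : ℂ) * dZp Z x ξ (gammaUp e x.1 i))
          * (starRingEnd ℂ) (∑ i, (nCoeff e x.1 γ i : ℂ) * dZp Z x η (gammaUp e x.1 i))
        + (∑ i, (nCoeff e x.1 γ i : ℂ) * dZp Z x η (gammaUp e x.1 i))
          * (starRingEnd ℂ) (∑ i, (nCoeff e x.1 γ i : ℂ) * dZp Z x ξ (gammaUp e x.1 i))) := by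
    simp only [map_sum, map_mul, map_intCast, Finset.sum_mul_sum]
    simp only [← Finset.sum_add_distrib, Finset.mul_sum]
    refine Finset.sum_congr rfl fun i _ => Finset.sum_congr rfl fun j _ => ?_
    simp only [symProdBar, NinstTerm]
    ring
  rw [h2]
  linear_combination (-(Ω x.1 γ : ℂ) * Vinst Z x γ / 2) * h1

end SupportFrameForms

/-! ### The summed formulas in a support frame. -/

section SupportFrameSums

variable {E : Type*} [NormedAddCommGroup E] [NormedSpace ℂ E] [FiniteDimensional ℂ E]
  {M : Type u} [TopologicalSpace M] [ChartedSpace E M] [IsManifold 𝓘(ℂ, E) ω M]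
  {r : ℕ} {Γf : Type v} [AddCommGroup Γf] [Module.Free ℤ Γf] [Module.Finite ℤ Γf]
  {L : ChargeLattice.{u, v, w} M r Γf}
  {θf : Γf →+ Real.Angle} {Z : CentralCharge E L} {Ω : ∀ p, L.fib p → ℤ}
  {U : Set M} {e : ∀ q : M, Model r Γf ≃+ L.fib q} {x : TorusBundle L θf}
  {τ : Matrix (Fin r) (Fin r) ℂ}

/-- The matrix `N + N^inst`, as a real matrix. -/
def realGmatrix (Z : CentralCharge E L) (Ω : ∀ p, L.fib p → ℤ)
    (e : ∀ q : M, Model r Γf ≃+ L.fib q) (x : TorusBundle L θf)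
    (τ : Matrix (Fin r) (Fin r) ℂ) : Matrix (Fin r) (Fin r) ℝ :=
  Matrix.of fun i j => (τ i j).im + (∑' γ : L.fib x.1, NinstTerm Z Ω e x i j γ).re

theorem Gmatrix_eq (hΩ : IsBPSVariation Z Ω) :
    Gmatrix Z Ω e x τ = toC (realGmatrix Z Ω e x τ) := by
  ext i j
  have h := tsum_im_eq_zero (NinstTerm_neg hΩ e x i j)
  simp only [Gmatrix, toC, realGmatrix, Matrix.map_apply, Matrix.of_apply, Complex.ofReal_add]
  congr 1
  exact Complex.ext (by simp) (by simp [h])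

theorem isSymm_realGmatrix (hτ : ∀ i j, τ i j = τ j i) : (realGmatrix Z Ω e x τ).IsSymm := by
  ext i j
  simp only [Matrix.transpose_apply, realGmatrix, Matrix.of_apply, hτ j i]
  congr 2
  exact tsum_congr fun γ => by simp only [NinstTerm]; ring

/-- The sum of the real forms `2π Ω(γ) n_i(γ) A_γ^inst`. -/
def Pform (Z : CentralCharge E L) (Ω : ∀ p, L.fib p → ℤ)
    (e : ∀ q : M, Model r Γf ≃+ L.fib q) (x : TorusBundle L θf) (i : Fin r) (ξ : Tan E x) : ℂ :=
  ∑' γ : L.fib x.1, AinstTerm Z Ω e x i ξ γ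

theorem conj_Pform (hΩ : IsBPSVariation Z Ω) (i : Fin r) (ξ : Tan E x) :
    (starRingEnd ℂ) (Pform Z Ω e x i ξ) = Pform Z Ω e x i ξ :=
  Complex.conj_eq_iff_im.2 (tsum_im_eq_zero (AinstTerm_neg hΩ e x i ξ))

theorem Pform_of_fst_eq_zero (i : Fin r) {ξ : Tan E x} (hξ : ξ.1 = 0) :
    Pform Z Ω e x i ξ = 0 := by
  refine (tsum_congr fun γ => ?_).trans tsum_zero
  simp [AinstTerm, Ainst, dZbarp_eq, dZp, dZform, hξ]

theorem isRealForm_Yform (hHK : IsHKVariation Z Ω) (hloc : IsMutuallyLocal L Ω)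
    (he : L.IsFlatFrame U e) (hx : x.1 ∈ U) (i : Fin r) :
    IsRealForm (Yform Z Ω e x τ i : Tan E x → ℂ) := by
  have hW := summable_WinstTerm hHK hloc he hx i
  have hT := fun γ => isRealForm_dTheta (E := E) x γ
  have hA := fun γ => isRealForm_Ainst (E := E) Z x γ
  refine ⟨fun ξ ξ' => ?_, fun c ξ => ?_⟩
  · have h1 : ∑' γ, WinstTerm Z Ω e x i (ξ + ξ') γ
        = ∑' γ, WinstTerm Z Ω e x i ξ γ + ∑' γ, WinstTerm Z Ω e x i ξ' γ := by
      rw [← (hW ξ).tsum_add (hW ξ')]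
      refine tsum_congr fun γ => ?_
      simp only [WinstTerm, (hT _).add, (hA _).add]
      ring
    simp only [Yform, Wform, h1, (hT _).add, mul_add, Finset.sum_add_distrib]
    ring
  · have h1 : ∑' γ, WinstTerm Z Ω e x i (c • ξ) γ = c * ∑' γ, WinstTerm Z Ω e x i ξ γ := by
      rw [← tsum_mul_left]
      refine tsum_congr fun γ => ?_
      simp only [WinstTerm, (hT _).smul, (hA _).smul]
      ring
    simp only [Yform, Wform, h1, (hT _).smul, mul_left_comm _ (c : ℂ), ← Finset.mul_sum]
    ring

/-- The decomposition `Y = R - i G v` into real and imaginary parts: `Im τ` comes from `W`, the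
matrix `N^inst` from the `V_γ^inst dθ_γ`, and the real `A_γ^inst` sums go into `R`. -/
theorem Yform_eq (hHK : IsHKVariation Z Ω) (hloc : IsMutuallyLocal L Ω)
    (he : IsSupportFrame Ω U e) (hx : x.1 ∈ U) (i : Fin r) (ξ : Tan E x) :
    Yform Z Ω e x τ i ξ = (dTheta x ξ (gammaTilde e x.1 i)
      - ∑ j, ((τ i j).re : ℂ) * dTheta x ξ (gammaUp e x.1 j) + Pform Z Ω e x i ξ)
      - Complex.I * ∑ j, Gmatrix Z Ω e x τ i j * dTheta x ξ (gammaUp e x.1 j) := by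
  have hN := fun j => (summable_NinstTerm hHK hloc he.1 hx i j).hasSum
  have hA := (summable_AinstTerm hHK hloc he.1 hx i ξ).hasSum
  have h1 : ∑' γ, WinstTerm Z Ω e x i ξ γ = Pform Z Ω e x i ξ
      - Complex.I * ∑ j, (∑' γ, NinstTerm Z Ω e x i j γ) * dTheta x ξ (gammaUp e x.1 j) := by
    rw [funext (he.WinstTerm_eq hx i ξ)]
    exact (hA.sub ((hasSum_sum fun j _ => (hN j).mul_right _).mul_left _)).tsum_eq
  rw [Yform, Wform, h1]
  have h2 : ∀ j, τ i j = ((τ i j).re : ℂ) + (τ i j).im * Complex.I := fun j =>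
    (Complex.re_add_im _).symm
  have h3 : ∑ j, τ i j * dTheta x ξ (gammaUp e x.1 j)
      = ∑ j, ((τ i j).re : ℂ) * dTheta x ξ (gammaUp e x.1 j)
        + Complex.I * ∑ j, ((τ i j).im : ℂ) * dTheta x ξ (gammaUp e x.1 j) := by
    rw [Finset.mul_sum, ← Finset.sum_add_distrib]
    refine Finset.sum_congr rfl fun j _ => ?_
    conv_lhs => rw [h2 j]
    ring
  simp only [Gmatrix, Matrix.of_apply, add_mul, Finset.sum_add_distrib]
  rw [h3]
  ring

theorem dZp_gammaTilde
    (hτ : ∀ i, dZ Z x.1 (gammaTilde e x.1 i) = ∑ j, τ i j • dZ Z x.1 (gammaUp e x.1 j))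
    (i : Fin r) (ξ : Tan E x) :
    dZp Z x ξ (gammaTilde e x.1 i) = ∑ j, τ i j * dZp Z x ξ (gammaUp e x.1 j) := by
  have := congrArg (fun F : E →L[ℂ] ℂ => F ξ.1) (hτ i)
  simp only [sum_apply, smul_apply, smul_eq_mul] at this
  exact this

theorem omega12_frame (hHK : IsHKVariation Z Ω) (hloc : IsMutuallyLocal L Ω)
    (he : IsSupportFrame Ω U e) (hx : x.1 ∈ U)
    (hτ : ∀ i, dZ Z x.1 (gammaTilde e x.1 i) = ∑ j, τ i j • dZ Z x.1 (gammaUp e x.1 j))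
    (hτs : ∀ i j, τ i j = τ j i) (ξ η : Tan E x) :
    omega12 Z Ω x ξ η = 1 / (2 * Real.pi) *
      ∑ i, wedge (fun ζ => dZp Z x ζ (gammaUp e x.1 i)) (Yform Z Ω e x τ i) ξ η := by
  have hW := fun i ξ => (summable_WinstTerm hHK hloc he.1 hx i ξ).hasSum
  have h1 : ∑' γ, omega12Term Z Ω x ξ η γ = 1 / (2 * Real.pi) *
      ∑ i, wedge (fun ζ => dZp Z x ζ (gammaUp e x.1 i))
        (fun ζ => ∑' γ, WinstTerm Z Ω e x i ζ γ) ξ η := by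
    rw [funext (he.omega12Term_eq hx ξ η)]
    exact ((hasSum_sum fun i _ =>
      ((hW i η).mul_left _).sub ((hW i ξ).mul_left _)).mul_left _).tsum_eq
  have h2 : L.pairWedge x.1 (dZp Z x) (dTheta x) ξ η = -∑ i,
      wedge (fun ζ => dZp Z x ζ (gammaUp e x.1 i)) (Wform e x τ i) ξ η := by
    rw [pairWedge_dZp_dTheta Z ξ η (he.1.adapted x.1 hx)]
    change ∑ i, (wedge (fun ζ => dZp Z x ζ (gammaTilde e x.1 i))
        (fun ζ => dTheta x ζ (gammaUp e x.1 i)) ξ η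
      - wedge (fun ζ => dZp Z x ζ (gammaUp e x.1 i))
        (fun ζ => dTheta x ζ (gammaTilde e x.1 i)) ξ η) = _
    simp only [wedge, Wform, dZp_gammaTilde hτ, mul_sub, Finset.sum_sub_distrib, Finset.mul_sum,
      Finset.sum_mul]
    rw [Finset.sum_comm (f := fun i j => τ i j * dZp Z x ξ (gammaUp e x.1 j)
        * dTheta x η (gammaUp e x.1 i)),
      Finset.sum_comm (f := fun i j => τ i j * dZp Z x η (gammaUp e x.1 j)
        * dTheta x ξ (gammaUp e x.1 i))]
    have h3 : ∀ ξ η : Tan E x, ∑ i, ∑ j, τ j i * dZp Z x ξ (gammaUp e x.1 i)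
        * dTheta x η (gammaUp e x.1 j) = ∑ i, ∑ j, dZp Z x ξ (gammaUp e x.1 i)
          * (τ i j * dTheta x η (gammaUp e x.1 j)) := fun ξ η =>
      Finset.sum_congr rfl fun i _ => Finset.sum_congr rfl fun j _ => by rw [hτs j i]; ring
    rw [h3, h3]
    ring
  have h3 : ∑ i, wedge (fun ζ => dZp Z x ζ (gammaUp e x.1 i)) (Yform Z Ω e x τ i) ξ η
      = ∑ i, wedge (fun ζ => dZp Z x ζ (gammaUp e x.1 i)) (Wform e x τ i) ξ η
        + ∑ i, wedge (fun ζ => dZp Z x ζ (gammaUp e x.1 i))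
          (fun ζ => ∑' γ, WinstTerm Z Ω e x i ζ γ) ξ η := by
    rw [← Finset.sum_add_distrib]
    exact Finset.sum_congr rfl fun i _ => by simp only [wedge, Yform]; ring
  rw [omega12, h1, h2, h3]
  ring

/-- Substituting `dZ_{γ̃} = τ dZ_γ` leaves the coefficients `τ - τ̄ = 2i Im τ`, once `τ` is known to
be symmetric. -/
theorem pairWedge_dZp_frame (he : L.IsFlatFrame U e) (hx : x.1 ∈ U)
    (hτ : ∀ i, dZ Z x.1 (gammaTilde e x.1 i) = ∑ j, τ i j • dZ Z x.1 (gammaUp e x.1 j))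
    (hτs : ∀ i j, τ i j = τ j i) (ξ η : Tan E x) :
    1 / 4 * L.pairWedge x.1 (dZp Z x) (dZbarp Z x) ξ η = Complex.I / 2 *
      ∑ i, ∑ j, ((τ i j).im : ℂ) * wedgeBar (fun ζ => dZp Z x ζ (gammaUp e x.1 i))
        (fun ζ => dZp Z x ζ (gammaUp e x.1 j)) ξ η := by
  rw [pairWedge_dZp_dZbarp Z ξ η (he.adapted x.1 hx)]
  change 1 / 4 * ∑ i, (wedgeBar (fun ζ => dZp Z x ζ (gammaTilde e x.1 i))
      (fun ζ => dZp Z x ζ (gammaUp e x.1 i)) ξ η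
    - wedgeBar (fun ζ => dZp Z x ζ (gammaUp e x.1 i))
      (fun ζ => dZp Z x ζ (gammaTilde e x.1 i)) ξ η) = _
  have h1 : ∀ i, wedgeBar (fun ζ => dZp Z x ζ (gammaTilde e x.1 i))
      (fun ζ => dZp Z x ζ (gammaUp e x.1 i)) ξ η
      = ∑ j, τ i j * wedgeBar (fun ζ => dZp Z x ζ (gammaUp e x.1 j))
      (fun ζ => dZp Z x ζ (gammaUp e x.1 i)) ξ η := fun i => by
    simp only [wedgeBar, wedge, dZp_gammaTilde hτ, Finset.sum_mul, ← Finset.sum_sub_distrib]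
    exact Finset.sum_congr rfl fun j _ => by ring
  have h2 : ∀ i, wedgeBar (fun ζ => dZp Z x ζ (gammaUp e x.1 i))
      (fun ζ => dZp Z x ζ (gammaTilde e x.1 i)) ξ η
      = ∑ j, (starRingEnd ℂ) (τ i j) * wedgeBar (fun ζ => dZp Z x ζ (gammaUp e x.1 i))
      (fun ζ => dZp Z x ζ (gammaUp e x.1 j)) ξ η := fun i => by
    simp only [wedgeBar, wedge, dZp_gammaTilde hτ, map_sum, map_mul, Finset.mul_sum,
      ← Finset.sum_sub_distrib]
    exact Finset.sum_congr rfl fun j _ => by ring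
  simp only [h1, h2, Finset.sum_sub_distrib]
  rw [Finset.sum_comm, ← Finset.sum_sub_distrib, Finset.mul_sum, Finset.mul_sum]
  refine Finset.sum_congr rfl fun i _ => ?_
  rw [← Finset.sum_sub_distrib, Finset.mul_sum, Finset.mul_sum]
  refine Finset.sum_congr rfl fun j _ => ?_
  have h3 := Complex.sub_conj (τ i j)
  push_cast at h3
  rw [hτs j i]
  linear_combination (wedgeBar (fun ζ => dZp Z x ζ (gammaUp e x.1 i))
        (fun ζ => dZp Z x ζ (gammaUp e x.1 j)) ξ η / 4) * h3

/-- This form of `ω₃` does not involve the inverse of `G` and holds at every point over `U`. The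
term with `Re τ` is missing since it would cancel by symmetry. -/
theorem omega3_frame_aux (hHK : IsHKVariation Z Ω) (hloc : IsMutuallyLocal L Ω)
    (he : IsSupportFrame Ω U e) (hx : x.1 ∈ U)
    (hτ : ∀ i, dZ Z x.1 (gammaTilde e x.1 i) = ∑ j, τ i j • dZ Z x.1 (gammaUp e x.1 j))
    (hτs : ∀ i j, τ i j = τ j i) (ξ η : Tan E x) :
    omega3 Z Ω x ξ η = Complex.I / 2 * ∑ i, ∑ j, Gmatrix Z Ω e x τ i j *
        wedgeBar (fun ζ => dZp Z x ζ (gammaUp e x.1 i))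
          (fun ζ => dZp Z x ζ (gammaUp e x.1 j)) ξ η
      - 1 / (4 * Real.pi ^ 2) * ∑ i, wedge (fun ζ => dTheta x ζ (gammaTilde e x.1 i)
          + Pform Z Ω e x i ζ) (fun ζ => dTheta x ζ (gammaUp e x.1 i)) ξ η := by
  have hN := fun i j => (summable_NinstTerm hHK hloc he.1 hx i j).hasSum
  have hA := fun i ξ => (summable_AinstTerm hHK hloc he.1 hx i ξ).hasSum
  have h1 : ∑' γ, omega3Term Z Ω x ξ η γ
      = Complex.I / 2 * ∑ i, ∑ j, (∑' γ, NinstTerm Z Ω e x i j γ)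
        * wedgeBar (fun ζ => dZp Z x ζ (gammaUp e x.1 i))
          (fun ζ => dZp Z x ζ (gammaUp e x.1 j)) ξ η
      + 1 / (4 * Real.pi ^ 2) * ∑ i, wedge (fun ζ => dTheta x ζ (gammaUp e x.1 i))
          (fun ζ => Pform Z Ω e x i ζ) ξ η := by
    rw [funext (he.omega3Term_eq hx ξ η)]
    exact (((hasSum_sum fun i _ => hasSum_sum fun j _ => (hN i j).mul_right _).mul_left _).add
      ((hasSum_sum fun i _ =>
      ((hA i η).mul_left _).sub ((hA i ξ).mul_left _)).mul_left _)).tsum_eq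
  have h2 : L.pairWedge x.1 (dTheta x) (dTheta x) ξ η
      = ∑ i, 2 * wedge (fun ζ => dTheta x ζ (gammaTilde e x.1 i))
        (fun ζ => dTheta x ζ (gammaUp e x.1 i)) ξ η :=
    pairWedge_dTheta_dTheta ξ η (he.1.adapted x.1 hx)
  rw [omega3, pairWedge_dZp_frame he.1 hx hτ hτs, h1, h2]
  have h3 : ∑ i, wedge (fun ζ => dTheta x ζ (gammaTilde e x.1 i)
          + Pform Z Ω e x i ζ) (fun ζ => dTheta x ζ (gammaUp e x.1 i)) ξ η
      = ∑ i, wedge (fun ζ => dTheta x ζ (gammaTilde e x.1 i))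
          (fun ζ => dTheta x ζ (gammaUp e x.1 i)) ξ η
        - ∑ i, wedge (fun ζ => dTheta x ζ (gammaUp e x.1 i))
          (fun ζ => Pform Z Ω e x i ζ) ξ η := by
    rw [← Finset.sum_sub_distrib]
    exact Finset.sum_congr rfl fun i _ => by simp only [wedge]; ring
  rw [h3]
  simp only [Gmatrix, Matrix.of_apply, add_mul, Finset.sum_add_distrib, ← Finset.mul_sum]
  ring

theorem tensorT_frame (hHK : IsHKVariation Z Ω) (hloc : IsMutuallyLocal L Ω)
    (he : IsSupportFrame Ω U e) (hx : x.1 ∈ U)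
    (hτ : ∀ i, dZ Z x.1 (gammaTilde e x.1 i) = ∑ j, τ i j • dZ Z x.1 (gammaUp e x.1 j))
    (hτs : ∀ i j, τ i j = τ j i) (ξ η : Tan E x) :
    tensorT Z Ω x ξ η = ∑ i, ∑ j, Gmatrix Z Ω e x τ i j *
      symProdBar (fun ζ => dZp Z x ζ (gammaUp e x.1 i))
          (fun ζ => dZp Z x ζ (gammaUp e x.1 j)) ξ η := by
  have hN := fun i j => (summable_NinstTerm hHK hloc he.1 hx i j).hasSum
  have h1 : ∑' γ, tensorTTerm Z Ω x ξ η γ = ∑ i, ∑ j, (∑' γ, NinstTerm Z Ω e x i j γ) *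
      symProdBar (fun ζ => dZp Z x ζ (gammaUp e x.1 i))
          (fun ζ => dZp Z x ζ (gammaUp e x.1 j)) ξ η := by
    rw [funext (he.tensorTTerm_eq hx ξ η)]
    exact (hasSum_sum fun i _ => hasSum_sum fun j _ => (hN i j).mul_right _).tsum_eq
  have h2 : gSK Z x.1 ξ.1 η.1 = ∑ i, ∑ j, ((τ i j).im : ℂ) *
      symProdBar (fun ζ => dZp Z x ζ (gammaUp e x.1 i))
          (fun ζ => dZp Z x ζ (gammaUp e x.1 j)) ξ η := by
    -- The metric is `ω(-, J -)`, so the second argument is multiplied by `i`; conjugation then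
    -- turns the wedge product into the symmetric one.
    have h3 := pairWedge_dZp_frame he.1 hx hτ hτs ξ ((Complex.I • η.1, 0) : Tan E x)
    refine Eq.trans h3 ?_
    rw [Finset.mul_sum]
    refine Finset.sum_congr rfl fun i _ => ?_
    rw [Finset.mul_sum]
    refine Finset.sum_congr rfl fun j _ => ?_
    have h4 : ∀ γ, dZp Z x ((Complex.I • η.1, 0) : Tan E x) γ = Complex.I * dZp Z x η γ := fun γ =>
      (dZ Z x.1 γ).map_smul _ _
    simp only [wedgeBar, wedge, symProdBar, h4, map_mul, Complex.conj_I]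
    linear_combination (-((τ i j).im : ℂ) / 2 * (dZp Z x ξ (gammaUp e x.1 i)
      * (starRingEnd ℂ) (dZp Z x η (gammaUp e x.1 j)) + dZp Z x η (gammaUp e x.1 i)
      * (starRingEnd ℂ) (dZp Z x ξ (gammaUp e x.1 j)))) * Complex.I_sq
  rw [tensorT, h1, h2]
  simp only [Gmatrix, Matrix.of_apply, add_mul, Finset.sum_add_distrib]

end SupportFrameSums

/-! ### The coframe `(dZ, W + W^inst)` and its non-degeneracy. -/

section Coframe

open Matrix

theorem sum_wedgeBar {V : Type*} {r : ℕ} (G : Matrix (Fin r) (Fin r) ℂ) (a : Fin r → V → ℂ)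
    (ξ η : V) : ∑ i, ∑ j, G i j * wedgeBar (a i) (a j) ξ η
      = (fun i => a i ξ) ⬝ᵥ G *ᵥ star (fun i => a i η)
        - (fun i => a i η) ⬝ᵥ G *ᵥ star (fun i => a i ξ) := by
  simp only [dotProduct, mulVec, Pi.star_apply, ← Finset.sum_sub_distrib, Finset.mul_sum]
  refine Finset.sum_congr rfl fun i _ => Finset.sum_congr rfl fun j _ => ?_
  simp only [wedgeBar, wedge, starRingEnd_apply]
  ring

theorem sum_symProdBar {V : Type*} {r : ℕ} (G : Matrix (Fin r) (Fin r) ℂ) (a : Fin r → V → ℂ)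
    (ξ η : V) : ∑ i, ∑ j, G i j * symProdBar (a i) (a j) ξ η
      = ((fun i => a i ξ) ⬝ᵥ G *ᵥ star (fun i => a i η)
        + (fun i => a i η) ⬝ᵥ G *ᵥ star (fun i => a i ξ)) / 2 := by
  simp only [dotProduct, mulVec, Pi.star_apply, ← Finset.sum_add_distrib, Finset.mul_sum,
    Finset.sum_div]
  refine Finset.sum_congr rfl fun i _ => Finset.sum_congr rfl fun j _ => ?_
  simp only [symProdBar, starRingEnd_apply]
  ring

/-- For real `R`, `v` the terms `R G⁻¹ R'` and `v G v'` are symmetric and cancel; in the mixed terms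
`G` meets its inverse. This explains why `ω₃` has both an expression with `G⁻¹` and one without. -/
theorem dotProduct_toC_inv_sub {r : ℕ} {G : Matrix (Fin r) (Fin r) ℝ} (hG : G.IsSymm)
    (hdet : IsUnit G.det) {R R' v v' : Fin r → ℂ} (hR : star R = R) (hR' : star R' = R')
    (hv : star v = v) (hv' : star v' = v') :
    (R - Complex.I • (toC G *ᵥ v)) ⬝ᵥ toC G⁻¹ *ᵥ star (R' - Complex.I • (toC G *ᵥ v'))
      - (R' - Complex.I • (toC G *ᵥ v')) ⬝ᵥ toC G⁻¹ *ᵥ star (R - Complex.I • (toC G *ᵥ v))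
      = 2 * Complex.I * (R ⬝ᵥ v' - R' ⬝ᵥ v) := by
  have h1 : ∀ R v : Fin r → ℂ, star R = R → star v = v →
      star (R - Complex.I • (toC G *ᵥ v)) = R + Complex.I • (toC G *ᵥ v) := fun R v h h' => by
    rw [star_sub, star_smul, star_toC_mulVec, h, h', Complex.star_def, Complex.conj_I, neg_smul,
      sub_neg_eq_add]
  rw [h1 R v hR hv, h1 R' v' hR' hv']
  simp only [mulVec_add, mulVec_smul, toC_inv_mul hdet, dotProduct_add, sub_dotProduct,
    dotProduct_smul, smul_dotProduct, smul_eq_mul, dotProduct_toC_inv_mul hG hdet]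
  rw [dotProduct_toC_comm (isSymm_inv hG) R' R, dotProduct_comm (toC G *ᵥ v) v',
    dotProduct_comm (toC G *ᵥ v') v, dotProduct_toC_comm hG v' v, dotProduct_comm v R',
    dotProduct_comm v' R]
  ring

variable {E : Type*} [NormedAddCommGroup E] [NormedSpace ℂ E] [FiniteDimensional ℂ E]
  {M : Type u} [TopologicalSpace M] [ChartedSpace E M] [IsManifold 𝓘(ℂ, E) ω M]
  {r : ℕ} {Γf : Type v} [AddCommGroup Γf] [Module.Free ℤ Γf] [Module.Finite ℤ Γf]
  {L : ChargeLattice.{u, v, w} M r Γf}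
  {θf : Γf →+ Real.Angle} {Z : CentralCharge E L} {Ω : ∀ p, L.fib p → ℤ}
  {U : Set M} {e : ∀ q : M, Model r Γf ≃+ L.fib q} {x : TorusBundle L θf}
  {τ : Matrix (Fin r) (Fin r) ℂ}

theorem finrank_coord (hr : Module.finrank ℂ E = r) :
    Module.finrank ℝ (Coord E r) = 2 * r + (r + r) := by
  have : FiniteDimensional ℝ E := FiniteDimensional.complexToReal E
  rw [Module.finrank_prod, Module.finrank_prod, finrank_real_of_complex, hr,
    Module.finrank_fin_fun]

theorem finite_tan (x : TorusBundle L θf) : Module.Finite ℝ (Tan E x) := by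
  have : FiniteDimensional ℝ E := FiniteDimensional.complexToReal E
  obtain ⟨p, y, hy, rfl⟩ := exists_param_eq (E := E) x
  exact Module.Finite.equiv (dParamEquiv hy)

theorem finrank_tan (hr : Module.finrank ℂ E = r) (x : TorusBundle L θf) :
    Module.finrank ℝ (Tan E x) = 2 * r + (r + r) := by
  obtain ⟨p, y, hy, rfl⟩ := exists_param_eq (E := E) x
  rw [← (dParamEquiv hy).finrank_eq, finrank_coord hr]

/-- The tangent vectors are determined by their horizontal part and the `dθ` of a frame. -/
theorem tan_ext_zero (he : L.IsFlatFrame U e) (hx : x.1 ∈ U) {ξ : Tan E x} (h : ξ.1 = 0)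
    (hu : ∀ i, dTheta x ξ (gammaTilde e x.1 i) = 0) (hv : ∀ i, dTheta x ξ (gammaUp e x.1 i) = 0) :
    ξ = 0 := by
  refine Prod.ext h (Subtype.ext (AddMonoidHom.ext fun γ => ?_))
  have h1 := hom_frame_eq (e x.1) ξ.2.1 ((e x.1).symm γ)
  rw [AddEquiv.apply_symm_apply, (he.adapted x.1 hx).flavor, ξ.2.2] at h1
  have hu' : ∀ i, ξ.2.1 (e x.1 (Pi.single i 1, 0, 0)) = 0 := fun i =>
    Complex.ofReal_eq_zero.1 (hu i)
  have hv' : ∀ i, ξ.2.1 (e x.1 (0, Pi.single i 1, 0)) = 0 := fun i =>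
    Complex.ofReal_eq_zero.1 (hv i)
  rw [h1]
  simp [hu', hv']

/-- A vertical tangent vector with prescribed `dθ` in a frame. -/
theorem exists_vert (he : L.IsFlatFrame U e) (hx : x.1 ∈ U) (a b : Fin r → ℝ) :
    ∃ ξ : Tan E x, ξ.1 = 0 ∧ (∀ i, dTheta x ξ (gammaTilde e x.1 i) = a i) ∧
      ∀ i, dTheta x ξ (gammaUp e x.1 i) = b i := by
  let φ : L.fib x.1 →+ ℝ := AddMonoidHom.mk' (fun γ => ∑ i, ((((e x.1).symm γ).1 i : ℝ) * a i
      + (((e x.1).symm γ).2.1 i : ℝ) * b i)) (by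
    intro γ γ'
    rw [← Finset.sum_add_distrib]
    refine Finset.sum_congr rfl fun i _ => ?_
    simp only [map_add, Prod.fst_add, Prod.snd_add, Pi.add_apply, Int.cast_add]
    ring)
  have hφ : ∀ m, φ (e x.1 m) = ∑ i, ((m.1 i : ℝ) * a i + (m.2.1 i : ℝ) * b i) := fun m => by
    simp [φ]
  refine ⟨(0, ⟨φ, fun f => ?_⟩), rfl, fun i => ?_, fun i => ?_⟩
  · rw [← (he.adapted x.1 hx).flavor, hφ]
    simp
  · have := hφ (Pi.single i 1, 0, 0)
    simp only [dTheta, gammaTilde, this]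
    simp [Pi.single_apply]
  · have := hφ (0, Pi.single i 1, 0)
    simp only [dTheta, gammaUp, this]
    simp [Pi.single_apply]

/-- The real part of `W_i + W_i^inst`. -/
def Rform (Z : CentralCharge E L) (Ω : ∀ p, L.fib p → ℤ)
    (e : ∀ q : M, Model r Γf ≃+ L.fib q) (x : TorusBundle L θf)
    (τ : Matrix (Fin r) (Fin r) ℂ) (ξ : Tan E x) (i : Fin r) : ℂ :=
  dTheta x ξ (gammaTilde e x.1 i) - ∑ j, ((τ i j).re : ℂ) * dTheta x ξ (gammaUp e x.1 j)
    + Pform Z Ω e x i ξ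

theorem star_Rform (hΩ : IsBPSVariation Z Ω) (ξ : Tan E x) :
    star (Rform Z Ω e x τ ξ) = Rform Z Ω e x τ ξ := by
  ext i
  rw [Pi.star_apply, Complex.star_def]
  simp only [Rform, map_add, map_sub, map_sum, map_mul, Complex.conj_ofReal, conj_dTheta,
    conj_Pform hΩ]

theorem star_dTheta (ξ : Tan E x) (γ : Fin r → L.fib x.1) :
    star (fun i => dTheta x ξ (γ i)) = fun i => dTheta x ξ (γ i) :=
  funext fun _ => conj_dTheta x ξ _

theorem Yform_eq_sub (hHK : IsHKVariation Z Ω) (hloc : IsMutuallyLocal L Ω)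
    (he : IsSupportFrame Ω U e) (hx : x.1 ∈ U) (ξ : Tan E x) :
    (fun i => Yform Z Ω e x τ i ξ) = Rform Z Ω e x τ ξ - Complex.I •
      (toC (realGmatrix Z Ω e x τ) *ᵥ fun i => dTheta x ξ (gammaUp e x.1 i)) := by
  ext i
  rw [Yform_eq hHK hloc he hx, Gmatrix_eq hHK.toIsBPSVariation]
  rfl

/-- Real and imaginary parts are separated by adding and subtracting the conjugate equation. -/
theorem Yform_eq_zero (hHK : IsHKVariation Z Ω) (hloc : IsMutuallyLocal L Ω)
    (he : IsSupportFrame Ω U e) (hx : x.1 ∈ U) {ξ : Tan E x}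
    (hξ : ∀ i, Yform Z Ω e x τ i ξ = 0) :
    Rform Z Ω e x τ ξ = 0 ∧
      (toC (realGmatrix Z Ω e x τ) *ᵥ fun i => dTheta x ξ (gammaUp e x.1 i)) = 0 := by
  have h1 := Yform_eq_sub (τ := τ) hHK hloc he hx ξ
  rw [funext hξ] at h1
  have h2 := congrArg star h1
  rw [star_sub, star_Rform hHK.toIsBPSVariation, star_smul, star_toC_mulVec, star_dTheta,
    Complex.star_def, Complex.conj_I, neg_smul, sub_neg_eq_add] at h2
  have h3 : star (fun _ : Fin r => (0 : ℂ)) = fun _ => 0 := by ext; simp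
  rw [h3] at h2
  refine ⟨funext fun i => ?_, funext fun i => ?_⟩
  · have h4 := congrFun h1 i
    have h5 := congrFun h2 i
    simp only [Pi.sub_apply, Pi.add_apply, Pi.smul_apply, smul_eq_mul, Pi.zero_apply] at *
    linear_combination (-1 / 2) * h4 - (1 / 2) * h5
  · have h4 := congrFun h1 i
    have h5 := congrFun h2 i
    simp only [Pi.sub_apply, Pi.add_apply, Pi.smul_apply, smul_eq_mul, Pi.zero_apply] at *
    refine mul_left_cancel₀ Complex.I_ne_zero ?_
    linear_combination (1 / 2) * h4 - (1 / 2) * h5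

/-- The coframe `(dZ_{γ^i}, W_i + W_i^inst)`. -/
def coframeMap (hHK : IsHKVariation Z Ω) (hloc : IsMutuallyLocal L Ω)
    (he : IsSupportFrame Ω U e) (hx : x.1 ∈ U) (τ : Matrix (Fin r) (Fin r) ℂ) :
    Tan E x →ₗ[ℝ] (Fin r → ℂ) × (Fin r → ℂ) where
  toFun ξ := (fun i => dZp Z x ξ (gammaUp e x.1 i), fun i => Yform Z Ω e x τ i ξ)
  map_add' ξ ξ' := Prod.ext (funext fun _ => (isRealForm_dZp Z x _).add _ _)
    (funext fun i => (isRealForm_Yform hHK hloc he.1 hx i).add _ _)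
  map_smul' c ξ := Prod.ext
    (funext fun _ => ((isRealForm_dZp Z x _).smul _ _).trans (Complex.real_smul).symm)
    (funext fun i => ((isRealForm_Yform hHK hloc he.1 hx i).smul _ _).trans
      (Complex.real_smul).symm)

theorem injective_of_forall_eq_zero {V K : Type*} [AddCommGroup V] [Module ℝ V] [AddCommGroup K]
    [Module ℝ K] {f : V →ₗ[ℝ] K} (h : ∀ ξ, f ξ = 0 → ξ = 0) : Function.Injective f :=
  (injective_iff_map_eq_zero f).2 h

/-- The group structure of the tangent space whose underlying monoid is, reducibly, the monoid
over which `Tan E x →ₗ[ℝ] Tan E x` is formed. -/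
@[reducible]
def tanGroup (x : TorusBundle L θf) : AddCommGroup (Tan E x) :=
  { (inferInstance : AddCommMonoid (Tan E x)) with
    neg := fun ξ => -ξ
    sub := fun ξ η => ξ - η
    sub_eq_add_neg := fun ξ η => sub_eq_add_neg ξ η
    zsmul := zsmulRec
    neg_add_cancel := fun ξ => neg_add_cancel ξ }

attribute [local instance] tanGroup

/-- From `dZ = 0` the vector is vertical, which kills the `A_γ^inst` part of `R`. Then `G v = 0`
gives `dθ_{γ^i} = 0`, and `R = 0` reduces to `dθ_{γ̃_i} = 0`. -/
theorem coframeMap_injective (hr : Module.finrank ℂ E = r) (hHK : IsHKVariation Z Ω)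
    (hloc : IsMutuallyLocal L Ω) (he : IsSupportFrame Ω U e) (hx : x.1 ∈ U)
    (hdet : IsUnit (realGmatrix Z Ω e x τ).det) :
    Function.Injective (coframeMap hHK hloc he hx τ) := by
  refine injective_of_forall_eq_zero fun ξ hξ => ?_
  have h1 : ∀ i, dZp Z x ξ (gammaUp e x.1 i) = 0 := fun i => congrFun (congrArg Prod.fst hξ) i
  have h2 := Yform_eq_zero hHK hloc he hx fun i => congrFun (congrArg Prod.snd hξ) i
  have h3 : ξ.1 = 0 := eq_zero_of_dZ_gammaUp hr hHK.ask he.1 hx h1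
  have h4 := congrArg (fun w => toC (realGmatrix Z Ω e x τ)⁻¹ *ᵥ w) h2.2
  simp only [toC_inv_mul hdet, mulVec_zero] at h4
  have h5 : ∀ i, dTheta x ξ (gammaUp e x.1 i) = 0 := fun i => congrFun h4 i
  refine tan_ext_zero he.1 hx h3 (fun i => ?_) h5
  have h6 := congrFun h2.1 i
  simpa [Rform, h5, Pform_of_fst_eq_zero i h3] using h6

/-- The coframe as an isomorphism. -/
def coframeEquiv (hr : Module.finrank ℂ E = r) (hHK : IsHKVariation Z Ω)
    (hloc : IsMutuallyLocal L Ω) (he : IsSupportFrame Ω U e) (hx : x.1 ∈ U)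
    (hdet : IsUnit (realGmatrix Z Ω e x τ).det) :
    Tan E x ≃ₗ[ℝ] (Fin r → ℂ) × (Fin r → ℂ) :=
  haveI := finite_tan (E := E) x
  LinearMap.linearEquivOfInjective (coframeMap hHK hloc he hx τ)
    (coframeMap_injective hr hHK hloc he hx hdet) (by
      rw [finrank_tan hr, Module.finrank_prod, finrank_real_of_complex, Module.finrank_fin_fun]
      ring)

theorem coframeEquiv_apply (hr : Module.finrank ℂ E = r) (hHK : IsHKVariation Z Ω)
    (hloc : IsMutuallyLocal L Ω) (he : IsSupportFrame Ω U e) (hx : x.1 ∈ U)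
    (hdet : IsUnit (realGmatrix Z Ω e x τ).det) (ξ : Tan E x) :
    coframeEquiv hr hHK hloc he hx hdet ξ
      = (fun i => dZp Z x ξ (gammaUp e x.1 i), fun i => Yform Z Ω e x τ i ξ) := rfl

end Coframe

/-! ### The hyperkähler structure on a single tangent space. -/

section PointwiseHyperkahler

open Matrix

variable {E : Type*} [NormedAddCommGroup E] [NormedSpace ℂ E] [FiniteDimensional ℂ E]
  {M : Type u} [TopologicalSpace M] [ChartedSpace E M] [IsManifold 𝓘(ℂ, E) ω M]
  {r : ℕ} {Γf : Type v} [AddCommGroup Γf] [Module.Free ℤ Γf] [Module.Finite ℤ Γf]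
  {L : ChargeLattice.{u, v, w} M r Γf}
  {θf : Γf →+ Real.Angle} {Z : CentralCharge E L} {Ω : ∀ p, L.fib p → ℤ}
  {U : Set M} {e : ∀ q : M, Model r Γf ≃+ L.fib q} {x : TorusBundle L θf}
  {τ : Matrix (Fin r) (Fin r) ℂ}

attribute [local instance] tanGroup

theorem tensorT_eq (hHK : IsHKVariation Z Ω) (hloc : IsMutuallyLocal L Ω)
    (he : IsSupportFrame Ω U e) (hx : x.1 ∈ U)
    (hτ : ∀ i, dZ Z x.1 (gammaTilde e x.1 i) = ∑ j, τ i j • dZ Z x.1 (gammaUp e x.1 j))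
    (hτs : ∀ i j, τ i j = τ j i) (ξ η : Tan E x) :
    tensorT Z Ω x ξ η = (((fun i => dZp Z x ξ (gammaUp e x.1 i)) ⬝ᵥ
      toC (realGmatrix Z Ω e x τ) *ᵥ star (fun i => dZp Z x η (gammaUp e x.1 i))).re : ℂ) := by
  rw [tensorT_frame hHK hloc he hx hτ hτs,
    sum_symProdBar _ (fun i (ζ : Tan E x) => dZp Z x ζ (gammaUp e x.1 i)),
    Gmatrix_eq hHK.toIsBPSVariation]
  set a := fun i => dZp Z x ξ (gammaUp e x.1 i)
  set b := fun i => dZp Z x η (gammaUp e x.1 i)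
  set G := realGmatrix Z Ω e x τ with hG
  have h1 : b ⬝ᵥ toC G *ᵥ star a = (starRingEnd ℂ) (a ⬝ᵥ toC G *ᵥ star b) := by
    rw [starRingEnd_apply, star_dotProduct_toC,
      dotProduct_toC_comm (isSymm_realGmatrix hτs)]
  rw [h1, Complex.add_conj]
  push_cast
  ring

/-- The regular set consists of the points where the matrix `N + N^inst` is invertible. -/
theorem mem_regularSet_iff (hr : Module.finrank ℂ E = r) (hHK : IsHKVariation Z Ω)
    (hloc : IsMutuallyLocal L Ω) (he : IsSupportFrame Ω U e) (hx : x.1 ∈ U)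
    (hτ : ∀ i, dZ Z x.1 (gammaTilde e x.1 i) = ∑ j, τ i j • dZ Z x.1 (gammaUp e x.1 j))
    (hτs : ∀ i j, τ i j = τ j i) :
    x ∈ regularSet Z Ω θf ↔ IsUnit (realGmatrix Z Ω e x τ).det := by
  have hT := tensorT_eq hHK hloc he hx hτ hτs
  set G := realGmatrix Z Ω e x τ with hG
  constructor
  · intro hreg
    by_contra hdet
    rw [isUnit_iff_ne_zero, not_not] at hdet
    obtain ⟨c, hc0, hc⟩ := Matrix.exists_mulVec_eq_zero_iff.2 hdet
    -- A null vector of `G` is lifted to a horizontal vector in the kernel of `T`.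
    obtain ⟨a, ha⟩ := exists_dZ_gammaUp_eq hr hHK.ask he.1 hx (fun i => (c i : ℂ))
    have hc' : toC G *ᵥ (fun i => (c i : ℂ)) = 0 := by
      ext i
      have := congrArg Complex.ofReal (congrFun hc i)
      simpa [mulVec, dotProduct] using this
    have h1 : a = 0 := hreg ((a, 0) : Tan E x) fun η => by
      rw [hT, dotProduct_toC_comm (isSymm_realGmatrix hτs)]
      have h2 : (fun i => dZp Z x ((a, 0) : Tan E x) (gammaUp e x.1 i)) = fun i => (c i : ℂ) :=
        funext ha
      rw [h2, ← hG, hc', dotProduct_zero]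
      simp
    refine hc0 (funext fun i => ?_)
    have := ha i
    rw [h1, map_zero] at this
    exact_mod_cast this.symm
  · intro hdet ξ hξ
    refine eq_zero_of_dZ_gammaUp hr hHK.ask he.1 hx fun i => ?_
    -- The test vector is chosen so that `G` cancels and `T` yields the standard norm of `dZ(ξ)`;
    -- the indefiniteness of `T` plays no role.
    obtain ⟨b, hb⟩ := exists_dZ_gammaUp_eq hr hHK.ask he.1 hx
      (toC G⁻¹ *ᵥ fun i => dZp Z x ξ (gammaUp e x.1 i))
    have h1 := hξ ((b, 0) : Tan E x)
    have h2 : (fun i => dZp Z x ((b, 0) : Tan E x) (gammaUp e x.1 i))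
        = toC G⁻¹ *ᵥ fun i => dZp Z x ξ (gammaUp e x.1 i) := funext hb
    rw [hT, h2, star_toC_mulVec, toC_mul_inv hdet] at h1
    exact congrFun (eq_zero_of_dotProduct_star_re (by exact_mod_cast h1)) i

/-- This is the converse half of the description of the regular set by `ω₁`; openness of the set is
deduced from it. -/
theorem isUnit_det_of_nondegenerate (hHK : IsHKVariation Z Ω)
    (hloc : IsMutuallyLocal L Ω) (he : IsSupportFrame Ω U e) (hx : x.1 ∈ U)
    (hτ : ∀ i, dZ Z x.1 (gammaTilde e x.1 i) = ∑ j, τ i j • dZ Z x.1 (gammaUp e x.1 j))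
    (hτs : ∀ i j, τ i j = τ j i)
    (h : ∀ ξ : Tan E x, (∀ η, kahlerForms Z Ω 0 x ξ η = 0) → ξ = 0) :
    IsUnit (realGmatrix Z Ω e x τ).det := by
  by_contra hdet
  rw [isUnit_iff_ne_zero, not_not] at hdet
  obtain ⟨c, hc0, hc⟩ := Matrix.exists_mulVec_eq_zero_iff.2 hdet
  -- For a null vector `c` of `G`, the vertical vector with `dθ_{γ^i} = c_i` and `dθ_{γ̃_i} = (Re τ
  -- c)_i` satisfies `R = 0` and `G v = 0`, so it annihilates the whole coframe.
  obtain ⟨ξ, h1, h2, h3⟩ := exists_vert (E := E) he.1 hx (fun i => ∑ j, (τ i j).re * c j) c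
  have hc' : ∀ i, ∑ j, Gmatrix Z Ω e x τ i j * (c j : ℂ) = 0 := fun i => by
    rw [Gmatrix_eq hHK.toIsBPSVariation]
    have := congrArg Complex.ofReal (congrFun hc i)
    simpa [mulVec, dotProduct] using this
  have hY : ∀ i, Yform Z Ω e x τ i ξ = 0 := fun i => by
    rw [Yform_eq hHK hloc he hx]
    simp only [h2, h3, Pform_of_fst_eq_zero i h1, hc']
    push_cast
    ring
  have hα : ∀ i, dZp Z x ξ (gammaUp e x.1 i) = 0 := fun i => by
    rw [dZp, dZform, h1, map_zero]
  have h0 : ξ = 0 := h ξ fun η => by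
    change (omega12 Z Ω x ξ η).re = 0
    rw [omega12_frame hHK hloc he hx hτ hτs]
    simp [wedge, hα, hY]
  refine hc0 (funext fun i => ?_)
  have h4 := h3 i
  rw [h0] at h4
  have h5 : dTheta x (0 : Tan E x) (gammaUp e x.1 i) = 0 := by simp [dTheta]
  rw [h5] at h4
  exact_mod_cast h4.symm

theorem omega12_eq_hkSymplectic (hr : Module.finrank ℂ E = r) (hHK : IsHKVariation Z Ω)
    (hloc : IsMutuallyLocal L Ω) (he : IsSupportFrame Ω U e) (hx : x.1 ∈ U)
    (hτ : ∀ i, dZ Z x.1 (gammaTilde e x.1 i) = ∑ j, τ i j • dZ Z x.1 (gammaUp e x.1 j))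
    (hτs : ∀ i j, τ i j = τ j i) (hdet : IsUnit (realGmatrix Z Ω e x τ).det) (ξ η : Tan E x) :
    omega12 Z Ω x ξ η = hkSymplectic (coframeEquiv hr hHK hloc he hx hdet ξ)
      (coframeEquiv hr hHK hloc he hx hdet η) := by
  rw [omega12_frame hHK hloc he hx hτ hτs]
  simp only [hkSymplectic, coframeEquiv_apply, dotProduct, wedge, ← Finset.sum_sub_distrib]

theorem omega3_eq_hkHermitian (hr : Module.finrank ℂ E = r) (hHK : IsHKVariation Z Ω)
    (hloc : IsMutuallyLocal L Ω) (he : IsSupportFrame Ω U e) (hx : x.1 ∈ U)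
    (hτ : ∀ i, dZ Z x.1 (gammaTilde e x.1 i) = ∑ j, τ i j • dZ Z x.1 (gammaUp e x.1 j))
    (hτs : ∀ i j, τ i j = τ j i) (hdet : IsUnit (realGmatrix Z Ω e x τ).det) (ξ η : Tan E x) :
    omega3 Z Ω x ξ η = Complex.I / 2 * (hkHermitian (realGmatrix Z Ω e x τ)
        (coframeEquiv hr hHK hloc he hx hdet ξ) (coframeEquiv hr hHK hloc he hx hdet η)
      - hkHermitian (realGmatrix Z Ω e x τ)
        (coframeEquiv hr hHK hloc he hx hdet η) (coframeEquiv hr hHK hloc he hx hdet ξ)) := by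
  rw [omega3_frame_aux hHK hloc he hx hτ hτs,
    sum_wedgeBar _ (fun i (ζ : Tan E x) => dZp Z x ζ (gammaUp e x.1 i)),
    Gmatrix_eq hHK.toIsBPSVariation]
  have hR := star_Rform (e := e) (x := x) (τ := τ) hHK.toIsBPSVariation
  have h1 := dotProduct_toC_inv_sub (isSymm_realGmatrix hτs) hdet (hR ξ) (hR η)
    (star_dTheta ξ (gammaUp e x.1)) (star_dTheta η (gammaUp e x.1))
  rw [← Yform_eq_sub hHK hloc he hx, ← Yform_eq_sub hHK hloc he hx] at h1
  have h2 : ∑ i, wedge (fun ζ => dTheta x ζ (gammaTilde e x.1 i) + Pform Z Ω e x i ζ)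
      (fun ζ => dTheta x ζ (gammaUp e x.1 i)) ξ η
      = Rform Z Ω e x τ ξ ⬝ᵥ (fun i => dTheta x η (gammaUp e x.1 i))
        - Rform Z Ω e x τ η ⬝ᵥ (fun i => dTheta x ξ (gammaUp e x.1 i)) := by
    -- The terms with `Re τ` are symmetric in `ξ` and `η` and disappear from the alternating
    -- expression.
    have h3 : ∑ i, (∑ j, ((τ i j).re : ℂ) * dTheta x ξ (gammaUp e x.1 j))
          * dTheta x η (gammaUp e x.1 i)
        = ∑ i, (∑ j, ((τ i j).re : ℂ) * dTheta x η (gammaUp e x.1 j))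
          * dTheta x ξ (gammaUp e x.1 i) := by
      simp only [Finset.sum_mul]
      rw [Finset.sum_comm]
      refine Finset.sum_congr rfl fun i _ => Finset.sum_congr rfl fun j _ => ?_
      rw [hτs j i]
      ring
    simp only [dotProduct, Rform, wedge, add_mul, sub_mul, Finset.sum_add_distrib,
      Finset.sum_sub_distrib]
    rw [h3]
    ring
  rw [h2]
  simp only [hkHermitian, coframeEquiv_apply]
  have hpi : (Real.pi : ℂ) ≠ 0 := by exact_mod_cast Real.pi_ne_zero
  have hI := Complex.I_sq
  generalize Rform Z Ω e x τ ξ ⬝ᵥ (fun i => dTheta x η (gammaUp e x.1 i))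
        - Rform Z Ω e x τ η ⬝ᵥ (fun i => dTheta x ξ (gammaUp e x.1 i)) = s at *
  linear_combination (-Complex.I / (8 * Real.pi ^ 2)) * h1 - (s / (4 * Real.pi ^ 2)) * hI

theorem isHKAlgebra_frame (hr : Module.finrank ℂ E = r) (hHK : IsHKVariation Z Ω)
    (hloc : IsMutuallyLocal L Ω) (he : IsSupportFrame Ω U e) (hx : x.1 ∈ U)
    (hτ : ∀ i, dZ Z x.1 (gammaTilde e x.1 i) = ∑ j, τ i j • dZ Z x.1 (gammaUp e x.1 j))
    (hτs : ∀ i j, τ i j = τ j i) (hdet : IsUnit (realGmatrix Z Ω e x τ).det) :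
    ∃ I : Fin 3 → Tan E x →ₗ[ℝ] Tan E x, IsHKAlgebra
      (fun ξ η => (hkHermitian (realGmatrix Z Ω e x τ) (coframeEquiv hr hHK hloc he hx hdet ξ)
        (coframeEquiv hr hHK hloc he hx hdet η)).re) I (fun α => kahlerForms Z Ω α x) := by
  have h := (isHKAlgebra_standard (isSymm_realGmatrix (Z := Z) (Ω := Ω) (e := e) (x := x) hτs)
    hdet).comap (coframeEquiv hr hHK hloc he hx hdet)
  have hΦ : (fun α => kahlerForms Z Ω α x) = fun α ξ η => hkForm (realGmatrix Z Ω e x τ) α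
      (coframeEquiv hr hHK hloc he hx hdet ξ) (coframeEquiv hr hHK hloc he hx hdet η) := by
    funext α ξ η
    fin_cases α
    · exact congrArg Complex.re (omega12_eq_hkSymplectic hr hHK hloc he hx hτ hτs hdet ξ η)
    · exact congrArg Complex.im (omega12_eq_hkSymplectic hr hHK hloc he hx hτ hτs hdet ξ η)
    · change (omega3 Z Ω x ξ η).re = (Complex.I * hkHermitian _ _ _).re
      rw [omega3_eq_hkHermitian hr hHK hloc he hx hτ hτs hdet,
        ← hkHermitian_conj (isSymm_realGmatrix hτs) (coframeEquiv hr hHK hloc he hx hdet ξ)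
          (coframeEquiv hr hHK hloc he hx hdet η), Complex.sub_conj]
      simp
  rw [hΦ]
  exact ⟨_, h⟩

theorem omega3_frame (hr : Module.finrank ℂ E = r) (hHK : IsHKVariation Z Ω)
    (hloc : IsMutuallyLocal L Ω) (he : IsSupportFrame Ω U e) (hx : x.1 ∈ U)
    (hτ : ∀ i, dZ Z x.1 (gammaTilde e x.1 i) = ∑ j, τ i j • dZ Z x.1 (gammaUp e x.1 j))
    (hτs : ∀ i j, τ i j = τ j i) (hdet : IsUnit (realGmatrix Z Ω e x τ).det) (ξ η : Tan E x) :
    omega3 Z Ω x ξ η =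
      Complex.I / 2 * ∑ i, ∑ j, Gmatrix Z Ω e x τ i j *
        wedgeBar (fun ζ => dZp Z x ζ (gammaUp e x.1 i))
          (fun ζ => dZp Z x ζ (gammaUp e x.1 j)) ξ η
      + Complex.I / (8 * Real.pi ^ 2) * ∑ i, ∑ j, (Gmatrix Z Ω e x τ)⁻¹ i j *
        wedgeBar (Yform Z Ω e x τ i) (Yform Z Ω e x τ j) ξ η := by
  rw [omega3_eq_hkHermitian hr hHK hloc he hx hτ hτs hdet,
    sum_wedgeBar _ (fun i (ζ : Tan E x) => dZp Z x ζ (gammaUp e x.1 i)),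
    sum_wedgeBar _ (Yform Z Ω e x τ),
    Gmatrix_eq hHK.toIsBPSVariation, toC_inv hdet]
  simp only [hkHermitian, coframeEquiv_apply]
  ring

/-- Any metric with the given forms agrees with the standard one in the coframe, by
`IsHKAlgebra.unique`; so a metric chosen without reference to a frame satisfies the formula in all
support frames. -/
theorem metric_frame (hr : Module.finrank ℂ E = r) (hHK : IsHKVariation Z Ω)
    (hloc : IsMutuallyLocal L Ω) (he : IsSupportFrame Ω U e) (hx : x.1 ∈ U)
    (hτ : ∀ i, dZ Z x.1 (gammaTilde e x.1 i) = ∑ j, τ i j • dZ Z x.1 (gammaUp e x.1 j))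
    (hτs : ∀ i j, τ i j = τ j i) (hdet : IsUnit (realGmatrix Z Ω e x τ).det)
    {g : Tan E x → Tan E x → ℝ} {I : Fin 3 → Tan E x →ₗ[ℝ] Tan E x}
    (h : IsHKAlgebra g I (fun α => kahlerForms Z Ω α x)) (ξ η : Tan E x) :
    (g ξ η : ℂ) = ∑ i, ∑ j, Gmatrix Z Ω e x τ i j *
        symProdBar (fun ζ => dZp Z x ζ (gammaUp e x.1 i))
          (fun ζ => dZp Z x ζ (gammaUp e x.1 j)) ξ η
      + 1 / (4 * Real.pi ^ 2) * ∑ i, ∑ j, (Gmatrix Z Ω e x τ)⁻¹ i j *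
        symProdBar (Yform Z Ω e x τ i) (Yform Z Ω e x τ j) ξ η := by
  obtain ⟨I', h'⟩ := isHKAlgebra_frame hr hHK hloc he hx hτ hτs hdet
  rw [h.unique h' ξ η,
    sum_symProdBar _ (fun i (ζ : Tan E x) => dZp Z x ζ (gammaUp e x.1 i)),
    sum_symProdBar _ (Yform Z Ω e x τ),
    Gmatrix_eq hHK.toIsBPSVariation, toC_inv hdet]
  have h1 := Complex.add_conj (hkHermitian (realGmatrix Z Ω e x τ)
    (coframeEquiv hr hHK hloc he hx hdet ξ) (coframeEquiv hr hHK hloc he hx hdet η))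
  rw [hkHermitian_conj (isSymm_realGmatrix hτs)] at h1
  push_cast at h1
  have h2 : ∀ z : ℂ, ((z.re : ℝ) : ℂ) = (2 * (z.re : ℂ)) / 2 := fun z => by ring
  rw [h2, ← h1]
  simp only [hkHermitian, coframeEquiv_apply]
  ring

/-- At the points of the regular set, the forms are the Kähler forms of a hyperkähler structure
on the tangent space. -/
theorem regularSet_isHKAlgebra (hr : Module.finrank ℂ E = r) (hHK : IsHKVariation Z Ω)
    (hloc : IsMutuallyLocal L Ω) (x : TorusBundle L θf) :
    (x ∈ regularSet Z Ω θf → ∃ g I, IsHKAlgebra g I (fun α => kahlerForms Z Ω α x)) ∧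
      ((∀ ξ : Tan E x, (∀ η, kahlerForms Z Ω 0 x ξ η = 0) → ξ = 0) → x ∈ regularSet Z Ω θf) := by
  obtain ⟨U, e, hx, he⟩ := exists_supportFrame hHK.toIsBPSVariation hloc x.1
  obtain ⟨τ, hτ⟩ := exists_tau hr hHK.ask he.1 hx
  have hτs := isSymm_tau hr hHK.ask he.1 hx hτ
  refine ⟨fun h => ⟨_, isHKAlgebra_frame hr hHK hloc he hx hτ hτs
    ((mem_regularSet_iff hr hHK hloc he hx hτ hτs).1 h)⟩, fun h => ?_⟩
  exact (mem_regularSet_iff hr hHK hloc he hx hτ hτs).2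
    (isUnit_det_of_nondegenerate hHK hloc he hx hτ hτs h)

end PointwiseHyperkahler

/-! ### Quotients of symplectic forms -/

section SymplecticQuotient

variable {X : Type*} [NormedAddCommGroup X] [NormedSpace ℝ X]

/-- If `A`, `B = A(J -, -)` are closed `2`-forms, `A` is non-degenerate and `J² = -1`, then the
Nijenhuis tensor of `J` vanishes. -/
theorem nijenhuis_eq_zero {A B : X → X →L[ℝ] X →L[ℝ] ℝ} {J : X → X →L[ℝ] X} {y : X}
    (hA : DifferentiableAt ℝ A y) (hB : DifferentiableAt ℝ B y) (hJ : DifferentiableAt ℝ J y)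
    (h : ∀ᶠ z in 𝓝 y, ∀ k l, A z (J z k) l = B z k l)
    (hsq : ∀ᶠ z in 𝓝 y, ∀ k, J z (J z k) = -k)
    (hAs : ∀ z k l, A z k l = -A z l k) (hBs : ∀ z k l, B z k l = -B z l k)
    (hAc : ∀ k₀ k₁ k₂, fderiv ℝ A y k₀ k₁ k₂ - fderiv ℝ A y k₁ k₀ k₂
      + fderiv ℝ A y k₂ k₀ k₁ = 0)
    (hBc : ∀ k₀ k₁ k₂, fderiv ℝ B y k₀ k₁ k₂ - fderiv ℝ B y k₁ k₀ k₂
      + fderiv ℝ B y k₂ k₀ k₁ = 0)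
    (hA0 : ∀ k, (∀ l, A y k l = 0) → k = 0) (k l : X) :
    VectorField.lieBracket ℝ (fun z => J z k) (fun z => J z l) y
      - J y (VectorField.lieBracket ℝ (fun z => J z k) (fun _ => l) y)
      - J y (VectorField.lieBracket ℝ (fun _ => k) (fun z => J z l) y) = 0 := by
  have dF : ∀ {F : X → X →L[ℝ] X →L[ℝ] ℝ}, DifferentiableAt ℝ F y → ∀ k l : X,
      HasFDerivAt (fun z => F z k l)
        (((ContinuousLinearMap.apply ℝ ℝ l).comp (ContinuousLinearMap.apply ℝ _ k)).comp
        (fderiv ℝ F y)) y := fun {F} hF k l =>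
    HasFDerivAt.comp (g := (ContinuousLinearMap.apply ℝ ℝ l).comp
      (ContinuousLinearMap.apply ℝ (X →L[ℝ] ℝ) k)) y
      (ContinuousLinearMap.hasFDerivAt _) hF.hasFDerivAt
  have dA := dF hA
  have dB := dF hB
  have dJ : ∀ k : X, HasFDerivAt (fun z => J z k)
      ((ContinuousLinearMap.apply ℝ _ k).comp (fderiv ℝ J y)) y := fun k =>
    HasFDerivAt.comp (g := ContinuousLinearMap.apply ℝ X k) y
      (ContinuousLinearMap.hasFDerivAt _) hJ.hasFDerivAt
  have h1 : ∀ m k l, fderiv ℝ A y m (J y k) l + A y (fderiv ℝ J y m k) l = fderiv ℝ B y m k l := by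
    intro m k l
    have e1 : HasFDerivAt (fun z => A z (J z k) l) _ y :=
      (hA.hasFDerivAt.clm_apply (dJ k)).clm_apply (hasFDerivAt_const l y)
    have e2 := (dB k l).congr_of_eventuallyEq (f₁ := fun z => A z (J z k) l)
      (h.mono fun z hz => hz k l)
    have := congrArg (fun F : X →L[ℝ] ℝ => F m) (e1.unique e2)
    simp at this
    linarith
  have h2 : ∀ m k l, fderiv ℝ B y m (J y k) l + B y (fderiv ℝ J y m k) l
      = -fderiv ℝ A y m k l := by
    intro m k l
    have e1 : HasFDerivAt (fun z => B z (J z k) l) _ y :=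
      (hB.hasFDerivAt.clm_apply (dJ k)).clm_apply (hasFDerivAt_const l y)
    have e2 := (dA k l).neg.congr_of_eventuallyEq (f₁ := fun z => B z (J z k) l)
      ((h.and hsq).mono fun z hz => by
        change B z (J z k) l = -(A z k l)
        rw [← hz.1, hz.2, map_neg, neg_apply])
    have := congrArg (fun F : X →L[ℝ] ℝ => F m) (e1.unique e2)
    simp at this
    linarith
  have hAs' : ∀ m k l, fderiv ℝ A y m k l = -fderiv ℝ A y m l k := by
    intro m k l
    have e2 := (dA l k).neg.congr_of_eventuallyEq (f₁ := fun z => A z k l)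
      (Eventually.of_forall fun z => hAs z k l)
    exact congrArg (fun F : X →L[ℝ] ℝ => F m) ((dA k l).unique e2)
  have hBs' : ∀ m k l, fderiv ℝ B y m k l = -fderiv ℝ B y m l k := by
    intro m k l
    have e2 := (dB l k).neg.congr_of_eventuallyEq (f₁ := fun z => B z k l)
      (Eventually.of_forall fun z => hBs z k l)
    exact congrArg (fun F : X →L[ℝ] ℝ => F m) ((dB k l).unique e2)
  have h3 : ∀ k l, A y (J y k) l = A y k (J y l) := fun k l => by
    rw [h.self_of_nhds, hBs, ← h.self_of_nhds, hAs, neg_neg]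
  have b1 : VectorField.lieBracket ℝ (fun z => J z k) (fun z => J z l) y
      = fderiv ℝ J y (J y k) l - fderiv ℝ J y (J y l) k := by
    rw [VectorField.lieBracket, (dJ k).fderiv, (dJ l).fderiv]
    rfl
  have b2 : VectorField.lieBracket ℝ (fun z => J z k) (fun _ => l) y = -fderiv ℝ J y l k := by
    rw [VectorField.lieBracket, (dJ k).fderiv, fderiv_const_apply]
    simp
  have b3 : VectorField.lieBracket ℝ (fun _ => k) (fun z => J z l) y = fderiv ℝ J y k l := by
    rw [VectorField.lieBracket, (dJ l).fderiv, fderiv_const_apply]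
    simp
  rw [b1, b2, b3, map_neg]
  refine hA0 _ fun q => ?_
  simp only [map_sub, map_neg, sub_apply, neg_apply, h3]
  -- Elimination of the derivative of `J` between `h1` and `h2`.
  have star : ∀ m k l, fderiv ℝ B y m (J y k) l + fderiv ℝ B y m k (J y l)
      - fderiv ℝ A y m (J y k) (J y l) = -fderiv ℝ A y m k l := fun m k l => by
    have e1 := h2 m k l
    rw [← h.self_of_nhds, h3] at e1
    linear_combination e1 - h1 m k (J y l)
  -- The identity `h1` trades derivatives of `J` for derivatives of `A` and `B`. Closedness of `A`
  -- on `(Jk, Jl, q)` and `(k, l, q)`, and of `B` on `(Jk, l, q)` and `(Jl, k, q)`, disposes of the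
  -- rest, with `star` linking the two forms.
  linear_combination h1 (J y k) l q - h1 (J y l) k q + h1 l k (J y q) - h1 k l (J y q)
    - hAc (J y k) (J y l) q + hBc (J y k) l q - hBc (J y l) k q + star l k q - star k l q
    - star q k l + hAc k l q + hBs' q (J y l) k

variable [FiniteDimensional ℝ X]

/-- A bilinear form as a continuous linear map. -/
def bilinCLM (B : X → X → ℝ) (hB : IsBilin B) : X →L[ℝ] X →L[ℝ] ℝ :=
  LinearMap.toContinuousLinearMap
    { toFun := fun k => LinearMap.toContinuousLinearMap ((hB.1 k).mk' _)
      map_add' := fun k k' => by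
        ext l
        exact (hB.2 l).map_add k k'
      map_smul' := fun c k => by
        ext l
        exact (hB.2 l).map_smul c k }

/-- A non-degenerate bilinear form as an isomorphism to the dual space. -/
def dualEquiv (A : X →L[ℝ] X →L[ℝ] ℝ) (hA : ∀ k, (∀ l, A k l = 0) → k = 0) :
    X ≃L[ℝ] (X →L[ℝ] ℝ) :=
  (LinearEquiv.ofInjectiveOfFinrankEq A.toLinearMap
    (injective_of_forall_eq_zero fun k hk => hA k fun l => by
      have := congrArg (fun F : X →L[ℝ] ℝ => F l) hk
      exact this)
    (by rw [← LinearMap.toContinuousLinearMap.finrank_eq, Module.finrank_linearMap_self])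
    ).toContinuousLinearEquiv

theorem coe_dualEquiv (A : X →L[ℝ] X →L[ℝ] ℝ) (hA : ∀ k, (∀ l, A k l = 0) → k = 0) :
    (dualEquiv A hA : X →L[ℝ] X →L[ℝ] ℝ) = A := by
  ext
  rfl

/-- Non-degeneracy means that `A z` is an isomorphism to the dual space, and isomorphisms form an
open set. -/
theorem eventually_nondegenerate {A : X → X →L[ℝ] X →L[ℝ] ℝ} {y : X} (hA : ContinuousAt A y)
    (hA0 : ∀ k, (∀ l, A y k l = 0) → k = 0) :
    ∀ᶠ z in 𝓝 y, ∀ k, (∀ l, A z k l = 0) → k = 0 := by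
  have h1 : Set.range ((↑) : (X ≃L[ℝ] (X →L[ℝ] ℝ)) → X →L[ℝ] X →L[ℝ] ℝ) ∈ 𝓝 (A y) :=
    ContinuousLinearEquiv.isOpen.mem_nhds ⟨dualEquiv (A y) hA0, coe_dualEquiv _ _⟩
  filter_upwards [hA h1] with z hz k hk
  obtain ⟨e, he⟩ := hz
  refine e.injective ?_
  rw [map_zero]
  ext l
  change e k l = 0
  rw [← hk l, ← he]
  rfl

/-- The endomorphism `J` with `A(J -, -) = B`. -/
def formQuotient (A B : X →L[ℝ] X →L[ℝ] ℝ) : X →L[ℝ] X := A.inverse.comp B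

theorem formQuotient_apply {A B : X →L[ℝ] X →L[ℝ] ℝ} (hA : ∀ k, (∀ l, A k l = 0) → k = 0)
    {k m : X} (h : ∀ l, A m l = B k l) : formQuotient A B k = m := by
  have h1 : B k = A m := ContinuousLinearMap.ext fun l => (h l).symm
  rw [formQuotient, ContinuousLinearMap.comp_apply, h1, ← coe_dualEquiv A hA,
    ContinuousLinearMap.inverse_equiv]
  exact (dualEquiv A hA).symm_apply_apply m

/-- Inversion of continuous linear maps is smooth at isomorphisms. -/
theorem contDiffAt_formQuotient {A B : X → X →L[ℝ] X →L[ℝ] ℝ} {y : X}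
    (hA : ContDiffAt ℝ ∞ A y) (hB : ContDiffAt ℝ ∞ B y)
    (hA0 : ∀ k, (∀ l, A y k l = 0) → k = 0) :
    ContDiffAt ℝ ∞ (fun z => formQuotient (A z) (B z)) y := by
  have : CompleteSpace X := FiniteDimensional.complete ℝ X
  have h1 : ContDiffAt ℝ ∞ ContinuousLinearMap.inverse (A y) := by
    rw [← coe_dualEquiv (A y) hA0]
    exact contDiffAt_map_inverse _
  exact (h1.comp y hA).clm_comp hB

end SymplecticQuotient

theorem IsBilin.skew {V : Type*} [AddCommGroup V] [Module ℝ V] {B : V → V → ℝ} (hB : IsBilin B)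
    (h : ∀ ξ, B ξ ξ = 0) (ξ η : V) : B ξ η = -B η ξ := by
  have h1 := h (ξ + η)
  rw [(hB.1 _).map_add, (hB.2 _).map_add, (hB.2 _).map_add, h, h] at h1
  linarith

/-! ### The hyperkähler structure on the regular set. -/

section Hyperkahler

variable {E : Type*} [NormedAddCommGroup E] [NormedSpace ℂ E] [FiniteDimensional ℂ E]
  {M : Type u} [TopologicalSpace M] [ChartedSpace E M] [IsManifold 𝓘(ℂ, E) ω M]
  {r : ℕ} {Γf : Type v} [AddCommGroup Γf] [Module.Free ℤ Γf] [Module.Finite ℤ Γf]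
  {L : ChargeLattice.{u, v, w} M r Γf}
  {θf : Γf →+ Real.Angle} {Z : CentralCharge E L} {Ω : ∀ p, L.fib p → ℤ}

theorem kahlerForms_skew (hHK : IsHKVariation Z Ω) (hloc : IsMutuallyLocal L Ω) (α : Fin 3)
    (x : TorusBundle L θf) (ξ η : Tan E x) :
    kahlerForms Z Ω α x ξ η = -kahlerForms Z Ω α x η ξ := by
  have h := isBilin_kahlerForms hHK hloc α x
  exact h.1.skew h.2 ξ η

theorem isBilin_pull (hHK : IsHKVariation Z Ω) (hloc : IsMutuallyLocal L Ω) (α : Fin 3) (p : M)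
    (y : Coord E r) : IsBilin (pull (θf := θf) (kahlerForms Z Ω α) p y) := by
  have h := (isBilin_kahlerForms hHK hloc α (param L θf p y)).1
  have ha : ∀ k l, dParam L θf p y (k + l) = dParam L θf p y k + dParam L θf p y l :=
    (dParamLin L θf p y).map_add
  have hs : ∀ (c : ℝ) k, dParam L θf p y (c • k) = c • dParam L θf p y k :=
    (dParamLin L θf p y).map_smul
  refine ⟨fun k => ⟨fun l l' => ?_, fun c l => ?_⟩, fun l => ⟨fun k k' => ?_, fun c k => ?_⟩⟩ <;>
    simp only [pull]
  · rw [ha]; exact (h.1 _).map_add _ _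
  · rw [hs]; exact (h.1 _).map_smul _ _
  · rw [ha]; exact (h.2 _).map_add _ _
  · rw [hs]; exact (h.2 _).map_smul _ _

/-- The Kähler forms in local coordinates. -/
def coordForm (hHK : IsHKVariation Z Ω) (hloc : IsMutuallyLocal L Ω) (θf : Γf →+ Real.Angle)
    (α : Fin 3) (p : M) (y : Coord E r) : Coord E r →L[ℝ] Coord E r →L[ℝ] ℝ :=
  bilinCLM _ (isBilin_pull (θf := θf) hHK hloc α p y)

theorem coordForm_apply (hHK : IsHKVariation Z Ω) (hloc : IsMutuallyLocal L Ω) (α : Fin 3) (p : M)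
    (y k l : Coord E r) : coordForm hHK hloc θf α p y k l
      = kahlerForms Z Ω α (param L θf p y) (dParam L θf p y k) (dParam L θf p y l) := rfl

theorem coordForm_skew (hHK : IsHKVariation Z Ω) (hloc : IsMutuallyLocal L Ω) (α : Fin 3) (p : M)
    (y k l : Coord E r) : coordForm hHK hloc θf α p y k l = -coordForm hHK hloc θf α p y l k :=
  kahlerForms_skew hHK hloc α _ _ _

theorem contDiffAt_coordForm (hHK : IsHKVariation Z Ω) (hloc : IsMutuallyLocal L Ω) (α : Fin 3)
    {p : M} {y : Coord E r} (hy : y ∈ paramDomain E L p) :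
    ContDiffAt ℝ ∞ (coordForm hHK hloc θf α p) y := by
  have h1 : ContDiffOn ℝ ∞ (coordForm hHK hloc θf α p) (paramDomain E L p) := by
    rw [contDiffOn_clm_apply]
    intro k
    rw [contDiffOn_clm_apply]
    exact fun l z hz => ((kahlerForms_smooth_closed hHK hloc θf α hz).1 k l).contDiffWithinAt
  exact h1.contDiffAt (mem_nhds_paramDomain hy)

theorem fderiv_coordForm (hHK : IsHKVariation Z Ω) (hloc : IsMutuallyLocal L Ω) (α : Fin 3)
    {p : M} {y : Coord E r} (hy : y ∈ paramDomain E L p) (m k l : Coord E r) :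
    fderiv ℝ (coordForm hHK hloc θf α p) y m k l
      = fderiv ℝ (fun y => pull (θf := θf) (kahlerForms Z Ω α) p y k l) y m := by
  have h1 := (contDiffAt_coordForm (θf := θf) hHK hloc α hy).differentiableAt (by simp)
  have h2 : HasFDerivAt (fun y => pull (θf := θf) (kahlerForms Z Ω α) p y k l) _ y :=
    HasFDerivAt.comp (g := (ContinuousLinearMap.apply ℝ ℝ l).comp
      (ContinuousLinearMap.apply ℝ (Coord E r →L[ℝ] ℝ) k)) y
      (ContinuousLinearMap.hasFDerivAt _) h1.hasFDerivAt
  rw [h2.fderiv]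
  rfl

theorem closed_coordForm (hHK : IsHKVariation Z Ω) (hloc : IsMutuallyLocal L Ω) (α : Fin 3)
    {p : M} {y : Coord E r} (hy : y ∈ paramDomain E L p) (k₀ k₁ k₂ : Coord E r) :
    fderiv ℝ (coordForm hHK hloc θf α p) y k₀ k₁ k₂
      - fderiv ℝ (coordForm hHK hloc θf α p) y k₁ k₀ k₂
      + fderiv ℝ (coordForm hHK hloc θf α p) y k₂ k₀ k₁ = 0 := by
  simp only [fderiv_coordForm hHK hloc α hy]
  exact (kahlerForms_smooth_closed hHK hloc θf α hy).2 k₀ k₁ k₂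

theorem dParam_eq_zero {p : M} {y : Coord E r} (hy : y ∈ paramDomain E L p) {k : Coord E r}
    (hk : dParam L θf p y k = 0) : k = 0 :=
  (dParamEquiv (θf := θf) hy).map_eq_zero_iff.1 hk

attribute [local instance] tanGroup

theorem coordForm_nondegenerate (hr : Module.finrank ℂ E = r) (hHK : IsHKVariation Z Ω)
    (hloc : IsMutuallyLocal L Ω) (α : Fin 3) {p : M} {y : Coord E r}
    (hy : y ∈ chartPart (regularSet Z Ω θf) p) (k : Coord E r)
    (hk : ∀ l, coordForm hHK hloc θf α p y k l = 0) : k = 0 := by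
  obtain ⟨g, I, h⟩ := (regularSet_isHKAlgebra hr hHK hloc (param L θf p y)).1 hy.2
  refine dParam_eq_zero (θf := θf) hy.1 (h.form_nondegenerate α fun η => ?_)
  have h1 := hk (dParamInv L θf p y η)
  rw [coordForm_apply, dParam_dParamInv hy.1] at h1
  exact h1

theorem mem_regularSet_of_nondegenerate (hr : Module.finrank ℂ E = r) (hHK : IsHKVariation Z Ω)
    (hloc : IsMutuallyLocal L Ω) {p : M} {y : Coord E r} (hy : y ∈ paramDomain E L p)
    (h : ∀ k, (∀ l, coordForm hHK hloc θf 0 p y k l = 0) → k = 0) :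
    param L θf p y ∈ regularSet Z Ω θf := by
  refine (regularSet_isHKAlgebra hr hHK hloc (param L θf p y)).2 fun ξ hξ => ?_
  have h1 := h (dParamInv L θf p y ξ) fun l => by
    rw [coordForm_apply, dParam_dParamInv hy]
    exact hξ _
  rw [← dParam_dParamInv hy ξ, h1]
  exact (dParamLin L θf p y).map_zero

/-- The regular set is where `ω₁` is non-degenerate, and `ω₁` is continuous in coordinates. This
avoids any discussion of how `G` and the support frame vary with the point. -/
theorem isOpen_chartPart (hr : Module.finrank ℂ E = r) (hHK : IsHKVariation Z Ω)
    (hloc : IsMutuallyLocal L Ω) (p : M) :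
    IsOpen (chartPart (E := E) (regularSet Z Ω θf) p) := by
  rw [isOpen_iff_mem_nhds]
  intro y hy
  filter_upwards [mem_nhds_paramDomain hy.1, eventually_nondegenerate
    (contDiffAt_coordForm (θf := θf) hHK hloc 0 hy.1).continuousAt
    (coordForm_nondegenerate hr hHK hloc 0 hy)] with z hz hz'
  exact ⟨hz, mem_regularSet_of_nondegenerate hr hHK hloc hz hz'⟩

theorem isOpen_regularSet (hr : Module.finrank ℂ E = r) (hHK : IsHKVariation Z Ω)
    (hloc : IsMutuallyLocal L Ω) : IsOpen[torusTopology E L θf] (regularSet Z Ω θf) := by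
  rw [isOpen_iSup_iff]
  intro p
  rw [isOpen_coinduced]
  have h := (isOpen_chartPart (θf := θf) hr hHK hloc p).preimage
    (continuous_subtype_val (p := fun y => y ∈ paramDomain E L p))
  convert h using 1
  ext y
  exact ⟨fun h => ⟨y.2, h⟩, fun h => h.2⟩

variable {g : ∀ x : TorusBundle L θf, Tan E x → Tan E x → ℝ}
  {I : Fin 3 → ∀ x : TorusBundle L θf, Tan E x →ₗ[ℝ] Tan E x}

theorem formQuotient_coordForm (hr : Module.finrank ℂ E = r) (hHK : IsHKVariation Z Ω)
    (hloc : IsMutuallyLocal L Ω)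
    (h : ∀ x ∈ regularSet Z Ω θf,
      IsHKAlgebra (g x) (fun α => I α x) (fun α => kahlerForms Z Ω α x))
    (α : Fin 3) {p : M} {y : Coord E r} (hy : y ∈ chartPart (regularSet Z Ω θf) p)
    (k : Coord E r) :
    formQuotient (coordForm hHK hloc θf (α + 1) p y) (coordForm hHK hloc θf α p y) k
      = pullEnd (I (α + 2)) p y k := by
  refine formQuotient_apply (coordForm_nondegenerate hr hHK hloc _ hy) fun l => ?_
  rw [coordForm_apply, coordForm_apply, pullEnd, dParam_dParamInv hy.1]
  exact (h _ hy.2).form_apply α _ _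

/-- The pointwise structures may have been chosen arbitrarily; on the regular set they are quotients
of the smooth closed forms, from which smoothness and integrability follow. -/
theorem isPseudoHyperkahler (hr : Module.finrank ℂ E = r) (hHK : IsHKVariation Z Ω)
    (hloc : IsMutuallyLocal L Ω)
    (h : ∀ x ∈ regularSet Z Ω θf,
      IsHKAlgebra (g x) (fun α => I α x) (fun α => kahlerForms Z Ω α x)) :
    IsPseudoHyperkahler (regularSet Z Ω θf) g I (kahlerForms Z Ω) := by
  -- Indices are cyclic modulo `3`: each structure `I β` is the quotient of the form `β - 2` by the
  -- form `β - 1`.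
  have hα : ∀ β : Fin 3, ∃ α : Fin 3, α + 2 = β := fun β => ⟨β - 2, by simp⟩
  have hnhds : ∀ {p : M} {y : Coord E r}, y ∈ chartPart (regularSet Z Ω θf) p →
      ∀ᶠ z in 𝓝 y, z ∈ chartPart (E := E) (regularSet Z Ω θf) p := fun {p y} hy =>
    (isOpen_chartPart (θf := θf) hr hHK hloc p).mem_nhds hy
  have hJ : ∀ (α : Fin 3) {p : M} {y : Coord E r}, y ∈ chartPart (regularSet Z Ω θf) p →
      ContDiffAt ℝ ∞ (fun z => formQuotient (coordForm hHK hloc θf (α + 1) p z)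
        (coordForm hHK hloc θf α p z)) y := fun α p y hy =>
    contDiffAt_formQuotient (contDiffAt_coordForm hHK hloc _ hy.1)
      (contDiffAt_coordForm hHK hloc _ hy.1) (coordForm_nondegenerate hr hHK hloc _ hy)
  have hq := fun α {p} {y} => formQuotient_coordForm hr hHK hloc h α (p := p) (y := y)
  have hI : ∀ (α : Fin 3) {p : M} {y : Coord E r}, y ∈ chartPart (regularSet Z Ω θf) p →
      ∀ k, ContDiffAt ℝ ∞ (fun z => pullEnd (I α) p z k) y := by
    intro β p y hy k
    obtain ⟨α, rfl⟩ := hα β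
    refine ContDiffAt.congr_of_eventuallyEq ((hJ α hy).clm_apply contDiffAt_const)
      ((hnhds hy).mono fun z hz => (hq α hz k).symm)
  refine ⟨isOpen_regularSet hr hHK hloc, fun x hx => ?_, fun x hx => (h x hx).symm,
    fun x hx => (h x hx).nondegenerate, fun p k l y hy => ContDiffAt.contDiffWithinAt ?_,
    fun α p k y hy => (hI α hy k).contDiffWithinAt, fun α x hx => (h x hx).sq α,
    fun x hx => (h x hx).quaternion, fun α x hx => (h x hx).isometry fun ξ η => ?_,
    fun α x hx => (h x hx).kahler α, fun β p y hy k l => ?_,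
    fun α => isClosedForm_kahlerForms hHK hloc _ α⟩
  · exact ⟨fun ξ => ⟨((h x hx).bilin.1 ξ).map_add, ((h x hx).bilin.1 ξ).map_smul⟩,
      fun ξ => ⟨((h x hx).bilin.2 ξ).map_add, ((h x hx).bilin.2 ξ).map_smul⟩⟩
  · refine ContDiffAt.congr_of_eventuallyEq
      (((contDiffAt_coordForm (θf := θf) hHK hloc 2 hy.1).clm_apply (hI 2 hy k)).clm_apply
        (contDiffAt_const (c := l))).neg ((hnhds hy).mono fun z hz => ?_)
    change g _ _ _ = -coordForm hHK hloc θf 2 p z _ l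
    rw [coordForm_apply, pullEnd, dParam_dParamInv hz.1]
    exact (h _ hz.2).metric_eq _ _
  · exact kahlerForms_skew hHK hloc α x ξ η
  · obtain ⟨α, rfl⟩ := hα β
    have he : ∀ k, (fun z => pullEnd (I (α + 2)) p z k) =ᶠ[𝓝 y]
        fun z => formQuotient (coordForm hHK hloc θf (α + 1) p z)
        (coordForm hHK hloc θf α p z) k := fun k => (hnhds hy).mono fun z hz => (hq α hz k).symm
    rw [(he k).lieBracket_vectorField_eq (he l), (he k).lieBracket_vectorField_eq
      (EventuallyEq.refl _ _), (EventuallyEq.refl _ _).lieBracket_vectorField_eq (he l),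
      ← hq α hy, ← hq α hy]
    refine nijenhuis_eq_zero (B := coordForm hHK hloc θf α p)
      ((contDiffAt_coordForm hHK hloc (α + 1) hy.1).differentiableAt (by simp))
      ((contDiffAt_coordForm hHK hloc α hy.1).differentiableAt (by simp))
      ((hJ α hy).differentiableAt (by simp)) ((hnhds hy).mono fun z hz k l => ?_)
      ((hnhds hy).mono fun z hz k => ?_) (coordForm_skew hHK hloc _ p) (coordForm_skew hHK hloc _ p)
      (closed_coordForm hHK hloc _ hy.1) (closed_coordForm hHK hloc _ hy.1)
      (coordForm_nondegenerate hr hHK hloc _ hy) k l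
    · rw [hq α hz, coordForm_apply, coordForm_apply, pullEnd, dParam_dParamInv hz.1]
      exact (h _ hz.2).form_apply α _ _
    · rw [hq α hz, hq α hz, pullEnd, pullEnd, dParam_dParamInv hz.1]
      refine (congrArg _ ((h _ hz.2).sq (α + 2) _)).trans ?_
      rw [← dParamEquiv_symm_apply hz.1, LinearEquiv.symm_apply_eq, dParamEquiv_apply]
      have h1 := (dParamLin L θf p z).map_smul (-1) k
      rw [neg_one_smul] at h1
      refine Eq.trans ?_ h1.symm
      exact (neg_one_smul ℝ _).symm

end Hyperkahler

end HKBPS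

end

/-! ### Assembly of the theorem. -/

theorem mainTheorem2 {E : Type*} [NormedAddCommGroup E] [NormedSpace ℂ E] [FiniteDimensional ℂ E]
    {M : Type*} [TopologicalSpace M] [ChartedSpace E M] [IsManifold 𝓘(ℂ, E) ω M]
    {r : ℕ} (hr : Module.finrank ℂ E = r)
    {Γf : Type*} [AddCommGroup Γf] [Module.Free ℤ Γf] [Module.Finite ℤ Γf]
    (L : ChargeLattice M r Γf) (Z : CentralCharge E L) (Ω : ∀ p, L.fib p → ℤ)
    (hHK : IsHKVariation Z Ω) (hloc : IsMutuallyLocal L Ω) (θf : Γf →+ Real.Angle) :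
    -- the infinite sums converge absolutely
    (∀ x : TorusBundle L θf,
      (∀ γ, Ω x.1 γ ≠ 0 → Summable (VTerm Z x γ) ∧ Summable (ATerm Z x γ)) ∧
      ∀ ξ η : Tan E x, Summable (omega12Term Z Ω x ξ η) ∧ Summable (omega3Term Z Ω x ξ η) ∧
        Summable (tensorTTerm Z Ω x ξ η)) ∧
    -- `ω₁`, `ω₂`, `ω₃` are smooth real `2`-forms on the whole torus bundle
    (∀ (x : TorusBundle L θf) (ξ η : Tan E x), (omega3 Z Ω x ξ η).im = 0) ∧
    (∀ α, IsSmoothTwoForm (Set.univ : Set (TorusBundle L θf)) (kahlerForms Z Ω α)) ∧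
    -- around every point of `M` there is a frame as required in the local formulas
    (∀ p : M, ∃ (U : Set M) (e : ∀ q : M, Model r Γf ≃+ L.fib q),
      p ∈ U ∧ IsSupportFrame Ω U e) ∧
    -- the hyperkähler structure on `N`, and the local formulas
    ∃ (g : ∀ x : TorusBundle L θf, Tan E x → Tan E x → ℝ)
      (I : Fin 3 → ∀ x : TorusBundle L θf, Tan E x →ₗ[ℝ] Tan E x),
      IsPseudoHyperkahler (regularSet Z Ω θf) g I (kahlerForms Z Ω) ∧
      ∀ (U : Set M) (e : ∀ q : M, Model r Γf ≃+ L.fib q), IsSupportFrame Ω U e →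
        ∀ x : TorusBundle L θf, x.1 ∈ U → ∃ τ : Matrix (Fin r) (Fin r) ℂ,
          (∀ i, dZ Z x.1 (gammaTilde e x.1 i) = ∑ j, τ i j • dZ Z x.1 (gammaUp e x.1 j)) ∧
          (∀ i ξ, Summable (WinstTerm Z Ω e x i ξ)) ∧
          (∀ i j, Summable (NinstTerm Z Ω e x i j)) ∧
          (∀ ξ η : Tan E x, omega12 Z Ω x ξ η = 1 / (2 * Real.pi) *
            ∑ i, wedge (fun ζ => dZp Z x ζ (gammaUp e x.1 i)) (Yform Z Ω e x τ i) ξ η) ∧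
          (x ∈ regularSet Z Ω θf →
            IsUnit (Gmatrix Z Ω e x τ).det ∧
            (∀ ξ η : Tan E x, (g x ξ η : ℂ) =
              ∑ i, ∑ j, Gmatrix Z Ω e x τ i j *
                symProdBar (fun ζ => dZp Z x ζ (gammaUp e x.1 i))
                  (fun ζ => dZp Z x ζ (gammaUp e x.1 j)) ξ η
              + 1 / (4 * Real.pi ^ 2) * ∑ i, ∑ j, (Gmatrix Z Ω e x τ)⁻¹ i j *
                symProdBar (Yform Z Ω e x τ i) (Yform Z Ω e x τ j) ξ η) ∧
            (∀ ξ η : Tan E x, omega3 Z Ω x ξ η =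
              Complex.I / 2 * ∑ i, ∑ j, Gmatrix Z Ω e x τ i j *
                wedgeBar (fun ζ => dZp Z x ζ (gammaUp e x.1 i))
                  (fun ζ => dZp Z x ζ (gammaUp e x.1 j)) ξ η
              + Complex.I / (8 * Real.pi ^ 2) * ∑ i, ∑ j, (Gmatrix Z Ω e x τ)⁻¹ i j *
                wedgeBar (Yform Z Ω e x τ i) (Yform Z Ω e x τ j) ξ η)) := by
  have hT : ∀ x : TorusBundle L θf, ∃ (g : Tan E x → Tan E x → ℝ)
      (I : Fin 3 → Tan E x →ₗ[ℝ] Tan E x), x ∈ regularSet Z Ω θf →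
        @IsHKAlgebra _ (tanGroup x) _ g I (fun α => kahlerForms Z Ω α x) := fun x => by
    by_cases hx : x ∈ regularSet Z Ω θf
    · obtain ⟨g, I, h⟩ := (regularSet_isHKAlgebra hr hHK hloc x).1 hx
      exact ⟨g, I, fun _ => h⟩
    -- Off the regular set `g` and `I` are arbitrary.
    · exact ⟨fun _ _ => 0, fun _ => 0, fun h => absurd h hx⟩
  choose g I hgI using hT
  refine ⟨fun x => ⟨fun γ hγ => ?_, fun ξ η => ⟨summable_omega12Term hHK hloc x ξ η,
    summable_omega3Term hHK hloc x ξ η, summable_tensorTTerm hHK hloc x ξ η⟩⟩,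
    fun x ξ η => omega3_im hHK.toIsBPSVariation x ξ η, isSmoothTwoForm_kahlerForms hHK hloc,
    exists_supportFrame hHK.toIsBPSVariation hloc, g, fun α x => I x α,
    isPseudoHyperkahler hr hHK hloc hgI, fun U e he x hx => ?_⟩
  · have h0 := hHK.ne_zero hγ
    exact ⟨summable_VTerm Z h0, summable_ATerm Z h0⟩
  · obtain ⟨τ, hτ⟩ := exists_tau hr hHK.ask he.1 hx
    have hτs := isSymm_tau hr hHK.ask he.1 hx hτ
    refine ⟨τ, hτ, summable_WinstTerm hHK hloc he.1 hx, summable_NinstTerm hHK hloc he.1 hx,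
      omega12_frame hHK hloc he hx hτ hτs, fun hN => ?_⟩
    have hdet := (mem_regularSet_iff hr hHK hloc he hx hτ hτs).1 hN
    refine ⟨?_, metric_frame hr hHK hloc he hx hτ hτs hdet (hgI x hN),
      omega3_frame hr hHK hloc he hx hτ hτs hdet⟩
    rw [Gmatrix_eq hHK.toIsBPSVariation]
    have := hdet.map Complex.ofRealHom
    rwa [RingHom.map_det] at this
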